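/- **Online cube packing.** Items are cubes with side lengths in $(0,1]$; they arrive one by one, and each must be placed irrevocably, axis-parallel and without overlap, in some unit cube (bin), without knowledge of later items. $\mathrm{OPT}(L)$ is the least number of bins into which the list $L$ can be packed, and $\mathcal A(L)$ the number of bins used by the online algorithm $\mathcal A$ (with the worst choice wherever $\mathcal A$ leaves a choice). The asymptotic competitive ratio of $\mathcal A$ is $$R^\infty_{\mathcal A}=\limsup_{k\to\infty}\ \sup_L\Big\{\tfrac{\mathcal A(L)}{\mathrm{OPT}(L)} : \mathrm{OPT}(L)=k\Big\}.$$ **The algorithm $\mathcal A$.** An item of size $x$ is *small* if $x\le 1/11$; otherwise it has type $i\in\{1,\dots,16\}$ if $x\in(t_{i+1},t_i]$, where $(t_1,\dots,t_{17})=(1,\ 0.7,\ 0.65,\ 0.6,\ 0.5,\ 0.4,\ 0.35,\ \tfrac13,\ 0.3,\ \tfrac14,\ \tfrac15,\ \tfrac16,\ \tfrac17,\ \tfrac18,\ \tfrac19,\ 0.1,\ \tfrac1{11})$. Let $\beta_i=\lfloor 1/t_i\rfloor$; $\phi(2)=2$, $\phi(3)=3$, $\phi(4)=4$, $\phi(6)=1$,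 $\phi(7)=2$ and $\phi(i)=0$ otherwise; $\Delta_1=0.2$, $\Delta_2=0.3$, $\Delta_3=0.35$, $\Delta_4=0.4$; $\alpha_6=0.12$, $\alpha_7=0.2$, $\alpha_9=0.325$, $\alpha_{10}=0.2096$, $\alpha_{11}=0.15$ and $\alpha_i=0$ otherwise (in particular for $12\le i\le16$); for the types $i$ with $\alpha_i\neq0$ let $\gamma_i=1$ and $\theta_i=\beta_i^3-(\beta_i-\gamma_i)^3$ (that is, $\theta_6=\theta_7=7$, $\theta_9=19$, $\theta_{10}=37$, $\theta_{11}=61$). *Large items.* Let $s_i$ be the number of type $i$ items so far (including the current one) and $e_i$ the number of red ones among the earlier ones. A new item of type $i$ becomes red if $e_i<\lfloor\alpha_i s_i\rfloor$, otherwise blue. A bin can hold $\beta_i^3$ blue items of type $i$, put in a grid of mesh $t_i$ at one corner of the bin, and $\theta_j$ red items of type $j$, put in the outer layer of a grid of mesh $t_j$ at the opposite corner. A bin is named $i$ or $(i,?)$ if it holds only blue items, of type $i$, with $\phi(i)=0$ or $\phi(i)\ne0$ respectively; $(?,j)$ if it holds only red items, of type $j$; and $(i,j)$ if it holds blue items of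 type $i$ and red items of type $j$. A red item of type $i$ goes into the first available of: a bin $(?,i)$ with fewer than $\theta_i$ items; a bin $(j,i)$ with fewer than $\theta_i$ red items; a bin $(j,?)$ with $\gamma_it_i\le\Delta_{\phi(j)}$, which becomes $(j,i)$; a new bin $(?,i)$. A blue item of type $i$ with $\phi(i)=0$ goes into a bin $i$ with fewer than $\beta_i^3$ items, or else into a new bin $i$. If $\phi(i)\neq0$, it goes into the first available of: a bin $(i,j)$ with fewer than $\beta_i^3$ blue items; a bin $(i,?)$ with fewer than $\beta_i^3$ items; a bin $(?,j)$ with $\gamma_jt_j\le\Delta_{\phi(i)}$, which becomes $(i,j)$; a new bin $(i,?)$. *Small items.* A small item of size $x$ has group $i\in\{11,\dots,21\}$ and level $k\ge0$ if $2^kx\in(\frac1{i+1},\frac1i]$. Each group has its own bins, at most one of which is active. If the active bin has an empty sub-bin of side $1/(2^ki)$, the item goes there. Otherwise, if the active bin has no empty sub-bin of side $1/(2^ji)$ with $j<k$ (or there is no active bin), the active bin is closed and a new one is opened and partitioned into $i^3$ sub-bins of side $1/i$; if $k=0$ the item goes into one of these. In the remaining case an empty sub-bin of side $1/(2^ji)$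 with the largest $j<k$ is partitioned into $8$ equal sub-bins, one of these is partitioned in the same way, and so on, until sub-bins of side $1/(2^ki)$ are reached; the item goes into one of them. **Theorem.** $\mathcal A$ is a well-defined online algorithm for cube packing (every item can be packed as described, and the result is always a correct packing), and its asymptotic competitive ratio satisfies $R^\infty_{\mathcal A}\le 2.6852$. -/

import Mathlib

open scoped ENNReal

noncomputable section

namespace CubePacking

/-! ### Packing `d`-dimensional cubes into unit cubes -/

/-- A cube of side `size`, placed in a unit bin with its lower corner at `pos`. -/
structure Placed (d : ℕ) where
  size : ℝ
  pos : Fin d → ℝ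

/-- The placed cube lies in the unit bin. -/
def Placed.Inside {d : ℕ} (p : Placed d) : Prop :=
  ∀ k, 0 ≤ p.pos k ∧ p.pos k + p.size ≤ 1

/-- Two placed cubes do not overlap (they may touch): some coordinate direction separates them. -/
def Placed.NonOverlap {d : ℕ} (p q : Placed d) : Prop :=
  ∃ k, p.pos k + p.size ≤ q.pos k ∨ q.pos k + q.size ≤ p.pos k

/-- A correctly filled bin. -/
def IsBin {d : ℕ} (b : List (Placed d)) : Prop :=
  (∀ p ∈ b, p.Inside) ∧ b.Pairwise Placed.NonOverlap

/-- The sizes that may occur in an input list. -/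
def IsInput (L : List ℝ) : Prop := ∀ x ∈ L, 0 < x ∧ x ≤ 1

/-- `B` is a collection of correctly filled bins that holds exactly the items of `L`
(items are given by their side lengths). -/
def IsPacking {d : ℕ} (L : List ℝ) (B : Multiset (List (Placed d))) : Prop :=
  (∀ b ∈ B, IsBin b) ∧ B.bind (fun b => ((b.map Placed.size : List ℝ) : Multiset ℝ)) = (L : Multiset ℝ)

/-- `OPT(L)`: the least number of bins that an offline packing of `L` needs. -/
def opt (d : ℕ) (L : List ℝ) : ℕ :=
  sInf {n | ∃ B : Multiset (List (Placed d)), IsPacking L B ∧ B.card = n}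

/-- The asymptotic competitive ratio `lim sup_{k → ∞} sup {A(L) / OPT(L) | OPT(L) = k}`.
As the algorithm may break ties arbitrarily, it is given by the relation `cost L n`: "on input `L`
the algorithm may end up with `n` bins", and the supremum also runs over all these outcomes. -/
def asymptoticRatio (d : ℕ) (cost : List ℝ → ℕ → Prop) : ℝ≥0∞ :=
  Filter.limsup
    (fun k : ℕ => ⨆ (L : List ℝ) (n : ℕ) (_ : IsInput L ∧ opt d L = k ∧ cost L n),
      (n : ℝ≥0∞) / (k : ℝ≥0∞))
    Filter.atTop

/-! ### Parameters of the algorithm -/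

/-- Parameters of the algorithm. Types are numbered `1, …, N`; the large items of type `i` are those
of size in `(t (i + 1), t i]`, the small items those of size at most `1 / M`.
`β i` is the number of blue items of type `i` along an edge of a bin, `γ i` the number of layers of
red items of type `i`, `α i` the fraction of items of type `i` that become red, and `Δ (φ i)` the
space left for red items in a bin with blue items of type `i` (`φ i = 0`: no red items accepted). -/
structure Params where
  M : ℕ
  N : ℕ
  t : ℕ → ℝ
  α : ℕ → ℝ
  β : ℕ → ℕ
  γ : ℕ → ℕ
  φ : ℕ → ℕ
  Δ : ℕ → ℝ

/-- The number `θ_i = β_i ^ d - (β_i - γ_i) ^ d` of red items of type `i` that share a bin. -/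
def Params.θ (P : Params) (d i : ℕ) : ℕ := P.β i ^ d - (P.β i - P.γ i) ^ d

/-- A large item of size `x` has type `i`. -/
def Params.HasType (P : Params) (x : ℝ) (i : ℕ) : Prop :=
  1 ≤ i ∧ i ≤ P.N ∧ P.t (i + 1) < x ∧ x ≤ P.t i

/-- A small item of size `x` belongs to group `i` and level `k`: `2 ^ k * x ∈ (1 / (i + 1), 1 / i]`
with `M ≤ i ≤ 2 * M - 1`. -/
def Params.HasGroup (P : Params) (x : ℝ) (i k : ℕ) : Prop :=
  x ≤ 1 / (P.M : ℝ) ∧ P.M ≤ i ∧ i + 1 ≤ 2 * P.M ∧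
    1 / ((i : ℝ) + 1) < 2 ^ k * x ∧ 2 ^ k * x ≤ 1 / (i : ℝ)

/-! ### Large items -/

/-- Names of bins for large items: `i`, `(i, ?)`, `(?, j)` and `(i, j)`. -/
inductive Group where
  | mono (i : ℕ)
  | blueIndet (i : ℕ)
  | redIndet (j : ℕ)
  | bichrom (i j : ℕ)

/-- A bin for large items, with its name and its blue and red contents. -/
structure LargeBin (d : ℕ) where
  group : Group
  blue : List (Placed d)
  red : List (Placed d)

/-- Blue items of type `i` sit in a grid of mesh `t i` at the corner `(0, …, 0)` of the bin. -/
def bluePos {d : ℕ} (P : Params) (i : ℕ) (c : Fin d → Fin (P.β i)) : Fin d → ℝ :=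
  fun k => (c k : ℝ) * P.t i

/-- Red items of type `j` sit in a grid of mesh `t j` at the corner `(1, …, 1)` of the bin. -/
def redPos {d : ℕ} (P : Params) (j : ℕ) (c : Fin d → Fin (P.β j)) : Fin d → ℝ :=
  fun k => 1 - ((c k : ℝ) + 1) * P.t j

/-- `b'` arises from `b` by putting a blue item of type `i` and size `x` into a free cell and
renaming the bin to `g`. -/
def AddBlue {d : ℕ} (P : Params) (i : ℕ) (x : ℝ) (g : Group) (b b' : LargeBin d) : Prop :=
  ∃ c : Fin d → Fin (P.β i), (∀ q ∈ b.blue, q.pos ≠ bluePos P i c) ∧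
    b' = ⟨g, ⟨x, bluePos P i c⟩ :: b.blue, b.red⟩

/-- `b'` arises from `b` by putting a red item of type `j` and size `x` into a free cell and
renaming the bin to `g`. Only cells in the `γ j` outermost layers are used; there are `θ j` of
them. -/
def AddRed {d : ℕ} (P : Params) (j : ℕ) (x : ℝ) (g : Group) (b b' : LargeBin d) : Prop :=
  ∃ c : Fin d → Fin (P.β j), (∃ k, (c k : ℕ) < P.γ j) ∧ (∀ q ∈ b.red, q.pos ≠ redPos P j c) ∧
    b' = ⟨g, b.blue, ⟨x, redPos P j c⟩ :: b.red⟩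

/-- A new bin, before it gets its first item. -/
def LargeBin.empty (d : ℕ) (g : Group) : LargeBin d := ⟨g, [], []⟩

/-- Bin `b` is in group `(?, i)` and has fewer than `θ i` red items. -/
def RedIndetOpen {d : ℕ} (P : Params) (i : ℕ) (b : LargeBin d) : Prop :=
  b.group = .redIndet i ∧ b.red.length < P.θ d i

/-- Bin `b` is in group `(j, i)` and has fewer than `θ i` red items. -/
def RedBichromOpen {d : ℕ} (P : Params) (j i : ℕ) (b : LargeBin d) : Prop :=
  b.group = .bichrom j i ∧ b.red.length < P.θ d i

/-- Bin `b` is in group `(j, ?)` and its free space can hold red items of type `i`. -/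
def RedJoinable {d : ℕ} (P : Params) (j i : ℕ) (b : LargeBin d) : Prop :=
  b.group = .blueIndet j ∧ (P.γ i : ℝ) * P.t i ≤ P.Δ (P.φ j)

/-- Packing a red item of type `i` and size `x`. -/
inductive PlaceRed {d : ℕ} (P : Params) (i : ℕ) (x : ℝ) :
    Multiset (LargeBin d) → Multiset (LargeBin d) → Prop
  | indet (b b' : LargeBin d) (rest : Multiset (LargeBin d))
      (hb : RedIndetOpen P i b)
      (hadd : AddRed P i x (.redIndet i) b b') :
      PlaceRed P i x (b ::ₘ rest) (b' ::ₘ rest)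
  | bichrom (j : ℕ) (b b' : LargeBin d) (rest : Multiset (LargeBin d))
      (h₁ : ∀ a ∈ b ::ₘ rest, ¬ RedIndetOpen P i a)
      (hb : RedBichromOpen P j i b)
      (hadd : AddRed P i x (.bichrom j i) b b') :
      PlaceRed P i x (b ::ₘ rest) (b' ::ₘ rest)
  | join (j : ℕ) (b b' : LargeBin d) (rest : Multiset (LargeBin d))
      (h₁ : ∀ a ∈ b ::ₘ rest, ¬ RedIndetOpen P i a)
      (h₂ : ∀ a ∈ b ::ₘ rest, ∀ l, ¬ RedBichromOpen P l i a)
      (hb : RedJoinable P j i b)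
      (hadd : AddRed P i x (.bichrom j i) b b') :
      PlaceRed P i x (b ::ₘ rest) (b' ::ₘ rest)
  | new (bins : Multiset (LargeBin d)) (b' : LargeBin d)
      (h₁ : ∀ a ∈ bins, ¬ RedIndetOpen P i a)
      (h₂ : ∀ a ∈ bins, ∀ l, ¬ RedBichromOpen P l i a)
      (h₃ : ∀ a ∈ bins, ∀ l, ¬ RedJoinable P l i a)
      (hadd : AddRed P i x (.redIndet i) (LargeBin.empty d (.redIndet i)) b') :
      PlaceRed P i x bins (b' ::ₘ bins)

/-- Bin `b` is in group `i` and has fewer than `(β i) ^ d` items. -/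
def MonoOpen {d : ℕ} (P : Params) (i : ℕ) (b : LargeBin d) : Prop :=
  b.group = .mono i ∧ b.blue.length < P.β i ^ d

/-- Bin `b` is in group `(i, j)` and has fewer than `(β i) ^ d` blue items. -/
def BlueBichromOpen {d : ℕ} (P : Params) (i j : ℕ) (b : LargeBin d) : Prop :=
  b.group = .bichrom i j ∧ b.blue.length < P.β i ^ d

/-- Bin `b` is in group `(i, ?)` and has fewer than `(β i) ^ d` items. -/
def BlueIndetOpen {d : ℕ} (P : Params) (i : ℕ) (b : LargeBin d) : Prop :=
  b.group = .blueIndet i ∧ b.blue.length < P.β i ^ d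

/-- Bin `b` is in group `(?, j)` and its red items fit beside blue items of type `i`. -/
def BlueJoinable {d : ℕ} (P : Params) (i j : ℕ) (b : LargeBin d) : Prop :=
  b.group = .redIndet j ∧ (P.γ j : ℝ) * P.t j ≤ P.Δ (P.φ i)

/-- Packing a blue item of type `i` and size `x`. -/
inductive PlaceBlue {d : ℕ} (P : Params) (i : ℕ) (x : ℝ) :
    Multiset (LargeBin d) → Multiset (LargeBin d) → Prop
  | mono (b b' : LargeBin d) (rest : Multiset (LargeBin d))
      (hφ : P.φ i = 0)
      (hb : MonoOpen P i b)
      (hadd : AddBlue P i x (.mono i) b b') :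
      PlaceBlue P i x (b ::ₘ rest) (b' ::ₘ rest)
  | monoNew (bins : Multiset (LargeBin d)) (b' : LargeBin d)
      (hφ : P.φ i = 0)
      (h₁ : ∀ a ∈ bins, ¬ MonoOpen P i a)
      (hadd : AddBlue P i x (.mono i) (LargeBin.empty d (.mono i)) b') :
      PlaceBlue P i x bins (b' ::ₘ bins)
  | bichrom (j : ℕ) (b b' : LargeBin d) (rest : Multiset (LargeBin d))
      (hφ : P.φ i ≠ 0)
      (hb : BlueBichromOpen P i j b)
      (hadd : AddBlue P i x (.bichrom i j) b b') :
      PlaceBlue P i x (b ::ₘ rest) (b' ::ₘ rest)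
  | indet (b b' : LargeBin d) (rest : Multiset (LargeBin d))
      (hφ : P.φ i ≠ 0)
      (h₁ : ∀ a ∈ b ::ₘ rest, ∀ l, ¬ BlueBichromOpen P i l a)
      (hb : BlueIndetOpen P i b)
      (hadd : AddBlue P i x (.blueIndet i) b b') :
      PlaceBlue P i x (b ::ₘ rest) (b' ::ₘ rest)
  | join (j : ℕ) (b b' : LargeBin d) (rest : Multiset (LargeBin d))
      (hφ : P.φ i ≠ 0)
      (h₁ : ∀ a ∈ b ::ₘ rest, ∀ l, ¬ BlueBichromOpen P i l a)
      (h₂ : ∀ a ∈ b ::ₘ rest, ¬ BlueIndetOpen P i a)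
      (hb : BlueJoinable P i j b)
      (hadd : AddBlue P i x (.bichrom i j) b b') :
      PlaceBlue P i x (b ::ₘ rest) (b' ::ₘ rest)
  | new (bins : Multiset (LargeBin d)) (b' : LargeBin d)
      (hφ : P.φ i ≠ 0)
      (h₁ : ∀ a ∈ bins, ∀ l, ¬ BlueBichromOpen P i l a)
      (h₂ : ∀ a ∈ bins, ¬ BlueIndetOpen P i a)
      (h₃ : ∀ a ∈ bins, ∀ l, ¬ BlueJoinable P i l a)
      (hadd : AddBlue P i x (.blueIndet i) (LargeBin.empty d (.blueIndet i)) b') :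
      PlaceBlue P i x bins (b' ::ₘ bins)

/-! ### Small items -/

/-- A sub-bin; in a bin of group `i` it is the cube of side `1 / (2 ^ level * i)` with lower corner
`corner`. -/
structure SubBin (d : ℕ) where
  level : ℕ
  corner : Fin d → ℝ

/-- The `i ^ d` sub-bins of side `1 / i` into which a new bin of group `i` is partitioned. -/
def freshSubBins (d i : ℕ) : Multiset (SubBin d) :=
  (Finset.univ : Finset (Fin d → Fin i)).val.map fun c => ⟨0, fun k => (c k : ℝ) / (i : ℝ)⟩

/-- The `2 ^ d` identical sub-bins into which a sub-bin is partitioned. -/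
def SubBin.children {d : ℕ} (i : ℕ) (u : SubBin d) : Multiset (SubBin d) :=
  (Finset.univ : Finset (Fin d → Fin 2)).val.map fun c =>
    ⟨u.level + 1, fun k => u.corner k + (c k : ℝ) * (1 / (2 ^ (u.level + 1) * (i : ℝ)))⟩

/-- Starting from the sub-bin `u`, one partitions it, takes one of the parts, partitions that, and
so on until a sub-bin `v` of level `k` is reached; `left` are the other sub-bins that arise. -/
inductive Carve {d : ℕ} (i k : ℕ) : SubBin d → SubBin d → Multiset (SubBin d) → Prop
  | done (u : SubBin d) (h : u.level = k) : Carve i k u u 0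
  | split (u w v : SubBin d) (rest left : Multiset (SubBin d)) (h : u.level < k)
      (hc : u.children i = w ::ₘ rest) (hw : Carve i k w v left) : Carve i k u v (rest + left)

/-- A bin for small items of group `group`: its contents and its empty sub-bins. A closed bin
(`active = false`) receives no more items. -/
structure SmallBin (d : ℕ) where
  group : ℕ
  active : Bool
  items : List (Placed d)
  empties : Multiset (SubBin d)

/-- The bin is closed. -/
def SmallBin.close {d : ℕ} (b : SmallBin d) : SmallBin d := { b with active := false }

/-- An item of size `x` and level `k` goes into an empty sub-bin of level `k` of the bin `b` if
there is one, and otherwise into one that is carved out of an empty sub-bin of the largest level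
below `k`. -/
def AddSmall {d : ℕ} (k : ℕ) (x : ℝ) (b b' : SmallBin d) : Prop :=
  ∃ (u v : SubBin d) (rest left : Multiset (SubBin d)),
    b.empties = u ::ₘ rest ∧ u.level ≤ k ∧ (∀ w ∈ b.empties, w.level ≤ k → w.level ≤ u.level) ∧
    Carve b.group k u v left ∧
    b' = { b with items := ⟨x, v.corner⟩ :: b.items, empties := rest + left }

/-- Bin `b` is the active bin of group `i` and has an empty sub-bin of level at most `k`. -/
def CanTake {d : ℕ} (i k : ℕ) (b : SmallBin d) : Prop :=
  b.group = i ∧ b.active = true ∧ ∃ u ∈ b.empties, u.level ≤ k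

/-- Packing a small item of group `i`, level `k` and size `x`. -/
inductive PlaceSmall {d : ℕ} (i k : ℕ) (x : ℝ) :
    Multiset (SmallBin d) → Multiset (SmallBin d) → Prop
  | current (b b' : SmallBin d) (rest : Multiset (SmallBin d))
      (hb : CanTake i k b)
      (hadd : AddSmall k x b b') :
      PlaceSmall i k x (b ::ₘ rest) (b' ::ₘ rest)
  | new (bins : Multiset (SmallBin d)) (b' : SmallBin d)
      (h : ∀ a ∈ bins, ¬ CanTake i k a)
      (hadd : AddSmall k x ⟨i, true, [], freshSubBins d i⟩ b') :
      PlaceSmall i k x bins (b' ::ₘ bins.map fun a => if a.group = i then a.close else a)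

/-! ### The algorithm -/

/-- A state of the algorithm: its bins, the number `s i` of items of type `i` seen so far, and the
number `e i` of those that are red. -/
structure State (d : ℕ) where
  large : Multiset (LargeBin d)
  small : Multiset (SmallBin d)
  s : ℕ → ℕ
  e : ℕ → ℕ

/-- The initial state. -/
def State.init (d : ℕ) : State d := ⟨0, 0, fun _ => 0, fun _ => 0⟩

/-- The packing that the algorithm has produced. -/
def State.packing {d : ℕ} (S : State d) : Multiset (List (Placed d)) :=
  S.large.map (fun b => b.blue ++ b.red) + S.small.map (fun b => b.items)

/-- The algorithm, in state `S`, packs an item of size `x`; `S'` is a possible next state. -/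
inductive Step {d : ℕ} (P : Params) (S : State d) (x : ℝ) : State d → Prop
  | small (i k : ℕ) (bins : Multiset (SmallBin d))
      (hx : P.HasGroup x i k)
      (hplace : PlaceSmall i k x S.small bins) :
      Step P S x { S with small := bins }
  | red (i : ℕ) (bins : Multiset (LargeBin d))
      (hx : P.HasType x i)
      (hcol : S.e i < ⌊P.α i * ((S.s i + 1 : ℕ) : ℝ)⌋₊)
      (hplace : PlaceRed P i x S.large bins) :
      Step P S x
        { S with
          large := bins
          s := Function.update S.s i (S.s i + 1)
          e := Function.update S.e i (S.e i + 1) }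
  | blue (i : ℕ) (bins : Multiset (LargeBin d))
      (hx : P.HasType x i)
      (hcol : ¬ S.e i < ⌊P.α i * ((S.s i + 1 : ℕ) : ℝ)⌋₊)
      (hplace : PlaceBlue P i x S.large bins) :
      Step P S x
        { S with
          large := bins
          s := Function.update S.s i (S.s i + 1) }

/-- `Run P L S`: the algorithm may be in state `S` after it has packed the items of `L` one after
the other. -/
inductive Run {d : ℕ} (P : Params) : List ℝ → State d → Prop
  | nil : Run P [] (State.init d)
  | snoc (L : List ℝ) (x : ℝ) (S S' : State d) (h : Run P L S) (hs : Step P S x S') :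
      Run P (L ++ [x]) S'

/-- The algorithm may use `n` bins for the list `L`. -/
def Cost (d : ℕ) (P : Params) (L : List ℝ) (n : ℕ) : Prop :=
  ∃ S : State d, Run P L S ∧ S.packing.card = n

/-! ### The instance for cube packing -/

/-- Interval ends: type `i` is `(t (i + 1), t i]`. -/
def tTable : ℕ → ℝ
  | 1 => 1
  | 2 => 0.7
  | 3 => 0.65
  | 4 => 0.6
  | 5 => 0.5
  | 6 => 0.4
  | 7 => 0.35
  | 8 => 1 / 3
  | 9 => 0.3
  | 10 => 1 / 4
  | 11 => 1 / 5
  | 12 => 1 / 6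
  | 13 => 1 / 7
  | 14 => 1 / 8
  | 15 => 1 / 9
  | 16 => 0.1
  | 17 => 1 / 11
  | _ => 0

/-- `β i`, the integer part of `1 / t i`. -/
def βTable : ℕ → ℕ
  | 1 => 1
  | 2 => 1
  | 3 => 1
  | 4 => 1
  | 5 => 2
  | 6 => 2
  | 7 => 2
  | 8 => 3
  | 9 => 3
  | 10 => 4
  | 11 => 5
  | 12 => 6
  | 13 => 7
  | 14 => 8
  | 15 => 9
  | 16 => 10
  | _ => 0

def γTable : ℕ → ℕ
  | 6 => 1
  | 7 => 1
  | 9 => 1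
  | 10 => 1
  | 11 => 1
  | 12 => 1
  | 13 => 1
  | 14 => 1
  | 15 => 1
  | 16 => 2
  | _ => 0

def φTable : ℕ → ℕ
  | 2 => 2
  | 3 => 3
  | 4 => 4
  | 6 => 1
  | 7 => 2
  | _ => 0

def ΔTable : ℕ → ℝ
  | 1 => 0.20
  | 2 => 0.30
  | 3 => 0.35
  | 4 => 0.40
  | _ => 0

/-- The fractions of red items for cube packing; `0` for all types other than 6, 7, 9, 10, 11. -/
def αCube : ℕ → ℝ
  | 6 => 0.12
  | 7 => 0.2
  | 9 => 0.325
  | 10 => 0.2096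
  | 11 => 0.15
  | _ => 0

/-- The parameters for cube packing. -/
def cubeParams : Params where
  M := 11
  N := 16
  t := tTable
  α := αCube
  β := βTable
  γ := γTable
  φ := φTable
  Δ := ΔTable

end CubePacking

end

open scoped ENNReal

noncomputable section

namespace CubePacking

/-! Correctness. The name of a bin determines its contents (`LargeOK`): blue items of one type
occupy distinct cells of a grid at one corner, red items of one type distinct cells in the outer
layer of a grid at the opposite corner. A red cell lies beyond 1 - t_j in some direction, whereas
blue cells end at β_i t_i ≤ 1 - Δ_{φ(i)} at the latest, so the colours do not meet when t_j ≤
Δ_{φ(i)}. In a bin for small items, the items and the empty sub-bins always come from a partition of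
the bin (`SmallOK`).

Counting. For each type, at most one bin with blue items and at most one bin with red items can
still take more of them, and e_i = ⌊α_i s_i⌋. Hence, up to constants, there are at most (1 - α_i)
s_i / β_i³ bins with blue items of type i and at most α_j s_j / θ_j bins with red items of type j. A
closed bin for small items is filled to at least (11³ - 1) / 12³. Adding all these numbers would
count two-coloured bins twice. It suffices to charge the blue bins of the types in a set I and the
red bins of the types in a set J such that every bin for large items is charged at least once. If
there is no bin (?, j), all blue types suffice. If there is one, the joining rules exclude every bin
(i, ?) with room for its red items, so all red types and the blue types in `lonelyTypes j` suffice.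
If only the types 6 and 7 occur as lonely red types, a second scheme is valid as well, and a convex
combination of the two is better than either. Each scheme defines a weight function whose sum over L
bounds the cost up to 60. Therefore it is enough that, for each of six weight functions, every
correctly filled bin has weight at most 2.6852 (`BinBound`, `ratio_le`).

Weight of a bin. This is linear programming duality: if a measure on the unit cube gives each placed
cube at least the weight of the item, then the measure of the unit cube bounds the weight of the
bin. The measures in use are multiples of the volume, equal masses at the inner points of a grid of
mesh 1/m (a cube of side more than k/m contains at least k³ of the (m - 1)³ points), and a mass at
the centre, which only an item larger than 1/2 claims (`Cert`). They settle four weight functions,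
and most bins for the two mixed ones.

What remains are bins with seven items of size in (1/3, 1/2] beside a large item of type 2 or 3. The
eight inner points of the grid of mesh 1/3 leave at most one point for the large item. So, up to
reflection, it lies in [0, 2/3]³ and covers a known set of points, the core. The other items avoid
the core, so the measure only has to be large on cubes that miss it. Such a measure is given by
explicit point masses on a fine grid (`PointCert`). That all grid boxes have enough mass is checked
by integer arithmetic: a plane of masses is one long number, a multiplication sums over all squares
of a given side, and one bitwise operation compares all the sums with a threshold
(`PackFormat.le_boxMass`). -/

abbrev PC : Params := cubeParams

/-- The types with red items. -/
def IsRedType (j : ℕ) : Prop := j = 6 ∨ j = 7 ∨ j = 9 ∨ j = 10 ∨ j = 11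

/-! ### Numerical properties of the parameter tables -/

lemma isRedType_of_alpha_ne {j : ℕ} (h : αCube j ≠ 0) : IsRedType j := by
  unfold αCube at h
  split at h <;> simp_all [IsRedType]

lemma t_pos {i : ℕ} (h1 : 1 ≤ i) (h2 : i ≤ 16) : 0 < tTable i := by
  interval_cases i <;> norm_num [tTable]

lemma beta_pos {i : ℕ} (h1 : 1 ≤ i) (h2 : i ≤ 16) : 0 < βTable i := by
  interval_cases i <;> norm_num [βTable]

lemma beta_mul_t_le {i : ℕ} (h1 : 1 ≤ i) (h2 : i ≤ 16) : (βTable i : ℝ) * tTable i ≤ 1 := by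
  interval_cases i <;> norm_num [tTable, βTable]

lemma IsRedType.range {j : ℕ} (h : IsRedType j) : 1 ≤ j ∧ j ≤ 16 := by
  rcases h with h | h | h | h | h <;> omega

/-- The table contains other values of γ, but only for types with α = 0; where red items exist, they
fill exactly one layer. -/
lemma IsRedType.gamma {j : ℕ} (h : IsRedType j) : γTable j = 1 := by
  rcases h with rfl | rfl | rfl | rfl | rfl <;> rfl

/-- This is what Δ stands for: the blue grid leaves a margin of width Δ_{φ(i)} on its far side in
every direction. -/
lemma beta_mul_t_add_delta {i : ℕ} (h : φTable i ≠ 0) :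
    (βTable i : ℝ) * tTable i + ΔTable (φTable i) ≤ 1 := by
  unfold φTable at h
  split at h <;> first | (exact absurd rfl h) | norm_num [tTable, βTable, ΔTable, φTable]

lemma phi_range {i : ℕ} (h : φTable i ≠ 0) : 1 ≤ i ∧ i ≤ 16 := by
  unfold φTable at h
  split at h <;> first | (exact absurd rfl h) | omega

/-! ### Contents of the bins for large items, and free cells -/

/-- A blue item of type `i` in a cell. -/
def BlueCell (i : ℕ) (q : Placed 3) : Prop :=
  PC.HasType q.size i ∧ ∃ c : Fin 3 → Fin (PC.β i), q.pos = bluePos PC i c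

/-- A red item of type `j` in an outer cell. -/
def RedCell (j : ℕ) (q : Placed 3) : Prop :=
  PC.HasType q.size j ∧ ∃ c : Fin 3 → Fin (PC.β j), (∃ k, (c k : ℕ) < PC.γ j) ∧ q.pos = redPos PC j c

/-- Different positions are all that has to be remembered: in a common grid they mean different
cells, which do not overlap. -/
def BlueList (i : ℕ) (l : List (Placed 3)) : Prop :=
  (∀ q ∈ l, BlueCell i q) ∧ l.Pairwise (fun p q => p.pos ≠ q.pos)

def RedList (j : ℕ) (l : List (Placed 3)) : Prop :=
  (∀ q ∈ l, RedCell j q) ∧ l.Pairwise (fun p q => p.pos ≠ q.pos)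

/-- The name of a bin describes its contents. -/
def LargeOK (b : LargeBin 3) : Prop :=
  match b.group with
  | .mono i => PC.φ i = 0 ∧ BlueList i b.blue ∧ b.red = []
  | .blueIndet i => PC.φ i ≠ 0 ∧ BlueList i b.blue ∧ b.red = []
  | .redIndet j => IsRedType j ∧ b.blue = [] ∧ RedList j b.red
  | .bichrom i j => PC.φ i ≠ 0 ∧ IsRedType j ∧ PC.γ j * PC.t j ≤ PC.Δ (PC.φ i) ∧
      BlueList i b.blue ∧ RedList j b.red

lemma bluePos_injective {i : ℕ} (h1 : 1 ≤ i) (h2 : i ≤ 16) :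
    Function.Injective (bluePos (d := 3) PC i) := by
  intro c c' h
  funext k
  have := congrFun h k
  have ht : 0 < PC.t i := t_pos h1 h2
  simp only [bluePos, mul_eq_mul_right_iff, Nat.cast_inj] at this
  rcases this with h | h
  · exact Fin.ext h
  · exact absurd h ht.ne'

lemma redPos_injective {i : ℕ} (h1 : 1 ≤ i) (h2 : i ≤ 16) :
    Function.Injective (redPos (d := 3) PC i) := by
  intro c c' h
  funext k
  have := congrFun h k
  have ht : 0 < PC.t i := t_pos h1 h2
  simp only [redPos, sub_right_inj, mul_eq_mul_right_iff, add_left_inj, Nat.cast_inj] at this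
  rcases this with h | h
  · exact Fin.ext h
  · exact absurd h ht.ne'

/-- Pigeonhole: if every cell were occupied, the positions of the items would include the injective
image of a larger set. -/
lemma exists_free_of_length_lt {ι : Type*} [Fintype ι] (f : ι → Fin 3 → ℝ)
    (hf : Function.Injective f) (l : List (Placed 3)) (h : l.length < Fintype.card ι) :
    ∃ c, ∀ q ∈ l, q.pos ≠ f c := by
  classical
  by_contra hcon
  push Not at hcon
  have hsub : (Finset.univ.image f) ⊆ (l.map Placed.pos).toFinset := by
    intro p hp
    obtain ⟨c, -, rfl⟩ := Finset.mem_image.1 hp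
    obtain ⟨q, hq, e⟩ := hcon c
    simp only [List.mem_toFinset, List.mem_map]
    exact ⟨q, hq, e⟩
  have := Finset.card_le_card hsub
  rw [Finset.card_image_of_injective _ hf, Finset.card_univ] at this
  have h2 := (l.map Placed.pos).toFinset_card_le
  simp only [List.length_map] at h2
  omega

lemma exists_addBlue {i : ℕ} (h1 : 1 ≤ i) (h2 : i ≤ 16) (x : ℝ) (g : Group) (b : LargeBin 3)
    (h : b.blue.length < PC.β i ^ 3) : ∃ b', AddBlue PC i x g b b' := by
  obtain ⟨c, hc⟩ := exists_free_of_length_lt (bluePos (d := 3) PC i) (bluePos_injective h1 h2)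
    b.blue (by simpa using h)
  exact ⟨_, c, hc, rfl⟩

/-- The complement consists of the indices with all coordinates at least 1; subtracting 1 identifies
it with the indices of a grid with n cells along an edge. -/
lemma card_outer_cells (n : ℕ) :
    Fintype.card {c : Fin 3 → Fin (n + 1) // ∃ k, (c k : ℕ) < 1} = (n + 1) ^ 3 - n ^ 3 := by
  classical
  have h : Fintype.card {c : Fin 3 → Fin (n + 1) // ¬ ∃ k, (c k : ℕ) < 1} = n ^ 3 := by
    have e : {c : Fin 3 → Fin (n + 1) // ¬ ∃ k, (c k : ℕ) < 1} ≃ (Fin 3 → Fin n) :=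
      { toFun := fun c k => ⟨(c.1 k : ℕ) - 1, by
          have h := c.2; push Not at h; have := h k; have := (c.1 k).2; omega⟩
        invFun := fun c => ⟨fun k => (c k).succ, by push Not; intro k; simp⟩
        left_inv := by
          intro c
          have h := c.2
          push Not at h
          ext k
          have := h k
          simp only [Fin.val_succ]
          omega
        right_inv := by intro c; ext k; simp }
    rw [Fintype.card_congr e]; simp
  have h3 := Fintype.card_subtype_compl (fun c : Fin 3 → Fin (n + 1) => ∃ k, (c k : ℕ) < 1)
  have h4 := Fintype.card_subtype_le (fun c : Fin 3 → Fin (n + 1) => ∃ k, (c k : ℕ) < 1)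
  rw [h] at h3
  simp only [Fintype.card_pi, Fintype.card_fin, Finset.prod_const, Finset.card_univ] at h3 h4
  omega

lemma exists_addRed {j : ℕ} (hj : IsRedType j) (x : ℝ) (g : Group) (b : LargeBin 3)
    (h : b.red.length < PC.θ 3 j) : ∃ b', AddRed PC j x g b b' := by
  have hr := hj.range
  have hb : 0 < PC.β j := beta_pos hr.1 hr.2
  have hg : PC.γ j = 1 := hj.gamma
  have hcard : Fintype.card {c : Fin 3 → Fin (PC.β j) // ∃ k, (c k : ℕ) < 1} = PC.θ 3 j := by
    unfold Params.θ
    rw [hg]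
    obtain ⟨n, hn⟩ : ∃ n, PC.β j = n + 1 := ⟨PC.β j - 1, by omega⟩
    rw [hn]
    simpa using card_outer_cells n
  obtain ⟨c, hc⟩ := exists_free_of_length_lt
    (fun c : {c : Fin 3 → Fin (PC.β j) // ∃ k, (c k : ℕ) < 1} => redPos PC j c.1)
    ((redPos_injective hr.1 hr.2).comp Subtype.val_injective) b.red (by rw [hcard]; exact h)
  exact ⟨_, c.1, by rw [hg]; exact c.2, hc, rfl⟩

lemma BlueList.cons {i : ℕ} {x : ℝ} {l : List (Placed 3)} (h : BlueList i l) (hx : PC.HasType x i)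
    {c : Fin 3 → Fin (PC.β i)} (hc : ∀ q ∈ l, q.pos ≠ bluePos PC i c) :
    BlueList i (⟨x, bluePos PC i c⟩ :: l) := by
  refine ⟨?_, List.pairwise_cons.2 ⟨fun q hq => (hc q hq).symm, h.2⟩⟩
  intro q hq
  rcases List.mem_cons.1 hq with rfl | hq
  · exact ⟨hx, c, rfl⟩
  · exact h.1 q hq

lemma RedList.cons {i : ℕ} {x : ℝ} {l : List (Placed 3)} (h : RedList i l) (hx : PC.HasType x i)
    {c : Fin 3 → Fin (PC.β i)} (ho : ∃ k, (c k : ℕ) < PC.γ i)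
    (hc : ∀ q ∈ l, q.pos ≠ redPos PC i c) :
    RedList i (⟨x, redPos PC i c⟩ :: l) := by
  refine ⟨?_, List.pairwise_cons.2 ⟨fun q hq => (hc q hq).symm, h.2⟩⟩
  intro q hq
  rcases List.mem_cons.1 hq with rfl | hq
  · exact ⟨hx, c, ho, rfl⟩
  · exact h.1 q hq

lemma blueList_nil (i : ℕ) : BlueList i [] := ⟨by simp, List.Pairwise.nil⟩
lemma redList_nil (i : ℕ) : RedList i [] := ⟨by simp, List.Pairwise.nil⟩

/-! ### Geometry of the cells: the bins for large items are correctly filled -/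

lemma cell_separated {n : ℕ} {t : ℝ} (ht : 0 < t) {c c' : Fin 3 → Fin n} (h : c ≠ c') :
    ∃ k, ((c k : ℕ) : ℝ) * t + t ≤ ((c' k : ℕ) : ℝ) * t ∨
      ((c' k : ℕ) : ℝ) * t + t ≤ ((c k : ℕ) : ℝ) * t := by
  obtain ⟨k, hk⟩ := Function.ne_iff.1 h
  refine ⟨k, ?_⟩
  have : (c k : ℕ) ≠ c' k := fun e => hk (Fin.ext e)
  rcases Nat.lt_or_gt_of_ne this with h | h
  · left
    have : ((c k : ℕ) : ℝ) + 1 ≤ ((c' k : ℕ) : ℝ) := by exact_mod_cast h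
    nlinarith
  · right
    have : ((c' k : ℕ) : ℝ) + 1 ≤ ((c k : ℕ) : ℝ) := by exact_mod_cast h
    nlinarith

lemma BlueCell.nonOverlap {i : ℕ} {p q : Placed 3} (hp : BlueCell i p) (hq : BlueCell i q)
    (h : p.pos ≠ q.pos) : p.NonOverlap q := by
  obtain ⟨⟨h1, h2, -, hp⟩, c, hc⟩ := hp
  obtain ⟨⟨-, -, -, hq⟩, c', hc'⟩ := hq
  obtain ⟨k, hk⟩ := cell_separated (t_pos h1 h2) (c := c) (c' := c') (by
    rintro rfl; exact h (hc.trans hc'.symm))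
  refine ⟨k, ?_⟩
  rw [hc, hc']
  simp only [bluePos]
  change p.size ≤ tTable i at hp
  change q.size ≤ tTable i at hq
  change _ * tTable i + _ ≤ _ * tTable i ∨ _ * tTable i + _ ≤ _ * tTable i
  rcases hk with h | h
  · left; linarith
  · right; linarith

lemma RedCell.nonOverlap {i : ℕ} {p q : Placed 3} (hp : RedCell i p) (hq : RedCell i q)
    (h : p.pos ≠ q.pos) : p.NonOverlap q := by
  obtain ⟨⟨h1, h2, -, hp⟩, c, -, hc⟩ := hp
  obtain ⟨⟨-, -, -, hq⟩, c', -, hc'⟩ := hq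
  obtain ⟨k, hk⟩ := cell_separated (t_pos h1 h2) (c := c) (c' := c') (by
    rintro rfl; exact h (hc.trans hc'.symm))
  refine ⟨k, ?_⟩
  rw [hc, hc']
  simp only [redPos]
  change p.size ≤ tTable i at hp
  change q.size ≤ tTable i at hq
  change 1 - (_ + 1) * tTable i + _ ≤ 1 - (_ + 1) * tTable i ∨
    1 - (_ + 1) * tTable i + _ ≤ 1 - (_ + 1) * tTable i
  rcases hk with h | h
  · right; linarith
  · left; linarith

lemma cell_le {n : ℕ} (c : Fin n) {t : ℝ} (ht : 0 < t) : ((c : ℕ) : ℝ) * t + t ≤ n * t := by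
  have : ((c : ℕ) : ℝ) + 1 ≤ (n : ℝ) := by exact_mod_cast c.2
  nlinarith

lemma BlueCell.inside {i : ℕ} {p : Placed 3} (hp : BlueCell i p) : p.Inside := by
  obtain ⟨⟨h1, h2, -, hp⟩, c, hc⟩ := hp
  have ht := t_pos h1 h2
  intro k
  have h := cell_le (c k) ht
  have h3 : ((PC.β i : ℕ) : ℝ) * tTable i ≤ 1 := beta_mul_t_le h1 h2
  change p.size ≤ tTable i at hp
  rw [hc]
  change 0 ≤ ((c k : ℕ) : ℝ) * tTable i ∧ ((c k : ℕ) : ℝ) * tTable i + p.size ≤ 1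
  exact ⟨by positivity, by linarith⟩

lemma RedCell.inside {i : ℕ} {p : Placed 3} (hp : RedCell i p) : p.Inside := by
  obtain ⟨⟨h1, h2, -, hp⟩, c, -, hc⟩ := hp
  have ht := t_pos h1 h2
  intro k
  have h := cell_le (c k) ht
  have h3 : ((PC.β i : ℕ) : ℝ) * tTable i ≤ 1 := beta_mul_t_le h1 h2
  change p.size ≤ tTable i at hp
  rw [hc]
  change 0 ≤ 1 - (((c k : ℕ) : ℝ) + 1) * tTable i ∧ 1 - (((c k : ℕ) : ℝ) + 1) * tTable i + p.size ≤ 1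
  have : (0:ℝ) ≤ ((c k : ℕ) : ℝ) * tTable i := by positivity
  exact ⟨by linarith, by linarith⟩

/-- One direction suffices. Since γ_j = 1, the red cell has index 0 in some direction k, so it
starts at 1 - t_j there, while the blue cell ends at β_i t_i ≤ 1 - Δ_{φ(i)} ≤ 1 - t_j at the latest.
-/
lemma BlueCell.nonOverlap_red {i j : ℕ} {p q : Placed 3} (hp : BlueCell i p) (hq : RedCell j q)
    (hi : PC.φ i ≠ 0) (hj : IsRedType j) (h : PC.γ j * PC.t j ≤ PC.Δ (PC.φ i)) :
    p.NonOverlap q := by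
  obtain ⟨⟨h1, h2, -, hp⟩, c, hc⟩ := hp
  obtain ⟨⟨-, -, -, hq⟩, c', ⟨k, hk⟩, hc'⟩ := hq
  have hg : PC.γ j = 1 := hj.gamma
  rw [hg] at h hk
  have hk0 : (c' k : ℕ) = 0 := by omega
  have ht := t_pos h1 h2
  have h4 := cell_le (c k) ht
  have h5 := beta_mul_t_add_delta hi
  change p.size ≤ tTable i at hp
  refine ⟨k, Or.inl ?_⟩
  rw [hc, hc']
  simp only [bluePos, redPos, hk0]
  change ((c k : ℕ) : ℝ) * tTable i + p.size ≤ 1 - ((0 : ℕ) + 1 : ℝ) * PC.t j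
  change ((1 : ℕ) : ℝ) * PC.t j ≤ ΔTable (φTable i) at h
  change ((c k : ℕ) : ℝ) * tTable i + tTable i ≤ (βTable i : ℝ) * tTable i at h4
  push_cast at h ⊢
  linarith

lemma LargeOK.isBin {b : LargeBin 3} (h : LargeOK b) : IsBin (b.blue ++ b.red) := by
  have hB : ∀ i, BlueList i b.blue → IsBin b.blue := fun i h =>
    ⟨fun p hp => (h.1 p hp).inside, h.2.imp_of_mem fun hp hq hpq =>
      (h.1 _ hp).nonOverlap (h.1 _ hq) hpq⟩
  have hR : ∀ i, RedList i b.red → IsBin b.red := fun i h =>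
    ⟨fun p hp => (h.1 p hp).inside, h.2.imp_of_mem fun hp hq hpq =>
      (h.1 _ hp).nonOverlap (h.1 _ hq) hpq⟩
  unfold LargeOK at h
  split at h
  · rw [h.2.2, List.append_nil]; exact hB _ h.2.1
  · rw [h.2.2, List.append_nil]; exact hB _ h.2.1
  · rw [h.2.1, List.nil_append]; exact hR _ h.2.2
  · obtain ⟨h1, h2, h3, h4, h5⟩ := h
    have e1 := hB _ h4
    have e2 := hR _ h5
    refine ⟨?_, List.pairwise_append.2 ⟨e1.2, e2.2, ?_⟩⟩
    · intro p hp
      rcases List.mem_append.1 hp with hp | hp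
      · exact e1.1 p hp
      · exact e2.1 p hp
    · intro p hp q hq
      exact (h4.1 p hp).nonOverlap_red (h5.1 q hq) h1 h2 h3

/-! ### Large items: the invariant is preserved and a placement always exists -/

lemma PlaceRed.largeOK {i : ℕ} {x : ℝ} {B B' : Multiset (LargeBin 3)} (h : PlaceRed PC i x B B')
    (hx : PC.HasType x i) (hi : IsRedType i) (hB : ∀ b ∈ B, LargeOK b) : ∀ b ∈ B', LargeOK b := by
  cases h with
  | indet b b' rest hb hadd =>
    obtain ⟨c, ho, hc, rfl⟩ := hadd
    have hb0 := hB b (by simp)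
    intro a ha
    rcases Multiset.mem_cons.1 ha with rfl | ha
    · simp only [LargeOK, hb.1] at hb0 ⊢
      exact ⟨hi, hb0.2.1, hb0.2.2.cons hx ho hc⟩
    · exact hB a (by simp [ha])
  | bichrom j b b' rest h₁ hb hadd =>
    obtain ⟨c, ho, hc, rfl⟩ := hadd
    have hb0 := hB b (by simp)
    intro a ha
    rcases Multiset.mem_cons.1 ha with rfl | ha
    · simp only [LargeOK, hb.1] at hb0 ⊢
      exact ⟨hb0.1, hi, hb0.2.2.1, hb0.2.2.2.1, hb0.2.2.2.2.cons hx ho hc⟩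
    · exact hB a (by simp [ha])
  | join j b b' rest h₁ h₂ hb hadd =>
    obtain ⟨c, ho, hc, rfl⟩ := hadd
    have hb0 := hB b (by simp)
    intro a ha
    rcases Multiset.mem_cons.1 ha with rfl | ha
    · simp only [LargeOK, hb.1] at hb0 ⊢
      refine ⟨hb0.1, hi, hb.2, hb0.2.1, ?_⟩
      rw [hb0.2.2] at hc ⊢
      exact (redList_nil i).cons hx ho hc
    · exact hB a (by simp [ha])
  | new B b' h₁ h₂ h₃ hadd =>
    obtain ⟨c, ho, hc, rfl⟩ := hadd
    intro a ha
    rcases Multiset.mem_cons.1 ha with rfl | ha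
    · simp only [LargeOK]
      exact ⟨hi, rfl, (redList_nil i).cons hx ho hc⟩
    · exact hB a ha

lemma PlaceBlue.largeOK {i : ℕ} {x : ℝ} {B B' : Multiset (LargeBin 3)} (h : PlaceBlue PC i x B B')
    (hx : PC.HasType x i) (hB : ∀ b ∈ B, LargeOK b) : ∀ b ∈ B', LargeOK b := by
  cases h with
  | mono b b' rest hφ hb hadd =>
    obtain ⟨c, hc, rfl⟩ := hadd
    have hb0 := hB b (by simp)
    intro a ha
    rcases Multiset.mem_cons.1 ha with rfl | ha
    · simp only [LargeOK, hb.1] at hb0 ⊢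
      exact ⟨hφ, hb0.2.1.cons hx hc, hb0.2.2⟩
    · exact hB a (by simp [ha])
  | monoNew B b' hφ h₁ hadd =>
    obtain ⟨c, hc, rfl⟩ := hadd
    intro a ha
    rcases Multiset.mem_cons.1 ha with rfl | ha
    · simp only [LargeOK]
      exact ⟨hφ, (blueList_nil i).cons hx hc, rfl⟩
    · exact hB a ha
  | bichrom j b b' rest hφ hb hadd =>
    obtain ⟨c, hc, rfl⟩ := hadd
    have hb0 := hB b (by simp)
    intro a ha
    rcases Multiset.mem_cons.1 ha with rfl | ha
    · simp only [LargeOK, hb.1] at hb0 ⊢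
      exact ⟨hφ, hb0.2.1, hb0.2.2.1, hb0.2.2.2.1.cons hx hc, hb0.2.2.2.2⟩
    · exact hB a (by simp [ha])
  | indet b b' rest hφ h₁ hb hadd =>
    obtain ⟨c, hc, rfl⟩ := hadd
    have hb0 := hB b (by simp)
    intro a ha
    rcases Multiset.mem_cons.1 ha with rfl | ha
    · simp only [LargeOK, hb.1] at hb0 ⊢
      exact ⟨hφ, hb0.2.1.cons hx hc, hb0.2.2⟩
    · exact hB a (by simp [ha])
  | join j b b' rest hφ h₁ h₂ hb hadd =>
    obtain ⟨c, hc, rfl⟩ := hadd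
    have hb0 := hB b (by simp)
    intro a ha
    rcases Multiset.mem_cons.1 ha with rfl | ha
    · simp only [LargeOK, hb.1] at hb0 ⊢
      refine ⟨hφ, hb0.1, hb.2, ?_, hb0.2.2⟩
      rw [hb0.2.1] at hc ⊢
      exact (blueList_nil i).cons hx hc
    · exact hB a (by simp [ha])
  | new B b' hφ h₁ h₂ h₃ hadd =>
    obtain ⟨c, hc, rfl⟩ := hadd
    intro a ha
    rcases Multiset.mem_cons.1 ha with rfl | ha
    · simp only [LargeOK]
      exact ⟨hφ, (blueList_nil i).cons hx hc, rfl⟩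
    · exact hB a ha

/-- For α_i = 0 the floor is 0, so no item of type i is ever made red. -/
lemma isRedType_of_floor {i s e : ℕ} (h : e < ⌊PC.α i * ((s + 1 : ℕ) : ℝ)⌋₊) : IsRedType i := by
  apply isRedType_of_alpha_ne
  intro h0
  have : PC.α i = 0 := h0
  rw [this, zero_mul, Nat.floor_zero] at h
  omega

theorem Run.largeOK {L : List ℝ} {S : State 3} (h : Run PC L S) : ∀ b ∈ S.large, LargeOK b := by
  induction h with
  | nil => simp [State.init]
  | snoc L x S S' h hs ih =>
    cases hs with
    | small i k bins hx hp => exact ih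
    | red i bins hx hcol hp => exact hp.largeOK hx (isRedType_of_floor hcol) ih
    | blue i bins hx hcol hp => exact hp.largeOK hx ih

lemma theta_pos {j : ℕ} (h : IsRedType j) : 0 < PC.θ 3 j := by
  rcases h with rfl | rfl | rfl | rfl | rfl <;>
    norm_num [Params.θ, PC, cubeParams, βTable, γTable]

/-- The rules are tried by priority: the failure of one rule supplies the negative hypotheses of the
next. A cell is free either by the capacity condition of the rule or because the bin holds no red
items yet. -/
lemma exists_placeRed {i : ℕ} {x : ℝ} (hi : IsRedType i) (B : Multiset (LargeBin 3))
    (hB : ∀ b ∈ B, LargeOK b) : ∃ B', PlaceRed PC i x B B' := by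
  classical
  by_cases h₁ : ∀ a ∈ B, ¬ RedIndetOpen PC i a
  · by_cases h₂ : ∀ a ∈ B, ∀ l, ¬ RedBichromOpen PC l i a
    · by_cases h₃ : ∀ a ∈ B, ∀ l, ¬ RedJoinable PC l i a
      · obtain ⟨b', hb'⟩ := exists_addRed hi x (.redIndet i) (LargeBin.empty 3 (.redIndet i))
          (theta_pos hi)
        exact ⟨_, PlaceRed.new B b' h₁ h₂ h₃ hb'⟩
      · push Not at h₃
        obtain ⟨b, hb, l, hl⟩ := h₃
        obtain ⟨rest, rfl⟩ := Multiset.exists_cons_of_mem hb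
        have h0 := hB b hb
        simp only [LargeOK, hl.1] at h0
        obtain ⟨b', hb'⟩ := exists_addRed hi x (.bichrom l i) b (by
          rw [h0.2.2]; exact theta_pos hi)
        exact ⟨_, PlaceRed.join l b b' rest h₁ h₂ hl hb'⟩
    · push Not at h₂
      obtain ⟨b, hb, l, hl⟩ := h₂
      obtain ⟨rest, rfl⟩ := Multiset.exists_cons_of_mem hb
      obtain ⟨b', hb'⟩ := exists_addRed hi x (.bichrom l i) b hl.2
      exact ⟨_, PlaceRed.bichrom l b b' rest h₁ hl hb'⟩
  · push Not at h₁
    obtain ⟨b, hb, hl⟩ := h₁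
    obtain ⟨rest, rfl⟩ := Multiset.exists_cons_of_mem hb
    obtain ⟨b', hb'⟩ := exists_addRed hi x (.redIndet i) b hl.2
    exact ⟨_, PlaceRed.indet b b' rest hl hb'⟩

lemma exists_placeBlue {i : ℕ} {x : ℝ} (h1 : 1 ≤ i) (h2 : i ≤ 16) (B : Multiset (LargeBin 3))
    (hB : ∀ b ∈ B, LargeOK b) : ∃ B', PlaceBlue PC i x B B' := by
  classical
  have hpos : 0 < PC.β i ^ 3 := pow_pos (beta_pos h1 h2) 3
  by_cases hφ : PC.φ i = 0
  · by_cases h₁ : ∀ a ∈ B, ¬ MonoOpen PC i a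
    · obtain ⟨b', hb'⟩ := exists_addBlue h1 h2 x (.mono i) (LargeBin.empty 3 (.mono i)) hpos
      exact ⟨_, PlaceBlue.monoNew B b' hφ h₁ hb'⟩
    · push Not at h₁
      obtain ⟨b, hb, hl⟩ := h₁
      obtain ⟨rest, rfl⟩ := Multiset.exists_cons_of_mem hb
      obtain ⟨b', hb'⟩ := exists_addBlue h1 h2 x (.mono i) b hl.2
      exact ⟨_, PlaceBlue.mono b b' rest hφ hl hb'⟩
  by_cases h₁ : ∀ a ∈ B, ∀ l, ¬ BlueBichromOpen PC i l a
  · by_cases h₂ : ∀ a ∈ B, ¬ BlueIndetOpen PC i a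
    · by_cases h₃ : ∀ a ∈ B, ∀ l, ¬ BlueJoinable PC i l a
      · obtain ⟨b', hb'⟩ := exists_addBlue h1 h2 x (.blueIndet i)
          (LargeBin.empty 3 (.blueIndet i)) hpos
        exact ⟨_, PlaceBlue.new B b' hφ h₁ h₂ h₃ hb'⟩
      · push Not at h₃
        obtain ⟨b, hb, l, hl⟩ := h₃
        obtain ⟨rest, rfl⟩ := Multiset.exists_cons_of_mem hb
        have h0 := hB b hb
        simp only [LargeOK, hl.1] at h0
        obtain ⟨b', hb'⟩ := exists_addBlue h1 h2 x (.bichrom i l) b (by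
          rw [h0.2.1]; exact hpos)
        exact ⟨_, PlaceBlue.join l b b' rest hφ h₁ h₂ hl hb'⟩
    · push Not at h₂
      obtain ⟨b, hb, hl⟩ := h₂
      obtain ⟨rest, rfl⟩ := Multiset.exists_cons_of_mem hb
      obtain ⟨b', hb'⟩ := exists_addBlue h1 h2 x (.blueIndet i) b hl.2
      exact ⟨_, PlaceBlue.indet b b' rest hφ h₁ hl hb'⟩
  · push Not at h₁
    obtain ⟨b, hb, l, hl⟩ := h₁
    obtain ⟨rest, rfl⟩ := Multiset.exists_cons_of_mem hb
    obtain ⟨b', hb'⟩ := exists_addBlue h1 h2 x (.bichrom i l) b hl.2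
    exact ⟨_, PlaceBlue.bichrom l b b' rest hφ hl hb'⟩

/-! ### Sub-bins: containment, disjointness, volume -/

/-- The cube occupied by a sub-bin in a bin of group `i`. -/
def SubBin.cube (i : ℕ) (u : SubBin 3) : Placed 3 := ⟨1 / (2 ^ u.level * (i : ℝ)), u.corner⟩

/-- Two sub-bins of a bin of group `i` do not overlap. -/
def SubDisjoint (i : ℕ) (u v : SubBin 3) : Prop := (u.cube i).NonOverlap (v.cube i)

/-- The sub-bin `w` is a part of `u`. -/
def SubContained (i : ℕ) (w u : SubBin 3) : Prop :=
  ∀ k, u.corner k ≤ w.corner k ∧ w.corner k + (w.cube i).size ≤ u.corner k + (u.cube i).size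

/-- Symmetry makes pairwise disjointness independent of the order, hence meaningful for multisets.
-/
instance (i : ℕ) : Std.Symm (SubDisjoint i) :=
  ⟨fun _ _ ⟨k, hk⟩ => ⟨k, hk.symm⟩⟩

lemma pairwise_add_iff {α : Type*} {r : α → α → Prop} [Std.Symm r] {A B : Multiset α} :
    (A + B).Pairwise r ↔ A.Pairwise r ∧ B.Pairwise r ∧ ∀ a ∈ A, ∀ b ∈ B, r a b := by
  induction A using Quotient.inductionOn with | h a =>
  induction B using Quotient.inductionOn with | h b =>
  simp only [Multiset.quot_mk_to_coe, Multiset.coe_add, Multiset.pairwise_coe_iff_pairwise,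
    List.pairwise_append, Multiset.mem_coe]

lemma pairwise_cons_iff {α : Type*} {r : α → α → Prop} [Std.Symm r] {a : α} {B : Multiset α} :
    (a ::ₘ B).Pairwise r ↔ (∀ b ∈ B, r a b) ∧ B.Pairwise r := by
  induction B using Quotient.inductionOn with | h b =>
  simp only [Multiset.quot_mk_to_coe, Multiset.cons_coe, Multiset.pairwise_coe_iff_pairwise,
    List.pairwise_cons, Multiset.mem_coe]

lemma pairwise_map_univ {ι α : Type*} [Fintype ι] {r : α → α → Prop} {f : ι → α}
    (h : ∀ a b, a ≠ b → r (f a) (f b)) :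
    ((Finset.univ : Finset ι).val.map f).Pairwise r := by
  refine ⟨(Finset.univ : Finset ι).toList.map f, ?_, ?_⟩
  · rw [← Multiset.map_coe, Finset.coe_toList]
  · rw [List.pairwise_map]
    exact (Finset.nodup_toList _).imp (fun {a b} hab => h a b hab)

lemma SubDisjoint.mono {i : ℕ} {u v w : SubBin 3} (h : SubDisjoint i u v)
    (hw : SubContained i w u) : SubDisjoint i w v := by
  obtain ⟨k, hk⟩ := h
  refine ⟨k, ?_⟩
  have := hw k
  simp only [SubBin.cube] at *
  rcases hk with h | h
  · left; linarith
  · right; linarith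

lemma SubContained.trans {i : ℕ} {u v w : SubBin 3} (hwv : SubContained i w v)
    (hvu : SubContained i v u) : SubContained i w u := fun k =>
  ⟨(hvu k).1.trans (hwv k).1, (hwv k).2.trans (hvu k).2⟩

/-- Volume of a sub-bin. -/
def SubBin.vol (i : ℕ) (u : SubBin 3) : ℝ := (u.cube i).size ^ 3

/-- The sub-bins in `M` partition the sub-bin `u`. -/
structure Refines (i : ℕ) (u : SubBin 3) (M : Multiset (SubBin 3)) : Prop where
  contained : ∀ w ∈ M, SubContained i w u
  disjoint : M.Pairwise (SubDisjoint i)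
  vol : (M.map (SubBin.vol i)).sum = u.vol i

lemma Refines.refl (i : ℕ) (u : SubBin 3) : Refines i u {u} where
  contained := by
    intro w hw
    rw [Multiset.mem_singleton.1 hw]
    exact fun k => ⟨le_rfl, le_rfl⟩
  disjoint := Multiset.pairwise_coe_iff_pairwise.2 (List.pairwise_singleton _ u)
  vol := by simp

/-- Partitioning one part of a partition again gives a partition; this is the inductive step for
`Carve`. -/
lemma Refines.split {i : ℕ} {u w : SubBin 3} {M N : Multiset (SubBin 3)}
    (h : Refines i u (w ::ₘ M)) (h' : Refines i w N) : Refines i u (N + M) where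
  contained := by
    intro x hx
    rcases Multiset.mem_add.1 hx with hx | hx
    · exact (h'.contained x hx).trans (h.contained w (Multiset.mem_cons_self _ _))
    · exact h.contained x (Multiset.mem_cons_of_mem hx)
  disjoint := by
    obtain ⟨h1, h2⟩ := pairwise_cons_iff.1 h.disjoint
    exact pairwise_add_iff.2 ⟨h'.disjoint, h2, fun a ha b hb => (h1 b hb).mono (h'.contained a ha)⟩
  vol := by
    have := h.vol
    rw [Multiset.map_cons, Multiset.sum_cons] at this
    rw [Multiset.map_add, Multiset.sum_add, h'.vol, this]

/-- The parts are the cells of a grid of half the side, shifted to the corner of the sub-bin, and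
eight cubes of half the side have the volume of the whole. -/
lemma refines_children {i : ℕ} (hi : 0 < i) (u : SubBin 3) : Refines i u (u.children i) where
  contained := by
    intro w hw
    obtain ⟨c, -, rfl⟩ := Multiset.mem_map.1 hw
    intro k
    have hp : (0 : ℝ) < 1 / (2 ^ (u.level + 1) * (i : ℝ)) := by positivity
    have h2 : (1 : ℝ) / (2 ^ u.level * (i : ℝ)) = 2 * (1 / (2 ^ (u.level + 1) * (i : ℝ))) := by
      field_simp; ring
    have hc : ((c k : ℕ) : ℝ) ≤ 1 := by
      have := (c k).2
      exact_mod_cast (by omega : (c k : ℕ) ≤ 1)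
    have hc0 : (0 : ℝ) ≤ ((c k : ℕ) : ℝ) := by positivity
    simp only [SubBin.cube]
    rw [h2]
    constructor <;> nlinarith
  disjoint := by
    refine pairwise_map_univ fun a b hab => ?_
    obtain ⟨k, hk⟩ := cell_separated (t := 1 / (2 ^ (u.level + 1) * (i : ℝ))) (by positivity) hab
    refine ⟨k, ?_⟩
    simp only [SubBin.cube]
    rcases hk with h | h
    · left; linarith
    · right; linarith
  vol := by
    simp only [SubBin.children, SubBin.vol, SubBin.cube, Multiset.map_map, Function.comp_def,
      Multiset.map_const', Multiset.sum_replicate]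
    simp only [Finset.card_val, Finset.card_univ, Fintype.card_fun, Fintype.card_fin, nsmul_eq_mul]
    have : (i : ℝ) ≠ 0 := by positivity
    push_cast
    field_simp
    ring

lemma children_level {i : ℕ} {u w : SubBin 3} (h : w ∈ u.children i) : w.level = u.level + 1 := by
  obtain ⟨c, -, rfl⟩ := Multiset.mem_map.1 h
  rfl

lemma card_children (i : ℕ) (u : SubBin 3) : (u.children i).card = 8 := by
  simp [SubBin.children]

lemma Carve.refines {i k : ℕ} (hi : 0 < i) {u v : SubBin 3} {left : Multiset (SubBin 3)}
    (h : Carve i k u v left) : Refines i u (v ::ₘ left) := by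
  induction h with
  | done u h => exact Refines.refl i u
  | split u w v rest left h hc hw ih =>
    have := (hc ▸ refines_children hi u : Refines i u (w ::ₘ rest)).split ih
    rwa [Multiset.cons_add, add_comm] at this

lemma Carve.level_eq {i k : ℕ} {u v : SubBin 3} {left : Multiset (SubBin 3)}
    (h : Carve i k u v left) : v.level = k := by
  induction h with
  | done u h => exact h
  | split u w v rest left h hc hw ih => exact ih

lemma Carve.left_level {i k : ℕ} {u v : SubBin 3} {left : Multiset (SubBin 3)}
    (h : Carve i k u v left) : ∀ w ∈ left, u.level < w.level ∧ w.level ≤ k := by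
  induction h with
  | done u h => simp
  | split u w v rest left h hc hw ih =>
    have hwl : w.level = u.level + 1 := children_level (hc ▸ Multiset.mem_cons_self w rest)
    intro x hx
    rcases Multiset.mem_add.1 hx with hx | hx
    · have : x.level = u.level + 1 := children_level (hc ▸ Multiset.mem_cons_of_mem hx)
      omega
    · have := ih x hx
      omega

/-- Each partition leaves seven parts, all of the level that it creates, and these levels increase
strictly. So no level receives leftovers twice. -/
lemma Carve.count_left {i k : ℕ} {u v : SubBin 3} {left : Multiset (SubBin 3)}
    (h : Carve i k u v left) (l : ℕ) : (left.map SubBin.level).count l ≤ 7 := by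
  induction h with
  | done u h => simp
  | split u w v rest left h hc hw ih =>
    have hwl : w.level = u.level + 1 := children_level (hc ▸ Multiset.mem_cons_self w rest)
    have hcard : rest.card = 7 := by
      have := card_children i u
      rw [hc, Multiset.card_cons] at this
      omega
    rw [Multiset.map_add, Multiset.count_add]
    by_cases hl : l = u.level + 1
    · have : (left.map SubBin.level).count l = 0 := by
        rw [Multiset.count_eq_zero]
        intro hm
        obtain ⟨x, hx, rfl⟩ := Multiset.mem_map.1 hm
        have := hw.left_level x hx
        omega
      have := Multiset.count_le_card l (rest.map SubBin.level)
      rw [Multiset.card_map] at this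
      omega
    · have : (rest.map SubBin.level).count l = 0 := by
        rw [Multiset.count_eq_zero]
        intro hm
        obtain ⟨x, hx, rfl⟩ := Multiset.mem_map.1 hm
        exact hl (children_level (hc ▸ Multiset.mem_cons_of_mem hx))
      omega

lemma exists_carve {i : ℕ} (k : ℕ) (u : SubBin 3) (h : u.level ≤ k) :
    ∃ v left, Carve i k u v left := by
  induction hn : k - u.level generalizing u with
  | zero => exact ⟨u, 0, .done u (by omega)⟩
  | succ n ih =>
    have : 0 < (u.children i).card := by rw [card_children]; norm_num
    obtain ⟨w, hw⟩ := Multiset.card_pos_iff_exists_mem.1 this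
    obtain ⟨rest, hr⟩ := Multiset.exists_cons_of_mem hw
    have hl := children_level hw
    obtain ⟨v, left, hc⟩ := ih w (by omega) (by omega)
    exact ⟨v, _, .split u w v rest left (by omega) hr hc⟩

/-- The whole bin, as a sub-bin of a bin of group one. -/
lemma refines_fresh {i : ℕ} (hi : 0 < i) :
    (∀ u ∈ freshSubBins 3 i, (u.cube i).Inside) ∧
      (freshSubBins 3 i).Pairwise (SubDisjoint i) ∧
      ((freshSubBins 3 i).map (SubBin.vol i)).sum = 1 := by
  have hi' : (0 : ℝ) < i := by exact_mod_cast hi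
  refine ⟨?_, ?_, ?_⟩
  · intro u hu
    obtain ⟨c, -, rfl⟩ := Multiset.mem_map.1 hu
    intro k
    have := cell_le (c k) (t := 1 / (i : ℝ)) (by positivity)
    have h1 : (i : ℝ) * (1 / (i : ℝ)) = 1 := by field_simp
    simp only [SubBin.cube, pow_zero, one_mul]
    refine ⟨by positivity, ?_⟩
    rw [div_eq_mul_one_div]
    linarith
  · refine pairwise_map_univ fun a b hab => ?_
    obtain ⟨k, hk⟩ := cell_separated (t := 1 / (i : ℝ)) (by positivity) hab
    refine ⟨k, ?_⟩
    simp only [SubBin.cube, pow_zero, one_mul]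
    rw [div_eq_mul_one_div ((a k : ℕ) : ℝ), div_eq_mul_one_div ((b k : ℕ) : ℝ)]
    exact hk
  · simp only [freshSubBins, SubBin.vol, SubBin.cube, Multiset.map_map, Function.comp_def,
      Multiset.map_const', Multiset.sum_replicate]
    simp only [Finset.card_val, Finset.card_univ, Fintype.card_fun, Fintype.card_fin, nsmul_eq_mul]
    push_cast
    field_simp

/-! ### Invariant of the bins for small items -/

/-- The item `q` fills the sub-bin `u` of a bin of group `i` as far as its group demands. -/
def Fills (i : ℕ) (q : Placed 3) (u : SubBin 3) : Prop :=
  q.pos = u.corner ∧ 1 / ((i : ℝ) + 1) < 2 ^ u.level * q.size ∧ 2 ^ u.level * q.size ≤ 1 / (i : ℝ)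

/-- The items and the empty sub-bins partition the bin, and few sub-bins are empty. -/
structure SmallOK (b : SmallBin 3) : Prop where
  group_ge : 11 ≤ b.group
  group_le : b.group ≤ 21
  tiling : ∃ cells : List (SubBin 3), List.Forall₂ (Fills b.group) b.items cells ∧
    (∀ u ∈ (cells : Multiset (SubBin 3)) + b.empties, (u.cube b.group).Inside) ∧
    ((cells : Multiset (SubBin 3)) + b.empties).Pairwise (SubDisjoint b.group) ∧
    (((cells : Multiset (SubBin 3)) + b.empties).map (SubBin.vol b.group)).sum = 1
  few : ∀ l, 1 ≤ l → (b.empties.map SubBin.level).count l ≤ 7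
  closed : b.active = false → ∀ u ∈ b.empties, 1 ≤ u.level

/-- The partition survives because `u` is exchanged for a refinement of itself. The bound of seven
survives because `u` has the largest level not above k: no empty sub-bin has a level strictly above
that of `u` and at most k, and only such levels receive leftovers. -/
lemma AddSmall.smallOK {k : ℕ} {x : ℝ} {b b' : SmallBin 3} (h : AddSmall k x b b')
    (hb : SmallOK b) (hact : b.active = true) (hx : PC.HasGroup x b.group k) :
    SmallOK b' ∧ b'.group = b.group ∧ b'.active = true ∧ b'.items.map Placed.size = x :: b.items.map Placed.size := by
  obtain ⟨u, v, rest, left, he, huk, hmax, hcarve, rfl⟩ := h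
  refine ⟨⟨hb.group_ge, hb.group_le, ?_, ?_, ?_⟩, rfl, hact, rfl⟩
  · obtain ⟨cells, hf, hin, hdis, hvol⟩ := hb.tiling
    have hi : 0 < b.group := by have := hb.group_ge; omega
    have hr := hcarve.refines hi
    refine ⟨v :: cells, ?_, ?_, ?_, ?_⟩
    · refine List.Forall₂.cons ⟨rfl, ?_, ?_⟩ hf
      · rw [hcarve.level_eq]; exact hx.2.2.2.1
      · rw [hcarve.level_eq]; exact hx.2.2.2.2
    · have hu : (u.cube b.group).Inside := hin u (by rw [he]; simp)
      have aux : ∀ w ∈ v ::ₘ left, (w.cube b.group).Inside := by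
        intro w hw k
        have h1 := hr.contained w hw k
        have h2 := hu k
        simp only [SubBin.cube] at *
        exact ⟨h2.1.trans h1.1, h1.2.trans h2.2⟩
      intro w hw
      simp only [Multiset.mem_add, Multiset.mem_coe, List.mem_cons] at hw
      rcases hw with (rfl | hw) | hw | hw
      · exact aux _ (by simp)
      · exact hin _ (by simp [hw])
      · exact hin _ (by rw [he]; simp [hw])
      · exact aux _ (by simp [hw])
    all_goals
      -- The two tilings differ only in that `u` is replaced by `v ::ₘ left`.
      have e1 : ((v :: cells : List (SubBin 3)) : Multiset (SubBin 3)) + (rest + left) =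
          (v ::ₘ left) + ((cells : Multiset (SubBin 3)) + rest) := by
        rw [← Multiset.cons_coe, Multiset.cons_add, Multiset.cons_add, add_comm rest left,
          add_left_comm]
      have e2 : (cells : Multiset (SubBin 3)) + b.empties =
          u ::ₘ ((cells : Multiset (SubBin 3)) + rest) := by
        rw [he, Multiset.add_cons]
    · change (((v :: cells : List (SubBin 3)) : Multiset (SubBin 3)) + (rest + left)).Pairwise _
      rw [e1]
      rw [e2] at hdis
      obtain ⟨h1, h2⟩ := pairwise_cons_iff.1 hdis
      exact pairwise_add_iff.2 ⟨hr.disjoint, h2, fun a ha c hc => (h1 c hc).mono (hr.contained a ha)⟩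
    · change ((((v :: cells : List (SubBin 3)) : Multiset (SubBin 3)) + (rest + left)).map _).sum = 1
      rw [e1, Multiset.map_add, Multiset.sum_add, hr.vol]
      rw [e2, Multiset.map_cons, Multiset.sum_cons] at hvol
      exact hvol
  · intro l hl
    change ((rest + left).map SubBin.level).count l ≤ 7
    have hold := hb.few l hl
    rw [he, Multiset.map_cons] at hold
    have hrest : (rest.map SubBin.level).count l ≤ 7 :=
      (Multiset.count_le_of_le l (Multiset.le_cons_self _ _)).trans hold
    rw [Multiset.map_add, Multiset.count_add]
    -- In this range all empty sub-bins are new leftovers; outside it there are no leftovers and the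
    -- old bound remains.
    by_cases hlk : u.level < l ∧ l ≤ k
    · have : (rest.map SubBin.level).count l = 0 := by
        rw [Multiset.count_eq_zero]
        intro hm
        obtain ⟨y, hy, rfl⟩ := Multiset.mem_map.1 hm
        have := hmax y (by rw [he]; simp [hy]) hlk.2
        omega
      have := hcarve.count_left l
      omega
    · have : (left.map SubBin.level).count l = 0 := by
        rw [Multiset.count_eq_zero]
        intro hm
        obtain ⟨y, hy, rfl⟩ := Multiset.mem_map.1 hm
        exact hlk (hcarve.left_level y hy)
      omega
  · intro h
    exact absurd (hact.symm.trans h) (by simp)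

lemma exists_addSmall {i k : ℕ} {x : ℝ} {b : SmallBin 3} (h : CanTake i k b) :
    ∃ b', AddSmall k x b b' := by
  obtain ⟨-, -, u₀, hu₀, hk₀⟩ := h
  classical
  have hne : ((b.empties.map SubBin.level).toFinset.filter (· ≤ k)).Nonempty :=
    ⟨u₀.level, by simp only [Finset.mem_filter, Multiset.mem_toFinset, Multiset.mem_map]; exact ⟨⟨u₀, hu₀, rfl⟩, hk₀⟩⟩
  obtain ⟨l, hl, hmax⟩ := Finset.exists_max_image _ id hne
  simp only [Finset.mem_filter, Multiset.mem_toFinset, Multiset.mem_map] at hl hmax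
  obtain ⟨⟨u, hu, rfl⟩, hlk⟩ := hl
  obtain ⟨rest, hr⟩ := Multiset.exists_cons_of_mem hu
  obtain ⟨v, left, hc⟩ := exists_carve (i := b.group) k u hlk
  exact ⟨_, u, v, rest, left, hr, hlk, fun w hw hwk => hmax _ ⟨⟨w, hw, rfl⟩, hwk⟩, hc, rfl⟩

/-- All i³ empty sub-bins of a fresh bin have level 0; for this reason the bound of seven only
concerns positive levels. -/
lemma fresh_smallOK {i : ℕ} (h1 : 11 ≤ i) (h2 : i ≤ 21) :
    SmallOK ⟨i, true, [], freshSubBins 3 i⟩ where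
  group_ge := h1
  group_le := h2
  tiling := by
    obtain ⟨h, h', h''⟩ := refines_fresh (i := i) (by omega)
    exact ⟨[], .nil, by simpa using h, by simpa using h', by simpa using h''⟩
  few := by
    intro l hl
    change ((freshSubBins 3 i).map SubBin.level).count l ≤ 7
    rw [Multiset.count_eq_zero.2]
    · omega
    · intro hm
      obtain ⟨y, hy, rfl⟩ := Multiset.mem_map.1 hm
      obtain ⟨c, -, rfl⟩ := Multiset.mem_map.1 hy
      simp at hl
  closed := by simp

/-- The invariant of the collection of bins for small items. -/
def SmallInv (B : Multiset (SmallBin 3)) : Prop :=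
  (∀ b ∈ B, SmallOK b) ∧ ∀ i, (B.filter fun b => b.group = i ∧ b.active = true).card ≤ 1

lemma HasGroup.range {x : ℝ} {i k : ℕ} (h : PC.HasGroup x i k) : 11 ≤ i ∧ i ≤ 21 := by
  have h1 : 11 ≤ i := h.2.1
  have h2 : i + 1 ≤ 2 * 11 := h.2.2.1
  omega

/-- Opening a bin closes the active bin of the same group, so at most one stays active. It is closed
only when it has no empty sub-bin of level at most k, in particular none of level 0. -/
lemma PlaceSmall.inv {i k : ℕ} {x : ℝ} {B B' : Multiset (SmallBin 3)} (h : PlaceSmall i k x B B')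
    (hx : PC.HasGroup x i k) (hB : SmallInv B) : SmallInv B' := by
  obtain ⟨h1, h2⟩ := HasGroup.range hx
  cases h with
  | current b b' rest hb hadd =>
    obtain ⟨ho, hg, ha, -⟩ := hadd.smallOK (hB.1 b (by simp)) hb.2.1 (hb.1 ▸ hx)
    refine ⟨?_, fun j => ?_⟩
    · intro a ha
      rcases Multiset.mem_cons.1 ha with rfl | ha
      · exact ho
      · exact hB.1 a (by simp [ha])
    · have := hB.2 j
      rw [← Multiset.countP_eq_card_filter, Multiset.countP_cons] at this ⊢
      simpa [hg, ha, hb.2.1] using this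
  | new _ b' h hadd =>
    obtain ⟨ho, hg, ha, -⟩ := hadd.smallOK (fresh_smallOK h1 h2) rfl hx
    have hg : b'.group = i := hg
    refine ⟨?_, fun j => ?_⟩
    · intro a ha
      rcases Multiset.mem_cons.1 ha with rfl | ha
      · exact ho
      · obtain ⟨c, hc, rfl⟩ := Multiset.mem_map.1 ha
        have hcok := hB.1 c hc
        split_ifs with hci
        · refine ⟨hcok.group_ge, hcok.group_le, hcok.tiling, hcok.few, fun _ u hu => ?_⟩
          change u ∈ c.empties at hu
          -- An active bin with an empty sub-bin of level 0 could have taken the item; a bin that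
          -- was closed earlier has the property already.
          by_cases hact : c.active = true
          · by_contra hlt
            exact h c hc ⟨hci, hact, u, hu, by omega⟩
          · exact hcok.closed (by simpa using hact) u hu
        · exact hcok
    · rw [← Multiset.countP_eq_card_filter, Multiset.countP_cons, Multiset.countP_map]
      -- In the group of the item all old bins are now closed and only the new one counts; in the
      -- other groups nothing changes.
      by_cases hj : j = i
      · subst hj
        have : (B.filter fun a => (if a.group = j then a.close else a).group = j ∧
            (if a.group = j then a.close else a).active = true) = 0 := by
          rw [Multiset.filter_eq_nil]
          intro a _
          split_ifs with hh
          · simp [SmallBin.close]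
          · simp [hh]
        rw [this]
        split_ifs <;> simp
      · have e : (B.filter fun a => (if a.group = i then a.close else a).group = j ∧
            (if a.group = i then a.close else a).active = true) =
            B.filter fun b => b.group = j ∧ b.active = true := by
          refine Multiset.filter_congr fun a _ => ?_
          split_ifs with hh
          · simp [SmallBin.close]
            intro h'
            exact absurd (h'.symm.trans hh) hj
          · rfl
        rw [e, if_neg (by rw [hg]; tauto)]
        simpa using hB.2 j

lemma exists_placeSmall {i k : ℕ} {x : ℝ} (hx : PC.HasGroup x i k) (B : Multiset (SmallBin 3)) :
    ∃ B', PlaceSmall i k x B B' := by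
  by_cases h : ∃ a ∈ B, CanTake i k a
  · obtain ⟨a, ha, hc⟩ := h
    obtain ⟨rest, rfl⟩ := Multiset.exists_cons_of_mem ha
    obtain ⟨b', hb'⟩ := exists_addSmall (x := x) hc
    exact ⟨_, .current a b' rest hc hb'⟩
  · push Not at h
    have : CanTake i k (⟨i, true, [], freshSubBins 3 i⟩ : SmallBin 3) := by
      obtain ⟨h1, -⟩ := HasGroup.range hx
      refine ⟨rfl, rfl, ⟨0, fun k => ((⟨0, by omega⟩ : Fin i) : ℕ) / (i : ℝ)⟩, ?_, Nat.zero_le _⟩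
      exact Multiset.mem_map.2 ⟨fun _ => ⟨0, by omega⟩, Finset.mem_univ _, rfl⟩
    obtain ⟨b', hb'⟩ := exists_addSmall (x := x) this
    exact ⟨_, .new B b' h hb'⟩

/-- An item shares the lower corner of its sub-bin and is not larger, so it inherits position and
disjointness from the sub-bin. -/
lemma SmallOK.isBin {b : SmallBin 3} (hb : SmallOK b) : IsBin b.items := by
  obtain ⟨cells, hf, hin', hdis', -⟩ := hb.tiling
  have hi : (0 : ℝ) < b.group := by have := hb.group_ge; positivity
  have key : ∀ q u, Fills b.group q u → ∀ k, q.pos k = (u.cube b.group).pos k ∧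
      q.size ≤ (u.cube b.group).size := by
    rintro q u ⟨h1, -, h3⟩ k
    refine ⟨by rw [h1]; rfl, ?_⟩
    simp only [SubBin.cube]
    rw [le_div_iff₀ (by positivity)] at h3 ⊢
    linarith
  have hdis : cells.Pairwise (SubDisjoint b.group) :=
    Multiset.pairwise_coe_iff_pairwise.1 (pairwise_add_iff.1 hdis').1
  have hin : ∀ u ∈ cells, (u.cube b.group).Inside := fun u hu => hin' u (by simp [hu])
  clear hb hin' hdis'
  generalize b.items = items at hf
  induction hf with
  | nil => exact ⟨by simp, .nil⟩
  | @cons q u qs us hqu hrest ih =>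
    obtain ⟨i1, i2⟩ := ih (List.pairwise_cons.1 hdis).2 (fun u hu => hin u (by simp [hu]))
    have hd := (List.pairwise_cons.1 hdis).1
    refine ⟨?_, List.pairwise_cons.2 ⟨?_, i2⟩⟩
    · intro p hp
      rcases List.mem_cons.1 hp with rfl | hp
      · intro k
        have := key _ _ hqu k
        have := hin u (by simp) k
        constructor <;> linarith
      · exact i1 p hp
    · intro p hp
      obtain ⟨n, hn, rfl⟩ := List.mem_iff_getElem.1 hp
      have hf2 := List.Forall₂.get hrest hn (hrest.length_eq ▸ hn)
      obtain ⟨k, hk⟩ := hd _ (List.getElem_mem (hrest.length_eq ▸ hn))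
      have h1 := key _ _ hqu k
      have h2 := key _ _ hf2 k
      refine ⟨k, ?_⟩
      simp only [List.get_eq_getElem] at h2
      rcases hk with h | h
      · left; linarith
      · right; linarith

/-! ### Density of the closed bins for small items -/

/-- A multiset of positive levels, each at most seven times, has `8`-adic weight at most one. -/
lemma sum_levels_le {M : Multiset ℕ} (h0 : ∀ l ∈ M, 1 ≤ l) (h7 : ∀ l, 1 ≤ l → M.count l ≤ 7) :
    (M.map fun l => ((1 : ℝ) / 8) ^ l).sum ≤ 1 := by
  rw [Finset.sum_multiset_map_count]
  obtain ⟨N, hN⟩ : ∃ N, ∀ l ∈ M, l ≤ N := ⟨M.sup, fun l hl => Multiset.le_sup hl⟩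
  have hsub : M.toFinset ⊆ Finset.Icc 1 N := by
    intro l hl
    rw [Multiset.mem_toFinset] at hl
    exact Finset.mem_Icc.2 ⟨h0 l hl, hN l hl⟩
  -- Seven sub-bins on each level fill the octal expansion 0.777… of 1.
  have hgeo : ∀ n : ℕ, ∑ l ∈ Finset.Icc 1 n, (7 : ℝ) * (1 / 8) ^ l = 1 - (1 / 8) ^ n := by
    intro n
    induction n with
    | zero => simp
    | succ n ih => rw [Finset.sum_Icc_succ_top (by omega), ih]; ring
  calc ∑ l ∈ M.toFinset, M.count l • ((1 : ℝ) / 8) ^ l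
      ≤ ∑ l ∈ M.toFinset, (7 : ℝ) * (1 / 8) ^ l := by
        refine Finset.sum_le_sum fun l hl => ?_
        rw [nsmul_eq_mul]
        have : (M.count l : ℝ) ≤ 7 := by exact_mod_cast h7 l (h0 l (Multiset.mem_toFinset.1 hl))
        gcongr
    _ ≤ ∑ l ∈ Finset.Icc 1 N, (7 : ℝ) * (1 / 8) ^ l :=
        Finset.sum_le_sum_of_subset_of_nonneg hsub fun _ _ _ => by positivity
    _ ≤ 1 := by rw [hgeo]; have : (0 : ℝ) ≤ (1 / 8) ^ N := by positivity
                linarith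

/-- A closed bin is filled to at least `1330 / 1728`. -/
lemma SmallOK.volume_closed {b : SmallBin 3} (hb : SmallOK b) (hc : b.active = false) :
    (1330 : ℝ) / 1728 ≤ (b.items.map fun q => q.size ^ 3).sum := by
  obtain ⟨cells, hf, -, -, hvol⟩ := hb.tiling
  have h11 : (11 : ℝ) ≤ b.group := by exact_mod_cast hb.group_ge
  set i : ℝ := (b.group : ℝ) with hi
  have hi0 : 0 < i := by linarith
  -- A sub-bin of level l has volume 8^(-l) / i³, so all the empty ones together are at most as
  -- large as one sub-bin of level 0.
  have hE : (b.empties.map (SubBin.vol b.group)).sum ≤ 1 / i ^ 3 := by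
    have e : b.empties.map (SubBin.vol b.group) =
        (b.empties.map SubBin.level).map fun l => (1 / i ^ 3) * ((1 : ℝ) / 8) ^ l := by
      rw [Multiset.map_map]
      refine Multiset.map_congr rfl fun u _ => ?_
      simp only [SubBin.vol, SubBin.cube, Function.comp]
      rw [← hi, div_pow, mul_pow, div_pow, one_pow, one_pow, ← pow_mul, mul_comm u.level 3, pow_mul]
      norm_num
    rw [e, Multiset.sum_map_mul_left]
    have h1 := sum_levels_le (M := b.empties.map SubBin.level) (by
      intro l hl
      obtain ⟨u, hu, rfl⟩ := Multiset.mem_map.1 hl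
      exact hb.closed hc u hu) hb.few
    have : 0 < 1 / i ^ 3 := by positivity
    nlinarith
  -- In each direction an item covers more than the fraction i / (i + 1) of its sub-bin.
  have hcells : (i / (i + 1)) ^ 3 * (cells.map (SubBin.vol b.group)).sum ≤
      (b.items.map fun q => q.size ^ 3).sum := by
    clear hvol
    generalize b.items = items at hf
    induction hf with
    | nil => simp
    | @cons q u qs us hqu hrest ih =>
      simp only [List.map_cons, List.sum_cons, mul_add]
      refine add_le_add ?_ ih
      obtain ⟨-, h2, -⟩ := hqu
      simp only [SubBin.vol, SubBin.cube]
      rw [← mul_pow, ← hi]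
      refine pow_le_pow_left₀ (by positivity) ?_ 3
      rw [← hi, div_lt_iff₀ (by positivity)] at h2
      rw [div_mul_div_comm, div_le_iff₀ (by positivity)]
      nlinarith
  rw [Multiset.map_add, Multiset.sum_add, Multiset.map_coe, Multiset.sum_coe] at hvol
  refine le_trans ?_ hcells
  have h1 : 1 - 1 / i ^ 3 ≤ (cells.map (SubBin.vol b.group)).sum := by linarith
  -- The product is (i³ - 1) / (i + 1)³, which for i = 11 equals 1330 / 1728.
  have h2 : (1330 : ℝ) / 1728 ≤ (i / (i + 1)) ^ 3 * (1 - 1 / i ^ 3) := by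
    have : (i / (i + 1)) ^ 3 * (1 - 1 / i ^ 3) = (i ^ 3 - 1) / (i + 1) ^ 3 := by
      field_simp
    rw [this, div_le_div_iff₀ (by norm_num) (by positivity)]
    nlinarith [mul_nonneg (sub_nonneg.2 h11) (sub_nonneg.2 h11), mul_nonneg (mul_nonneg (sub_nonneg.2 h11) (sub_nonneg.2 h11)) hi0.le]
  exact h2.trans (mul_le_mul_of_nonneg_left h1 (by positivity))

/-! ### Every item has a group or a type -/

/-- When doubling makes x exceed 1/22 for the first time, the result y lies in (1/22, 1/11]. Then 1
/ y lies in [11, 22), and its integer part is the group. -/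
lemma exists_hasGroup {x : ℝ} (h0 : 0 < x) (h1 : x ≤ 1 / 11) : ∃ i k, PC.HasGroup x i k := by
  have hex : ∃ k : ℕ, 1 / 22 < 2 ^ k * x := by
    obtain ⟨k, hk⟩ := pow_unbounded_of_one_lt (1 / x) (one_lt_two)
    refine ⟨k, ?_⟩
    rw [div_lt_iff₀ h0] at hk
    linarith
  classical
  set k := Nat.find hex with hk
  have hlow : 1 / 22 < 2 ^ k * x := Nat.find_spec hex
  have hup : 2 ^ k * x ≤ 1 / 11 := by
    rcases Nat.eq_zero_or_pos k with h | h
    · rw [h]; simpa using h1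
    · obtain ⟨m, hm⟩ : ∃ m, k = m + 1 := ⟨k - 1, by omega⟩
      have := Nat.find_min hex (m := m) (by omega)
      rw [hm, pow_succ]
      linarith [not_lt.1 this]
  set y := 2 ^ k * x
  have hy : 0 < y := by positivity
  have ha : 11 ≤ 1 / y := by rw [le_div_iff₀ hy]; linarith
  have hb : 1 / y < 22 := by rw [div_lt_iff₀ hy]; linarith
  refine ⟨⌊1 / y⌋₊, k, ?_, ?_, ?_, ?_, ?_⟩
  · exact h1
  · exact Nat.le_floor (by exact_mod_cast ha)
  · have : ⌊1 / y⌋₊ < 22 := (Nat.floor_lt (by positivity)).2 (by exact_mod_cast hb)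
    change _ + 1 ≤ 2 * 11
    omega
  · have := Nat.lt_floor_add_one (1 / y)
    rw [div_lt_iff₀ (by positivity)]
    rw [div_lt_iff₀ hy] at this
    linarith
  · have := Nat.floor_le (a := 1 / y) (by positivity)
    have hpos : (0 : ℝ) < ⌊1 / y⌋₊ := by
      have : 11 ≤ ⌊1 / y⌋₊ := Nat.le_floor (by exact_mod_cast ha)
      positivity
    rw [le_div_iff₀ hpos]
    rw [le_div_iff₀ hy] at this
    linarith

/-- If no interval contained x, then x ≤ t_i would imply x ≤ t_{i+1} for each i, down to x ≤ 1/11.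
-/
lemma exists_hasType {x : ℝ} (h0 : 1 / 11 < x) (h1 : x ≤ 1) : ∃ i, PC.HasType x i := by
  by_contra hcon
  push Not at hcon
  have step : ∀ i, 1 ≤ i → i ≤ 16 → x ≤ tTable i → x ≤ tTable (i + 1) := by
    intro i hi hi' hx
    by_contra hlt
    exact hcon i ⟨hi, hi', not_le.1 hlt, hx⟩
  have : ∀ n, n ≤ 16 → x ≤ tTable (n + 1) := by
    intro n
    induction n with
    | zero => intro _; simpa [tTable] using h1
    | succ n ih => intro hn; exact step (n + 1) (by omega) hn (ih (by omega))
  have := this 16 le_rfl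
  norm_num [tTable] at this
  linarith

/-! ### No item is lost: the algorithm yields a correct packing -/

/-- The sizes of the items of all bins in `B`. -/
def itemSizes (B : Multiset (List (Placed 3))) : Multiset ℝ :=
  B.bind fun b => ((b.map Placed.size : List ℝ) : Multiset ℝ)

lemma AddBlue.sizes {i : ℕ} {x : ℝ} {g : Group} {b b' : LargeBin 3} (h : AddBlue PC i x g b b') :
    (((b'.blue ++ b'.red).map Placed.size : List ℝ) : Multiset ℝ) =
      x ::ₘ (((b.blue ++ b.red).map Placed.size : List ℝ) : Multiset ℝ) := by
  obtain ⟨c, -, rfl⟩ := h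
  simp

lemma AddRed.sizes {i : ℕ} {x : ℝ} {g : Group} {b b' : LargeBin 3} (h : AddRed PC i x g b b') :
    (((b'.blue ++ b'.red).map Placed.size : List ℝ) : Multiset ℝ) =
      x ::ₘ (((b.blue ++ b.red).map Placed.size : List ℝ) : Multiset ℝ) := by
  obtain ⟨c, -, -, rfl⟩ := h
  simp only [List.map_append, List.map_cons, Multiset.cons_coe, Multiset.coe_eq_coe]
  exact List.perm_middle

lemma PlaceRed.itemSizes {i : ℕ} {x : ℝ} {B B' : Multiset (LargeBin 3)}
    (h : PlaceRed PC i x B B') :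
    itemSizes (B'.map fun b => b.blue ++ b.red) = x ::ₘ itemSizes (B.map fun b => b.blue ++ b.red) := by
  unfold CubePacking.itemSizes
  cases h with
  | indet b b' rest hb hadd => simp only [Multiset.map_cons, Multiset.cons_bind, hadd.sizes, Multiset.cons_add]
  | bichrom j b b' rest h1 hb hadd => simp only [Multiset.map_cons, Multiset.cons_bind, hadd.sizes, Multiset.cons_add]
  | join j b b' rest h1 h2 hb hadd => simp only [Multiset.map_cons, Multiset.cons_bind, hadd.sizes, Multiset.cons_add]
  | new _ b' h1 h2 h3 hadd =>
    simp only [Multiset.map_cons, Multiset.cons_bind, hadd.sizes, Multiset.cons_add]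
    simp [LargeBin.empty]

lemma PlaceBlue.itemSizes {i : ℕ} {x : ℝ} {B B' : Multiset (LargeBin 3)}
    (h : PlaceBlue PC i x B B') :
    itemSizes (B'.map fun b => b.blue ++ b.red) = x ::ₘ itemSizes (B.map fun b => b.blue ++ b.red) := by
  unfold CubePacking.itemSizes
  cases h with
  | mono b b' rest hφ hb hadd => simp only [Multiset.map_cons, Multiset.cons_bind, hadd.sizes, Multiset.cons_add]
  | monoNew _ b' hφ h1 hadd =>
    simp only [Multiset.map_cons, Multiset.cons_bind, hadd.sizes, Multiset.cons_add]
    simp [LargeBin.empty]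
  | bichrom j b b' rest hφ hb hadd => simp only [Multiset.map_cons, Multiset.cons_bind, hadd.sizes, Multiset.cons_add]
  | indet b b' rest hφ h1 hb hadd => simp only [Multiset.map_cons, Multiset.cons_bind, hadd.sizes, Multiset.cons_add]
  | join j b b' rest hφ h1 h2 hb hadd => simp only [Multiset.map_cons, Multiset.cons_bind, hadd.sizes, Multiset.cons_add]
  | new _ b' hφ h1 h2 h3 hadd =>
    simp only [Multiset.map_cons, Multiset.cons_bind, hadd.sizes, Multiset.cons_add]
    simp [LargeBin.empty]

lemma AddSmall.sizes {k : ℕ} {x : ℝ} {b b' : SmallBin 3} (h : AddSmall k x b b') :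
    ((b'.items.map Placed.size : List ℝ) : Multiset ℝ) =
      x ::ₘ ((b.items.map Placed.size : List ℝ) : Multiset ℝ) := by
  obtain ⟨u, v, rest, left, -, -, -, -, rfl⟩ := h
  simp

lemma PlaceSmall.itemSizes {i k : ℕ} {x : ℝ} {B B' : Multiset (SmallBin 3)}
    (h : PlaceSmall i k x B B') :
    itemSizes (B'.map fun b => b.items) = x ::ₘ itemSizes (B.map fun b => b.items) := by
  unfold CubePacking.itemSizes
  cases h with
  | current b b' rest hb hadd => simp only [Multiset.map_cons, Multiset.cons_bind, hadd.sizes, Multiset.cons_add]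
  | new _ b' h hadd =>
    simp only [Multiset.map_cons, Multiset.cons_bind, hadd.sizes, Multiset.cons_add, Multiset.map_map]
    congr 1
    simp only [List.map_nil, Multiset.coe_nil, zero_add]
    congr 1
    refine Multiset.map_congr rfl fun a _ => ?_
    simp only [Function.comp]
    split_ifs <;> rfl

lemma Step.itemSizes {S S' : State 3} {x : ℝ} (h : Step PC S x S') :
    itemSizes S'.packing = x ::ₘ itemSizes S.packing := by
  have key : ∀ T : State 3, CubePacking.itemSizes T.packing =
      CubePacking.itemSizes (T.large.map fun b => b.blue ++ b.red) +
        CubePacking.itemSizes (T.small.map fun b => b.items) :=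
    fun T => Multiset.add_bind _ _ _
  rw [key, key]
  cases h with
  | small i k bins hx hp => simp only [hp.itemSizes, Multiset.add_cons]
  | red i bins hx hc hp => simp only [hp.itemSizes, Multiset.cons_add]
  | blue i bins hx hc hp => simp only [hp.itemSizes, Multiset.cons_add]

theorem Run.itemSizes {L : List ℝ} {S : State 3} (h : Run PC L S) :
    itemSizes S.packing = (L : Multiset ℝ) := by
  induction h with
  | nil => simp [CubePacking.itemSizes, State.packing, State.init]
  | snoc L x S S' h hs ih =>
    rw [hs.itemSizes, ih, Multiset.cons_coe, Multiset.coe_eq_coe]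
    exact (List.perm_append_singleton x L).symm

theorem Run.smallInv {L : List ℝ} {S : State 3} (h : Run PC L S) : SmallInv S.small := by
  induction h with
  | nil => exact ⟨by simp [State.init], by simp [State.init]⟩
  | snoc L x S S' h hs ih =>
    cases hs with
    | small i k bins hx hp => exact hp.inv hx ih
    | red i bins hx hc hp => exact ih
    | blue i bins hx hc hp => exact ih

theorem Run.isPacking {L : List ℝ} {S : State 3} (h : Run PC L S) : IsPacking L S.packing := by
  refine ⟨fun b hb => ?_, h.itemSizes⟩
  rcases Multiset.mem_add.1 hb with hb | hb
  · obtain ⟨a, ha, rfl⟩ := Multiset.mem_map.1 hb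
    exact (h.largeOK a ha).isBin
  · obtain ⟨a, ha, rfl⟩ := Multiset.mem_map.1 hb
    exact (h.smallInv.1 a ha).isBin

theorem exists_step {S : State 3} (hS : ∀ b ∈ S.large, LargeOK b) {x : ℝ} (h0 : 0 < x)
    (h1 : x ≤ 1) : ∃ S', Step PC S x S' := by
  rcases le_or_gt x (1 / 11) with h | h
  · obtain ⟨i, k, hik⟩ := exists_hasGroup h0 h
    obtain ⟨B', hB'⟩ := exists_placeSmall hik S.small
    exact ⟨_, .small i k B' hik hB'⟩
  · obtain ⟨i, hi⟩ := exists_hasType h h1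
    by_cases hc : S.e i < ⌊PC.α i * ((S.s i + 1 : ℕ) : ℝ)⌋₊
    · obtain ⟨B', hB'⟩ := exists_placeRed (x := x) (isRedType_of_floor hc) S.large hS
      exact ⟨_, .red i B' hi hc hB'⟩
    · obtain ⟨B', hB'⟩ := exists_placeBlue (x := x) hi.1 hi.2.1 S.large hS
      exact ⟨_, .blue i B' hi hc hB'⟩

/-- Besides well-definedness this shows that every input has some packing, so that the minimum in
`opt` is attained. -/
theorem exists_run {L : List ℝ} (hL : IsInput L) : ∃ S : State 3, Run PC L S := by
  induction L using List.reverseRecOn with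
  | nil => exact ⟨_, .nil⟩
  | append_singleton L x ih =>
    obtain ⟨S, hS⟩ := ih fun y hy => hL y (by simp [hy])
    obtain ⟨S', hS'⟩ := exists_step hS.largeOK (hL x (by simp)).1 (hL x (by simp)).2
    exact ⟨S', .snoc L x S S' hS hS'⟩

/-! ### Open bins and numbers of items for each type -/

/-- The type of the blue items of a bin (`0` if there are none). -/
def Group.blueType : Group → ℕ
  | .mono i => i
  | .blueIndet i => i
  | .redIndet _ => 0
  | .bichrom i _ => i

/-- The type of the red items of a bin (`0` if there are none). -/
def Group.redType : Group → ℕ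
  | .mono _ => 0
  | .blueIndet _ => 0
  | .redIndet j => j
  | .bichrom _ j => j

/-- Indicator of an open bin: its items have type `i`, and there are fewer than `cap` of them. -/
def openInd (i cap ty len : ℕ) : ℕ := if ty = i ∧ len < cap then 1 else 0

/-- The number `len` of items of a bin if their type `ty` is `i`. -/
def lenInd (i ty len : ℕ) : ℕ := if ty = i then len else 0

lemma openInd_le_one (i cap ty len : ℕ) : openInd i cap ty len ≤ 1 := by
  unfold openInd; split_ifs <;> omega

lemma openInd_self_of_lt {i cap len : ℕ} (h : len < cap) : openInd i cap i len = 1 := by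
  simp [openInd, h]

lemma openInd_of_ne {i ty : ℕ} (h : ty ≠ i) (cap len : ℕ) : openInd i cap ty len = 0 := by
  simp [openInd, h]

lemma lenInd_of_ne {i ty : ℕ} (h : ty ≠ i) (len : ℕ) : lenInd i ty len = 0 := by
  simp [lenInd, h]

lemma lenInd_zero (i ty : ℕ) : lenInd i ty 0 = 0 := by
  simp [lenInd]

lemma lenInd_succ (i ty len : ℕ) :
    lenInd i ty (len + 1) = lenInd i ty len + if i = ty then 1 else 0 := by
  unfold lenInd
  rcases eq_or_ne ty i with rfl | h
  · simp
  · simp [h, h.symm]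

/-- The number of bins with blue items of type `i` that can take another one. -/
def openBlue (i : ℕ) (B : Multiset (LargeBin 3)) : ℕ :=
  B.countP fun b => b.group.blueType = i ∧ b.blue.length < PC.β i ^ 3

def openRed (j : ℕ) (B : Multiset (LargeBin 3)) : ℕ :=
  B.countP fun b => b.group.redType = j ∧ b.red.length < PC.θ 3 j

def blueCount (i : ℕ) (B : Multiset (LargeBin 3)) : ℕ :=
  (B.map fun b => lenInd i b.group.blueType b.blue.length).sum

def redCount (j : ℕ) (B : Multiset (LargeBin 3)) : ℕ :=
  (B.map fun b => lenInd j b.group.redType b.red.length).sum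

/-- No bin `(?, j)` coexists with a bin `(i, ?)` that could have taken its items. -/
def NoWaste (B : Multiset (LargeBin 3)) : Prop :=
  ∀ a ∈ B, ∀ b ∈ B, ∀ i j, a.group = .redIndet j → b.group = .blueIndet i →
    PC.Δ (PC.φ i) < PC.γ j * PC.t j

lemma openBlue_cons (i : ℕ) (b : LargeBin 3) (B : Multiset (LargeBin 3)) :
    openBlue i (b ::ₘ B) = openBlue i B +
      openInd i (PC.β i ^ 3) b.group.blueType b.blue.length :=
  Multiset.countP_cons _ _ _

lemma openRed_cons (i : ℕ) (b : LargeBin 3) (B : Multiset (LargeBin 3)) :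
    openRed i (b ::ₘ B) = openRed i B +
      openInd i (PC.θ 3 i) b.group.redType b.red.length :=
  Multiset.countP_cons _ _ _

lemma blueCount_cons (i : ℕ) (b : LargeBin 3) (B : Multiset (LargeBin 3)) :
    blueCount i (b ::ₘ B) = lenInd i b.group.blueType b.blue.length + blueCount i B := by
  simp [blueCount]

lemma redCount_cons (i : ℕ) (b : LargeBin 3) (B : Multiset (LargeBin 3)) :
    redCount i (b ::ₘ B) = lenInd i b.group.redType b.red.length + redCount i B := by
  simp [redCount]

lemma LargeOK.of_redIndet {b : LargeBin 3} (h : LargeOK b) {j : ℕ} (hb : b.group = .redIndet j) :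
    IsRedType j ∧ b.blue = [] := by
  simp only [LargeOK, hb] at h
  exact ⟨h.1, h.2.1⟩

lemma LargeOK.of_blueIndet {b : LargeBin 3} (h : LargeOK b) {j : ℕ} (hb : b.group = .blueIndet j) :
    b.red = [] := by
  simp only [LargeOK, hb] at h
  exact h.2.2

/-- Type 0 stands for the absence of red items, so i ≥ 1 leaves only the names (?, i) and (l, i),
which the two hypotheses exclude. -/
lemma openRed_eq_zero {i : ℕ} (hi : 1 ≤ i) {B : Multiset (LargeBin 3)}
    (h1 : ∀ a ∈ B, ¬ RedIndetOpen PC i a) (h2 : ∀ a ∈ B, ∀ l, ¬ RedBichromOpen PC l i a) :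
    openRed i B = 0 := by
  rw [openRed, Multiset.countP_eq_zero]
  rintro a ha ⟨h, h'⟩
  rcases hg : a.group with l | l | l | ⟨l, m⟩ <;> rw [hg] at h <;> simp only [Group.redType] at h
  · omega
  · omega
  · exact h1 a ha ⟨by rw [hg, h], h'⟩
  · exact h2 a ha l ⟨by rw [hg, h], h'⟩

/-- As φ(i) ≠ 0, the invariant rules out bins named i, and i ≥ 1 rules out bins without blue items.
-/
lemma openBlue_eq_zero {i : ℕ} (hi : 1 ≤ i) (hφ : PC.φ i ≠ 0) {B : Multiset (LargeBin 3)}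
    (hB : ∀ b ∈ B, LargeOK b)
    (h1 : ∀ a ∈ B, ∀ l, ¬ BlueBichromOpen PC i l a) (h2 : ∀ a ∈ B, ¬ BlueIndetOpen PC i a) :
    openBlue i B = 0 := by
  rw [openBlue, Multiset.countP_eq_zero]
  rintro a ha ⟨h, h'⟩
  rcases hg : a.group with l | l | l | ⟨l, m⟩ <;> rw [hg] at h <;> simp only [Group.blueType] at h
  · have := hB a ha
    simp only [LargeOK, hg] at this
    rw [h] at this
    exact hφ this.1
  · exact h2 a ha ⟨by rw [hg, h], h'⟩
  · omega
  · exact h1 a ha m ⟨by rw [hg, h], h'⟩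

lemma openBlue_eq_zero_of_mono {i : ℕ} (hi : 1 ≤ i) (hφ : PC.φ i = 0) {B : Multiset (LargeBin 3)}
    (hB : ∀ b ∈ B, LargeOK b) (h1 : ∀ a ∈ B, ¬ MonoOpen PC i a) : openBlue i B = 0 := by
  rw [openBlue, Multiset.countP_eq_zero]
  rintro a ha ⟨h, h'⟩
  rcases hg : a.group with l | l | l | ⟨l, m⟩ <;> rw [hg] at h <;> simp only [Group.blueType] at h
  · exact h1 a ha ⟨by rw [hg, h], h'⟩
  · have := hB a ha
    simp only [LargeOK, hg] at this
    rw [h] at this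
    exact this.1 hφ
  · omega
  · have := hB a ha
    simp only [LargeOK, hg] at this
    rw [h] at this
    exact this.1 hφ

/-- What the counting argument needs to know about the bins for large items. -/
structure LargeInv (B : Multiset (LargeBin 3)) : Prop where
  ok : ∀ b ∈ B, LargeOK b
  openBlue_le : ∀ i, 1 ≤ i → openBlue i B ≤ 1
  openRed_le : ∀ i, 1 ≤ i → openRed i B ≤ 1
  noWaste : NoWaste B

/-- Only a new name of the form (?, j) or (i, ?) can violate the condition; a bin that keeps its
name or becomes two-coloured cannot. -/
lemma NoWaste.replace {b b' : LargeBin 3} {rest : Multiset (LargeBin 3)} (h : NoWaste (b ::ₘ rest))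
    (h1 : ∀ j, b'.group = .redIndet j → b.group = .redIndet j)
    (h2 : ∀ j, b'.group = .blueIndet j → b.group = .blueIndet j) : NoWaste (b' ::ₘ rest) := by
  intro a ha c hc i j hga hgc
  have key : ∀ x ∈ b' ::ₘ rest, ∃ y ∈ b ::ₘ rest, (∀ j, x.group = .redIndet j → y.group = .redIndet j) ∧
      (∀ j, x.group = .blueIndet j → y.group = .blueIndet j) := by
    intro x hx
    rcases Multiset.mem_cons.1 hx with rfl | hx
    · exact ⟨b, by simp, h1, h2⟩
    · exact ⟨x, by simp [hx], fun _ h => h, fun _ h => h⟩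
  obtain ⟨a', ha', h1', -⟩ := key a ha
  obtain ⟨c', hc', -, h2'⟩ := key c hc
  exact h a' ha' c' hc' i j (h1' j hga) (h2' i hgc)

/-- The order of the rules yields the invariant. Another bin gets red items of type i only when no
bin with such items is open, so at most one is open. A bin (?, i) is created only when no bin (j, ?)
has room for it, which is `NoWaste`. -/
lemma PlaceRed.inv {i : ℕ} {x : ℝ} {B B' : Multiset (LargeBin 3)} (h : PlaceRed PC i x B B')
    (hi : IsRedType i) (hx : PC.HasType x i) (hB : LargeInv B) :
    LargeInv B' ∧ (∀ l, 1 ≤ l → blueCount l B' = blueCount l B) ∧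
      ∀ l, 1 ≤ l → redCount l B' = redCount l B + if l = i then 1 else 0 := by
  have hi1 := hi.range.1
  have hok := h.largeOK hx hi hB.ok
  cases h with
  | indet b b' rest hb hadd =>
    obtain ⟨c, -, -, rfl⟩ := hadd
    refine ⟨⟨hok, fun l hl => ?_, fun l hl => ?_, hB.noWaste.replace ?_ ?_⟩, fun l hl => ?_,
      fun l hl => ?_⟩
    · have := hB.openBlue_le l hl
      simpa [openBlue_cons, hb.1] using this
    · have := hB.openRed_le l hl
      simp only [openRed_cons, hb.1, Group.redType, List.length_cons] at this ⊢
      -- The bin was open before, so the number of open bins cannot grow, whether or not it is full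
      -- now.
      rcases eq_or_ne i l with rfl | hil
      · rw [openInd_self_of_lt hb.2] at this
        have := openInd_le_one i (PC.θ 3 i) i (b.red.length + 1)
        omega
      · rw [openInd_of_ne hil] at this ⊢
        exact this
    · intro j hj; rw [hb.1, ← hj]
    · intro j hj; cases hj
    · simp [blueCount_cons, hb.1]
    · simp only [redCount_cons, hb.1, Group.redType, List.length_cons, lenInd_succ]
      omega
  | bichrom j b b' rest h1 hb hadd =>
    obtain ⟨c, -, -, rfl⟩ := hadd
    refine ⟨⟨hok, fun l hl => ?_, fun l hl => ?_, hB.noWaste.replace ?_ ?_⟩, fun l hl => ?_,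
      fun l hl => ?_⟩
    · have := hB.openBlue_le l hl
      simpa [openBlue_cons, hb.1] using this
    · have := hB.openRed_le l hl
      simp only [openRed_cons, hb.1, Group.redType, List.length_cons] at this ⊢
      rcases eq_or_ne i l with rfl | hil
      · rw [openInd_self_of_lt hb.2] at this
        have := openInd_le_one i (PC.θ 3 i) i (b.red.length + 1)
        omega
      · rw [openInd_of_ne hil] at this ⊢
        exact this
    · intro j hj; cases hj
    · intro j hj; cases hj
    · simp [blueCount_cons, hb.1]
    · simp only [redCount_cons, hb.1, Group.redType, List.length_cons, lenInd_succ]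
      omega
  | join j b b' rest h1 h2 hb hadd =>
    have h0 := openRed_eq_zero hi1 h1 h2
    have hr := (hB.ok b (by simp)).of_blueIndet hb.1
    obtain ⟨c, -, -, rfl⟩ := hadd
    refine ⟨⟨hok, fun l hl => ?_, fun l hl => ?_, hB.noWaste.replace ?_ ?_⟩, fun l hl => ?_,
      fun l hl => ?_⟩
    · have := hB.openBlue_le l hl
      simpa [openBlue_cons, hb.1, Group.blueType] using this
    · have := hB.openRed_le l hl
      simp only [openRed_cons, hb.1, Group.redType, List.length_cons] at this h0 ⊢
      -- No bin with red items of type i was open, so the joined bin is the only one that can be.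
      rcases eq_or_ne i l with rfl | hil
      · have := openInd_le_one i (PC.θ 3 i) i (b.red.length + 1)
        omega
      · rw [openInd_of_ne hil]
        omega
    · intro j hj; cases hj
    · intro j hj; cases hj
    · simp [blueCount_cons, hb.1, Group.blueType]
    · simp only [redCount_cons, hb.1, Group.redType, List.length_cons, hr, List.length_nil,
        lenInd_succ, lenInd_zero]
      omega
  | new _ b' h1 h2 h3 hadd =>
    have h0 := openRed_eq_zero hi1 h1 h2
    obtain ⟨c, -, -, rfl⟩ := hadd
    refine ⟨⟨hok, fun l hl => ?_, fun l hl => ?_, ?_⟩, fun l hl => ?_,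
      fun l hl => ?_⟩
    · have := hB.openBlue_le l hl
      simp only [openBlue_cons, Group.blueType]
      rw [openInd_of_ne (by omega)]
      omega
    · have := hB.openRed_le l hl
      simp only [openRed_cons, Group.redType, List.length_cons]
      rcases eq_or_ne i l with rfl | hil
      · rw [h0]
        have := openInd_le_one i (PC.θ 3 i) i ((LargeBin.empty 3 (.redIndet i)).red.length + 1)
        omega
      · rw [openInd_of_ne hil]
        omega
    · intro a ha d hd k j hga hgd
      rcases Multiset.mem_cons.1 hd with rfl | hd
      · cases hgd
      rcases Multiset.mem_cons.1 ha with rfl | ha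
      · cases hga
        by_contra hle
        exact h3 d hd k ⟨hgd, not_lt.1 hle⟩
      · exact hB.noWaste a ha d hd k j hga hgd
    · simp only [blueCount_cons, Group.blueType]
      rw [lenInd_of_ne (by omega)]
      omega
    · simp only [redCount_cons, Group.redType, List.length_cons, LargeBin.empty, List.length_nil,
        lenInd_succ, lenInd_zero]
      omega

/-- The counterpart of `PlaceRed.inv`. For φ(i) = 0 the bins never accept red items and do not enter
`NoWaste`. -/
lemma PlaceBlue.inv {i : ℕ} {x : ℝ} {B B' : Multiset (LargeBin 3)} (h : PlaceBlue PC i x B B')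
    (hx : PC.HasType x i) (hB : LargeInv B) :
    LargeInv B' ∧ (∀ l, 1 ≤ l → blueCount l B' = blueCount l B + if l = i then 1 else 0) ∧
      ∀ l, 1 ≤ l → redCount l B' = redCount l B := by
  have hi1 := hx.1
  have hok := h.largeOK hx hB.ok
  cases h with
  | mono b b' rest hφ hb hadd =>
    obtain ⟨c, -, rfl⟩ := hadd
    refine ⟨⟨hok, fun l hl => ?_, fun l hl => ?_, hB.noWaste.replace ?_ ?_⟩, fun l hl => ?_,
      fun l hl => ?_⟩
    · have := hB.openBlue_le l hl
      simp only [openBlue_cons, hb.1, Group.blueType, List.length_cons] at this ⊢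
      rcases eq_or_ne i l with rfl | hil
      · rw [openInd_self_of_lt hb.2] at this
        have := openInd_le_one i (PC.β i ^ 3) i (b.blue.length + 1)
        omega
      · rw [openInd_of_ne hil] at this ⊢
        exact this
    · have := hB.openRed_le l hl
      simpa [openRed_cons, hb.1] using this
    · intro j hj; cases hj
    · intro j hj; cases hj
    · simp only [blueCount_cons, hb.1, Group.blueType, List.length_cons, lenInd_succ]
      omega
    · simp [redCount_cons, hb.1]
  | monoNew _ b' hφ h1 hadd =>
    have h0 := openBlue_eq_zero_of_mono hi1 hφ hB.ok h1
    obtain ⟨c, -, rfl⟩ := hadd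
    refine ⟨⟨hok, fun l hl => ?_, fun l hl => ?_, ?_⟩, fun l hl => ?_,
      fun l hl => ?_⟩
    · have := hB.openBlue_le l hl
      simp only [openBlue_cons, Group.blueType, List.length_cons]
      rcases eq_or_ne i l with rfl | hil
      · rw [h0]
        have := openInd_le_one i (PC.β i ^ 3) i ((LargeBin.empty 3 (.mono i)).blue.length + 1)
        omega
      · rw [openInd_of_ne hil]
        omega
    · have := hB.openRed_le l hl
      simp only [openRed_cons, Group.redType]
      rw [openInd_of_ne (by omega)]
      omega
    · intro a ha d hd k j hga hgd
      rcases Multiset.mem_cons.1 hd with rfl | hd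
      · cases hgd
      rcases Multiset.mem_cons.1 ha with rfl | ha
      · cases hga
      · exact hB.noWaste a ha d hd k j hga hgd
    · simp only [blueCount_cons, Group.blueType, List.length_cons, LargeBin.empty, List.length_nil,
        lenInd_succ, lenInd_zero]
      omega
    · simp only [redCount_cons, Group.redType]
      rw [lenInd_of_ne (by omega)]
      omega
  | bichrom j b b' rest hφ hb hadd =>
    obtain ⟨c, -, rfl⟩ := hadd
    refine ⟨⟨hok, fun l hl => ?_, fun l hl => ?_, hB.noWaste.replace ?_ ?_⟩, fun l hl => ?_,
      fun l hl => ?_⟩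
    · have := hB.openBlue_le l hl
      simp only [openBlue_cons, hb.1, Group.blueType, List.length_cons] at this ⊢
      rcases eq_or_ne i l with rfl | hil
      · rw [openInd_self_of_lt hb.2] at this
        have := openInd_le_one i (PC.β i ^ 3) i (b.blue.length + 1)
        omega
      · rw [openInd_of_ne hil] at this ⊢
        exact this
    · have := hB.openRed_le l hl
      simpa [openRed_cons, hb.1] using this
    · intro j hj; cases hj
    · intro j hj; cases hj
    · simp only [blueCount_cons, hb.1, Group.blueType, List.length_cons, lenInd_succ]
      omega
    · simp [redCount_cons, hb.1]
  | indet b b' rest hφ h1 hb hadd =>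
    obtain ⟨c, -, rfl⟩ := hadd
    refine ⟨⟨hok, fun l hl => ?_, fun l hl => ?_, hB.noWaste.replace ?_ ?_⟩, fun l hl => ?_,
      fun l hl => ?_⟩
    · have := hB.openBlue_le l hl
      simp only [openBlue_cons, hb.1, Group.blueType, List.length_cons] at this ⊢
      rcases eq_or_ne i l with rfl | hil
      · rw [openInd_self_of_lt hb.2] at this
        have := openInd_le_one i (PC.β i ^ 3) i (b.blue.length + 1)
        omega
      · rw [openInd_of_ne hil] at this ⊢
        exact this
    · have := hB.openRed_le l hl
      simpa [openRed_cons, hb.1] using this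
    · intro j hj; cases hj
    · intro j hj; rw [hb.1, ← hj]
    · simp only [blueCount_cons, hb.1, Group.blueType, List.length_cons, lenInd_succ]
      omega
    · simp [redCount_cons, hb.1]
  | join j b b' rest hφ h1 h2 hb hadd =>
    have h0 := openBlue_eq_zero hi1 hφ hB.ok h1 h2
    have hr := ((hB.ok b (by simp)).of_redIndet hb.1).2
    obtain ⟨c, -, rfl⟩ := hadd
    refine ⟨⟨hok, fun l hl => ?_, fun l hl => ?_, hB.noWaste.replace ?_ ?_⟩, fun l hl => ?_,
      fun l hl => ?_⟩
    · have := hB.openBlue_le l hl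
      simp only [openBlue_cons, hb.1, Group.blueType, List.length_cons] at this h0 ⊢
      rcases eq_or_ne i l with rfl | hil
      · have := openInd_le_one i (PC.β i ^ 3) i (b.blue.length + 1)
        omega
      · rw [openInd_of_ne hil]
        omega
    · have := hB.openRed_le l hl
      simpa [openRed_cons, hb.1, Group.redType] using this
    · intro j hj; cases hj
    · intro j hj; cases hj
    · simp only [blueCount_cons, hb.1, Group.blueType, List.length_cons, hr, List.length_nil,
        lenInd_succ, lenInd_zero]
      omega
    · simp [redCount_cons, hb.1, Group.redType]
  | new _ b' hφ h1 h2 h3 hadd =>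
    have h0 := openBlue_eq_zero hi1 hφ hB.ok h1 h2
    obtain ⟨c, -, rfl⟩ := hadd
    refine ⟨⟨hok, fun l hl => ?_, fun l hl => ?_, ?_⟩, fun l hl => ?_,
      fun l hl => ?_⟩
    · have := hB.openBlue_le l hl
      simp only [openBlue_cons, Group.blueType, List.length_cons]
      rcases eq_or_ne i l with rfl | hil
      · rw [h0]
        have := openInd_le_one i (PC.β i ^ 3) i ((LargeBin.empty 3 (.blueIndet i)).blue.length + 1)
        omega
      · rw [openInd_of_ne hil]
        omega
    · have := hB.openRed_le l hl
      simp only [openRed_cons, Group.redType]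
      rw [openInd_of_ne (by omega)]
      omega
    · intro a ha d hd k j hga hgd
      rcases Multiset.mem_cons.1 ha with rfl | ha
      · cases hga
      rcases Multiset.mem_cons.1 hd with rfl | hd
      · cases hgd
        by_contra hle
        exact h3 a ha j ⟨hga, not_lt.1 hle⟩
      · exact hB.noWaste a ha d hd k j hga hgd
    · simp only [blueCount_cons, Group.blueType, List.length_cons, LargeBin.empty, List.length_nil,
        lenInd_succ, lenInd_zero]
      omega
    · simp only [redCount_cons, Group.redType]
      rw [lenInd_of_ne (by omega)]
      omega

/-! ### Uniqueness of types, and weights of items -/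

lemma t_succ_le {i : ℕ} (h1 : 1 ≤ i) (h2 : i ≤ 16) : tTable (i + 1) ≤ tTable i := by
  interval_cases i <;> norm_num [tTable]

lemma t_antitone {i l : ℕ} (h1 : 1 ≤ i) (hil : i ≤ l) (hl : l ≤ 17) : tTable l ≤ tTable i := by
  induction l, hil using Nat.le_induction with
  | base => exact le_rfl
  | succ n hn ih => exact (t_succ_le (by omega) (by omega)).trans (ih (by omega))

lemma HasType.unique {x : ℝ} {i l : ℕ} (hi : PC.HasType x i) (hl : PC.HasType x l) : i = l := by
  obtain ⟨a1, a2, a3, a4⟩ := hi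
  obtain ⟨b1, b2, b3, b4⟩ := hl
  change tTable (i + 1) < x at a3
  change x ≤ tTable i at a4
  change tTable (l + 1) < x at b3
  change x ≤ tTable l at b4
  change i ≤ 16 at a2
  change l ≤ 16 at b2
  rcases lt_trichotomy i l with h | h | h
  · have := t_antitone (i := i + 1) (l := l) (by omega) (by omega) (by omega)
    linarith
  · exact h
  · have := t_antitone (i := l + 1) (l := i) (by omega) (by omega) (by omega)
    linarith

lemma HasType.gt {x : ℝ} {i : ℕ} (hi : PC.HasType x i) : 1 / 11 < x := by
  obtain ⟨a1, a2, a3, a4⟩ := hi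
  change tTable (i + 1) < x at a3
  change i ≤ 16 at a2
  have := t_antitone (i := i + 1) (l := 17) (by omega) (by omega) (by omega)
  have h17 : tTable 17 = 1 / 11 := rfl
  linarith

open Classical in
/-- The weight of an item: `w i` for type `i`, and its volume, scaled by the guaranteed density of
closed bins, for a small item. -/
def weight (w : ℕ → ℝ) (x : ℝ) : ℝ :=
  (∑ i ∈ Finset.Icc 1 16, if PC.HasType x i then w i else 0) +
    if x ≤ 1 / 11 then 1728 / 1330 * x ^ 3 else 0

lemma weight_of_hasType {w : ℕ → ℝ} {x : ℝ} {i : ℕ} (h : PC.HasType x i) : weight w x = w i := by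
  classical
  rw [weight, if_neg (not_le.2 (HasType.gt h)), add_zero, Finset.sum_eq_single i]
  · exact if_pos h
  · intro b _ hb
    exact if_neg fun h' => hb (HasType.unique h' h)
  · intro hi
    exact absurd (Finset.mem_Icc.2 ⟨h.1, h.2.1⟩) hi

lemma weight_of_small {w : ℕ → ℝ} {x : ℝ} (h : x ≤ 1 / 11) :
    weight w x = 1728 / 1330 * x ^ 3 := by
  classical
  rw [weight, if_pos h, Finset.sum_eq_zero, zero_add]
  intro i _
  exact if_neg fun hi => not_le.2 (HasType.gt hi) h

/-- The total volume of the small items. -/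
def smallVolume (B : Multiset (SmallBin 3)) : ℝ :=
  ((itemSizes (B.map fun b => b.items)).map fun x => x ^ 3).sum

lemma PlaceSmall.smallVolume {i k : ℕ} {x : ℝ} {B B' : Multiset (SmallBin 3)}
    (h : PlaceSmall i k x B B') :
    CubePacking.smallVolume B' = x ^ 3 + CubePacking.smallVolume B := by
  simp [CubePacking.smallVolume, h.itemSizes]

/-- The weight is constant on each type and proportional to the volume for small items, so the
counters and the small volume determine the total. -/
theorem Run.sum_weight {L : List ℝ} {S : State 3} (h : Run PC L S) (w : ℕ → ℝ) :
    (L.map (weight w)).sum =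
      (∑ i ∈ Finset.Icc 1 16, w i * S.s i) + 1728 / 1330 * smallVolume S.small := by
  have upd : ∀ (s : ℕ → ℕ) (i : ℕ), 1 ≤ i → i ≤ 16 →
      (∑ l ∈ Finset.Icc 1 16, w l * (Function.update s i (s i + 1) l : ℕ)) =
        (∑ l ∈ Finset.Icc 1 16, w l * s l) + w i := by
    intro s i h1 h2
    have hi : i ∈ Finset.Icc 1 16 := Finset.mem_Icc.2 ⟨h1, h2⟩
    rw [← Finset.add_sum_erase _ _ hi, ← Finset.add_sum_erase _ (fun l => w l * (s l : ℝ)) hi]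
    rw [Finset.sum_congr rfl fun l hl => by
      rw [Function.update_of_ne (Finset.ne_of_mem_erase hl)]]
    simp only [Function.update_self]
    push_cast
    ring
  induction h with
  | nil => simp [State.init, smallVolume, CubePacking.itemSizes]
  | snoc L x S S' h hs ih =>
    rw [List.map_append, List.sum_append, ih]
    simp only [List.map_cons, List.map_nil, List.sum_cons, List.sum_nil, add_zero]
    cases hs with
    | small i k bins hx hp =>
      have hx1 : x ≤ 1 / 11 := by
        have := hx.1
        change x ≤ 1 / ((11 : ℕ) : ℝ) at this
        exact_mod_cast this
      rw [weight_of_small hx1, hp.smallVolume]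
      ring
    | red i bins hx hc hp =>
      rw [weight_of_hasType hx, upd _ _ hx.1 hx.2.1]
      ring
    | blue i bins hx hc hp =>
      rw [weight_of_hasType hx, upd _ _ hx.1 hx.2.1]
      ring

lemma alpha_nonneg (i : ℕ) : 0 ≤ PC.α i := by
  change 0 ≤ αCube i
  unfold αCube
  split <;> norm_num

lemma alpha_le_one (i : ℕ) : PC.α i ≤ 1 := by
  change αCube i ≤ 1
  unfold αCube
  split <;> norm_num

/-! ### Numbers of bins of each colour and type -/

/-- The counters agree with the contents of the bins. -/
structure Counts (S : State 3) : Prop where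
  inv : LargeInv S.large
  blue : ∀ l, 1 ≤ l → blueCount l S.large + S.e l = S.s l
  red : ∀ l, 1 ≤ l → redCount l S.large = S.e l
  floor : ∀ l, S.e l = ⌊PC.α l * (S.s l : ℝ)⌋₊

/-- The colouring rule keeps e_i equal to ⌊α_i s_i⌋: since 0 ≤ α_i ≤ 1, this floor grows by 0 or 1
when s_i grows by 1, and the item becomes red exactly when it grows by 1. -/
theorem Run.counts {L : List ℝ} {S : State 3} (h : Run PC L S) : Counts S := by
  induction h with
  | nil =>
    refine ⟨⟨by simp [State.init], ?_, ?_, ?_⟩, ?_, ?_, ?_⟩ <;>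
      simp [State.init, openBlue, openRed, blueCount, redCount, NoWaste]
  | snoc L x S S' h hs ih =>
    have mono : ∀ i, ⌊PC.α i * (S.s i : ℝ)⌋₊ ≤ ⌊PC.α i * ((S.s i + 1 : ℕ) : ℝ)⌋₊ := fun i =>
      Nat.floor_le_floor (mul_le_mul_of_nonneg_left (by push_cast; linarith) (alpha_nonneg i))
    have step : ∀ i, ⌊PC.α i * ((S.s i + 1 : ℕ) : ℝ)⌋₊ ≤ ⌊PC.α i * (S.s i : ℝ)⌋₊ + 1 := by
      intro i
      rw [← Nat.floor_add_one (mul_nonneg (alpha_nonneg i) (Nat.cast_nonneg _))]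
      refine Nat.floor_le_floor ?_
      have := alpha_le_one i
      push_cast
      linarith
    cases hs with
    | small i k bins hx hp => exact ⟨ih.inv, ih.blue, ih.red, ih.floor⟩
    | red i bins hx hc hp =>
      obtain ⟨h1, h2, h3⟩ := hp.inv (isRedType_of_floor hc) hx ih.inv
      refine ⟨h1, fun l hl => ?_, fun l hl => ?_, fun l => ?_⟩
      · have := ih.blue l hl
        simp only [h2 l hl]
        rcases eq_or_ne l i with rfl | hli
        · simp only [Function.update_self]; omega
        · simp only [Function.update_of_ne hli]; omega
      · have := ih.red l hl
        simp only [h3 l hl]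
        rcases eq_or_ne l i with rfl | hli
        · simp only [Function.update_self, if_true]; omega
        · simp only [Function.update_of_ne hli, if_neg hli]; omega
      · have := ih.floor l
        rcases eq_or_ne l i with rfl | hli
        · simp only [Function.update_self]
          have := step l
          omega
        · simp only [Function.update_of_ne hli]; exact this
    | blue i bins hx hc hp =>
      obtain ⟨h1, h2, h3⟩ := hp.inv hx ih.inv
      refine ⟨h1, fun l hl => ?_, fun l hl => ?_, fun l => ?_⟩
      · have := ih.blue l hl
        simp only [h2 l hl]
        rcases eq_or_ne l i with rfl | hli
        · simp only [Function.update_self, if_true]; omega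
        · simp only [Function.update_of_ne hli, if_neg hli]; omega
      · simp only [h3 l hl]
        exact ih.red l hl
      · have := ih.floor l
        rcases eq_or_ne l i with rfl | hli
        · simp only [Function.update_self]
          have := mono l
          omega
        · simp only [Function.update_of_ne hli]; exact this

/-- The share of a blue bin per item of type `i`. -/
def blueShare (i : ℕ) : ℝ := (1 - PC.α i) / (PC.β i : ℝ) ^ 3

/-- The share of a red bin per item of type `i`. -/
def redShare (i : ℕ) : ℝ := PC.α i / (PC.θ 3 i : ℝ)

/-- A bin of type i that is not open holds at least `cap` items; the open ones are paid for by the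
last term. -/
lemma countP_mul_le {α : Type*} (B : Multiset α) (ty len : α → ℕ) (i cap : ℕ) :
    (B.countP fun b => ty b = i) * cap ≤ (B.map fun b => lenInd i (ty b) (len b)).sum +
      (B.countP fun b => ty b = i ∧ len b < cap) * cap := by
  induction B using Multiset.induction_on with
  | empty => simp
  | cons b B ih =>
    simp only [Multiset.countP_cons, Multiset.map_cons, Multiset.sum_cons]
    by_cases h : ty b = i
    · by_cases h' : len b < cap
      · simp only [h, h', true_and, if_true, add_mul, one_mul]
        omega
      · have hl : lenInd i (ty b) (len b) = len b := if_pos h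
        simp only [h, h', and_false, if_true, if_false, add_mul, one_mul, add_zero] at hl ⊢
        omega
    · simp only [h, false_and, if_false, lenInd_of_ne h, add_zero]
      omega

/-- All but at most one of these bins hold β_i³ items, and there are s_i - e_i < (1 - α_i) s_i + 1
blue items. The constant 2 covers the open bin and the rounding of e_i. -/
lemma Counts.card_blue_le {S : State 3} (h : Counts S) {i : ℕ} (h1 : 1 ≤ i) (h2 : i ≤ 16) :
    ((S.large.countP fun b => b.group.blueType = i : ℕ) : ℝ) ≤ blueShare i * S.s i + 2 := by
  have hc := countP_mul_le S.large (fun b => b.group.blueType) (fun b => b.blue.length) i (PC.β i ^ 3)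
  have ho := h.inv.openBlue_le i h1
  have hb := h.blue i h1
  have hpos : 0 < PC.β i := beta_pos h1 h2
  have hcap : 0 < PC.β i ^ 3 := by positivity
  have hN : (S.large.countP fun b => b.group.blueType = i) * PC.β i ^ 3 ≤
      blueCount i S.large + PC.β i ^ 3 := by
    refine hc.trans (Nat.add_le_add_left ?_ _)
    calc _ ≤ 1 * PC.β i ^ 3 := Nat.mul_le_mul_right _ ho
      _ = _ := one_mul _
  have hN' : ((S.large.countP fun b => b.group.blueType = i : ℕ) : ℝ) * (PC.β i : ℝ) ^ 3 ≤
      blueCount i S.large + (PC.β i : ℝ) ^ 3 := by exact_mod_cast hN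
  have hfl : PC.α i * (S.s i : ℝ) < S.e i + 1 := by
    rw [h.floor i]
    exact Nat.lt_floor_add_one _
  have hb' : (blueCount i S.large : ℝ) + S.e i = S.s i := by exact_mod_cast hb
  have hβ : (1 : ℝ) ≤ (PC.β i : ℝ) ^ 3 := by exact_mod_cast hcap
  rw [blueShare]
  have : blueShare i * S.s i = ((1 - PC.α i) * S.s i) / (PC.β i : ℝ) ^ 3 := by
    rw [blueShare]; ring
  rw [← blueShare, this, ← sub_le_iff_le_add, le_div_iff₀ (by linarith)]
  nlinarith

/-- As for blue items, but here the floor helps: e_i ≤ α_i s_i. -/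
lemma Counts.card_red_le {S : State 3} (h : Counts S) {i : ℕ} (hi : IsRedType i) :
    ((S.large.countP fun b => b.group.redType = i : ℕ) : ℝ) ≤ redShare i * S.s i + 2 := by
  have h1 := hi.range.1
  have hc := countP_mul_le S.large (fun b => b.group.redType) (fun b => b.red.length) i (PC.θ 3 i)
  have ho := h.inv.openRed_le i h1
  have hb := h.red i h1
  have hcap : 0 < PC.θ 3 i := theta_pos hi
  have hN : (S.large.countP fun b => b.group.redType = i) * PC.θ 3 i ≤
      redCount i S.large + PC.θ 3 i := by
    refine hc.trans (Nat.add_le_add_left ?_ _)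
    calc _ ≤ 1 * PC.θ 3 i := Nat.mul_le_mul_right _ ho
      _ = _ := one_mul _
  have hN' : ((S.large.countP fun b => b.group.redType = i : ℕ) : ℝ) * (PC.θ 3 i : ℝ) ≤
      redCount i S.large + (PC.θ 3 i : ℝ) := by exact_mod_cast hN
  have hfl : (S.e i : ℝ) ≤ PC.α i * (S.s i : ℝ) := by
    rw [h.floor i]
    exact Nat.floor_le (mul_nonneg (alpha_nonneg i) (Nat.cast_nonneg _))
  have hb' : (redCount i S.large : ℝ) = S.e i := by exact_mod_cast hb
  have hθ : (1 : ℝ) ≤ (PC.θ 3 i : ℝ) := by exact_mod_cast hcap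
  have : redShare i * S.s i = (PC.α i * S.s i) / (PC.θ 3 i : ℝ) := by
    rw [redShare]; ring
  rw [this, ← sub_le_iff_le_add, le_div_iff₀ (by linarith)]
  nlinarith

lemma card_le_sum_countP {α : Type*} (B : Multiset α) (f g : α → ℕ) (I J : Finset ℕ)
    (h : ∀ b ∈ B, f b ∈ I ∨ g b ∈ J) :
    B.card ≤ (∑ i ∈ I, B.countP fun b => f b = i) + ∑ j ∈ J, B.countP fun b => g b = j := by
  induction B using Multiset.induction_on with
  | empty => simp
  | cons b B ih =>
    have ih := ih fun a ha => h a (by simp [ha])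
    simp only [Multiset.countP_cons, Finset.sum_add_distrib, Finset.sum_ite_eq, Multiset.card_cons]
    rcases h b (by simp) with hb | hb <;> rw [if_pos hb] <;> omega

/-! ### Charging schemes: a weight function bounds the number of bins -/

/-- The weights of the types if the blue bins of the types in `I` and the red bins of the types in
`J` are charged. -/
def charge (I J : Finset ℕ) (i : ℕ) : ℝ :=
  (if i ∈ I then blueShare i else 0) + if i ∈ J then redShare i else 0

/-- Each closed bin contributes at least 1 to the scaled volume, and each of the eleven groups has
at most one active bin. -/
lemma smallBins_card_le {B : Multiset (SmallBin 3)} (hB : SmallInv B) :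
    (B.card : ℝ) ≤ 1728 / 1330 * smallVolume B + 11 := by
  have hact : (B.filter fun b => b.active = true).card ≤ 11 := by
    have hnd : ((B.filter fun b => b.active = true).map SmallBin.group).Nodup := by
      rw [Multiset.nodup_iff_count_le_one]
      intro i
      rw [Multiset.count_map, Multiset.filter_filter]
      refine le_trans (le_of_eq ?_) (hB.2 i)
      congr 1
      refine Multiset.filter_congr fun a _ => ?_
      constructor
      · rintro ⟨h1, h2⟩; exact ⟨h1.symm, h2⟩
      · rintro ⟨h1, h2⟩; exact ⟨h1.symm, h2⟩
    have hsub : (⟨_, hnd⟩ : Finset ℕ) ⊆ Finset.Icc 11 21 := by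
      intro i hi
      obtain ⟨b, hb, rfl⟩ := Multiset.mem_map.1 (show i ∈ (B.filter fun b => b.active = true).map SmallBin.group from hi)
      have := hB.1 b (Multiset.mem_of_mem_filter hb)
      exact Finset.mem_Icc.2 ⟨this.group_ge, this.group_le⟩
    have := Finset.card_le_card hsub
    simpa using this
  have key : ∀ C : Multiset (SmallBin 3), (∀ b ∈ C, SmallOK b) →
      (C.card : ℝ) ≤ 1728 / 1330 * smallVolume C + (C.filter fun b => b.active = true).card := by
    intro C
    induction C using Multiset.induction_on with
    | empty => simp [smallVolume, itemSizes]
    | cons b C ih =>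
      intro hC
      have ih := ih fun a ha => hC a (by simp [ha])
      have hb := hC b (by simp)
      have hv : smallVolume (b ::ₘ C) = (b.items.map fun q => q.size ^ 3).sum + smallVolume C := by
        simp [smallVolume, itemSizes, Function.comp_def]
      rw [hv, Multiset.card_cons]
      push_cast
      by_cases ha : b.active = true
      · rw [Multiset.filter_cons_of_pos (p := fun b : SmallBin 3 => b.active = true) _ ha,
          Multiset.card_cons]
        push_cast
        have hnn : 0 ≤ (b.items.map fun q => q.size ^ 3).sum := by
          refine List.sum_nonneg fun y hy => ?_
          obtain ⟨q, hq, rfl⟩ := List.mem_map.1 hy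
          obtain ⟨cells, hf, -⟩ := hb.tiling
          obtain ⟨n, hn, rfl⟩ := List.mem_iff_getElem.1 hq
          have := (List.Forall₂.get hf hn (hf.length_eq ▸ hn)).2.1
          simp only [List.get_eq_getElem] at this
          have h0 : (0 : ℝ) < 1 / ((b.group : ℝ) + 1) := by positivity
          have := h0.trans this
          have : 0 < (b.items[n]).size := by
            by_contra hneg
            exact absurd this (not_lt.2 (mul_nonpos_of_nonneg_of_nonpos (by positivity) (not_lt.1 hneg)))
          positivity
        linarith
      · rw [Multiset.filter_cons_of_neg (p := fun b : SmallBin 3 => b.active = true) _ ha]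
        have := hb.volume_closed (by simpa using ha)
        linarith
  have h1 := key B hB.1
  have h2 : ((B.filter fun b => b.active = true).card : ℝ) ≤ 11 := by exact_mod_cast hact
  linarith

/-- If every bin for large items has a blue type in `I` or a red type in `J`, the corresponding
weights bound the number of bins. -/
theorem Run.card_le {L : List ℝ} {S : State 3} (h : Run PC L S) {I J : Finset ℕ}
    (hI : I ⊆ Finset.Icc 1 16) (hJ : J ⊆ {6, 7, 9, 10, 11})
    (hIJ : ∀ b ∈ S.large, b.group.blueType ∈ I ∨ b.group.redType ∈ J) :
    (S.packing.card : ℝ) ≤ (L.map (weight (charge I J))).sum + 60 := by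
  have hc := h.counts
  have hsm := smallBins_card_le h.smallInv
  have hsum := h.sum_weight (charge I J)
  have hcard : S.packing.card = S.large.card + S.small.card := by simp [State.packing]
  have hl := card_le_sum_countP S.large (fun b => b.group.blueType) (fun b => b.group.redType) I J hIJ
  have hl' : (S.large.card : ℝ) ≤ (∑ i ∈ I, ((S.large.countP fun b => b.group.blueType = i : ℕ) : ℝ)) +
      ∑ j ∈ J, ((S.large.countP fun b => b.group.redType = j : ℕ) : ℝ) := by exact_mod_cast hl
  have hJr : ∀ j ∈ J, IsRedType j := by
    intro j hj
    have := hJ hj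
    simpa [IsRedType] using this
  have hJ' : J ⊆ Finset.Icc 1 16 := fun j hj => Finset.mem_Icc.2 (hJr j hj).range
  -- The constants are 2 for each of at most 16 blue and 5 red types, and 11 for active bins of
  -- small items: 53 in all, within the allowance of 60.
  have hA : (∑ i ∈ I, ((S.large.countP fun b => b.group.blueType = i : ℕ) : ℝ)) ≤
      (∑ i ∈ I, blueShare i * S.s i) + 32 := by
    calc _ ≤ ∑ i ∈ I, (blueShare i * S.s i + 2) := Finset.sum_le_sum fun i hi =>
          hc.card_blue_le (Finset.mem_Icc.1 (hI hi)).1 (Finset.mem_Icc.1 (hI hi)).2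
      _ ≤ _ := by
        rw [Finset.sum_add_distrib, Finset.sum_const, nsmul_eq_mul]
        have : (I.card : ℝ) ≤ 16 := by exact_mod_cast (Finset.card_le_card hI).trans (by simp)
        linarith
  have hB : (∑ j ∈ J, ((S.large.countP fun b => b.group.redType = j : ℕ) : ℝ)) ≤
      (∑ j ∈ J, redShare j * S.s j) + 10 := by
    calc _ ≤ ∑ j ∈ J, (redShare j * S.s j + 2) := Finset.sum_le_sum fun i hi =>
          hc.card_red_le (hJr i hi)
      _ ≤ _ := by
        rw [Finset.sum_add_distrib, Finset.sum_const, nsmul_eq_mul]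
        have : (J.card : ℝ) ≤ 5 := by exact_mod_cast (Finset.card_le_card hJ).trans (by decide)
        linarith
  have hw : (∑ i ∈ Finset.Icc 1 16, charge I J i * S.s i) =
      (∑ i ∈ I, blueShare i * S.s i) + ∑ j ∈ J, redShare j * S.s j := by
    simp only [charge, add_mul, Finset.sum_add_distrib, ite_mul, zero_mul]
    rw [← Finset.sum_filter, ← Finset.sum_filter, Finset.filter_mem_eq_inter,
      Finset.filter_mem_eq_inter, Finset.inter_eq_right.2 hI, Finset.inter_eq_right.2 hJ']
  rw [hcard]
  push_cast
  rw [hsum, hw]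
  linarith

/-- The red types. -/
def redTypes : Finset ℕ := {6, 7, 9, 10, 11}

/-- The blue types whose bins may stay without red items while there is a bin `(?, j)`. -/
def lonelyTypes : ℕ → Finset ℕ
  | 6 => Finset.Icc 1 16 \ {4}
  | 7 => Finset.Icc 1 16 \ {3, 4}
  | 9 => Finset.Icc 1 16 \ {2, 3, 4, 7}
  | 10 => Finset.Icc 1 16 \ {2, 3, 4, 7}
  | _ => Finset.Icc 1 16 \ {2, 3, 4, 6, 7}

/-- `n` is bounded by the total weight of `L`, up to a constant. -/
def ChargedBy (n : ℕ) (L : List ℝ) (I J : Finset ℕ) : Prop :=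
  (n : ℝ) ≤ (L.map (weight (charge I J))).sum + 60

/-- The types left out of `lonelyTypes j` are those with Δ_{φ(i)} ≥ t_j, whose bins (i, ?) would
have accepted red items of type j. -/
lemma delta_lt_mem {i j : ℕ} (hj : IsRedType j) (h1 : 1 ≤ i) (h2 : i ≤ 16)
    (h : PC.φ i = 0 ∨ PC.Δ (PC.φ i) < PC.γ j * PC.t j) : i ∈ lonelyTypes j := by
  have hg := hj.gamma
  change φTable i = 0 ∨ ΔTable (φTable i) < (γTable j : ℝ) * tTable j at h
  rw [hg] at h
  rcases hj with rfl | rfl | rfl | rfl | rfl <;> simp only [lonelyTypes, Finset.mem_sdiff, Finset.mem_Icc] <;>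
    refine ⟨⟨h1, h2⟩, fun hm => ?_⟩ <;>
    simp only [Finset.mem_insert, Finset.mem_singleton] at hm <;>
    (try rcases hm with rfl | rfl | rfl | rfl | rfl) <;>
    norm_num [φTable, ΔTable, tTable] at h

/-- The name i of a bin carries no bound on i by itself; an item in the bin shows that i is between
1 and 16. -/
theorem Run.nonempty {L : List ℝ} {S : State 3} (h : Run PC L S) :
    ∀ b ∈ S.large, b.blue ≠ [] ∨ b.red ≠ [] := by
  have red : ∀ {i : ℕ} {x : ℝ} {g : Group} {b b' : LargeBin 3}, AddRed PC i x g b b' →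
      b'.blue ≠ [] ∨ b'.red ≠ [] := by
    rintro i x g b b' ⟨c, -, -, rfl⟩
    exact Or.inr (List.cons_ne_nil _ _)
  have blue : ∀ {i : ℕ} {x : ℝ} {g : Group} {b b' : LargeBin 3}, AddBlue PC i x g b b' →
      b'.blue ≠ [] ∨ b'.red ≠ [] := by
    rintro i x g b b' ⟨c, -, rfl⟩
    exact Or.inl (List.cons_ne_nil _ _)
  induction h with
  | nil => simp [State.init]
  | snoc L x S S' h hs ih =>
    cases hs with
    | small i k bins hx hp => exact ih
    | red i bins hx hc hp =>
      generalize S.large = B at hp ih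
      cases hp <;> intro a ha <;> rcases Multiset.mem_cons.1 ha with rfl | ha <;>
        first | exact red (by assumption) | exact ih a (by simp [ha])
    | blue i bins hx hc hp =>
      generalize S.large = B at hp ih
      cases hp <;> intro a ha <;> rcases Multiset.mem_cons.1 ha with rfl | ha <;>
        first | exact blue (by assumption) | exact ih a (by simp [ha])

lemma LargeOK.mono_range {b : LargeBin 3} (hb : LargeOK b) (hne : b.blue ≠ [] ∨ b.red ≠ []) {i : ℕ}
    (hg : b.group = .mono i) : PC.φ i = 0 ∧ 1 ≤ i ∧ i ≤ 16 := by
  simp only [LargeOK, hg] at hb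
  have hne : b.blue ≠ [] := hne.resolve_right fun h => h hb.2.2
  obtain ⟨q, hq⟩ := List.exists_mem_of_ne_nil _ hne
  exact ⟨hb.1, (hb.2.1.1 q hq).1.1, (hb.2.1.1 q hq).1.2.1⟩

/-- While there is a bin `(?, j)`, every bin has red items or a lonely blue type. -/
theorem Run.chargedBy_lonely {L : List ℝ} {S : State 3} (h : Run PC L S) {a : LargeBin 3}
    (ha : a ∈ S.large) {j : ℕ} (hj : a.group = .redIndet j) :
    ChargedBy S.packing.card L (lonelyTypes j) redTypes := by
  have hred : IsRedType j := ((h.largeOK a ha).of_redIndet hj).1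
  have hsub : ∀ j, lonelyTypes j ⊆ Finset.Icc 1 16 := by
    intro j
    unfold lonelyTypes
    split <;> exact Finset.sdiff_subset
  refine h.card_le (hsub j) (Finset.Subset.refl _) fun b hb => ?_
  have hok := h.largeOK b hb
  rcases hg : b.group with l | l | l | ⟨l, m⟩ <;> simp only [Group.blueType, Group.redType]
  · obtain ⟨h1, h2, h3⟩ := hok.mono_range (h.nonempty b hb) hg
    exact Or.inl (delta_lt_mem hred h2 h3 (Or.inl h1))
  · simp only [LargeOK, hg] at hok
    obtain ⟨h2, h3⟩ := phi_range hok.1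
    exact Or.inl (delta_lt_mem hred h2 h3 (Or.inr (h.counts.inv.noWaste a ha b hb l j hj hg)))
  · exact Or.inr (by simpa [redTypes, IsRedType] using (hok.of_redIndet hg).1)
  · simp only [LargeOK, hg] at hok
    exact Or.inr (by simpa [redTypes, IsRedType] using hok.2.1)

/-- Every bin has blue items, unless it is a bin `(?, j)`. -/
theorem Run.chargedBy_blue {L : List ℝ} {S : State 3} (h : Run PC L S) {J : Finset ℕ}
    (hJ : J ⊆ redTypes) (hS : ∀ b ∈ S.large, ∀ j, b.group = .redIndet j → j ∈ J) :
    ChargedBy S.packing.card L (Finset.Icc 1 16) J := by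
  refine h.card_le (Finset.Subset.refl _) hJ fun b hb => ?_
  have hok := h.largeOK b hb
  rcases hg : b.group with l | l | l | ⟨l, m⟩ <;> simp only [Group.blueType, Group.redType]
  · obtain ⟨h1, h2, h3⟩ := hok.mono_range (h.nonempty b hb) hg
    exact Or.inl (Finset.mem_Icc.2 ⟨h2, h3⟩)
  · simp only [LargeOK, hg] at hok
    exact Or.inl (Finset.mem_Icc.2 (phi_range hok.1))
  · exact Or.inr (hS b hb l hg)
  · simp only [LargeOK, hg] at hok
    exact Or.inl (Finset.mem_Icc.2 (phi_range hok.1))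

/-- The six situations of the counting argument, according to the smallest red items that are alone
in their bins. -/
theorem Run.chargedBy {L : List ℝ} {S : State 3} (h : Run PC L S) :
    ChargedBy S.packing.card L (Finset.Icc 1 16) ∅ ∨
    ChargedBy S.packing.card L (lonelyTypes 11) redTypes ∨
    ChargedBy S.packing.card L (lonelyTypes 10) redTypes ∨
    ChargedBy S.packing.card L (lonelyTypes 9) redTypes ∨
    (ChargedBy S.packing.card L (lonelyTypes 7) redTypes ∧
      ChargedBy S.packing.card L (Finset.Icc 1 16) {6, 7}) ∨
    (ChargedBy S.packing.card L (lonelyTypes 6) redTypes ∧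
      ChargedBy S.packing.card L (Finset.Icc 1 16) {6}) := by
  by_cases h11 : ∃ b ∈ S.large, b.group = .redIndet 11
  · obtain ⟨b, hb, hg⟩ := h11
    exact Or.inr (Or.inl (h.chargedBy_lonely hb hg))
  by_cases h10 : ∃ b ∈ S.large, b.group = .redIndet 10
  · obtain ⟨b, hb, hg⟩ := h10
    exact Or.inr (Or.inr (Or.inl (h.chargedBy_lonely hb hg)))
  by_cases h9 : ∃ b ∈ S.large, b.group = .redIndet 9
  · obtain ⟨b, hb, hg⟩ := h9
    exact Or.inr (Or.inr (Or.inr (Or.inl (h.chargedBy_lonely hb hg))))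
  push Not at h11 h10 h9
  have hle : ∀ b ∈ S.large, ∀ j, b.group = .redIndet j → j = 6 ∨ j = 7 := by
    intro b hb j hg
    rcases ((h.largeOK b hb).of_redIndet hg).1 with rfl | rfl | rfl | rfl | rfl
    · exact Or.inl rfl
    · exact Or.inr rfl
    · exact absurd hg (h9 b hb)
    · exact absurd hg (h10 b hb)
    · exact absurd hg (h11 b hb)
  by_cases h7 : ∃ b ∈ S.large, b.group = .redIndet 7
  · obtain ⟨b, hb, hg⟩ := h7
    -- With no lonely red items of type 9, 10 or 11, two schemes cover all bins: the lonely types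
    -- with all red types, and all blue types with the red types 6 and 7.
    refine Or.inr (Or.inr (Or.inr (Or.inr (Or.inl ⟨h.chargedBy_lonely hb hg, ?_⟩))))
    refine h.chargedBy_blue (by decide) fun b hb j hg => ?_
    rcases hle b hb j hg with rfl | rfl <;> simp
  push Not at h7
  by_cases h6 : ∃ b ∈ S.large, b.group = .redIndet 6
  · obtain ⟨b, hb, hg⟩ := h6
    refine Or.inr (Or.inr (Or.inr (Or.inr (Or.inr ⟨h.chargedBy_lonely hb hg, ?_⟩))))
    refine h.chargedBy_blue (by decide) fun b hb j hg => ?_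
    rcases hle b hb j hg with rfl | rfl
    · simp
    · exact absurd hg (h7 b hb)
  push Not at h6
  refine Or.inl (h.chargedBy_blue (by decide) fun b hb j hg => ?_)
  rcases hle b hb j hg with rfl | rfl
  · exact absurd hg (h6 b hb)
  · exact absurd hg (h7 b hb)

/-! ### From weights of single bins to the competitive ratio -/

/-- The total weight of a bin. -/
def binWeight (w : ℕ → ℝ) (b : List (Placed 3)) : ℝ := (b.map fun p => weight w p.size).sum

/-- Every correctly filled bin has weight at most `2.6852`. -/
def BinBound (w : ℕ → ℝ) : Prop :=
  ∀ b : List (Placed 3), IsBin b → (∀ p ∈ b, 0 < p.size ∧ p.size ≤ 1) → binWeight w b ≤ 2.6852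

/-- The coefficients a and 1 - a add up to 1, so the weight of small items, which does not depend on
the scheme, is reproduced. -/
lemma weight_mix (a : ℝ) (v w : ℕ → ℝ) (x : ℝ) :
    weight (fun i => a * v i + (1 - a) * w i) x = a * weight v x + (1 - a) * weight w x := by
  classical
  unfold weight
  rw [mul_add, mul_add, Finset.mul_sum, Finset.mul_sum]
  have : ∀ i, (if PC.HasType x i then a * v i + (1 - a) * w i else 0) =
      a * (if PC.HasType x i then v i else 0) + (1 - a) * (if PC.HasType x i then w i else 0) := by
    intro i; split_ifs <;> ring
  simp only [this, Finset.sum_add_distrib]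
  ring

/-- Any packing, in particular an optimal one, distributes the same items over its bins. -/
lemma sum_weight_le {w : ℕ → ℝ} (hw : BinBound w) {L : List ℝ} (hL : IsInput L)
    {B : Multiset (List (Placed 3))} (hB : IsPacking L B) :
    (L.map (weight w)).sum ≤ 2.6852 * B.card := by
  have h1 : (L.map (weight w)).sum = (B.map (binWeight w)).sum := by
    rw [← Multiset.sum_coe, ← Multiset.map_coe, ← hB.2, Multiset.map_bind, Multiset.sum_bind]
    congr 1
    refine Multiset.map_congr rfl fun b _ => ?_
    simp [binWeight, Function.comp_def]
  rw [h1]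
  have h2 : ∀ y ∈ B.map (binWeight w), y ≤ 2.6852 := by
    intro y hy
    obtain ⟨b, hb, rfl⟩ := Multiset.mem_map.1 hy
    refine hw b (hB.1 b hb) fun p hp => hL _ ?_
    rw [← Multiset.mem_coe, ← hB.2, Multiset.mem_bind]
    exact ⟨b, hb, by simpa using ⟨p, hp, rfl⟩⟩
  have := Multiset.sum_le_card_nsmul _ _ h2
  rw [Multiset.card_map, nsmul_eq_mul] at this
  linarith

/-- The infimum is attained because the packing produced by the algorithm shows that the set is
nonempty. -/
lemma exists_opt_packing {L : List ℝ} (hL : IsInput L) :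
    ∃ B : Multiset (List (Placed 3)), IsPacking L B ∧ B.card = opt 3 L := by
  obtain ⟨S, hS⟩ := exists_run hL
  exact Nat.sInf_mem (s := {n | ∃ B : Multiset (List (Placed 3)), IsPacking L B ∧ B.card = n})
    ⟨_, S.packing, hS.isPacking, rfl⟩

/-- For OPT = k the quotient is at most c + C / k, which tends to c. -/
lemma ratio_le_of_cost_le {c C : ℝ} (hc : 0 ≤ c) (hC : 0 ≤ C) {cost : List ℝ → ℕ → Prop}
    (h : ∀ L n, IsInput L → cost L n → (n : ℝ) ≤ c * opt 3 L + C) :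
    asymptoticRatio 3 cost ≤ ENNReal.ofReal c := by
  unfold asymptoticRatio
  have hlim : Filter.Tendsto (fun k : ℕ => ENNReal.ofReal (c + C / k)) Filter.atTop
      (nhds (ENNReal.ofReal c)) := by
    refine ENNReal.tendsto_ofReal ?_
    simpa using (tendsto_const_div_atTop_nhds_zero_nat C).const_add c
  rw [← hlim.limsup_eq]
  refine Filter.limsup_le_limsup ?_
  filter_upwards [Filter.eventually_ge_atTop 1] with k hk
  refine iSup_le fun L => iSup_le fun n => iSup_le fun ⟨hL, ho, hn⟩ => ?_
  have hk' : (0 : ℝ) < k := by exact_mod_cast hk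
  have := h L n hL hn
  rw [ho] at this
  rw [ENNReal.div_le_iff (by simpa using hk'.ne') (by simp)]
  rw [← ENNReal.ofReal_natCast n, ← ENNReal.ofReal_natCast k, ← ENNReal.ofReal_mul (by positivity)]
  refine ENNReal.ofReal_le_ofReal ?_
  rw [add_mul, div_mul_cancel₀ _ hk'.ne']
  exact this

/-- The weights of the types in a mixed charging scheme. -/
def mix (a : ℝ) (j : ℕ) (J : Finset ℕ) (i : ℕ) : ℝ :=
  a * charge (lonelyTypes j) redTypes i + (1 - a) * charge (Finset.Icc 1 16) J i

/-- Two upper bounds for the same number may be averaged. This helps since no single bin has to be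
heavy for both weight functions at once. -/
lemma ChargedBy.mix {n : ℕ} {L : List ℝ} {I J J' : Finset ℕ} {a : ℝ} (h0 : 0 ≤ a) (h1 : a ≤ 1)
    (h : ChargedBy n L I J) (h' : ChargedBy n L (Finset.Icc 1 16) J') :
    (n : ℝ) ≤ (L.map (weight fun i => a * charge I J i + (1 - a) * charge (Finset.Icc 1 16) J' i)).sum
      + 60 := by
  unfold ChargedBy at h h'
  have : ∀ L : List ℝ,
      (L.map (weight fun i => a * charge I J i + (1 - a) * charge (Finset.Icc 1 16) J' i)).sum =
      a * (L.map (weight (charge I J))).sum + (1 - a) * (L.map (weight (charge (Finset.Icc 1 16) J'))).sum := by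
    intro L
    induction L with
    | nil => simp
    | cons x L ih => simp only [List.map_cons, List.sum_cons, ih, weight_mix]; ring
  rw [this]
  nlinarith

/-- This reduces the bound on the ratio to six statements about single bins; in each of the six
situations one of the weight functions bounds the cost. -/
theorem ratio_le {a a' : ℝ} (ha : 0 ≤ a ∧ a ≤ 1) (ha' : 0 ≤ a' ∧ a' ≤ 1)
    (h0 : BinBound (charge (Finset.Icc 1 16) ∅))
    (h11 : BinBound (charge (lonelyTypes 11) redTypes))
    (h10 : BinBound (charge (lonelyTypes 10) redTypes))
    (h9 : BinBound (charge (lonelyTypes 9) redTypes))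
    (h7 : BinBound (mix a 7 {6, 7})) (h6 : BinBound (mix a' 6 {6})) :
    asymptoticRatio 3 (Cost 3 cubeParams) ≤ ENNReal.ofReal 2.6852 := by
  refine ratio_le_of_cost_le (C := 60) (by norm_num) (by norm_num) fun L n hL hn => ?_
  obtain ⟨S, hS, rfl⟩ := hn
  obtain ⟨B, hB, hcard⟩ := exists_opt_packing hL
  have key : ∀ w, BinBound w → (S.packing.card : ℝ) ≤ (L.map (weight w)).sum + 60 →
      (S.packing.card : ℝ) ≤ 2.6852 * (opt 3 L) + 60 := by
    intro w hw h
    have := sum_weight_le hw hL hB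
    rw [hcard] at this
    linarith
  rcases Run.chargedBy hS with h | h | h | h | ⟨h, hmix⟩ | ⟨h, hmix⟩
  · exact key _ h0 h
  · exact key _ h11 h
  · exact key _ h10 h
  · exact key _ h9 h
  · exact key _ h7 (ChargedBy.mix ha.1 ha.2 h hmix)
  · exact key _ h6 (ChargedBy.mix ha'.1 ha'.2 h hmix)

/-! ### Dual certificates: point masses, grids, volume -/

/-- The point `x` lies in the half-open cube `p`. -/
def Placed.Contains (p : Placed 3) (x : Fin 3 → ℝ) : Prop :=
  ∀ k, p.pos k ≤ x k ∧ x k < p.pos k + p.size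

/-- Half-open cubes are used because cubes that touch then have no common point. -/
lemma Placed.NonOverlap.not_contains {p q : Placed 3} (h : p.NonOverlap q) {x : Fin 3 → ℝ}
    (hp : p.Contains x) : ¬ q.Contains x := by
  intro hq
  obtain ⟨k, hk⟩ := h
  have h1 := hp k
  have h2 := hq k
  rcases hk with h | h <;> linarith

open Classical in
/-- The mass that the point masses `y i` at `f i`, `i ∈ s`, give to `p`. -/
def mass {ι : Type*} (s : Finset ι) (f : ι → Fin 3 → ℝ) (y : ι → ℝ) (p : Placed 3) : ℝ :=
  ∑ i ∈ s with p.Contains (f i), y i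

/-- Weak duality: each point lies in at most one of the cubes. In the induction the points inside
the first cube are removed, which the other cubes do not notice. -/
lemma sum_mass_le {ι : Type*} {s : Finset ι} {f : ι → Fin 3 → ℝ} {y : ι → ℝ}
    (hy : ∀ i ∈ s, 0 ≤ y i) {b : List (Placed 3)} (hb : b.Pairwise Placed.NonOverlap) :
    (b.map (mass s f y)).sum ≤ ∑ i ∈ s, y i := by
  classical
  induction b generalizing s with
  | nil => simpa using Finset.sum_nonneg hy
  | cons p b ih =>
    obtain ⟨h1, h2⟩ := List.pairwise_cons.1 hb
    rw [List.map_cons, List.sum_cons, ← Finset.sum_filter_add_sum_filter_not s (fun i => p.Contains (f i))]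
    have e : ∀ q ∈ b, mass s f y q = mass (s.filter fun i => ¬ p.Contains (f i)) f y q := by
      intro q hq
      unfold mass
      rw [Finset.filter_filter]
      refine Finset.sum_congr (Finset.filter_congr fun i _ => ?_) fun _ _ => rfl
      constructor
      · intro h
        exact ⟨fun hp => (h1 q hq).not_contains hp h, h⟩
      · exact fun h => h.2
    rw [List.map_congr_left e]
    refine add_le_add (le_of_eq ?_) (ih (fun i hi => hy i (Finset.mem_of_mem_filter i hi)) h2)
    unfold mass
    exact Finset.sum_congr (by ext; simp) fun _ _ => rfl

/-- The half-open cube. -/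
def Placed.box (p : Placed 3) : Set (Fin 3 → ℝ) :=
  Set.pi Set.univ fun k => Set.Ico (p.pos k) (p.pos k + p.size)

lemma volume_box (p : Placed 3) : MeasureTheory.volume p.box = ENNReal.ofReal p.size ^ 3 := by
  rw [Placed.box, Real.volume_pi_Ico]
  simp

/-- The same duality for Lebesgue measure: the half-open cubes are disjoint and lie in the unit
cube. -/
lemma sum_volume_le {b : List (Placed 3)} (hb : IsBin b) (hs : ∀ p ∈ b, 0 < p.size) :
    (b.map fun p => p.size ^ 3).sum ≤ 1 := by
  have hdis : ∀ p q : Placed 3, p.NonOverlap q → Disjoint p.box q.box := by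
    intro p q h
    rw [Set.disjoint_left]
    intro x hx hx'
    simp only [Placed.box, Set.mem_univ_pi, Set.mem_Ico] at hx hx'
    exact h.not_contains hx hx'
  have hmeas : ∀ p : Placed 3, MeasurableSet p.box := fun p =>
    MeasurableSet.univ_pi fun k => measurableSet_Ico
  have key : ∀ b : List (Placed 3), b.Pairwise Placed.NonOverlap → (∀ p ∈ b, 0 < p.size) →
      MeasureTheory.volume (⋃ p ∈ b, p.box) = ENNReal.ofReal (b.map fun p => p.size ^ 3).sum := by
    intro b
    induction b with
    | nil => simp
    | cons p b ih =>
      intro h hs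
      obtain ⟨h1, h2⟩ := List.pairwise_cons.1 h
      have hs' : ∀ q ∈ b, 0 < q.size := fun q hq => hs q (by simp [hq])
      have hp := hs p (by simp)
      have hU : (⋃ q ∈ p :: b, q.box) = p.box ∪ ⋃ q ∈ b, q.box := by
        ext x; simp
      rw [hU, MeasureTheory.measure_union, ih h2 hs', volume_box, List.map_cons, List.sum_cons,
        ENNReal.ofReal_add (by positivity), ENNReal.ofReal_pow hp.le]
      · refine List.sum_nonneg fun y hy => ?_
        obtain ⟨q, hq, rfl⟩ := List.mem_map.1 hy
        have := hs' q hq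
        positivity
      · rw [Set.disjoint_iUnion₂_right]
        exact fun q hq => hdis p q (h1 q hq)
      · exact Set.Finite.measurableSet_biUnion (List.finite_toSet b) fun q _ => hmeas q
  have hsub : (⋃ p ∈ b, p.box) ⊆ Set.Icc (0 : Fin 3 → ℝ) 1 := by
    intro x hx
    obtain ⟨p, hp, hx⟩ := Set.mem_iUnion₂.1 hx
    simp only [Placed.box, Set.mem_univ_pi, Set.mem_Ico] at hx
    have := hb.1 p hp
    exact ⟨fun k => (this k).1.trans (hx k).1, fun k => ((hx k).2.le).trans (this k).2⟩
  have h1 := MeasureTheory.measure_mono (μ := MeasureTheory.volume) hsub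
  rw [key b hb.2 hs, Real.volume_Icc_pi] at h1
  simpa using h1

/-- The largest `k` with `k / m < x`. -/
def gridCount (m : ℕ) (x : ℝ) : ℕ := ⌈(m : ℝ) * x⌉₊ - 1

lemma le_gridCount {m k : ℕ} {x : ℝ} (h : (k : ℝ) < m * x) : k ≤ gridCount m x := by
  have : k < ⌈(m : ℝ) * x⌉₊ := Nat.lt_ceil.2 h
  unfold gridCount
  omega

/-- The inner points of the grid of mesh `1 / m`. -/
def gridPoint (m : ℕ) (c : Fin 3 → ℕ) : Fin 3 → ℝ := fun k => (c k : ℝ) / m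

/-- The indices of the inner grid points. -/
def gridIndex (m : ℕ) : Finset (Fin 3 → ℕ) := Fintype.piFinset fun _ => Finset.Ico 1 m

lemma card_gridIndex (m : ℕ) : (gridIndex m).card = (m - 1) ^ 3 := by
  simp [gridIndex]

/-- A half-open interval of length `s` in `[0, 1]` contains `gridCount m s` consecutive inner grid
coordinates. -/
lemma exists_grid_interval {m : ℕ} (hm : 0 < m) {a s : ℝ} (ha : 0 ≤ a) (h1 : a + s ≤ 1) :
    ∃ j : ℕ, ∀ i ∈ Finset.Ico j (j + gridCount m s),
      i ∈ Finset.Ico 1 m ∧ a ≤ (i : ℝ) / m ∧ (i : ℝ) / m < a + s := by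
  have hm' : (0 : ℝ) < m := by exact_mod_cast hm
  have hlt : ∀ i : ℕ, (i : ℝ) < m * (a + s) → i < m := by
    intro i hi
    have : (i : ℝ) < m := hi.trans_le (by nlinarith)
    exact_mod_cast this
  have hg : ∀ l : ℕ, l < gridCount m s → ((l : ℝ) + 1 < m * s) := by
    intro l hl
    unfold gridCount at hl
    have : l + 1 < ⌈(m : ℝ) * s⌉₊ := by omega
    have := Nat.lt_ceil.1 this
    push_cast at this
    exact this
  -- The coordinate 0 is not an inner one. So the indices start at 1 if a = 0, and at ⌈m a⌉ ≥ 1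
  -- otherwise.
  rcases ha.eq_or_lt with h0 | h0
  · refine ⟨1, fun i hi => ?_⟩
    rw [Finset.mem_Ico] at hi
    have h2 : (i : ℝ) < m * s := by
      have := hg (i - 1) (by omega)
      have e : ((i - 1 : ℕ) : ℝ) = (i : ℝ) - 1 := by push_cast [Nat.cast_sub hi.1]; ring
      rw [e] at this
      linarith
    refine ⟨Finset.mem_Ico.2 ⟨hi.1, hlt i (by nlinarith)⟩, by rw [← h0]; positivity, ?_⟩
    rw [div_lt_iff₀ hm']
    nlinarith
  · refine ⟨⌈(m : ℝ) * a⌉₊, fun i hi => ?_⟩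
    rw [Finset.mem_Ico] at hi
    have hc0 : 0 < ⌈(m : ℝ) * a⌉₊ := Nat.ceil_pos.2 (by positivity)
    have hc1 := Nat.le_ceil ((m : ℝ) * a)
    have hc2 := Nat.ceil_lt_add_one (a := (m : ℝ) * a) (by positivity)
    have hge : (m : ℝ) * a ≤ i := hc1.trans (by exact_mod_cast hi.1)
    have h2 : (i : ℝ) < m * (a + s) := by
      have := hg (i - ⌈(m : ℝ) * a⌉₊) (by omega)
      have e : ((i - ⌈(m : ℝ) * a⌉₊ : ℕ) : ℝ) = (i : ℝ) - ⌈(m : ℝ) * a⌉₊ := by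
        push_cast [Nat.cast_sub hi.1]; ring
      rw [e] at this
      linarith
    refine ⟨Finset.mem_Ico.2 ⟨by omega, hlt i h2⟩, ?_, ?_⟩
    · rw [le_div_iff₀ hm']; linarith
    · rw [div_lt_iff₀ hm']; linarith

/-- The cube contains the product of three intervals of inner grid coordinates, one for each
direction. -/
lemma gridCount_pow_le_mass {m : ℕ} (hm : 0 < m) {p : Placed 3} (hp : p.Inside) :
    ((gridCount m p.size : ℝ)) ^ 3 ≤ mass (gridIndex m) (gridPoint m) (fun _ => 1) p := by
  classical
  choose j hj using fun k => exists_grid_interval hm (hp k).1 (hp k).2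
  have hsub : (Fintype.piFinset fun k => Finset.Ico (j k) (j k + gridCount m p.size)) ⊆
      (gridIndex m).filter fun i => p.Contains (gridPoint m i) := by
    intro c hc
    rw [Fintype.mem_piFinset] at hc
    rw [Finset.mem_filter, gridIndex, Fintype.mem_piFinset]
    exact ⟨fun k => (hj k _ (hc k)).1, fun k => (hj k _ (hc k)).2⟩
  have := Finset.card_le_card hsub
  rw [Fintype.card_piFinset] at this
  simp only [Nat.card_Ico, Nat.add_sub_cancel_left, Finset.prod_const, Finset.card_univ,
    Fintype.card_fin] at this
  have h2 : mass (gridIndex m) (gridPoint m) (fun _ => 1) p =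
      (((gridIndex m).filter fun i => p.Contains (gridPoint m i)).card : ℝ) := by
    simp [mass]
  rw [h2]
  exact_mod_cast this

lemma sum_gridCount_le {m : ℕ} (hm : 0 < m) {b : List (Placed 3)} (hb : IsBin b) :
    (b.map fun p => (gridCount m p.size : ℝ) ^ 3).sum ≤ ((m : ℝ) - 1) ^ 3 := by
  have h1 := sum_mass_le (s := gridIndex m) (f := gridPoint m) (y := fun _ => 1) (by simp) hb.2
  rw [Finset.sum_const, card_gridIndex, nsmul_eq_mul, mul_one] at h1
  push_cast [Nat.cast_sub (Nat.succ_le_of_lt hm)] at h1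
  refine le_trans (List.sum_le_sum fun p hp => ?_) h1
  exact gridCount_pow_le_mass hm (hb.1 p hp)

/-- A dual certificate: multipliers for the volume and for grids of given mesh. -/
structure Cert where
  vol : ℚ
  grids : List (ℕ × ℚ)

/-- The value of a certificate on an item of size `x`. -/
def Cert.value (c : Cert) (x : ℝ) : ℝ :=
  c.vol * x ^ 3 + (c.grids.map fun g => (g.2 : ℝ) * (gridCount g.1 x : ℝ) ^ 3).sum

/-- The bound on the total value of the items of a bin. -/
def Cert.total (c : Cert) : ℚ :=
  c.vol + (c.grids.map fun g => g.2 * ((g.1 : ℚ) - 1) ^ 3).sum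

/-- Lower bound for the value of items of size more than `x`. -/
def Cert.valueQ (c : Cert) (x : ℚ) : ℚ :=
  c.vol * x ^ 3 + (c.grids.map fun g => g.2 * ((⌊(g.1 : ℚ) * x⌋₊ : ℕ) : ℚ) ^ 3).sum

/-- All multipliers are nonnegative, and small items are covered. -/
def Cert.Valid (c : Cert) : Prop :=
  1728 / 1330 ≤ c.vol ∧ ∀ g ∈ c.grids, 0 < g.1 ∧ 0 ≤ g.2

instance (c : Cert) : Decidable c.Valid := inferInstanceAs (Decidable (_ ∧ _))

/-- A nonnegative combination of the volume bound and of the grid bounds. -/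
lemma Cert.sum_value_le {c : Cert} (hc : c.Valid) {b : List (Placed 3)} (hb : IsBin b)
    (hs : ∀ p ∈ b, 0 < p.size) : (b.map fun p => c.value p.size).sum ≤ c.total := by
  obtain ⟨v, gs⟩ := c
  obtain ⟨h1, h2⟩ := hc
  simp only at h1 h2
  have hv : (0 : ℝ) ≤ v := by
    have : (0 : ℚ) ≤ v := le_trans (by norm_num) h1
    exact_mod_cast this
  simp only [Cert.value, Cert.total]
  have hvol := sum_volume_le hb hs
  have hgs : (b.map fun p => (gs.map fun g => (g.2 : ℝ) * (gridCount g.1 p.size : ℝ) ^ 3).sum).sum ≤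
      (gs.map fun g => (g.2 : ℝ) * ((g.1 : ℝ) - 1) ^ 3).sum := by
    clear h1
    induction gs with
    | nil => simp
    | cons g gs ih =>
      simp only [List.map_cons, List.sum_cons, List.sum_map_add, List.sum_map_mul_left]
      refine add_le_add ?_ (ih fun g hg => h2 g (by simp [hg]))
      obtain ⟨hm, hy⟩ := h2 g (by simp)
      exact mul_le_mul_of_nonneg_left (sum_gridCount_le hm hb) (by exact_mod_cast hy)
  rw [List.sum_map_add, List.sum_map_mul_left]
  push_cast
  refine add_le_add (by nlinarith) ?_
  refine le_trans hgs (le_of_eq ?_)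
  simp [List.map_map, Function.comp_def]

/-- From x > q it follows that ⌊m q⌋ / m < x, so the grid count of x is at least ⌊m q⌋. Thus one
rational number bounds the value for all items of a type from below, with q the excluded lower end
of the interval. -/
lemma Cert.valueQ_le {c : Cert} (hc : c.Valid) {q : ℚ} (hq : 0 ≤ q) {x : ℝ} (hx : (q : ℝ) < x) :
    (c.valueQ q : ℝ) ≤ c.value x := by
  obtain ⟨v, gs⟩ := c
  obtain ⟨h1, h2⟩ := hc
  simp only at h1 h2
  have hv : (0 : ℝ) ≤ v := by
    have : (0 : ℚ) ≤ v := le_trans (by norm_num) h1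
    exact_mod_cast this
  have hq' : (0 : ℝ) ≤ q := by exact_mod_cast hq
  simp only [Cert.value, Cert.valueQ]
  push_cast
  refine add_le_add (mul_le_mul_of_nonneg_left (pow_le_pow_left₀ hq' hx.le 3) hv) ?_
  rw [List.map_map]
  refine List.sum_le_sum fun g hg => ?_
  obtain ⟨hm, hy⟩ := h2 g hg
  simp only [Function.comp]
  push_cast
  refine mul_le_mul_of_nonneg_left (pow_le_pow_left₀ (by positivity) ?_ 3) (by exact_mod_cast hy)
  have hle : ⌊(g.1 : ℚ) * q⌋₊ ≤ gridCount g.1 x := by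
    refine le_gridCount ?_
    have h3 : ((⌊(g.1 : ℚ) * q⌋₊ : ℕ) : ℚ) ≤ g.1 * q := Nat.floor_le (by positivity)
    have h4 : ((⌊(g.1 : ℚ) * q⌋₊ : ℕ) : ℝ) ≤ g.1 * q := by exact_mod_cast h3
    have h5 : (g.1 : ℝ) * q < g.1 * x := mul_lt_mul_of_pos_left hx (by exact_mod_cast hm)
    linarith
  exact_mod_cast hle

/-- For small items the volume term alone suffices, by the lower bound for `vol` in `Cert.Valid`. -/
lemma Cert.small_le {c : Cert} (hc : c.Valid) {x : ℝ} (hx : 0 ≤ x) :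
    1728 / 1330 * x ^ 3 ≤ c.value x := by
  obtain ⟨v, gs⟩ := c
  obtain ⟨h1, h2⟩ := hc
  simp only at h1 h2
  have hv : ((1728 / 1330 : ℚ) : ℝ) ≤ v := by exact_mod_cast h1
  push_cast at hv
  simp only [Cert.value]
  have : 0 ≤ (gs.map fun g => (g.2 : ℝ) * (gridCount g.1 x : ℝ) ^ 3).sum := by
    refine List.sum_nonneg fun y hy => ?_
    obtain ⟨g, hg, rfl⟩ := List.mem_map.1 hy
    have : (0 : ℝ) ≤ g.2 := by exact_mod_cast (h2 g hg).2
    positivity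
  have := mul_le_mul_of_nonneg_right hv (pow_nonneg hx 3)
  linarith

/-! ### Weights as rational numbers -/

/-- Interval ends as rational numbers. -/
def tQ : ℕ → ℚ
  | 1 => 1 | 2 => 7 / 10 | 3 => 13 / 20 | 4 => 3 / 5 | 5 => 1 / 2 | 6 => 2 / 5 | 7 => 7 / 20
  | 8 => 1 / 3 | 9 => 3 / 10 | 10 => 1 / 4 | 11 => 1 / 5 | 12 => 1 / 6 | 13 => 1 / 7 | 14 => 1 / 8
  | 15 => 1 / 9 | 16 => 1 / 10 | 17 => 1 / 11 | _ => 0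

lemma tQ_eq {i : ℕ} (h1 : 1 ≤ i) (h2 : i ≤ 17) : tTable i = (tQ i : ℝ) := by
  interval_cases i <;> norm_num [tTable, tQ]

def alphaQ : ℕ → ℚ
  | 6 => 12 / 100 | 7 => 2 / 10 | 9 => 325 / 1000 | 10 => 2096 / 10000 | 11 => 15 / 100 | _ => 0

def blueShareQ (i : ℕ) : ℚ := (1 - alphaQ i) / (βTable i : ℚ) ^ 3

def redShareQ (i : ℕ) : ℚ := alphaQ i / ((βTable i ^ 3 - (βTable i - γTable i) ^ 3 : ℕ) : ℚ)

lemma alphaQ_eq (i : ℕ) : αCube i = (alphaQ i : ℝ) := by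
  unfold αCube alphaQ
  split <;> norm_num

lemma blueShare_eq (i : ℕ) : blueShare i = (blueShareQ i : ℝ) := by
  simp only [blueShare, blueShareQ]
  push_cast
  rw [← alphaQ_eq]
  rfl

lemma redShare_eq (i : ℕ) : redShare i = (redShareQ i : ℝ) := by
  unfold redShare redShareQ
  rw [Rat.cast_div, ← alphaQ_eq, Rat.cast_natCast]
  rfl

def chargeQ (I J : Finset ℕ) (i : ℕ) : ℚ :=
  (if i ∈ I then blueShareQ i else 0) + if i ∈ J then redShareQ i else 0

lemma charge_eq (I J : Finset ℕ) (i : ℕ) : charge I J i = (chargeQ I J i : ℝ) := by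
  unfold charge chargeQ
  rw [blueShare_eq, redShare_eq]
  push_cast
  split_ifs <;> simp

def mixQ (a : ℚ) (j : ℕ) (J : Finset ℕ) (i : ℕ) : ℚ :=
  a * chargeQ (lonelyTypes j) redTypes i + (1 - a) * chargeQ (Finset.Icc 1 16) J i

lemma mix_eq (a : ℚ) (j : ℕ) (J : Finset ℕ) (i : ℕ) : mix a j J i = (mixQ a j J i : ℝ) := by
  unfold mix mixQ
  rw [charge_eq, charge_eq]
  push_cast
  ring

/-! ### Surplus for large items and for items of middle size -/

/-- The number of items of a list with a given property. -/
lemma sum_ite_le {α : Type*} (b : List α) (P : α → Prop) [DecidablePred P] {z : ℝ} (hz : 0 ≤ z)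
    {K : ℕ} (hK : b.countP (fun a => decide (P a)) ≤ K) :
    (b.map fun a => if P a then z else 0).sum ≤ K * z := by
  have : (b.map fun a => if P a then z else 0).sum = (b.countP fun a => decide (P a) : ℕ) * z := by
    clear hK
    induction b with
    | nil => simp
    | cons a b ih =>
      rw [List.map_cons, List.sum_cons, ih, List.countP_cons]
      by_cases h : P a
      · simp only [h, if_true, decide_true]; push_cast; ring
      · simp [h]
  rw [this]
  exact mul_le_mul_of_nonneg_right (by exact_mod_cast hK) hz

/-- The centre is the only inner point of the grid of mesh 1/2, and every item larger than 1/2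
contains it. -/
lemma countP_le_one_of_center {b : List (Placed 3)} (hb : IsBin b) :
    b.countP (fun p => decide (1 / 2 < p.size)) ≤ 1 := by
  have h := sum_gridCount_le (m := 2) (by norm_num) hb
  have h1 : ((b.countP (fun p => decide (1 / 2 < p.size)) : ℕ) : ℝ) =
      (b.map fun p => if 1 / 2 < p.size then (1 : ℝ) else 0).sum := by
    clear h
    induction b with
    | nil => simp
    | cons p b ih =>
      have ih := ih ⟨fun q hq => hb.1 q (by simp [hq]), (List.pairwise_cons.1 hb.2).2⟩
      rw [List.map_cons, List.sum_cons, ← ih, List.countP_cons]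
      by_cases h : 1 / 2 < p.size
      · simp only [h, if_true, decide_true]; push_cast; ring
      · rw [if_neg h]; simp only [h, decide_false]; norm_num
  have h2 : (b.map fun p => if 1 / 2 < p.size then (1 : ℝ) else 0).sum ≤
      (b.map fun p => (gridCount 2 p.size : ℝ) ^ 3).sum := by
    refine List.sum_le_sum fun p _ => ?_
    split_ifs with h
    · have : 1 ≤ gridCount 2 p.size := le_gridCount (by push_cast; linarith)
      have : (1 : ℝ) ≤ gridCount 2 p.size := by exact_mod_cast this
      exact one_le_pow₀ this
    · positivity
  have h3 : ((b.countP (fun p => decide (1 / 2 < p.size)) : ℕ) : ℝ) ≤ 1 := by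
    rw [h1]
    refine h2.trans (h.trans ?_)
    norm_num
  exact_mod_cast h3

/-- The certificate bounds the weight of a bin, with a surplus `σ` for an item larger than `1 / 2`
and `z` for each of at most `K` items of middle size. -/
lemma Cert.binWeight_le {c : Cert} (hc : c.Valid) {w : ℕ → ℝ} {wQ : ℕ → ℚ} (hw : ∀ i, w i = (wQ i : ℝ))
    {σ z : ℚ} (hσ : 0 ≤ σ) (hz : 0 ≤ z) {K : ℕ} {T : Finset ℕ}
    (hmid : ∀ i ∈ Finset.Icc 5 7, wQ i ≤ c.valueQ (tQ (i + 1)) + z)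
    (hlow : ∀ i ∈ Finset.Icc 8 16, wQ i ≤ c.valueQ (tQ (i + 1)))
    (hbig : ∀ i ∈ T, wQ i ≤ c.valueQ (tQ (i + 1)) + σ)
    {b : List (Placed 3)} (hb : IsBin b) (hs : ∀ p ∈ b, 0 < p.size ∧ p.size ≤ 1)
    (hT : ∀ p ∈ b, ∀ i, PC.HasType p.size i → i ≤ 4 → i ∈ T)
    (hK : b.countP (fun p => decide (1 / 3 < p.size ∧ p.size ≤ 1 / 2)) ≤ K) :
    binWeight w b ≤ c.total + σ + K * z := by
  have hσ' : (0 : ℝ) ≤ σ := by exact_mod_cast hσ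
  have hz' : (0 : ℝ) ≤ z := by exact_mod_cast hz
  -- The weight is dominated item by item; the surplus depends only on the size class, so it can be
  -- summed by counting.
  have key : ∀ p ∈ b, weight w p.size ≤ c.value p.size + ((if 1 / 2 < p.size then (σ : ℝ) else 0) +
      if 1 / 3 < p.size ∧ p.size ≤ 1 / 2 then (z : ℝ) else 0) := by
    intro p hp
    obtain ⟨h0, h1⟩ := hs p hp
    rcases le_or_gt p.size (1 / 11) with h | h
    · rw [weight_of_small h]
      have := Cert.small_le hc h0.le
      rw [if_neg (by linarith), if_neg (by rintro ⟨h, -⟩; linarith)]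
      linarith
    · obtain ⟨i, hi⟩ := exists_hasType h h1
      rw [weight_of_hasType hi, hw]
      obtain ⟨i1, i2, i3, i4⟩ := id hi
      change i ≤ 16 at i2
      change tTable (i + 1) < p.size at i3
      change p.size ≤ tTable i at i4
      have hlo : ((tQ (i + 1) : ℚ) : ℝ) < p.size := by
        rw [← tQ_eq (by omega) (by omega)]; exact i3
      have h0Q : (0 : ℚ) ≤ tQ (i + 1) := by
        unfold tQ; split <;> norm_num
      have hv := Cert.valueQ_le hc h0Q hlo
      have hn1 : (0 : ℝ) ≤ (if 1 / 2 < p.size then (σ : ℝ) else 0) := by split_ifs <;> simp [hσ']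
      have hn2 : (0 : ℝ) ≤ (if 1 / 3 < p.size ∧ p.size ≤ 1 / 2 then (z : ℝ) else 0) := by
        split_ifs <;> simp [hz']
      rcases Nat.lt_or_ge i 5 with hi5 | hi5
      · have := hbig i (hT p hp i hi (by omega))
        have h2 : ((wQ i : ℚ) : ℝ) ≤ c.valueQ (tQ (i + 1)) + σ := by exact_mod_cast this
        have h3 : 1 / 2 < p.size := by
          have := t_antitone (i := i + 1) (l := 5) (by omega) (by omega) (by omega)
          have e : tTable 5 = 0.5 := rfl
          rw [e] at this
          norm_num at this
          linarith
        rw [if_pos h3]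
        linarith
      · rcases Nat.lt_or_ge i 8 with hi8 | hi8
        · have := hmid i (Finset.mem_Icc.2 ⟨hi5, by omega⟩)
          have h2 : ((wQ i : ℚ) : ℝ) ≤ c.valueQ (tQ (i + 1)) + z := by exact_mod_cast this
          have h3 : 1 / 3 < p.size := by
            have := t_antitone (i := i + 1) (l := 8) (by omega) (by omega) (by omega)
            have e : tTable 8 = 1 / 3 := rfl
            rw [e] at this
            linarith
          have h4 : p.size ≤ 1 / 2 := by
            have := t_antitone (i := 5) (l := i) (by omega) (by omega) (by omega)
            have e : tTable 5 = 0.5 := rfl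
            rw [e] at this
            norm_num at this
            linarith
          rw [if_pos (⟨h3, h4⟩ : 1 / 3 < p.size ∧ p.size ≤ 1 / 2)]
          linarith
        · have := hlow i (Finset.mem_Icc.2 ⟨hi8, i2⟩)
          have h2 : ((wQ i : ℚ) : ℝ) ≤ c.valueQ (tQ (i + 1)) := by exact_mod_cast this
          linarith
  unfold binWeight
  refine (List.sum_le_sum key).trans ?_
  rw [List.sum_map_add, List.sum_map_add]
  have h1 := Cert.sum_value_le hc hb fun p hp => (hs p hp).1
  have h2 := sum_ite_le b (fun p => 1 / 2 < p.size) hσ' (countP_le_one_of_center hb)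
  have h3 := sum_ite_le b (fun p => 1 / 3 < p.size ∧ p.size ≤ 1 / 2) hz' hK
  push_cast at h2
  linarith

/-- Items of middle size. -/
def midCount (b : List (Placed 3)) : ℕ :=
  b.countP fun p => decide (1 / 3 < p.size ∧ p.size ≤ 1 / 2)

lemma nonOverlap_symm {p q : Placed 3} (h : p.NonOverlap q) : q.NonOverlap p := by
  obtain ⟨k, hk⟩ := h
  exact ⟨k, hk.symm⟩

lemma IsBin.nonOverlap {b : List (Placed 3)} (hb : IsBin b) {p q : Placed 3} (hp : p ∈ b)
    (hq : q ∈ b) (hne : p ≠ q) : p.NonOverlap q := by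
  have : Std.Symm (Placed.NonOverlap (d := 3)) := ⟨fun _ _ => nonOverlap_symm⟩
  exact hb.2.forall hp hq hne

lemma contains_center {p : Placed 3} (hp : p.Inside) (h : 1 / 2 < p.size) :
    p.Contains fun _ => 1 / 2 := fun k => by
  have := hp k
  constructor <;> linarith

lemma HasType.half_lt {x : ℝ} {i : ℕ} (h : PC.HasType x i) (hi : i ≤ 4) : 1 / 2 < x := by
  obtain ⟨i1, i2, i3, i4⟩ := h
  change tTable (i + 1) < x at i3
  have := t_antitone (i := i + 1) (l := 5) (by omega) (by omega) (by omega)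
  have e : tTable 5 = 0.5 := rfl
  rw [e] at this
  norm_num at this
  linarith

/-- All items larger than `1 / 2` have the same type. -/
lemma IsBin.big_type_unique {b : List (Placed 3)} (hb : IsBin b) {p q : Placed 3} (hp : p ∈ b)
    (hq : q ∈ b) {i j : ℕ} (hi : PC.HasType p.size i) (hj : PC.HasType q.size j) (hi4 : i ≤ 4)
    (hj4 : j ≤ 4) : i = j := by
  by_cases h : p = q
  · subst h
    exact HasType.unique hi hj
  · exact absurd (contains_center (hb.1 q hq) (HasType.half_lt hj hj4))
      ((hb.nonOverlap hp hq h).not_contains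
        (contains_center (hb.1 p hp) (HasType.half_lt hi hi4)))

/-- A certificate without restriction on the number of items of middle size. -/
lemma Cert.binWeight_le_total {c : Cert} {w : ℕ → ℝ} {wQ : ℕ → ℚ} (hw : ∀ i, w i = (wQ i : ℝ))
    {σ : ℚ} {T : Finset ℕ}
    (hcheck : c.Valid ∧ 0 ≤ σ ∧ (∀ i ∈ Finset.Icc 5 16, wQ i ≤ c.valueQ (tQ (i + 1))) ∧
      (∀ i ∈ T, wQ i ≤ c.valueQ (tQ (i + 1)) + σ) ∧ c.total + σ ≤ 26852 / 10000)
    {b : List (Placed 3)} (hb : IsBin b) (hs : ∀ p ∈ b, 0 < p.size ∧ p.size ≤ 1)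
    (hT : ∀ p ∈ b, ∀ i, PC.HasType p.size i → i ≤ 4 → i ∈ T) : binWeight w b ≤ 2.6852 := by
  obtain ⟨hc, hσ, h1, h2, h3⟩ := hcheck
  have := Cert.binWeight_le hc hw hσ (z := 0) le_rfl (T := T)
    (fun i hi => by
      rw [add_zero]
      rw [Finset.mem_Icc] at hi
      exact h1 i (Finset.mem_Icc.2 ⟨hi.1, by omega⟩))
    (fun i hi => h1 i (by rw [Finset.mem_Icc] at hi ⊢; omega)) h2 hb hs hT le_rfl
  have h4 : ((c.total + σ : ℚ) : ℝ) ≤ ((26852 / 10000 : ℚ) : ℝ) := by exact_mod_cast h3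
  push_cast at h4 this
  norm_num at h4 this ⊢
  linarith

/-- A certificate for bins with at most six items of middle size. -/
lemma Cert.binWeight_le_of_mid {c : Cert} {w : ℕ → ℝ} {wQ : ℕ → ℚ} (hw : ∀ i, w i = (wQ i : ℝ))
    {σ z : ℚ} {T : Finset ℕ}
    (hcheck : c.Valid ∧ 0 ≤ σ ∧ 0 ≤ z ∧ (∀ i ∈ Finset.Icc 5 7, wQ i ≤ c.valueQ (tQ (i + 1)) + z) ∧
      (∀ i ∈ Finset.Icc 8 16, wQ i ≤ c.valueQ (tQ (i + 1))) ∧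
      (∀ i ∈ T, wQ i ≤ c.valueQ (tQ (i + 1)) + σ) ∧ c.total + σ + 6 * z ≤ 26852 / 10000)
    {b : List (Placed 3)} (hb : IsBin b) (hs : ∀ p ∈ b, 0 < p.size ∧ p.size ≤ 1)
    (hT : ∀ p ∈ b, ∀ i, PC.HasType p.size i → i ≤ 4 → i ∈ T) (hK : midCount b ≤ 6) :
    binWeight w b ≤ 2.6852 := by
  obtain ⟨hc, hσ, hz, h0, h1, h2, h3⟩ := hcheck
  have := Cert.binWeight_le hc hw hσ hz h0 h1 h2 hb hs hT hK
  have h4 : ((c.total + σ + 6 * z : ℚ) : ℝ) ≤ ((26852 / 10000 : ℚ) : ℝ) := by exact_mod_cast h3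
  push_cast at h4 this
  norm_num at h4 this ⊢
  linarith

/-! ### Certificates for the six weight functions -/

/-- The types 1 to 4 all have weight 1. The number σ is the price of the centre, paid at most once.
What is left to evaluate is one rational inequality for each type and one for the total. -/
theorem binBound_blue : BinBound (charge (Finset.Icc 1 16) ∅) := fun b hb hs =>
  Cert.binWeight_le_total (wQ := chargeQ (Finset.Icc 1 16) ∅) (fun i => charge_eq _ _ i)
    (c := ⟨34123781/25000000, [(3, 2160408249/50000000000), (4, 19504623/50000000000),
      (8, 8083743/100000000000), (21, 2108677/100000000000)]⟩)
    (σ := 30271673/40000000) (T := {1, 2, 3, 4}) (by decide +kernel) hb hs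
    (fun p _ i hi h4 => by have := hi.1; simp only [Finset.mem_insert, Finset.mem_singleton]; omega)

theorem binBound_lonely_eleven : BinBound (charge (lonelyTypes 11) redTypes) := fun b hb hs =>
  Cert.binWeight_le_total (wQ := chargeQ (lonelyTypes 11) redTypes) (fun i => charge_eq _ _ i)
    (c := ⟨1299248121/1000000000, [(4, 338696819/50000000000), (5, 88700603/100000000000),
      (12, 8716233/100000000000), (20, 9432149/100000000000)]⟩)
    (σ := 4319299/25000000) (T := {1, 2, 3, 4}) (by decide +kernel) hb hs
    (fun p _ i hi h4 => by have := hi.1; simp only [Finset.mem_insert, Finset.mem_singleton]; omega)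

/-- Of the types 1 to 4 only type 1 keeps a positive weight; volume and grids cover it, so no
surplus is needed. -/
theorem binBound_lonely_ten : BinBound (charge (lonelyTypes 10) redTypes) := fun b hb hs =>
  Cert.binWeight_le_total (wQ := chargeQ (lonelyTypes 10) redTypes) (fun i => charge_eq _ _ i)
    (c := ⟨1299248121/1000000000, [(3, 2361349387/100000000000), (4, 684885243/100000000000),
      (12, 6253/1000000000), (20, 11829463/100000000000)]⟩)
    (σ := 0) (T := {1, 2, 3, 4}) (by decide +kernel) hb hs
    (fun p _ i hi h4 => by have := hi.1; simp only [Finset.mem_insert, Finset.mem_singleton]; omega)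

/-- No Δ lies in [0.25, 0.3), so red items of types 9 and 10 are accepted beside the same blue types
and the weight functions agree. -/
theorem binBound_lonely_nine : BinBound (charge (lonelyTypes 9) redTypes) := binBound_lonely_ten

/-- The mixed weights for the case that the smallest lonely red items have type 7. -/
def weightsSeven : ℕ → ℚ := mixQ (269 / 1000) 7 {6, 7}

/-- The mixed weights for the case that the smallest lonely red items have type 6. -/
def weightsSix : ℕ → ℚ := mixQ (16 / 100) 6 {6}

/-- The centre admits one large item only, so once its type is known, the certificate need not
provide for other large types. -/
lemma mem_singleton_of_big {b : List (Placed 3)} (hb : IsBin b) {q : Placed 3} (hq : q ∈ b) {j : ℕ}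
    (hj : PC.HasType q.size j) (hj4 : j ≤ 4) :
    ∀ p ∈ b, ∀ i, PC.HasType p.size i → i ≤ 4 → i ∈ ({j} : Finset ℕ) := fun _ hp _ hi hi4 =>
  Finset.mem_singleton.2 (hb.big_type_unique hp hq hi hj hi4 hj4)

/-- The types 1 and 2 have mixed weight 1, the types 3 and 4 only 0.731. So type 2, the smaller one
with full weight, is critical. Bins without it, and bins with at most six items of middle size, are
settled by volume and grids; `h` is the rest. -/
theorem binBound_seven
    (h : ∀ b : List (Placed 3), IsBin b → (∀ p ∈ b, 0 < p.size ∧ p.size ≤ 1) →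
      (∃ p ∈ b, PC.HasType p.size 2) → 7 ≤ midCount b →
      binWeight (fun i => (weightsSeven i : ℝ)) b ≤ 2.6852) :
    BinBound (mix ((269 / 1000 : ℚ) : ℝ) 7 {6, 7}) := by
  have e : mix ((269 / 1000 : ℚ) : ℝ) 7 {6, 7} = fun i => (weightsSeven i : ℝ) :=
    funext fun i => mix_eq _ _ _ i
  rw [e]
  intro b hb hs
  by_cases h2 : ∃ p ∈ b, PC.HasType p.size 2
  · by_cases h7 : 7 ≤ midCount b
    · exact h b hb hs h2 h7
    · obtain ⟨q, hq, hqt⟩ := h2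
      exact Cert.binWeight_le_of_mid (wQ := weightsSeven) (fun _ => rfl)
        (c := ⟨1299248121/1000000000, [(4, 56133909/25000000000), (5, 22542971/25000000000),
          (12, 8638623/100000000000), (16, 600971/50000000000), (21, 488291/20000000000)]⟩)
        (σ := 252798031/500000000) (z := 61898719/1000000000) (T := {2}) (by decide +kernel) hb hs
        (mem_singleton_of_big hb hq hqt (by norm_num)) (by omega)
  · push Not at h2
    refine Cert.binWeight_le_total (wQ := weightsSeven) (fun _ => rfl)
      (c := ⟨1299248121/1000000000, [(3, 553275281/10000000000), (4, 69743167/20000000000),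
        (6, 65062757/50000000000), (16, 228177/10000000000), (21, 488291/20000000000)]⟩)
      (σ := 414138089/1000000000) (T := {1, 3, 4}) (by decide +kernel) hb hs fun p hp i hi h4 => ?_
    have := hi.1
    have : i ≠ 2 := by rintro rfl; exact h2 p hp hi
    simp only [Finset.mem_insert, Finset.mem_singleton]
    omega

/-- Here the types 1, 2 and 3 have mixed weight 1 and type 4 only 0.84, so type 3 is critical. -/
theorem binBound_six
    (h : ∀ b : List (Placed 3), IsBin b → (∀ p ∈ b, 0 < p.size ∧ p.size ≤ 1) →
      (∃ p ∈ b, PC.HasType p.size 3) → 7 ≤ midCount b →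
      binWeight (fun i => (weightsSix i : ℝ)) b ≤ 2.6852) :
    BinBound (mix ((16 / 100 : ℚ) : ℝ) 6 {6}) := by
  have e : mix ((16 / 100 : ℚ) : ℝ) 6 {6} = fun i => (weightsSix i : ℝ) :=
    funext fun i => mix_eq _ _ _ i
  rw [e]
  intro b hb hs
  by_cases h2 : ∃ p ∈ b, PC.HasType p.size 3
  · by_cases h7 : 7 ≤ midCount b
    · exact h b hb hs h2 h7
    · obtain ⟨q, hq, hqt⟩ := h2
      exact Cert.binWeight_le_of_mid (wQ := weightsSix) (fun _ => rfl)
        (c := ⟨1320293349/1000000000, [(4, 184547809/100000000000), (20, 937281/50000000000),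
          (21, 2334863/100000000000)]⟩)
        (σ := 156828487/250000000) (z := 54251477/1000000000) (T := {3}) (by decide +kernel) hb hs
        (mem_singleton_of_big hb hq hqt (by norm_num)) (by omega)
  · push Not at h2
    refine Cert.binWeight_le_total (wQ := weightsSix) (fun _ => rfl)
      (c := ⟨1299248121/1000000000, [(3, 2719289419/50000000000), (4, 179661881/100000000000),
        (16, 433703/100000000000), (20, 462017/25000000000), (21, 488291/20000000000)]⟩)
      (σ := 563719457/1000000000) (T := {1, 2, 4}) (by decide +kernel) hb hs fun p hp i hi h4 => ?_
    have := hi.1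
    have : i ≠ 3 := by rintro rfl; exact h2 p hp hi
    simp only [Finset.mem_insert, Finset.mem_singleton]
    omega

/-! ### Numbers as vectors of digits -/

/-- All digits are below the base 2^β, so there are no carries; the induction strips off the lowest
digit. -/
lemma testBit_sum_digits {β : ℕ} {D : ℕ → ℕ} (hD : ∀ E, D E < 2 ^ β) {n E j : ℕ} (hE : E < n)
    (hj : j < β) : (∑ F ∈ Finset.range n, D F * 2 ^ (β * F)).testBit (β * E + j) = (D E).testBit j := by
  induction n generalizing D E with
  | zero => omega
  | succ n ih =>
    have h : ∑ F ∈ Finset.range (n + 1), D F * 2 ^ (β * F) =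
        2 ^ β * (∑ F ∈ Finset.range n, D (F + 1) * 2 ^ (β * F)) + D 0 := by
      rw [Finset.sum_range_succ', Finset.mul_sum, Nat.mul_zero, pow_zero, mul_one]
      congr 1
      refine Finset.sum_congr rfl fun F _ => ?_
      rw [Nat.mul_succ, pow_add]
      ring
    rw [h, Nat.testBit_two_pow_mul_add _ (hD 0)]
    cases E with
    | zero => rw [Nat.mul_zero, Nat.zero_add, if_pos hj]
    | succ E =>
      rw [if_neg (by rw [Nat.mul_succ]; omega)]
      have : β * (E + 1) + j - β = β * E + j := by rw [Nat.mul_succ]; omega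
      rw [this]
      exact ih (fun E => hD (E + 1)) (by omega)

/-- A lower bound for many digits of a number, tested by one bitwise operation. -/
lemma le_digit_of_land {ι : Type*} {s : Finset ι} {e w : ι → ℕ} {T : Finset ℕ} {β r g : ℕ}
    (hr : r < β) (hv : ∀ E, ∑ m ∈ s with e m = E, w m < 2 ^ r)
    (h : Nat.land (∑ m ∈ s, w m * 2 ^ (β * e m) + (2 ^ r - g) * ∑ E ∈ T, 2 ^ (β * E))
      (2 ^ r * ∑ E ∈ T, 2 ^ (β * E)) = 2 ^ r * ∑ E ∈ T, 2 ^ (β * E)) (hg : g ≤ 2 ^ r) :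
    ∀ E ∈ T, g ≤ ∑ m ∈ s with e m = E, w m := by
  classical
  intro E hE
  -- A common bound for all positions lets the three sums be written with the same digits 0, …, n -
  -- 1.
  obtain ⟨n, hn⟩ : ∃ n, ∀ F ∈ T ∪ s.image e, F < n :=
    ⟨(T ∪ s.image e).sup id + 1, fun F hF => Nat.lt_succ_of_le (Finset.le_sup (f := id) hF)⟩
  have hnT : ∀ F ∈ T, F < n := fun F hF => hn F (Finset.mem_union_left _ hF)
  have hT : ∀ z : ℕ, z * ∑ E ∈ T, 2 ^ (β * E) =
      ∑ F ∈ Finset.range n, (if F ∈ T then z else 0) * 2 ^ (β * F) := by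
    intro z
    rw [Finset.mul_sum]
    simp only [ite_mul, zero_mul]
    rw [← Finset.sum_filter]
    refine Finset.sum_congr ?_ fun _ _ => rfl
    ext F
    simp only [Finset.mem_filter, Finset.mem_range]
    exact ⟨fun h => ⟨hnT F h, h⟩, fun h => h.2⟩
  have hs : ∑ m ∈ s, w m * 2 ^ (β * e m) =
      ∑ F ∈ Finset.range n, (∑ m ∈ s with e m = F, w m) * 2 ^ (β * F) := by
    rw [← Finset.sum_fiberwise_of_maps_to (g := e) (t := Finset.range n)
      (fun m hm => Finset.mem_range.2 (hn _ (Finset.mem_union_right _ (Finset.mem_image_of_mem e hm))))]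
    refine Finset.sum_congr rfl fun F _ => ?_
    rw [Finset.sum_mul]
    refine Finset.sum_congr rfl fun m hm => ?_
    rw [(Finset.mem_filter.1 hm).2]
  rw [hT, hT, hs, ← Finset.sum_add_distrib] at h
  simp only [← add_mul] at h
  -- A digit plus 2^r - g stays below 2^(r+1) ≤ 2^β, so nothing is carried, and bit r is set exactly
  -- when the digit is at least g.
  have h2r : 2 * 2 ^ r ≤ 2 ^ β := by
    rw [← pow_succ']
    exact Nat.pow_le_pow_right (by norm_num) hr
  have hb := congrArg (fun z => z.testBit (β * E + r)) h
  change Nat.testBit (_ &&& _) _ = _ at hb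
  rw [Nat.testBit_land,
    testBit_sum_digits (D := fun F => ∑ m ∈ s with e m = F, w m + if F ∈ T then 2 ^ r - g else 0)
      (fun F => by have := hv F; split_ifs <;> omega) (hnT E hE) hr,
    testBit_sum_digits (D := fun F => if F ∈ T then 2 ^ r else 0)
      (fun F => by have := Nat.two_pow_pos r; split_ifs <;> omega) (hnT E hE) hr] at hb
  simp only [hE, if_true, Nat.testBit_two_pow_self, Bool.and_true] at hb
  have := Nat.ge_two_pow_of_testBit hb
  omega

/-- The sum of `2 ^ (s * k)` for `l ≤ k < u`. -/
def geomBlock (s l u : ℕ) : ℕ := 2 ^ (s * l) * ((2 ^ (s * (u - l)) - 1) / (2 ^ s - 1))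

lemma geomBlock_eq {s l u : ℕ} (hs : 0 < s) :
    geomBlock s l u = ∑ k ∈ Finset.Ico l u, 2 ^ (s * k) := by
  have h2 : 2 ≤ 2 ^ s := by
    calc 2 = 2 ^ 1 := rfl
      _ ≤ 2 ^ s := Nat.pow_le_pow_right (by norm_num) hs
  rw [geomBlock, pow_mul 2 s (u - l), ← Nat.geomSum_eq h2, Finset.mul_sum,
    Finset.sum_Ico_eq_sum_range]
  refine Finset.sum_congr rfl fun k _ => ?_
  rw [mul_add, pow_add, ← pow_mul]

/-! ### Point masses on a grid -/

/-- A point mass `w` at a grid point with integer coordinates. -/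
structure PointMass where
  a : ℕ
  b : ℕ
  c : ℕ
  w : ℕ

/-- The mass of the box of side `L` at the grid point `(i, j, k)`. -/
def boxMass (pts : List PointMass) (L i j k : ℕ) : ℕ :=
  (pts.map fun q => if (i ≤ q.a ∧ q.a < i + L) ∧ (j ≤ q.b ∧ q.b < j + L) ∧ (k ≤ q.c ∧ q.c < k + L)
    then q.w else 0).sum

/-- `f A' B'`, where `A'` and `B'` are `A` and `B` together with the elements of `l` with key below `t`
and at least `t`. -/
def splitAtKey {α γ : Type} (t : ℕ) (l : List (ℕ × α)) :
    List (ℕ × α) → List (ℕ × α) → (List (ℕ × α) → List (ℕ × α) → γ) → γ :=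
  List.rec (fun A B f => f A B)
    (fun q _ ih A B f => bif Nat.blt q.1 t then ih (q :: A) B f else ih A (q :: B) f) l

/-- The definition uses a continuation, `List.rec` and `Nat.blt`, a form suited to evaluation by the
kernel. It reverses the order of the elements, so the two parts are described up to permutation. -/
lemma splitAtKey_eq {α γ : Type} (t : ℕ) (l A B : List (ℕ × α))
    (f : List (ℕ × α) → List (ℕ × α) → γ) : ∃ A' B', splitAtKey t l A B f = f A' B' ∧
      A'.Perm (l.filter (fun q => q.1 < t) ++ A) ∧ B'.Perm (l.filter (fun q => t ≤ q.1) ++ B) := by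
  induction l generalizing A B with
  | nil => exact ⟨A, B, rfl, by simp, by simp⟩
  | cons q l ih =>
    by_cases h : q.1 < t
    · obtain ⟨A', B', h1, h2, h3⟩ := ih (q :: A) B
      refine ⟨A', B', ?_, ?_, ?_⟩
      · rw [← h1]
        have : Nat.blt q.1 t = true := by simpa [Nat.blt_eq] using h
        change (bif Nat.blt q.1 t then _ else _) = _
        rw [this]
        rfl
      · rw [List.filter_cons, if_pos (by simpa using h)]
        exact h2.trans List.perm_middle
      · rw [List.filter_cons, if_neg (by simpa using h)]
        exact h3
    · obtain ⟨A', B', h1, h2, h3⟩ := ih A (q :: B)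
      refine ⟨A', B', ?_, ?_, ?_⟩
      · rw [← h1]
        have : Nat.blt q.1 t = false := by
          rw [Bool.eq_false_iff, Ne, Nat.blt_eq]; exact h
        change (bif Nat.blt q.1 t then _ else _) = _
        rw [this]
        rfl
      · rw [List.filter_cons, if_neg (by simpa using h)]
        exact h2
      · rw [List.filter_cons, if_pos (by simpa using h)]
        exact h3.trans List.perm_middle

lemma sum_map_filter_add {α : Type} (t : ℕ) (l : List (ℕ × α)) (v : ℕ × α → ℕ) :
    ((l.filter fun q => q.1 < t).map v).sum + ((l.filter fun q => t ≤ q.1).map v).sum =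
      (l.map v).sum := by
  induction l with
  | nil => rfl
  | cons q l ih =>
    rw [List.filter_cons, List.filter_cons, List.map_cons, List.sum_cons, ← ih]
    by_cases h : q.1 < t
    · rw [if_pos (by simpa using h), if_neg (by simpa using h), List.map_cons, List.sum_cons, add_assoc]
    · rw [if_neg (by simpa using h), if_pos (by simpa using h), List.map_cons, List.sum_cons]
      ring

/-- The sum of `q.2 * 2 ^ (s * (q.1 - o))` over `l`, computed by bisection of the exponents. -/
def packSum (s : ℕ) : ℕ → ℕ → List (ℕ × ℕ) → ℕ
  | _, _, [] => 0
  | 0, o, q :: l => ((q :: l).map fun q => q.2 * 2 ^ (s * (q.1 - o))).sum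
  | h + 1, o, q :: l => splitAtKey (o + 2 ^ h) (q :: l) [] [] fun A B =>
    packSum s h o A + 2 ^ (s * 2 ^ h) * packSum s h (o + 2 ^ h) B

/-- The upper half of the exponents is shifted by a single multiplication. The identity holds for
every depth h, since at depth 0 the remaining terms are added directly. -/
lemma packSum_eq (s h o : ℕ) (l : List (ℕ × ℕ)) (hl : ∀ q ∈ l, o ≤ q.1) :
    2 ^ (s * o) * packSum s h o l = (l.map fun q => q.2 * 2 ^ (s * q.1)).sum := by
  induction h generalizing o l with
  | zero =>
    have : packSum s 0 o l = (l.map fun q => q.2 * 2 ^ (s * (q.1 - o))).sum := by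
      cases l <;> rfl
    rw [this, ← List.sum_map_mul_left]
    refine congrArg List.sum (List.map_congr_left fun q hq => ?_)
    have e : s * q.1 = s * o + s * (q.1 - o) := by rw [← mul_add, Nat.add_sub_cancel' (hl q hq)]
    rw [e, pow_add]
    ring
  | succ h ih =>
    cases l with
    | nil => simp [packSum]
    | cons q l =>
      rw [packSum]
      obtain ⟨A, B, h1, h2, h3⟩ := splitAtKey_eq (o + 2 ^ h) (q :: l) [] [] fun A B =>
        packSum s h o A + 2 ^ (s * 2 ^ h) * packSum s h (o + 2 ^ h) B
      rw [List.append_nil] at h2 h3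
      have hA : ∀ q ∈ A, o ≤ q.1 := fun p hp => hl p (List.mem_of_mem_filter (h2.mem_iff.1 hp))
      have hB : ∀ q ∈ B, o + 2 ^ h ≤ q.1 := fun p hp => by
        simpa using (List.mem_filter.1 (h3.mem_iff.1 hp)).2
      rw [h1, mul_add, ih o A hA, ← mul_assoc, ← pow_add, ← mul_add, ih _ B hB, (h2.map _).sum_eq,
        (h3.map _).sum_eq, sum_map_filter_add]

/-- The numbers `packSum s 7 0` of the elements of `l` with key `o`, `o + 1`, …, `o + 2 ^ h - 1`. -/
def packSlabs (s : ℕ) : ℕ → ℕ → List (ℕ × ℕ × ℕ) → List ℕ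
  | 0, _, l => [packSum s 7 0 (l.map Prod.snd)]
  | h + 1, o, l => splitAtKey (o + 2 ^ h) l [] [] fun A B =>
    packSlabs s h o A ++ packSlabs s h (o + 2 ^ h) B

/-- Stated for sums of initial segments, because the masses in consecutive planes are obtained as
differences of partial sums. -/
lemma packSlabs_spec (s h o : ℕ) (l : List (ℕ × ℕ × ℕ)) (hl : ∀ q ∈ l, o ≤ q.1 ∧ q.1 < o + 2 ^ h) :
    (packSlabs s h o l).length = 2 ^ h ∧ ∀ n ≤ 2 ^ h, ((packSlabs s h o l).take n).sum =
      (l.map fun q => if q.1 < o + n then q.2.2 * 2 ^ (s * q.2.1) else 0).sum := by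
  induction h generalizing o l with
  | zero =>
    refine ⟨rfl, fun n hn => ?_⟩
    have hq : ∀ q ∈ l, q.1 = o := fun q hq => by have := hl q hq; simp at this; omega
    rcases Nat.le_one_iff_eq_zero_or_eq_one.1 hn with rfl | rfl
    · rw [List.take_zero, List.sum_nil]
      symm
      refine List.sum_eq_zero fun x hx => ?_
      obtain ⟨q, hq', rfl⟩ := List.mem_map.1 hx
      rw [if_neg (by rw [hq q hq']; omega)]
    · have := packSum_eq s 7 0 (l.map Prod.snd) fun _ _ => Nat.zero_le _
      rw [mul_zero, pow_zero, one_mul, List.map_map] at this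
      simp only [packSlabs, List.take_one, List.head?_cons, Option.toList_some, List.sum_singleton]
      rw [this]
      refine congrArg List.sum (List.map_congr_left fun q hq' => ?_)
      rw [if_pos (by rw [hq q hq']; omega)]
      rfl
  | succ h ih =>
    obtain ⟨A, B, h1, h2, h3⟩ := splitAtKey_eq (o + 2 ^ h) l [] [] fun A B =>
      packSlabs s h o A ++ packSlabs s h (o + 2 ^ h) B
    rw [packSlabs, h1]
    rw [List.append_nil] at h2 h3
    have hA : ∀ q ∈ A, o ≤ q.1 ∧ q.1 < o + 2 ^ h := fun p hp => by
      have := List.mem_filter.1 (h2.mem_iff.1 hp)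
      exact ⟨(hl p this.1).1, by simpa using this.2⟩
    have hB : ∀ q ∈ B, o + 2 ^ h ≤ q.1 ∧ q.1 < o + 2 ^ h + 2 ^ h := fun p hp => by
      have := List.mem_filter.1 (h3.mem_iff.1 hp)
      refine ⟨by simpa using this.2, ?_⟩
      have := (hl p this.1).2
      rw [pow_succ] at this
      omega
    obtain ⟨a1, a2⟩ := ih o A hA
    obtain ⟨b1, b2⟩ := ih (o + 2 ^ h) B hB
    refine ⟨by rw [List.length_append, a1, b1, pow_succ]; omega, fun n hn => ?_⟩
    rw [List.take_append, List.sum_append, a1, b2 _ (by rw [pow_succ] at hn; omega),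
      ← sum_map_filter_add (o + 2 ^ h) l, ← (h2.map _).sum_eq, ← (h3.map _).sum_eq]
    rcases le_total n (2 ^ h) with hn' | hn'
    · rw [a2 n hn']
      congr 1
      refine congrArg List.sum (List.map_congr_left fun q hq => ?_)
      have := (hB q hq).1
      rw [if_neg (by omega), if_neg (by omega)]
    · rw [List.take_of_length_le (by omega), ← List.take_of_length_le (l := packSlabs s h o A)
        (i := 2 ^ h) (by omega), a2 _ le_rfl]
      congr 1
      · refine congrArg List.sum (List.map_congr_left fun q hq => ?_)
        have := (hA q hq).2
        rw [if_pos (by omega), if_pos (by omega)]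
      · refine congrArg List.sum (List.map_congr_left fun q hq => ?_)
        have e : o + 2 ^ h + (n - 2 ^ h) = o + n := by omega
        rw [e]

/-- `f x`, with the argument evaluated first. -/
def withValue (x : ℕ) (f : ℕ → Bool) : Bool :=
  Nat.rec (f 0) (fun n _ => f (n + 1)) x

lemma withValue_eq (x : ℕ) (f : ℕ → Bool) : withValue x f = f x := by
  cases x <;> rfl

/-- The partial sums `acc`, `acc + x₀`, `acc + x₀ + x₁`, …, passed on to `f`. -/
def withPartialSums : List ℕ → ℕ → (List ℕ → Bool) → Bool
  | [], acc, f => f [acc]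
  | x :: l, acc, f => withValue (acc + x) fun y => withPartialSums l y fun ys => f (acc :: ys)

lemma withPartialSums_eq (l : List ℕ) (acc : ℕ) (f : List ℕ → Bool) :
    ∃ S : List ℕ, withPartialSums l acc f = f S ∧
      ∀ n ≤ l.length, S.getD n 0 = acc + (l.take n).sum := by
  induction l generalizing acc f with
  | nil => exact ⟨[acc], rfl, fun n hn => by simp at hn; simp [hn]⟩
  | cons x l ih =>
    obtain ⟨S, h1, h2⟩ := ih (acc + x) fun ys => f (acc :: ys)
    refine ⟨acc :: S, by rw [withPartialSums, withValue_eq, h1], fun n hn => ?_⟩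
    cases n with
    | zero => simp
    | succ n =>
      rw [List.getD_cons_succ, h2 n (by simpa using hn), List.take_succ_cons, List.sum_cons]
      ring

/-- Format of the numbers that encode two-dimensional arrays: the grid has mesh `1 / M`, a row has
`N` digits of `β` bits each, the values have at most `r` bits. -/
structure PackFormat where
  M : ℕ
  N : ℕ
  β : ℕ
  r : ℕ

/-- The point masses in the planes with first coordinate `0, …, 127`, each as one number. -/
def PackFormat.slabs (F : PackFormat) (pts : List PointMass) : List ℕ :=
  packSlabs (F.β * F.N) 7 0 (pts.map fun q => (q.a, q.c, q.w * 2 ^ (F.β * q.b)))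

/-- All boxes of side `L` have mass at least `g`; `S` holds the partial sums of the slabs. -/
def PackFormat.boxCheck (F : PackFormat) (S : List ℕ) (L g : ℕ) : Bool :=
  withValue (geomBlock F.β 0 L * geomBlock (F.β * F.N) 0 L) fun K =>
  withValue (geomBlock F.β L F.M * geomBlock (F.β * F.N) L F.M) fun T =>
  withValue ((2 ^ F.r - g) * T) fun C =>
  withValue (2 ^ F.r * T) fun Z =>
  (List.range (F.M - L)).all fun i =>
    Nat.beq (Nat.land ((S.getD (i + 1 + L) 0 - S.getD (i + 1) 0) * K + C) Z) Z

/-- For each `(L, g) ∈ th`, all boxes of side `L` have mass at least `g`. -/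
def PackFormat.check (F : PackFormat) (pts : List PointMass) (th : List (ℕ × ℕ)) : Bool :=
  withPartialSums (F.slabs pts) 0 fun S =>
    th.all fun e => F.boxCheck S e.1 e.2

/-- The point (a, b, c) contributes to the digit at position b + N c of the number for plane a.
Bisection of depth 7 explains the 128 planes. -/
lemma PackFormat.sum_slabs_eq (F : PackFormat) (pts : List PointMass) (hpts : ∀ q ∈ pts, q.a < 128) :
    (F.slabs pts).length = 128 ∧ ∀ n ≤ 128, ((F.slabs pts).take n).sum = ∑ m : Fin pts.length,
      if pts[m.1].a < n then pts[m.1].w * 2 ^ (F.β * (pts[m.1].b + F.N * pts[m.1].c)) else 0 := by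
  obtain ⟨h1, h2⟩ := packSlabs_spec (F.β * F.N) 7 0
    (pts.map fun q => (q.a, q.c, q.w * 2 ^ (F.β * q.b))) (by
      intro q hq
      obtain ⟨p, hp, rfl⟩ := List.mem_map.1 hq
      exact ⟨Nat.zero_le _, by simpa using hpts p hp⟩)
  refine ⟨h1, fun n hn => ?_⟩
  rw [PackFormat.slabs, h2 n hn, List.map_map, Fin.sum_univ_fun_getElem pts fun q =>
    if q.a < n then q.w * 2 ^ (F.β * (q.b + F.N * q.c)) else 0]
  refine congrArg List.sum (List.map_congr_left fun q _ => ?_)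
  simp only [Function.comp, zero_add]
  split_ifs
  · rw [mul_assoc, ← pow_add]
    congr 2
    ring
  · rfl

/-- Conditions on the format. -/
def PackFormat.Valid (F : PackFormat) (pts : List PointMass) (th : List (ℕ × ℕ)) : Prop :=
  0 < F.N ∧ F.r < F.β ∧ (pts.map PointMass.w).sum < 2 ^ F.r ∧ (∀ q ∈ pts, q.a < 128 ∧ q.b < F.M ∧ q.c < F.M) ∧ F.M ≤ 128 ∧
    ∀ e ∈ th, F.M + e.1 ≤ F.N ∧ e.2 ≤ 2 ^ F.r

instance (F : PackFormat) (pts : List PointMass) (th : List (ℕ × ℕ)) : Decidable (F.Valid pts th) := by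
  unfold PackFormat.Valid
  infer_instance

/-- Multiplication by K convolves the planes i, …, i + L - 1 with an L × L square: the digit at x +
N y becomes the mass of the box whose largest coordinates in these two directions are x and y. Rows
of length N ≥ M + L do not run into each other, and digits do not overflow because the total mass is
below 2^r. Then `le_digit_of_land` compares all boxes with g at once. -/
lemma PackFormat.le_boxMass {F : PackFormat} {pts : List PointMass} {th : List (ℕ × ℕ)}
    (hF : F.Valid pts th) (hc : F.check pts th = true) {L g : ℕ} (he : (L, g) ∈ th) {i j k : ℕ}
    (hi : 1 ≤ i ∧ i + L ≤ F.M) (hj : 1 ≤ j ∧ j + L ≤ F.M) (hk : 1 ≤ k ∧ k + L ≤ F.M) :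
    g ≤ boxMass pts L i j k := by
  classical
  obtain ⟨hN, hr, hw, hq, hM, hth⟩ := hF
  obtain ⟨hLN, hgr⟩ := hth _ he
  simp only at hLN hgr
  have hβ : 0 < F.β := by omega
  unfold PackFormat.check at hc
  obtain ⟨S, hS, hS'⟩ := withPartialSums_eq (F.slabs pts) 0 fun S =>
    th.all fun e => F.boxCheck S e.1 e.2
  rw [hS, List.all_eq_true] at hc
  have hc := hc _ he
  simp only [PackFormat.boxCheck, withValue_eq, List.all_eq_true, List.mem_range] at hc
  have hc := Nat.eq_of_beq_eq_true (hc (i - 1) (by omega))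
  have hSn : ∀ n ≤ F.M, S.getD n 0 = ∑ m : Fin pts.length,
      if pts[m.1].a < n then pts[m.1].w * 2 ^ (F.β * (pts[m.1].b + F.N * pts[m.1].c)) else 0 := by
    intro n hn
    obtain ⟨h1, h2⟩ := F.sum_slabs_eq pts fun q h => (hq q h).1
    rw [hS' n (by omega), zero_add, h2 n (by omega)]
  have e1 : i - 1 + 1 = i := by omega
  rw [e1, hSn _ hi.2, hSn i (by omega)] at hc
  -- The difference of two partial sums selects the planes from i to i + L - 1.
  have hdiff : (∑ m : Fin pts.length,
        if pts[m.1].a < i + L then pts[m.1].w * 2 ^ (F.β * (pts[m.1].b + F.N * pts[m.1].c)) else 0) -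
      (∑ m : Fin pts.length,
        if pts[m.1].a < i then pts[m.1].w * 2 ^ (F.β * (pts[m.1].b + F.N * pts[m.1].c)) else 0) =
      ∑ m : Fin pts.length, (if i ≤ pts[m.1].a ∧ pts[m.1].a < i + L then pts[m.1].w else 0) *
        2 ^ (F.β * (pts[m.1].b + F.N * pts[m.1].c)) := by
    rw [Nat.sub_eq_iff_eq_add, ← Finset.sum_add_distrib]
    · refine Finset.sum_congr rfl fun m _ => ?_
      by_cases h1 : pts[m.1].a < i
      · rw [if_pos h1, if_pos (by omega), if_neg (by omega)]; ring
      · by_cases h2 : pts[m.1].a < i + L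
        · rw [if_pos h2, if_neg h1, if_pos (by omega), add_zero]
        · rw [if_neg h2, if_neg h1, if_neg (by omega)]; ring
    · refine Finset.sum_le_sum fun m _ => ?_
      by_cases h1 : pts[m.1].a < i
      · rw [if_pos h1, if_pos (by omega)]
      · rw [if_neg h1]; exact Nat.zero_le _
  have hK : geomBlock F.β 0 L * geomBlock (F.β * F.N) 0 L =
      ∑ d ∈ Finset.range L ×ˢ Finset.range L, 2 ^ (F.β * (d.1 + F.N * d.2)) := by
    rw [geomBlock_eq hβ, geomBlock_eq (Nat.mul_pos hβ hN), Finset.sum_mul_sum,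
      ← Finset.sum_product', ← Finset.range_eq_Ico]
    refine Finset.sum_congr rfl fun d _ => ?_
    rw [← pow_add]
    congr 1
    ring
  -- Since x < N, the pair (x, y) is recovered from x + N y by division with remainder.
  have hinj : Set.InjOn (fun d : ℕ × ℕ => d.1 + F.N * d.2)
      (Finset.Ico L F.M ×ˢ Finset.Ico L F.M : Finset (ℕ × ℕ)) := by
    rintro ⟨x, y⟩ h1 ⟨x', y'⟩ h2 h
    simp only [Finset.coe_product, Set.mem_prod, Finset.mem_coe, Finset.mem_Ico] at h1 h2 h
    have hx : x < F.N := by omega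
    have hx' : x' < F.N := by omega
    have hm := congrArg (· % F.N) h
    have hd := congrArg (· / F.N) h
    simp only [Nat.add_mul_mod_self_left, Nat.mod_eq_of_lt hx, Nat.mod_eq_of_lt hx'] at hm
    simp only [Nat.add_mul_div_left _ _ hN, Nat.div_eq_of_lt hx, Nat.div_eq_of_lt hx', zero_add] at hd
    rw [hm, hd]
  have hT : geomBlock F.β L F.M * geomBlock (F.β * F.N) L F.M =
      ∑ E ∈ (Finset.Ico L F.M ×ˢ Finset.Ico L F.M).image fun d => d.1 + F.N * d.2, 2 ^ (F.β * E) := by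
    rw [Finset.sum_image hinj, geomBlock_eq hβ, geomBlock_eq (Nat.mul_pos hβ hN), Finset.sum_mul_sum,
      ← Finset.sum_product']
    refine Finset.sum_congr rfl fun d _ => ?_
    rw [← pow_add]
    congr 1
    ring
  rw [hdiff, hK, hT, Finset.sum_mul_sum, ← Finset.sum_product'] at hc
  -- A point contributes to the digit at x + N y through one shift only, and only if it lies in the
  -- box.
  have hbox : ∀ m : Fin pts.length, ∀ d ∈ Finset.range L ×ˢ Finset.range L, ∀ x y, x < F.N →
      pts[m.1].b + F.N * pts[m.1].c + (d.1 + F.N * d.2) = x + F.N * y →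
      d = (x - pts[m.1].b, y - pts[m.1].c) ∧ pts[m.1].b ≤ x ∧ x < pts[m.1].b + L ∧ pts[m.1].c ≤ y ∧
        y < pts[m.1].c + L := by
    rintro m ⟨d, d'⟩ hd x y hx h
    rw [Finset.mem_product, Finset.mem_range, Finset.mem_range] at hd
    simp only at hd h ⊢
    have hb := (hq _ (List.getElem_mem m.2)).2.1
    have h' : (pts[m.1].b + d) + F.N * (pts[m.1].c + d') = x + F.N * y := by rw [← h]; ring
    have hlt : pts[m.1].b + d < F.N := by
      have : pts[m.1].b < F.M := hb
      omega
    have hm := congrArg (· % F.N) h'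
    have hd2 := congrArg (· / F.N) h'
    simp only [Nat.add_mul_mod_self_left, Nat.mod_eq_of_lt hlt, Nat.mod_eq_of_lt hx] at hm
    simp only [Nat.add_mul_div_left _ _ hN, Nat.div_eq_of_lt hlt, Nat.div_eq_of_lt hx, zero_add] at hd2
    refine ⟨Prod.ext ?_ ?_, ?_, ?_, ?_, ?_⟩ <;> omega
  -- the digit at `x + N * y` is the mass of a box
  have hdig : ∀ x y, x < F.N → ∑ m ∈ (Finset.univ : Finset (Fin pts.length)) ×ˢ
        (Finset.range L ×ˢ Finset.range L) with pts[m.1.1].b + F.N * pts[m.1.1].c +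
          (m.2.1 + F.N * m.2.2) = x + F.N * y,
        (if i ≤ pts[m.1.1].a ∧ pts[m.1.1].a < i + L then pts[m.1.1].w else 0) ≤
      ∑ m : Fin pts.length, if (i ≤ pts[m.1].a ∧ pts[m.1].a < i + L) ∧ (pts[m.1].b ≤ x ∧ x < pts[m.1].b + L) ∧
        (pts[m.1].c ≤ y ∧ y < pts[m.1].c + L) then pts[m.1].w else 0 := by
    intro x y hx
    rw [Finset.sum_filter, Finset.sum_product]
    refine Finset.sum_le_sum fun m _ => ?_
    rw [← Finset.sum_filter]
    have hsub : (Finset.range L ×ˢ Finset.range L).filter (fun d => pts[m.1].b + F.N * pts[m.1].c +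
        (d.1 + F.N * d.2) = x + F.N * y) ⊆ {(x - pts[m.1].b, y - pts[m.1].c)} := by
      intro d hd
      rw [Finset.mem_filter] at hd
      exact Finset.mem_singleton.2 (hbox m d hd.1 x y hx hd.2).1
    by_cases hne : (pts[m.1].b ≤ x ∧ x < pts[m.1].b + L) ∧ (pts[m.1].c ≤ y ∧ y < pts[m.1].c + L)
    · refine (Finset.sum_le_sum_of_subset hsub).trans ?_
      rw [Finset.sum_singleton]
      by_cases h : i ≤ pts[m.1].a ∧ pts[m.1].a < i + L
      · rw [if_pos h, if_pos ⟨h, hne⟩]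
      · rw [if_neg h]; exact Nat.zero_le _
    · rw [Finset.filter_eq_empty_iff.2, Finset.sum_empty]
      · exact Nat.zero_le _
      · intro d hd h
        obtain ⟨-, h1, h2, h3, h4⟩ := hbox m d hd x y hx h
        exact hne ⟨⟨h1, h2⟩, h3, h4⟩
  have hc' := le_digit_of_land (s := (Finset.univ : Finset (Fin pts.length)) ×ˢ
      (Finset.range L ×ˢ Finset.range L))
    (e := fun m => pts[m.1.1].b + F.N * pts[m.1.1].c + (m.2.1 + F.N * m.2.2))
    (w := fun m => if i ≤ pts[m.1.1].a ∧ pts[m.1.1].a < i + L then pts[m.1.1].w else 0)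
    (T := (Finset.Ico L F.M ×ˢ Finset.Ico L F.M).image fun d => d.1 + F.N * d.2)
    (g := g) hr (fun E => by
      have h := hdig (E % F.N) (E / F.N) (Nat.mod_lt _ hN)
      rw [Nat.mod_add_div] at h
      refine (h.trans ?_).trans_lt hw
      rw [← Fin.sum_univ_fun_getElem]
      refine Finset.sum_le_sum fun m _ => ?_
      split_ifs <;> simp)
    (by
      rw [← hc]
      congr 2
      refine Finset.sum_congr rfl fun m _ => ?_
      rw [mul_add, pow_add, mul_assoc]) hgr
  -- The box that starts at (j, k) is found at the digit of its last point; this digit is among the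
  -- tested ones since j and k are at least 1.
  have h1 := hc' ((j + L - 1) + F.N * (k + L - 1)) (Finset.mem_image.2
    ⟨(j + L - 1, k + L - 1), Finset.mem_product.2 ⟨Finset.mem_Ico.2 ⟨by simp only; omega, by simp only; omega⟩,
      Finset.mem_Ico.2 ⟨by simp only; omega, by simp only; omega⟩⟩, rfl⟩)
  refine (h1.trans (hdig _ _ (by omega))).trans ?_
  rw [boxMass, ← Fin.sum_univ_fun_getElem]
  refine Finset.sum_le_sum fun m _ => ?_
  split_ifs with h2 h3
  · exact le_rfl
  · exact absurd ⟨h2.1, by omega, by omega⟩ h3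
  · exact Nat.zero_le _
  · exact le_rfl

/-! ### The position of a large item among seven items of middle size -/

/-- The mirror image of `p` in the coordinate directions `k` with `s k`. -/
def Placed.reflect (s : Fin 3 → Prop) [DecidablePred s] (p : Placed 3) : Placed 3 :=
  ⟨p.size, fun k => if s k then 1 - p.pos k - p.size else p.pos k⟩

lemma IsBin.map_reflect {b : List (Placed 3)} (hb : IsBin b) (s : Fin 3 → Prop) [DecidablePred s] :
    IsBin (b.map (Placed.reflect s)) := by
  constructor
  · intro q hq
    obtain ⟨p, hp, rfl⟩ := List.mem_map.1 hq
    intro k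
    have := hb.1 p hp k
    simp only [Placed.reflect]
    split_ifs
    · constructor <;> linarith
    · exact this
  · rw [List.pairwise_map]
    refine hb.2.imp fun {p q} h => ?_
    obtain ⟨k, hk⟩ := h
    refine ⟨k, ?_⟩
    simp only [Placed.reflect]
    split_ifs
    · rcases hk with h | h
      · right; linarith
      · left; linarith
    · exact hk

lemma binWeight_map_reflect (w : ℕ → ℝ) (b : List (Placed 3)) (s : Fin 3 → Prop) [DecidablePred s] :
    binWeight w (b.map (Placed.reflect s)) = binWeight w b := by
  simp only [binWeight, List.map_map]
  rfl

lemma IsBin.perm {b b' : List (Placed 3)} (hb : IsBin b) (h : b.Perm b') : IsBin b' :=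
  ⟨fun p hp => hb.1 p (h.mem_iff.2 hp), h.pairwise hb.2 fun h => nonOverlap_symm h⟩

lemma IsBin.tail {p : Placed 3} {b : List (Placed 3)} (hb : IsBin (p :: b)) : IsBin b :=
  ⟨fun q hq => hb.1 q (by simp [hq]), (List.pairwise_cons.1 hb.2).2⟩

/-- If there are seven items of middle size, a large item does not contain two points of the grid of
mesh `1 / 3`. -/
lemma mass_three_le_one {p : Placed 3} {b : List (Placed 3)} (hb : IsBin (p :: b))
    (hp : 1 / 2 < p.size) (h7 : 7 ≤ midCount (p :: b)) :
    mass (gridIndex 3) (gridPoint 3) (fun _ => 1) p ≤ 1 := by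
  have h7 : 7 ≤ midCount b := by
    unfold midCount at h7 ⊢
    rwa [List.countP_cons_of_neg (by simp only [decide_eq_true_eq]; rintro ⟨-, h⟩; linarith)] at h7
  -- There are eight points in all, and each of the seven items of middle size takes at least one.
  have h1 := sum_mass_le (s := gridIndex 3) (f := gridPoint 3) (y := fun _ => 1) (by simp) hb.2
  rw [Finset.sum_const, card_gridIndex, List.map_cons, List.sum_cons] at h1
  norm_num at h1
  have h2 : ∀ b : List (Placed 3), IsBin b →
      (midCount b : ℝ) ≤ (b.map (mass (gridIndex 3) (gridPoint 3) fun _ => 1)).sum := by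
    intro b
    induction b with
    | nil => intro _; simp [midCount]
    | cons q b ih =>
      intro hb
      have ih := ih hb.tail
      have hq := gridCount_pow_le_mass (m := 3) (by norm_num) (hb.1 q (by simp))
      rw [List.map_cons, List.sum_cons]
      unfold midCount at ih ⊢
      rw [List.countP_cons]
      by_cases h : 1 / 3 < q.size ∧ q.size ≤ 1 / 2
      · simp only [h, and_self, decide_true, if_true]
        have h3 : 1 ≤ gridCount 3 q.size := le_gridCount (by push_cast; linarith [h.1])
        have h4 : (1 : ℝ) ≤ gridCount 3 q.size := by exact_mod_cast h3
        have := one_le_pow₀ (n := 3) h4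
        push_cast
        linarith
      · have h5 : (0 : ℝ) ≤ (gridCount 3 q.size : ℝ) ^ 3 := by positivity
        rw [if_neg (by simpa using h), add_zero]
        linarith
  have h3 := h2 b hb.tail
  have h4 : (7 : ℝ) ≤ midCount b := by exact_mod_cast h7
  have e : (b.map fun q => mass (gridIndex 3) (gridPoint 3) (fun _ => 1) q) =
    b.map (mass (gridIndex 3) (gridPoint 3) fun _ => 1) := rfl
  linarith

/-- In every direction p contains one of the coordinates 1/3 and 2/3. If it contained both in
direction k, exchanging one for the other would give two grid points in p, against
`mass_three_le_one`. -/
lemma pos_add_size_le {p : Placed 3} {b : List (Placed 3)} (hb : IsBin (p :: b))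
    (hp : 1 / 2 < p.size) (h7 : 7 ≤ midCount (p :: b)) {k : Fin 3} (hk : p.pos k ≤ 1 / 3) :
    p.pos k + p.size ≤ 2 / 3 := by
  classical
  by_contra hlt
  push Not at hlt
  have hin := hb.1 p (by simp)
  let v : Fin 3 → ℕ := fun l => if p.pos l ≤ 1 / 3 then 1 else 2
  have hv : ∀ l, (1 ≤ v l ∧ v l < 3) ∧ p.pos l ≤ (v l : ℝ) / 3 ∧ (v l : ℝ) / 3 < p.pos l + p.size := by
    intro l
    have := hin l
    simp only [v]
    split_ifs with h
    · norm_num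
      constructor <;> linarith
    · push Not at h
      norm_num
      constructor <;> linarith
  have hmem : ∀ c : Fin 3 → ℕ, (∀ l, (1 ≤ c l ∧ c l < 3) ∧ p.pos l ≤ (c l : ℝ) / 3 ∧
      (c l : ℝ) / 3 < p.pos l + p.size) →
      c ∈ (gridIndex 3).filter fun i => p.Contains (gridPoint 3 i) := by
    intro c hc
    rw [Finset.mem_filter, gridIndex, Fintype.mem_piFinset]
    refine ⟨fun l => Finset.mem_Ico.2 (hc l).1, fun l => ?_⟩
    simpa [gridPoint] using (hc l).2
  have h1 := hmem v hv
  have h2 := hmem (Function.update v k 2) (by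
    intro l
    by_cases h : l = k
    · subst h
      rw [Function.update_self]
      norm_num
      constructor <;> linarith
    · rw [Function.update_of_ne h]
      exact hv l)
  have hne : v ≠ Function.update v k 2 := by
    intro h
    have := congrFun h k
    rw [Function.update_self] at this
    simp only [v, if_pos hk] at this
    omega
  have hcard := Finset.one_lt_card.2 ⟨_, h1, _, h2, hne⟩
  have hm := mass_three_le_one hb hp h7
  simp only [mass, Finset.sum_const, nsmul_eq_mul, mul_one] at hm
  have : (((gridIndex 3).filter fun i => p.Contains (gridPoint 3 i)).card : ℝ) ≤ 1 := hm
  have : ((gridIndex 3).filter fun i => p.Contains (gridPoint 3 i)).card ≤ 1 := by exact_mod_cast this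
  omega

/-- Up to reflections, a large item among seven items of middle size is close to the corner `0`. -/
lemma exists_reflected_bin {b : List (Placed 3)} (hb : IsBin b)
    (hs : ∀ p ∈ b, 0 < p.size ∧ p.size ≤ 1) (w : ℕ → ℝ) {p : Placed 3} (hp : p ∈ b)
    (hp2 : 1 / 2 < p.size) (h7 : 7 ≤ midCount b) :
    ∃ (p' : Placed 3) (b' : List (Placed 3)), IsBin (p' :: b') ∧
      (∀ q ∈ p' :: b', 0 < q.size ∧ q.size ≤ 1) ∧ binWeight w (p' :: b') = binWeight w b ∧
      p'.size = p.size ∧ ∀ k, p'.pos k + p'.size ≤ 2 / 3 := by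
  classical
  have hperm := List.perm_cons_erase hp
  have hb' := hb.perm hperm
  have hmid : 7 ≤ midCount (p :: b.erase p) := by
    unfold midCount at h7 ⊢
    rwa [← hperm.countP_eq]
  -- Reflection puts the upper face at 1 - pos, which is below 2/3 exactly in these directions; in
  -- the others the previous lemma applies.
  let s : Fin 3 → Prop := fun k => 1 / 3 < p.pos k
  refine ⟨p.reflect s, (b.erase p).map (Placed.reflect s), hb'.map_reflect s, ?_, ?_, rfl, ?_⟩
  · intro q hq
    rw [← List.map_cons, List.mem_map] at hq
    obtain ⟨r, hr, rfl⟩ := hq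
    exact hs r (hperm.mem_iff.2 hr)
  · rw [← List.map_cons, binWeight_map_reflect]
    exact ((hperm.map _).sum_eq).symm
  · intro k
    simp only [Placed.reflect, s]
    split_ifs with h
    · linarith
    · exact pos_add_size_le hb' hp2 hmid (not_lt.1 h)

/-! ### Certificates with point masses -/

/-- The images of `q` under permutations of coordinates, put in front of `l`. -/
def PointMass.orbitOnto (q : PointMass) (l : List PointMass) : List PointMass :=
  bif Nat.beq q.a q.b then
    bif Nat.beq q.b q.c then q :: l else q :: ⟨q.a, q.c, q.a, q.w⟩ :: ⟨q.c, q.a, q.a, q.w⟩ :: l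
  else bif Nat.beq q.b q.c then q :: ⟨q.b, q.a, q.b, q.w⟩ :: ⟨q.b, q.b, q.a, q.w⟩ :: l
  else q :: ⟨q.a, q.c, q.b, q.w⟩ :: ⟨q.b, q.a, q.c, q.w⟩ :: ⟨q.b, q.c, q.a, q.w⟩ ::
    ⟨q.c, q.a, q.b, q.w⟩ :: ⟨q.c, q.b, q.a, q.w⟩ :: l

lemma PointMass.orbitOnto_append (q : PointMass) (l l' : List PointMass) :
    q.orbitOnto (l ++ l') = q.orbitOnto l ++ l' := by
  unfold PointMass.orbitOnto
  cases Nat.beq q.a q.b <;> cases Nat.beq q.b q.c <;> rfl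

/-- The union of the orbits of the elements of `l`, put in front of `l'`. -/
def symmetrize (l l' : List PointMass) : List PointMass := l.foldr PointMass.orbitOnto l'

/-- The box check runs on all masses including the core, whereas the total counts only the others;
this separates the two. -/
lemma symmetrize_eq_append (l l' : List PointMass) : symmetrize l l' = symmetrize l [] ++ l' := by
  induction l with
  | nil => rfl
  | cons q l ih =>
    change q.orbitOnto (symmetrize l l') = q.orbitOnto (symmetrize l []) ++ l'
    rw [ih, PointMass.orbitOnto_append]

/-- A point mass `w` at each point with coordinates in `l`. -/
def cubeMasses (l : List ℕ) (w : ℕ) : List PointMass :=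
  l.flatMap fun a => l.flatMap fun b => l.map fun c => ⟨a, b, c, w⟩

lemma boxMass_append (l l' : List PointMass) (L i j k : ℕ) :
    boxMass (l ++ l') L i j k = boxMass l L i j k + boxMass l' L i j k := by
  simp [boxMass]

/-- A certificate for bins with an item of type `t` close to the corner `0`. This item contains the
points with coordinates in `core`, which get mass `heavy`. The other point masses, in units of
`1 / D`, are the images of `orbits` under permutations of coordinates. -/
structure PointCert where
  t : ℕ
  fmt : PackFormat
  orbits : List PointMass
  core : List ℕ
  heavy : ℕ
  th : List (ℕ × ℕ)
  D : ℕ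
  cert : Cert
  surplus : ℚ

/-- The numerical conditions on a certificate for the weights `w`. -/
def PointCert.Numerics (P : PointCert) (w : ℕ → ℚ) : Prop :=
  P.t ≤ 4 ∧ 0 < P.fmt.M ∧ 0 < P.D ∧ P.cert.Valid ∧
  (∀ c ∈ P.core, 2 / 3 - tQ (P.t + 1) ≤ (c : ℚ) / P.fmt.M ∧ (c : ℚ) / P.fmt.M ≤ tQ (P.t + 1)) ∧
  (∀ e ∈ P.th, 0 < e.1) ∧
  (∀ i ∈ Finset.Icc 5 16, w i ≤ P.cert.valueQ (tQ (i + 1)) ∨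
    ∃ e ∈ P.th, (e.1 : ℚ) ≤ P.fmt.M * tQ (i + 1) ∧ w i ≤ P.cert.valueQ (tQ (i + 1)) + (e.2 : ℚ) / P.D) ∧
  w P.t ≤ P.cert.valueQ (tQ (P.t + 1)) + P.surplus ∧
  P.cert.total + P.surplus + (((symmetrize P.orbits []).map PointMass.w).sum : ℚ) / P.D ≤ 26852 / 10000

instance (P : PointCert) (w : ℕ → ℚ) : Decidable (P.Numerics w) := by
  unfold PointCert.Numerics
  infer_instance

/-- The point masses of a certificate, as real points. -/
def PointCert.mass (P : PointCert) (q : Placed 3) : ℝ :=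
  CubePacking.mass (Finset.univ : Finset (Fin (symmetrize P.orbits []).length))
    (fun m => gridPoint P.fmt.M ![(symmetrize P.orbits [])[m.1].a, (symmetrize P.orbits [])[m.1].b,
      (symmetrize P.orbits [])[m.1].c])
    (fun m => ((symmetrize P.orbits [])[m.1].w : ℝ)) q

lemma PointCert.mass_nonneg (P : PointCert) (q : Placed 3) : 0 ≤ P.mass q :=
  by unfold PointCert.mass CubePacking.mass; exact Finset.sum_nonneg fun _ _ => Nat.cast_nonneg _

lemma PointCert.sum_mass_le (P : PointCert) {b : List (Placed 3)} (hb : IsBin b) :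
    (b.map P.mass).sum ≤ (((symmetrize P.orbits []).map PointMass.w).sum : ℝ) := by
  have := CubePacking.sum_mass_le (s := (Finset.univ : Finset (Fin (symmetrize P.orbits []).length)))
    (f := fun m => gridPoint P.fmt.M ![(symmetrize P.orbits [])[m.1].a, (symmetrize P.orbits [])[m.1].b,
      (symmetrize P.orbits [])[m.1].c])
    (y := fun m => ((symmetrize P.orbits [])[m.1].w : ℝ)) (fun _ _ => Nat.cast_nonneg _) hb.2
  refine this.trans (le_of_eq ?_)
  rw [← Nat.cast_sum, Fin.sum_univ_fun_getElem (symmetrize P.orbits []) PointMass.w]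

/-- An item that avoids the core has at least the mass of a box. -/
lemma PointCert.le_mass {P : PointCert}
    (hF : P.fmt.Valid (symmetrize P.orbits (cubeMasses P.core P.heavy)) P.th)
    (hc : P.fmt.check (symmetrize P.orbits (cubeMasses P.core P.heavy)) P.th = true)
    (hM : 0 < P.fmt.M) {L g : ℕ} (he : (L, g) ∈ P.th) (hL : 0 < L) {q : Placed 3} (hq : q.Inside)
    (hLq : (L : ℝ) < P.fmt.M * q.size)
    (hcore : ∀ c : Fin 3 → ℕ, (∀ k, c k ∈ P.core) → ¬ q.Contains (gridPoint P.fmt.M c)) :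
    (g : ℝ) ≤ P.mass q := by
  classical
  have hLg := le_gridCount hLq
  -- Since q is larger than L / M, it contains a full box of grid points, L in each direction.
  choose j hj using fun k => exists_grid_interval hM (hq k).1 (hq k).2
  have hj1 : ∀ k, 1 ≤ j k ∧ j k + L ≤ P.fmt.M := by
    intro k
    have h1 := (hj k (j k) (Finset.mem_Ico.2 ⟨le_rfl, by omega⟩)).1
    have h2 := (hj k (j k + L - 1) (Finset.mem_Ico.2 ⟨by omega, by omega⟩)).1
    rw [Finset.mem_Ico] at h1 h2
    omega
  have hcont : ∀ a b c : ℕ, (j 0 ≤ a ∧ a < j 0 + L) ∧ (j 1 ≤ b ∧ b < j 1 + L) ∧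
      (j 2 ≤ c ∧ c < j 2 + L) → q.Contains (gridPoint P.fmt.M ![a, b, c]) := by
    rintro a b c ⟨h0, h1, h2⟩ k
    fin_cases k
    · exact (hj 0 a (Finset.mem_Ico.2 ⟨h0.1, by omega⟩)).2
    · exact (hj 1 b (Finset.mem_Ico.2 ⟨h1.1, by omega⟩)).2
    · exact (hj 2 c (Finset.mem_Ico.2 ⟨h2.1, by omega⟩)).2
  have hbox := P.fmt.le_boxMass hF hc he (hj1 0) (hj1 1) (hj1 2)
  rw [symmetrize_eq_append, boxMass_append] at hbox
  -- The points of the box lie in q, and q avoids the core, so the heavy masses contribute nothing.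
  have hzero : boxMass (cubeMasses P.core P.heavy) L (j 0) (j 1) (j 2) = 0 := by
    refine List.sum_eq_zero fun x hx => ?_
    obtain ⟨r, hr, rfl⟩ := List.mem_map.1 hx
    simp only [cubeMasses, List.mem_flatMap, List.mem_map] at hr
    obtain ⟨a, ha, b, hb, c, hc, rfl⟩ := hr
    refine if_neg fun h => hcore ![a, b, c] (fun k => ?_) (hcont a b c h)
    fin_cases k
    · exact ha
    · exact hb
    · exact hc
  rw [hzero, add_zero] at hbox
  have hle : (boxMass (symmetrize P.orbits []) L (j 0) (j 1) (j 2) : ℝ) ≤ P.mass q := by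
    rw [boxMass, ← Fin.sum_univ_fun_getElem (symmetrize P.orbits []), PointCert.mass,
      CubePacking.mass, Finset.sum_filter]
    push_cast
    refine Finset.sum_le_sum fun m _ => ?_
    by_cases h : (j 0 ≤ (symmetrize P.orbits [])[m.1].a ∧ (symmetrize P.orbits [])[m.1].a < j 0 + L) ∧
        (j 1 ≤ (symmetrize P.orbits [])[m.1].b ∧ (symmetrize P.orbits [])[m.1].b < j 1 + L) ∧
        (j 2 ≤ (symmetrize P.orbits [])[m.1].c ∧ (symmetrize P.orbits [])[m.1].c < j 2 + L)
    · rw [if_pos h, if_pos (hcont _ _ _ h)]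
    · rw [if_neg h]
      split_ifs <;> simp
  exact le_trans (by exact_mod_cast hbox) hle

/-- After a reflection the large item p covers the core, so all other items avoid it and
`PointCert.le_mass` applies to them. The item p itself is paid by volume, grids and surplus; the
point masses are needed only for the other items. -/
theorem PointCert.binWeight_le {P : PointCert} {w : ℕ → ℚ} (hN : P.Numerics w)
    (hF : P.fmt.Valid (symmetrize P.orbits (cubeMasses P.core P.heavy)) P.th)
    (hc : P.fmt.check (symmetrize P.orbits (cubeMasses P.core P.heavy)) P.th = true)
    {b : List (Placed 3)} (hb : IsBin b) (hs : ∀ p ∈ b, 0 < p.size ∧ p.size ≤ 1)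
    (hbig : ∃ p ∈ b, PC.HasType p.size P.t) (h7 : 7 ≤ midCount b) :
    binWeight (fun i => (w i : ℝ)) b ≤ 2.6852 := by
  obtain ⟨ht, hM, hD, hcert, hcore, hth, hw, hwt, htot⟩ := hN
  obtain ⟨p₀, hp₀, hpt⟩ := hbig
  obtain ⟨p, b', hb', hs', hbw, hsz, hpos⟩ := exists_reflected_bin hb hs (fun i => (w i : ℝ)) hp₀
    (HasType.half_lt hpt ht) h7
  rw [← hbw]
  rw [← hsz] at hpt
  have hD' : (0 : ℝ) < P.D := by exact_mod_cast hD
  have hM' : (0 : ℝ) < P.fmt.M := by exact_mod_cast hM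
  have hlt : ∀ {x : ℝ} {i : ℕ}, PC.HasType x i → ((tQ (i + 1) : ℚ) : ℝ) < x := by
    intro x i hi
    obtain ⟨i1, i2, i3, -⟩ := hi
    change i ≤ 16 at i2
    rw [← tQ_eq (by omega) (by omega)]
    exact i3
  have h0Q : ∀ i, (0 : ℚ) ≤ tQ i := fun i => by unfold tQ; split <;> norm_num
  have hin := List.pairwise_cons.1 hb'.2
  have hpcore : ∀ c : Fin 3 → ℕ, (∀ k, c k ∈ P.core) → p.Contains (gridPoint P.fmt.M c) := by
    intro c hc k
    -- With τ the lower end of type `P.t`: the item has size above τ and ends at 2/3 or earlier, so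
    -- it starts before 2/3 - τ, and as it starts at 0 or later it ends after τ. Everything in [2/3
    -- - τ, τ] is covered.
    obtain ⟨h1, h2⟩ := hcore _ (hc k)
    have h1 : (((2 / 3 - tQ (P.t + 1) : ℚ)) : ℝ) ≤ (((c k : ℚ) / P.fmt.M : ℚ) : ℝ) := by exact_mod_cast h1
    have h2 : (((c k : ℚ) / P.fmt.M : ℚ) : ℝ) ≤ ((tQ (P.t + 1) : ℚ) : ℝ) := by exact_mod_cast h2
    push_cast at h1 h2
    have h3 := hlt hpt
    have h4 := hpos k
    have h5 := (hb'.1 p (by simp) k).1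
    simp only [gridPoint]
    constructor <;> linarith
  have key : ∀ q ∈ b', weight (fun i => (w i : ℝ)) q.size ≤ P.cert.value q.size + 1 / P.D * P.mass q := by
    intro q hq
    obtain ⟨h0, h1⟩ := hs' q (by simp [hq])
    have hm : 0 ≤ 1 / P.D * P.mass q := mul_nonneg (by positivity) (P.mass_nonneg q)
    rcases le_or_gt q.size (1 / 11) with h | h
    · rw [weight_of_small h]
      have := Cert.small_le hcert h0.le
      linarith
    · obtain ⟨i, hi⟩ := exists_hasType h h1
      rw [weight_of_hasType hi]
      -- A second item larger than 1/2 would share the centre with p.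
      have hi5 : 5 ≤ i := by
        by_contra hi4
        have := (hin.1 q hq).not_contains
          (contains_center (hb'.1 p (by simp)) (HasType.half_lt hpt ht))
        exact this (contains_center (hb'.1 q (by simp [hq])) (HasType.half_lt hi (by omega)))
      have hi16 : i ≤ 16 := hi.2.1
      have hv := Cert.valueQ_le hcert (h0Q (i + 1)) (hlt hi)
      rcases hw i (Finset.mem_Icc.2 ⟨hi5, hi16⟩) with h2 | ⟨⟨L, g⟩, he, hL, h2⟩
      · have : ((w i : ℚ) : ℝ) ≤ P.cert.valueQ (tQ (i + 1)) := by exact_mod_cast h2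
        linarith
      · have h2 : ((w i : ℚ) : ℝ) ≤ ((P.cert.valueQ (tQ (i + 1)) + (g : ℚ) / P.D : ℚ) : ℝ) := by
          exact_mod_cast h2
        push_cast at h2
        have hL : ((L : ℚ) : ℝ) ≤ ((P.fmt.M * tQ (i + 1) : ℚ) : ℝ) := by exact_mod_cast hL
        push_cast at hL
        have hmass := PointCert.le_mass hF hc hM he (hth _ he) (hb'.1 q (by simp [hq]))
          (hL.trans_lt (mul_lt_mul_of_pos_left (hlt hi) hM'))
          (fun c hc => (hin.1 q hq).not_contains (hpcore c hc))
        have : (g : ℝ) / P.D ≤ 1 / P.D * P.mass q := by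
          rw [div_eq_mul_one_div, mul_comm]
          exact mul_le_mul_of_nonneg_left hmass (by positivity)
        linarith
  have h1 := Cert.sum_value_le hcert hb' fun q hq => (hs' q hq).1
  have h2 := List.sum_le_sum key
  have h3 := P.sum_mass_le hb'.tail
  have h4 := Cert.valueQ_le hcert (h0Q (P.t + 1)) (hlt hpt)
  have h5 : ((w P.t : ℚ) : ℝ) ≤ ((P.cert.valueQ (tQ (P.t + 1)) + P.surplus : ℚ) : ℝ) := by
    exact_mod_cast hwt
  have h6 : ((P.cert.total + P.surplus + (((symmetrize P.orbits []).map PointMass.w).sum : ℚ) / P.D : ℚ) : ℝ) ≤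
      ((26852 / 10000 : ℚ) : ℝ) := by exact_mod_cast htot
  generalize ((symmetrize P.orbits []).map PointMass.w).sum = n at h3 h6
  have h7 : 1 / (P.D : ℝ) * (b'.map P.mass).sum ≤ 1 / P.D * n :=
    mul_le_mul_of_nonneg_left h3 (one_div_nonneg.2 hD'.le)
  rw [List.sum_map_add, List.sum_map_mul_left] at h2
  rw [List.map_cons, List.sum_cons] at h1
  rw [binWeight, List.map_cons, List.sum_cons, weight_of_hasType hpt]
  push_cast at h5 h6
  rw [div_eq_mul_one_div (n : ℝ), mul_comm (n : ℝ)] at h6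
  norm_num at h6 h7 h2 ⊢
  linarith

/-! ### Data for a large item of type 2 -/

/-- Point masses for bins with an item of type 2, in units of `1 / 4000000`, on the grid of mesh
`1 / 120`. -/
def massesSeven : List PointMass :=
  [⟨4, 36, 92, 2⟩, ⟨4, 36, 104, 2⟩, ⟨4, 36, 106, 2⟩, ⟨4, 36, 107, 2⟩, ⟨4, 40, 105, 3⟩,
   ⟨4, 44, 90, 1⟩, ⟨4, 44, 107, 2⟩, ⟨4, 47, 94, 2⟩, ⟨4, 50, 94, 1⟩, ⟨4, 52, 94, 2⟩, ⟨4, 53, 94, 2⟩,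
   ⟨4, 53, 102, 1⟩, ⟨4, 54, 94, 2⟩, ⟨4, 60, 100, 5⟩, ⟨4, 60, 108, 13⟩, ⟨4, 66, 96, 5⟩,
   ⟨4, 66, 98, 5⟩, ⟨4, 66, 100, 5⟩, ⟨4, 66, 102, 5⟩, ⟨6, 6, 108, 1⟩, ⟨6, 8, 90, 1⟩, ⟨6, 8, 108, 1⟩,
   ⟨6, 10, 107, 2⟩, ⟨6, 10, 108, 1⟩, ⟨6, 12, 108, 1⟩, ⟨6, 14, 94, 1⟩, ⟨6, 15, 90, 2⟩,
   ⟨6, 15, 93, 1⟩, ⟨6, 15, 94, 1⟩, ⟨6, 15, 108, 2⟩, ⟨6, 16, 94, 2⟩, ⟨6, 16, 108, 2⟩,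
   ⟨6, 26, 108, 3⟩, ⟨6, 36, 104, 22⟩, ⟨6, 36, 108, 25⟩, ⟨6, 38, 90, 3⟩, ⟨6, 38, 94, 8⟩,
   ⟨6, 40, 90, 36⟩, ⟨6, 40, 92, 32⟩, ⟨6, 44, 90, 2⟩, ⟨6, 44, 105, 16⟩, ⟨6, 45, 104, 12⟩,
   ⟨6, 47, 107, 8⟩, ⟨6, 50, 94, 5⟩, ⟨6, 52, 93, 7⟩, ⟨6, 52, 94, 8⟩, ⟨6, 52, 100, 4⟩,
   ⟨6, 53, 90, 11⟩, ⟨6, 53, 94, 9⟩, ⟨6, 60, 98, 14⟩, ⟨6, 64, 90, 31⟩, ⟨6, 64, 96, 9⟩,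
   ⟨6, 66, 90, 135⟩, ⟨6, 66, 96, 6⟩, ⟨6, 66, 98, 6⟩, ⟨6, 66, 100, 7⟩, ⟨6, 66, 102, 7⟩,
   ⟨6, 68, 90, 8⟩, ⟨6, 68, 100, 6⟩, ⟨6, 70, 94, 6⟩, ⟨6, 72, 96, 17⟩, ⟨6, 74, 108, 6⟩,
   ⟨6, 74, 110, 6⟩, ⟨6, 74, 112, 5⟩, ⟨6, 76, 96, 205⟩, ⟨6, 76, 98, 11⟩, ⟨6, 76, 100, 60⟩,
   ⟨6, 76, 104, 35⟩, ⟨6, 80, 80, 87⟩, ⟨6, 80, 104, 57⟩, ⟨6, 87, 107, 5⟩, ⟨6, 90, 107, 26⟩,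
   ⟨6, 93, 96, 9⟩, ⟨6, 96, 96, 53⟩, ⟨6, 96, 104, 14⟩, ⟨6, 105, 108, 2⟩, ⟨6, 106, 107, 2⟩,
   ⟨6, 106, 110, 2⟩, ⟨6, 106, 114, 1⟩, ⟨6, 106, 116, 1⟩, ⟨8, 8, 108, 1⟩, ⟨8, 10, 90, 3⟩,
   ⟨8, 10, 108, 1⟩, ⟨8, 12, 90, 4⟩, ⟨8, 12, 94, 6⟩, ⟨8, 12, 108, 1⟩, ⟨8, 14, 94, 1⟩, ⟨8, 15, 94, 1⟩,
   ⟨8, 15, 107, 1⟩, ⟨8, 16, 90, 6⟩, ⟨8, 16, 94, 2⟩, ⟨8, 16, 105, 1⟩, ⟨8, 16, 106, 1⟩,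
   ⟨8, 16, 108, 2⟩, ⟨8, 23, 98, 48⟩, ⟨8, 23, 102, 79⟩, ⟨8, 36, 104, 37⟩, ⟨8, 36, 106, 29⟩,
   ⟨8, 36, 108, 55⟩, ⟨8, 38, 90, 3⟩, ⟨8, 38, 108, 9⟩, ⟨8, 40, 107, 48⟩, ⟨8, 40, 108, 40⟩,
   ⟨8, 44, 90, 2⟩, ⟨8, 45, 106, 14⟩, ⟨8, 47, 90, 64⟩, ⟨8, 47, 94, 14⟩, ⟨8, 50, 104, 239⟩,
   ⟨8, 52, 94, 8⟩, ⟨8, 52, 108, 12⟩, ⟨8, 53, 94, 10⟩, ⟨8, 53, 98, 7⟩, ⟨8, 54, 94, 9⟩,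
   ⟨8, 54, 96, 9⟩, ⟨8, 54, 108, 105⟩, ⟨8, 60, 102, 22⟩, ⟨8, 64, 90, 312⟩, ⟨8, 64, 96, 9⟩,
   ⟨8, 64, 98, 9⟩, ⟨8, 66, 96, 7⟩, ⟨8, 66, 98, 7⟩, ⟨8, 66, 100, 7⟩, ⟨8, 66, 102, 8⟩,
   ⟨8, 66, 108, 12⟩, ⟨8, 68, 90, 10⟩, ⟨8, 68, 96, 6⟩, ⟨8, 70, 90, 13⟩, ⟨8, 70, 108, 11⟩,
   ⟨8, 72, 98, 14⟩, ⟨8, 72, 102, 43⟩, ⟨8, 74, 100, 115⟩, ⟨8, 74, 104, 38⟩, ⟨8, 74, 110, 6⟩,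
   ⟨8, 74, 114, 5⟩, ⟨8, 74, 116, 4⟩, ⟨8, 75, 104, 26⟩, ⟨8, 76, 108, 8⟩, ⟨8, 80, 87, 144⟩,
   ⟨8, 80, 94, 9⟩, ⟨8, 80, 96, 129⟩, ⟨8, 80, 104, 80⟩, ⟨8, 80, 107, 20⟩, ⟨8, 80, 112, 25⟩,
   ⟨8, 90, 107, 141⟩, ⟨8, 92, 96, 9⟩, ⟨8, 92, 107, 7⟩, ⟨8, 96, 96, 63⟩, ⟨8, 98, 107, 7⟩,
   ⟨8, 98, 112, 4⟩, ⟨8, 100, 107, 9⟩, ⟨8, 105, 107, 2⟩, ⟨8, 105, 108, 2⟩, ⟨8, 105, 110, 2⟩,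
   ⟨8, 105, 112, 2⟩, ⟨8, 105, 114, 2⟩, ⟨8, 106, 107, 2⟩, ⟨8, 106, 108, 2⟩, ⟨8, 106, 110, 2⟩,
   ⟨8, 106, 114, 2⟩, ⟨8, 106, 116, 1⟩, ⟨8, 107, 108, 13⟩, ⟨8, 110, 110, 21⟩, ⟨10, 10, 90, 30⟩,
   ⟨10, 10, 92, 11⟩, ⟨10, 10, 93, 11⟩, ⟨10, 10, 94, 28⟩, ⟨10, 10, 108, 2⟩, ⟨10, 12, 90, 232⟩,
   ⟨10, 12, 92, 7⟩, ⟨10, 12, 93, 10⟩, ⟨10, 12, 94, 56⟩, ⟨10, 12, 107, 171⟩, ⟨10, 12, 108, 2⟩,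
   ⟨10, 14, 92, 1⟩, ⟨10, 14, 94, 1⟩, ⟨10, 14, 108, 1⟩, ⟨10, 15, 90, 2⟩, ⟨10, 15, 94, 1⟩,
   ⟨10, 15, 107, 1⟩, ⟨10, 16, 94, 2⟩, ⟨10, 16, 108, 2⟩, ⟨10, 23, 90, 73⟩, ⟨10, 23, 100, 47⟩,
   ⟨10, 24, 90, 66⟩, ⟨10, 24, 100, 307⟩, ⟨10, 24, 108, 213⟩, ⟨10, 26, 90, 4⟩, ⟨10, 28, 90, 3⟩,
   ⟨10, 28, 107, 2⟩, ⟨10, 28, 108, 2⟩, ⟨10, 36, 90, 364⟩, ⟨10, 36, 93, 136⟩, ⟨10, 36, 104, 66⟩,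
   ⟨10, 36, 107, 325⟩, ⟨10, 38, 90, 4⟩, ⟨10, 38, 92, 12⟩, ⟨10, 38, 104, 62⟩, ⟨10, 38, 107, 12⟩,
   ⟨10, 40, 108, 87⟩, ⟨10, 45, 90, 8⟩, ⟨10, 45, 104, 159⟩, ⟨10, 47, 93, 159⟩, ⟨10, 47, 94, 58⟩,
   ⟨10, 47, 107, 17⟩, ⟨10, 47, 108, 16⟩, ⟨10, 50, 94, 7⟩, ⟨10, 50, 107, 33⟩, ⟨10, 50, 108, 47⟩,
   ⟨10, 52, 90, 65⟩, ⟨10, 52, 92, 6⟩, ⟨10, 52, 93, 14⟩, ⟨10, 52, 94, 18⟩, ⟨10, 52, 108, 36⟩,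
   ⟨10, 53, 90, 64⟩, ⟨10, 53, 92, 7⟩, ⟨10, 53, 93, 17⟩, ⟨10, 53, 94, 25⟩, ⟨10, 53, 106, 127⟩,
   ⟨10, 53, 108, 70⟩, ⟨10, 54, 90, 22⟩, ⟨10, 54, 92, 6⟩, ⟨10, 54, 93, 16⟩, ⟨10, 54, 94, 23⟩,
   ⟨10, 60, 90, 11⟩, ⟨10, 60, 96, 190⟩, ⟨10, 64, 96, 18⟩, ⟨10, 64, 98, 16⟩, ⟨10, 64, 102, 32⟩,
   ⟨10, 66, 96, 11⟩, ⟨10, 66, 98, 10⟩, ⟨10, 66, 100, 11⟩, ⟨10, 66, 102, 13⟩, ⟨10, 66, 108, 55⟩,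
   ⟨10, 70, 90, 164⟩, ⟨10, 74, 108, 7⟩, ⟨10, 74, 110, 6⟩, ⟨10, 74, 112, 6⟩, ⟨10, 74, 114, 6⟩,
   ⟨10, 74, 116, 5⟩, ⟨10, 75, 90, 8⟩, ⟨10, 76, 90, 9⟩, ⟨10, 76, 104, 136⟩, ⟨10, 80, 80, 158⟩,
   ⟨10, 80, 96, 414⟩, ⟨10, 80, 98, 13⟩, ⟨10, 80, 104, 137⟩, ⟨10, 80, 108, 57⟩, ⟨10, 87, 107, 7⟩,
   ⟨10, 87, 108, 13⟩, ⟨10, 90, 96, 271⟩, ⟨10, 92, 96, 10⟩, ⟨10, 93, 96, 11⟩, ⟨10, 96, 96, 78⟩,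
   ⟨10, 98, 107, 9⟩, ⟨10, 104, 104, 286⟩, ⟨10, 104, 110, 94⟩, ⟨10, 105, 107, 3⟩, ⟨10, 105, 108, 3⟩,
   ⟨10, 105, 114, 2⟩, ⟨10, 105, 116, 2⟩, ⟨10, 106, 107, 2⟩, ⟨10, 106, 108, 2⟩, ⟨10, 106, 110, 2⟩,
   ⟨10, 106, 112, 2⟩, ⟨10, 106, 114, 2⟩, ⟨10, 106, 116, 1⟩, ⟨10, 107, 110, 17⟩, ⟨12, 12, 92, 19⟩,
   ⟨12, 12, 93, 29⟩, ⟨12, 12, 94, 254⟩, ⟨12, 12, 104, 90⟩, ⟨12, 12, 106, 70⟩, ⟨12, 12, 108, 147⟩,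
   ⟨12, 14, 108, 1⟩, ⟨12, 15, 90, 2⟩, ⟨12, 16, 94, 1⟩, ⟨12, 16, 108, 3⟩, ⟨12, 23, 90, 202⟩,
   ⟨12, 23, 94, 17⟩, ⟨12, 23, 107, 280⟩, ⟨12, 24, 90, 158⟩, ⟨12, 26, 90, 4⟩, ⟨12, 26, 94, 8⟩,
   ⟨12, 26, 107, 2⟩, ⟨12, 26, 108, 5⟩, ⟨12, 28, 94, 4⟩, ⟨12, 28, 107, 1⟩, ⟨12, 36, 90, 138⟩,
   ⟨12, 36, 94, 363⟩, ⟨12, 36, 104, 39⟩, ⟨12, 36, 108, 99⟩, ⟨12, 40, 90, 397⟩, ⟨12, 40, 92, 131⟩,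
   ⟨12, 40, 94, 39⟩, ⟨12, 40, 107, 115⟩, ⟨12, 40, 108, 199⟩, ⟨12, 44, 106, 78⟩, ⟨12, 44, 108, 16⟩,
   ⟨12, 45, 90, 3⟩, ⟨12, 46, 90, 4⟩, ⟨12, 47, 94, 60⟩, ⟨12, 47, 107, 20⟩, ⟨12, 47, 108, 17⟩,
   ⟨12, 50, 92, 22⟩, ⟨12, 50, 94, 8⟩, ⟨12, 50, 96, 9⟩, ⟨12, 50, 100, 4⟩, ⟨12, 50, 107, 45⟩,
   ⟨12, 50, 108, 60⟩, ⟨12, 52, 90, 84⟩, ⟨12, 52, 92, 6⟩, ⟨12, 52, 93, 14⟩, ⟨12, 52, 107, 28⟩,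
   ⟨12, 52, 108, 31⟩, ⟨12, 53, 90, 216⟩, ⟨12, 53, 92, 7⟩, ⟨12, 53, 93, 18⟩, ⟨12, 53, 102, 6⟩,
   ⟨12, 53, 107, 130⟩, ⟨12, 53, 108, 55⟩, ⟨12, 54, 90, 30⟩, ⟨12, 54, 92, 7⟩, ⟨12, 54, 93, 16⟩,
   ⟨12, 54, 94, 31⟩, ⟨12, 54, 98, 10⟩, ⟨12, 60, 90, 21⟩, ⟨12, 60, 108, 198⟩, ⟨12, 64, 98, 16⟩,
   ⟨12, 66, 94, 72⟩, ⟨12, 66, 96, 11⟩, ⟨12, 66, 98, 10⟩, ⟨12, 66, 100, 11⟩, ⟨12, 66, 102, 13⟩,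
   ⟨12, 66, 107, 141⟩, ⟨12, 66, 108, 89⟩, ⟨12, 68, 90, 283⟩, ⟨12, 68, 107, 217⟩, ⟨12, 68, 108, 122⟩,
   ⟨12, 70, 98, 8⟩, ⟨12, 70, 108, 49⟩, ⟨12, 72, 102, 63⟩, ⟨12, 74, 108, 7⟩, ⟨12, 74, 110, 7⟩,
   ⟨12, 74, 112, 7⟩, ⟨12, 74, 114, 6⟩, ⟨12, 74, 116, 5⟩, ⟨12, 76, 90, 14⟩, ⟨12, 76, 107, 7⟩,
   ⟨12, 80, 80, 158⟩, ⟨12, 80, 92, 251⟩, ⟨12, 80, 93, 106⟩, ⟨12, 80, 104, 155⟩, ⟨12, 80, 107, 27⟩,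
   ⟨12, 80, 108, 99⟩, ⟨12, 80, 110, 91⟩, ⟨12, 80, 112, 39⟩, ⟨12, 80, 114, 26⟩, ⟨12, 80, 116, 14⟩,
   ⟨12, 84, 84, 509⟩, ⟨12, 87, 107, 11⟩, ⟨12, 87, 108, 73⟩, ⟨12, 92, 96, 81⟩, ⟨12, 92, 108, 160⟩,
   ⟨12, 93, 96, 118⟩, ⟨12, 93, 107, 66⟩, ⟨12, 96, 96, 110⟩, ⟨12, 96, 104, 20⟩, ⟨12, 96, 107, 56⟩,
   ⟨12, 96, 108, 192⟩, ⟨12, 96, 112, 19⟩, ⟨12, 100, 108, 46⟩, ⟨12, 105, 107, 3⟩, ⟨12, 105, 108, 3⟩,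
   ⟨12, 105, 110, 3⟩, ⟨12, 105, 112, 2⟩, ⟨12, 105, 114, 2⟩, ⟨12, 106, 107, 2⟩, ⟨12, 106, 108, 2⟩,
   ⟨12, 106, 110, 2⟩, ⟨12, 106, 112, 2⟩, ⟨12, 106, 114, 2⟩, ⟨12, 107, 107, 73⟩, ⟨12, 107, 112, 7⟩,
   ⟨12, 107, 114, 4⟩, ⟨12, 108, 108, 309⟩, ⟨12, 110, 110, 24⟩, ⟨14, 14, 108, 554⟩, ⟨14, 20, 90, 30⟩,
   ⟨14, 20, 107, 1⟩, ⟨14, 28, 90, 14⟩, ⟨14, 30, 90, 440⟩, ⟨14, 30, 94, 197⟩, ⟨14, 38, 90, 3⟩,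
   ⟨14, 40, 90, 6⟩, ⟨14, 44, 108, 27⟩, ⟨14, 45, 108, 27⟩, ⟨14, 47, 92, 51⟩, ⟨14, 52, 90, 8⟩,
   ⟨14, 52, 92, 26⟩, ⟨14, 52, 93, 27⟩, ⟨14, 53, 90, 9⟩, ⟨14, 53, 92, 33⟩, ⟨14, 53, 93, 33⟩,
   ⟨14, 53, 102, 2⟩, ⟨14, 54, 90, 11⟩, ⟨14, 54, 92, 38⟩, ⟨14, 54, 93, 39⟩, ⟨14, 54, 98, 3⟩,
   ⟨14, 54, 100, 2⟩, ⟨14, 64, 92, 110⟩, ⟨14, 66, 92, 61⟩, ⟨14, 70, 90, 179⟩, ⟨14, 74, 100, 16⟩,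
   ⟨14, 74, 104, 29⟩, ⟨14, 80, 104, 71⟩, ⟨14, 96, 104, 125⟩, ⟨15, 15, 93, 870⟩, ⟨15, 15, 94, 142⟩,
   ⟨15, 15, 107, 884⟩, ⟨15, 16, 93, 84⟩, ⟨15, 16, 94, 56⟩, ⟨15, 16, 104, 425⟩, ⟨15, 20, 90, 27⟩,
   ⟨15, 22, 90, 12⟩, ⟨15, 23, 90, 19⟩, ⟨15, 24, 90, 18⟩, ⟨15, 26, 107, 4⟩, ⟨15, 28, 107, 4⟩,
   ⟨15, 28, 108, 5⟩, ⟨15, 30, 92, 273⟩, ⟨15, 30, 93, 294⟩, ⟨15, 30, 94, 122⟩, ⟨15, 30, 104, 135⟩,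
   ⟨15, 30, 105, 256⟩, ⟨15, 30, 106, 256⟩, ⟨15, 30, 107, 239⟩, ⟨15, 30, 108, 239⟩, ⟨15, 36, 93, 4⟩,
   ⟨15, 36, 105, 6⟩, ⟨15, 36, 108, 6⟩, ⟨15, 38, 105, 7⟩, ⟨15, 38, 108, 7⟩, ⟨15, 40, 93, 39⟩,
   ⟨15, 40, 104, 71⟩, ⟨15, 40, 105, 177⟩, ⟨15, 40, 106, 49⟩, ⟨15, 40, 108, 109⟩, ⟨15, 46, 107, 52⟩,
   ⟨15, 46, 108, 46⟩, ⟨15, 50, 90, 291⟩, ⟨15, 52, 90, 8⟩, ⟨15, 52, 92, 30⟩, ⟨15, 52, 93, 30⟩,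
   ⟨15, 52, 100, 2⟩, ⟨15, 52, 107, 187⟩, ⟨15, 52, 108, 61⟩, ⟨15, 53, 90, 10⟩, ⟨15, 53, 92, 38⟩,
   ⟨15, 53, 93, 38⟩, ⟨15, 53, 102, 2⟩, ⟨15, 53, 108, 160⟩, ⟨15, 54, 90, 15⟩, ⟨15, 54, 92, 45⟩,
   ⟨15, 54, 93, 46⟩, ⟨15, 60, 98, 4⟩, ⟨15, 60, 100, 4⟩, ⟨15, 60, 108, 302⟩, ⟨15, 64, 92, 174⟩,
   ⟨15, 64, 94, 431⟩, ⟨15, 66, 90, 317⟩, ⟨15, 66, 92, 81⟩, ⟨15, 66, 108, 389⟩, ⟨15, 68, 94, 17⟩,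
   ⟨15, 70, 94, 226⟩, ⟨15, 70, 104, 90⟩, ⟨15, 70, 107, 233⟩, ⟨15, 76, 110, 171⟩, ⟨15, 78, 98, 8⟩,
   ⟨15, 80, 87, 193⟩, ⟨15, 80, 92, 20⟩, ⟨15, 80, 96, 222⟩, ⟨15, 80, 104, 86⟩, ⟨15, 80, 105, 50⟩,
   ⟨15, 80, 107, 109⟩, ⟨15, 80, 108, 109⟩, ⟨15, 80, 110, 116⟩, ⟨15, 80, 112, 50⟩, ⟨15, 80, 114, 33⟩,
   ⟨15, 80, 116, 18⟩, ⟨15, 81, 105, 3⟩, ⟨15, 82, 105, 5⟩, ⟨15, 82, 107, 5⟩, ⟨15, 84, 105, 22⟩,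
   ⟨15, 84, 106, 9⟩, ⟨15, 84, 108, 27⟩, ⟨15, 84, 110, 27⟩, ⟨15, 90, 90, 101⟩, ⟨15, 90, 92, 90⟩,
   ⟨15, 90, 93, 79⟩, ⟨15, 90, 94, 121⟩, ⟨15, 90, 105, 381⟩, ⟨15, 90, 110, 136⟩, ⟨15, 92, 107, 13⟩,
   ⟨15, 92, 108, 23⟩, ⟨15, 92, 110, 17⟩, ⟨15, 93, 105, 12⟩, ⟨15, 93, 107, 17⟩, ⟨15, 93, 108, 32⟩,
   ⟨15, 93, 110, 23⟩, ⟨15, 94, 94, 73⟩, ⟨15, 104, 104, 321⟩, ⟨15, 105, 105, 373⟩,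
   ⟨15, 105, 106, 13⟩, ⟨15, 105, 108, 50⟩, ⟨15, 105, 110, 19⟩, ⟨15, 107, 107, 21⟩,
   ⟨15, 108, 112, 5⟩, ⟨15, 110, 110, 15⟩, ⟨15, 110, 114, 2⟩, ⟨15, 110, 116, 2⟩, ⟨15, 112, 112, 5⟩,
   ⟨15, 112, 114, 2⟩, ⟨15, 114, 114, 3⟩, ⟨15, 114, 116, 1⟩, ⟨15, 116, 116, 2⟩, ⟨16, 16, 90, 385⟩,
   ⟨16, 16, 93, 122⟩, ⟨16, 16, 94, 122⟩, ⟨16, 20, 90, 36⟩, ⟨16, 26, 90, 82⟩, ⟨16, 26, 108, 167⟩,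
   ⟨16, 28, 90, 271⟩, ⟨16, 30, 92, 190⟩, ⟨16, 30, 93, 201⟩, ⟨16, 30, 94, 232⟩, ⟨16, 30, 104, 283⟩,
   ⟨16, 30, 105, 243⟩, ⟨16, 30, 106, 243⟩, ⟨16, 30, 107, 410⟩, ⟨16, 36, 90, 4⟩, ⟨16, 36, 104, 7⟩,
   ⟨16, 36, 105, 7⟩, ⟨16, 36, 106, 6⟩, ⟨16, 36, 107, 6⟩, ⟨16, 38, 104, 7⟩, ⟨16, 38, 107, 6⟩,
   ⟨16, 38, 108, 7⟩, ⟨16, 40, 90, 7⟩, ⟨16, 40, 92, 6⟩, ⟨16, 40, 94, 6⟩, ⟨16, 40, 105, 103⟩,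
   ⟨16, 40, 106, 80⟩, ⟨16, 44, 104, 76⟩, ⟨16, 44, 105, 50⟩, ⟨16, 44, 106, 44⟩, ⟨16, 45, 90, 2⟩,
   ⟨16, 45, 94, 1⟩, ⟨16, 45, 104, 58⟩, ⟨16, 45, 106, 37⟩, ⟨16, 45, 107, 35⟩, ⟨16, 45, 108, 34⟩,
   ⟨16, 46, 90, 2⟩, ⟨16, 46, 92, 2⟩, ⟨16, 46, 93, 2⟩, ⟨16, 46, 104, 70⟩, ⟨16, 46, 105, 47⟩,
   ⟨16, 46, 106, 45⟩, ⟨16, 47, 90, 121⟩, ⟨16, 47, 92, 216⟩, ⟨16, 47, 94, 479⟩, ⟨16, 47, 105, 35⟩,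
   ⟨16, 50, 90, 9⟩, ⟨16, 50, 92, 10⟩, ⟨16, 50, 93, 10⟩, ⟨16, 50, 94, 12⟩, ⟨16, 52, 90, 9⟩,
   ⟨16, 52, 92, 9⟩, ⟨16, 52, 93, 9⟩, ⟨16, 52, 107, 90⟩, ⟨16, 52, 108, 45⟩, ⟨16, 53, 90, 11⟩,
   ⟨16, 53, 92, 10⟩, ⟨16, 53, 93, 10⟩, ⟨16, 53, 108, 83⟩, ⟨16, 54, 90, 28⟩, ⟨16, 54, 92, 11⟩,
   ⟨16, 54, 93, 10⟩, ⟨16, 54, 108, 298⟩, ⟨16, 60, 96, 3⟩, ⟨16, 60, 102, 3⟩, ⟨16, 60, 106, 342⟩,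
   ⟨16, 60, 108, 198⟩, ⟨16, 64, 93, 182⟩, ⟨16, 66, 93, 15⟩, ⟨16, 68, 90, 36⟩, ⟨16, 68, 93, 16⟩,
   ⟨16, 68, 108, 87⟩, ⟨16, 70, 92, 85⟩, ⟨16, 70, 106, 179⟩, ⟨16, 70, 108, 268⟩, ⟨16, 75, 98, 9⟩,
   ⟨16, 76, 96, 59⟩, ⟨16, 76, 104, 511⟩, ⟨16, 78, 96, 28⟩, ⟨16, 78, 100, 22⟩, ⟨16, 80, 80, 992⟩,
   ⟨16, 80, 96, 691⟩, ⟨16, 80, 100, 240⟩, ⟨16, 80, 104, 265⟩, ⟨16, 96, 96, 920⟩,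
   ⟨16, 96, 104, 1332⟩, ⟨16, 104, 104, 939⟩, ⟨20, 20, 96, 725⟩, ⟨20, 20, 98, 1326⟩,
   ⟨20, 20, 100, 1121⟩, ⟨20, 20, 102, 1121⟩, ⟨20, 22, 96, 24⟩, ⟨20, 22, 98, 24⟩, ⟨20, 22, 100, 26⟩,
   ⟨20, 22, 102, 26⟩, ⟨20, 23, 96, 25⟩, ⟨20, 23, 98, 25⟩, ⟨20, 23, 100, 26⟩, ⟨20, 23, 102, 27⟩,
   ⟨20, 24, 96, 32⟩, ⟨20, 24, 98, 32⟩, ⟨20, 24, 100, 34⟩, ⟨20, 24, 102, 35⟩, ⟨20, 30, 96, 30⟩,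
   ⟨20, 30, 98, 30⟩, ⟨20, 30, 100, 29⟩, ⟨20, 30, 102, 32⟩, ⟨20, 36, 96, 7⟩, ⟨20, 38, 90, 19⟩,
   ⟨20, 38, 92, 7⟩, ⟨20, 38, 108, 15⟩, ⟨20, 40, 90, 166⟩, ⟨20, 40, 96, 822⟩, ⟨20, 40, 98, 822⟩,
   ⟨20, 40, 100, 1623⟩, ⟨20, 40, 108, 113⟩, ⟨20, 44, 108, 12⟩, ⟨20, 50, 92, 15⟩, ⟨20, 50, 94, 14⟩,
   ⟨20, 50, 98, 34⟩, ⟨20, 50, 105, 53⟩, ⟨20, 50, 106, 28⟩, ⟨20, 52, 90, 10⟩, ⟨20, 52, 92, 11⟩,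
   ⟨20, 52, 94, 12⟩, ⟨20, 52, 105, 24⟩, ⟨20, 52, 107, 14⟩, ⟨20, 53, 93, 11⟩, ⟨20, 53, 107, 15⟩,
   ⟨20, 53, 108, 16⟩, ⟨20, 54, 90, 197⟩, ⟨20, 54, 107, 18⟩, ⟨20, 54, 108, 19⟩, ⟨20, 60, 98, 1775⟩,
   ⟨20, 60, 100, 1829⟩, ⟨20, 66, 90, 234⟩, ⟨20, 68, 108, 49⟩, ⟨20, 70, 90, 16⟩, ⟨20, 70, 93, 5⟩,
   ⟨20, 70, 98, 23⟩, ⟨20, 70, 102, 34⟩, ⟨20, 70, 107, 25⟩, ⟨20, 70, 108, 43⟩, ⟨20, 72, 96, 48⟩,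
   ⟨20, 74, 96, 106⟩, ⟨20, 75, 100, 23⟩, ⟨20, 76, 96, 31⟩, ⟨20, 76, 100, 179⟩, ⟨20, 76, 102, 23⟩,
   ⟨20, 78, 96, 23⟩, ⟨20, 78, 98, 8⟩, ⟨20, 78, 100, 70⟩, ⟨20, 78, 102, 19⟩, ⟨20, 80, 80, 367⟩,
   ⟨20, 80, 96, 744⟩, ⟨20, 80, 102, 139⟩, ⟨20, 80, 104, 309⟩, ⟨20, 80, 107, 21⟩, ⟨20, 80, 108, 24⟩,
   ⟨20, 80, 114, 15⟩, ⟨20, 90, 96, 24⟩, ⟨20, 90, 107, 151⟩, ⟨20, 92, 108, 59⟩, ⟨20, 93, 107, 31⟩,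
   ⟨20, 96, 104, 7⟩, ⟨20, 96, 112, 6⟩, ⟨20, 96, 114, 4⟩, ⟨20, 96, 116, 3⟩, ⟨20, 98, 98, 11⟩,
   ⟨20, 98, 100, 7⟩, ⟨20, 100, 100, 1855⟩, ⟨20, 100, 102, 21⟩, ⟨20, 102, 102, 20⟩,
   ⟨20, 104, 104, 15⟩, ⟨20, 104, 107, 7⟩, ⟨20, 104, 110, 10⟩, ⟨20, 105, 108, 11⟩, ⟨20, 105, 110, 9⟩,
   ⟨20, 105, 112, 4⟩, ⟨20, 106, 112, 3⟩, ⟨20, 107, 107, 22⟩, ⟨20, 107, 108, 8⟩, ⟨20, 107, 110, 6⟩,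
   ⟨20, 108, 108, 21⟩, ⟨20, 108, 110, 8⟩, ⟨20, 110, 110, 12⟩, ⟨22, 22, 96, 71⟩, ⟨22, 22, 98, 71⟩,
   ⟨22, 22, 100, 71⟩, ⟨22, 22, 102, 71⟩, ⟨22, 23, 96, 36⟩, ⟨22, 23, 98, 36⟩, ⟨22, 23, 100, 36⟩,
   ⟨22, 23, 102, 36⟩, ⟨22, 24, 96, 53⟩, ⟨22, 24, 98, 53⟩, ⟨22, 24, 100, 53⟩, ⟨22, 24, 102, 53⟩,
   ⟨22, 30, 96, 44⟩, ⟨22, 30, 98, 44⟩, ⟨22, 30, 100, 44⟩, ⟨22, 30, 102, 50⟩, ⟨22, 36, 90, 28⟩,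
   ⟨22, 36, 94, 7⟩, ⟨22, 36, 100, 6⟩, ⟨22, 38, 108, 13⟩, ⟨22, 40, 96, 154⟩, ⟨22, 40, 98, 101⟩,
   ⟨22, 40, 107, 40⟩, ⟨22, 40, 108, 53⟩, ⟨22, 44, 108, 19⟩, ⟨22, 50, 90, 17⟩, ⟨22, 50, 94, 24⟩,
   ⟨22, 50, 102, 62⟩, ⟨22, 53, 96, 16⟩, ⟨22, 53, 107, 21⟩, ⟨22, 53, 108, 20⟩, ⟨22, 54, 92, 35⟩,
   ⟨22, 54, 107, 23⟩, ⟨22, 54, 108, 26⟩, ⟨22, 60, 96, 127⟩, ⟨22, 66, 92, 6⟩, ⟨22, 66, 108, 66⟩,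
   ⟨22, 70, 98, 20⟩, ⟨22, 72, 102, 39⟩, ⟨22, 74, 104, 19⟩, ⟨22, 76, 96, 27⟩, ⟨22, 76, 104, 14⟩,
   ⟨22, 80, 96, 706⟩, ⟨22, 90, 96, 29⟩, ⟨22, 93, 107, 20⟩, ⟨22, 93, 108, 56⟩, ⟨22, 96, 98, 9⟩,
   ⟨22, 96, 108, 27⟩, ⟨22, 96, 110, 28⟩, ⟨22, 96, 112, 6⟩, ⟨22, 96, 114, 5⟩, ⟨22, 96, 116, 3⟩,
   ⟨22, 104, 104, 23⟩, ⟨22, 104, 110, 9⟩, ⟨22, 106, 107, 7⟩, ⟨22, 110, 110, 12⟩, ⟨23, 23, 96, 74⟩,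
   ⟨23, 23, 98, 74⟩, ⟨23, 23, 100, 74⟩, ⟨23, 23, 102, 74⟩, ⟨23, 24, 96, 55⟩, ⟨23, 24, 98, 55⟩,
   ⟨23, 24, 100, 55⟩, ⟨23, 24, 102, 55⟩, ⟨23, 24, 108, 95⟩, ⟨23, 30, 96, 45⟩, ⟨23, 30, 98, 45⟩,
   ⟨23, 30, 100, 45⟩, ⟨23, 30, 102, 52⟩, ⟨23, 36, 90, 44⟩, ⟨23, 36, 100, 6⟩, ⟨23, 36, 107, 96⟩,
   ⟨23, 36, 108, 264⟩, ⟨23, 38, 108, 14⟩, ⟨23, 40, 90, 604⟩, ⟨23, 40, 93, 1134⟩, ⟨23, 40, 102, 472⟩,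
   ⟨23, 40, 108, 87⟩, ⟨23, 44, 107, 57⟩, ⟨23, 44, 108, 47⟩, ⟨23, 50, 96, 37⟩, ⟨23, 50, 108, 89⟩,
   ⟨23, 52, 104, 165⟩, ⟨23, 53, 90, 94⟩, ⟨23, 53, 100, 24⟩, ⟨23, 53, 107, 44⟩, ⟨23, 53, 108, 37⟩,
   ⟨23, 54, 93, 58⟩, ⟨23, 54, 98, 15⟩, ⟨23, 54, 104, 69⟩, ⟨23, 54, 107, 58⟩, ⟨23, 54, 108, 61⟩,
   ⟨23, 66, 100, 17⟩, ⟨23, 68, 90, 222⟩, ⟨23, 68, 107, 37⟩, ⟨23, 72, 102, 48⟩, ⟨23, 75, 104, 33⟩,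
   ⟨23, 78, 96, 109⟩, ⟨23, 78, 108, 86⟩, ⟨23, 80, 90, 42⟩, ⟨23, 80, 100, 20⟩, ⟨23, 80, 104, 721⟩,
   ⟨23, 80, 107, 49⟩, ⟨23, 80, 110, 78⟩, ⟨23, 84, 84, 283⟩, ⟨23, 90, 108, 23⟩, ⟨23, 92, 107, 16⟩,
   ⟨23, 93, 107, 35⟩, ⟨23, 96, 96, 30⟩, ⟨23, 96, 108, 27⟩, ⟨23, 96, 110, 28⟩, ⟨23, 96, 112, 6⟩,
   ⟨23, 96, 114, 5⟩, ⟨23, 96, 116, 3⟩, ⟨23, 100, 100, 14⟩, ⟨23, 104, 104, 105⟩, ⟨23, 104, 108, 14⟩,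
   ⟨23, 104, 110, 15⟩, ⟨23, 105, 107, 30⟩, ⟨23, 106, 108, 9⟩, ⟨23, 107, 108, 18⟩,
   ⟨23, 108, 108, 43⟩, ⟨23, 108, 110, 13⟩, ⟨23, 110, 110, 19⟩, ⟨24, 24, 96, 232⟩, ⟨24, 24, 98, 232⟩,
   ⟨24, 24, 100, 232⟩, ⟨24, 24, 102, 232⟩, ⟨24, 24, 107, 28⟩, ⟨24, 24, 108, 109⟩, ⟨24, 30, 96, 111⟩,
   ⟨24, 30, 98, 111⟩, ⟨24, 30, 100, 111⟩, ⟨24, 30, 102, 161⟩, ⟨24, 36, 90, 94⟩, ⟨24, 36, 93, 9⟩,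
   ⟨24, 36, 96, 7⟩, ⟨24, 36, 102, 7⟩, ⟨24, 38, 92, 8⟩, ⟨24, 38, 108, 16⟩, ⟨24, 40, 100, 434⟩,
   ⟨24, 40, 104, 492⟩, ⟨24, 40, 108, 502⟩, ⟨24, 44, 108, 65⟩, ⟨24, 45, 108, 53⟩, ⟨24, 50, 90, 62⟩,
   ⟨24, 50, 93, 61⟩, ⟨24, 50, 96, 57⟩, ⟨24, 52, 90, 114⟩, ⟨24, 52, 93, 110⟩, ⟨24, 52, 96, 32⟩,
   ⟨24, 52, 98, 48⟩, ⟨24, 52, 107, 49⟩, ⟨24, 53, 90, 346⟩, ⟨24, 53, 107, 52⟩, ⟨24, 53, 108, 46⟩,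
   ⟨24, 54, 106, 60⟩, ⟨24, 54, 107, 66⟩, ⟨24, 54, 108, 83⟩, ⟨24, 60, 100, 2970⟩, ⟨24, 68, 90, 249⟩,
   ⟨24, 68, 102, 23⟩, ⟨24, 70, 94, 12⟩, ⟨24, 70, 98, 32⟩, ⟨24, 70, 100, 36⟩, ⟨24, 70, 108, 49⟩,
   ⟨24, 72, 98, 97⟩, ⟨24, 72, 102, 238⟩, ⟨24, 75, 104, 546⟩, ⟨24, 78, 98, 19⟩, ⟨24, 78, 104, 92⟩,
   ⟨24, 80, 80, 190⟩, ⟨24, 80, 92, 558⟩, ⟨24, 80, 94, 81⟩, ⟨24, 80, 98, 111⟩, ⟨24, 80, 100, 114⟩,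
   ⟨24, 84, 84, 226⟩, ⟨24, 90, 96, 455⟩, ⟨24, 90, 108, 118⟩, ⟨24, 96, 96, 378⟩, ⟨24, 96, 104, 88⟩,
   ⟨24, 96, 107, 18⟩, ⟨24, 96, 108, 85⟩, ⟨24, 96, 110, 95⟩, ⟨24, 96, 112, 8⟩, ⟨24, 96, 114, 5⟩,
   ⟨24, 96, 116, 3⟩, ⟨24, 98, 98, 37⟩, ⟨24, 100, 100, 27⟩, ⟨24, 100, 102, 10⟩, ⟨24, 102, 102, 17⟩,
   ⟨24, 104, 104, 673⟩, ⟨24, 104, 110, 16⟩, ⟨24, 107, 107, 145⟩, ⟨24, 108, 108, 73⟩,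
   ⟨24, 108, 110, 17⟩, ⟨24, 110, 110, 22⟩, ⟨26, 26, 90, 61⟩, ⟨26, 26, 92, 2⟩, ⟨26, 26, 93, 2⟩,
   ⟨26, 26, 94, 2⟩, ⟨26, 26, 107, 9⟩, ⟨26, 26, 108, 17⟩, ⟨26, 28, 90, 121⟩, ⟨26, 28, 92, 1⟩,
   ⟨26, 28, 94, 1⟩, ⟨26, 28, 108, 13⟩, ⟨26, 30, 92, 2⟩, ⟨26, 30, 93, 2⟩, ⟨26, 30, 94, 2⟩,
   ⟨26, 52, 108, 2⟩, ⟨26, 53, 106, 2⟩, ⟨26, 54, 107, 2⟩, ⟨26, 56, 105, 1⟩, ⟨26, 56, 108, 2⟩,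
   ⟨26, 60, 104, 7⟩, ⟨26, 60, 107, 31⟩, ⟨26, 60, 108, 126⟩, ⟨26, 66, 108, 63⟩, ⟨26, 68, 107, 21⟩,
   ⟨26, 68, 108, 31⟩, ⟨26, 70, 90, 36⟩, ⟨26, 70, 93, 6⟩, ⟨26, 70, 94, 6⟩, ⟨26, 70, 107, 15⟩,
   ⟨26, 70, 108, 18⟩, ⟨26, 78, 108, 38⟩, ⟨26, 78, 110, 42⟩, ⟨26, 80, 107, 38⟩, ⟨26, 80, 108, 55⟩,
   ⟨26, 80, 110, 63⟩, ⟨28, 28, 90, 212⟩, ⟨28, 28, 108, 129⟩, ⟨28, 30, 90, 5⟩, ⟨28, 50, 90, 8⟩,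
   ⟨28, 52, 108, 2⟩, ⟨28, 53, 105, 2⟩, ⟨28, 53, 108, 2⟩, ⟨28, 54, 94, 8⟩, ⟨28, 54, 108, 2⟩,
   ⟨28, 56, 90, 7⟩, ⟨28, 56, 93, 3⟩, ⟨28, 56, 107, 2⟩, ⟨28, 56, 108, 2⟩, ⟨28, 60, 104, 7⟩,
   ⟨28, 60, 106, 11⟩, ⟨28, 60, 107, 36⟩, ⟨28, 60, 108, 182⟩, ⟨28, 66, 90, 272⟩, ⟨28, 66, 107, 25⟩,
   ⟨28, 68, 108, 33⟩, ⟨28, 70, 107, 15⟩, ⟨28, 70, 108, 20⟩, ⟨30, 30, 90, 1365⟩, ⟨30, 30, 92, 1365⟩,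
   ⟨30, 30, 105, 1444⟩, ⟨30, 30, 107, 1444⟩, ⟨30, 50, 90, 447⟩, ⟨30, 50, 94, 395⟩,
   ⟨30, 50, 104, 424⟩, ⟨30, 50, 108, 398⟩, ⟨30, 52, 90, 171⟩, ⟨30, 52, 107, 115⟩, ⟨30, 53, 93, 356⟩,
   ⟨30, 53, 106, 109⟩, ⟨30, 53, 107, 102⟩, ⟨30, 53, 108, 54⟩, ⟨30, 54, 105, 118⟩,
   ⟨30, 54, 107, 105⟩, ⟨30, 54, 108, 90⟩, ⟨30, 56, 90, 280⟩, ⟨30, 56, 93, 60⟩, ⟨30, 56, 94, 70⟩,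
   ⟨30, 56, 107, 51⟩, ⟨30, 60, 90, 55⟩, ⟨30, 60, 93, 18⟩, ⟨30, 60, 96, 957⟩, ⟨30, 60, 100, 376⟩,
   ⟨30, 60, 102, 376⟩, ⟨30, 60, 104, 50⟩, ⟨30, 60, 105, 127⟩, ⟨30, 60, 106, 127⟩,
   ⟨30, 60, 107, 354⟩, ⟨30, 66, 90, 356⟩, ⟨30, 66, 92, 131⟩, ⟨30, 66, 94, 321⟩, ⟨30, 66, 102, 76⟩,
   ⟨30, 66, 104, 1019⟩, ⟨30, 66, 106, 69⟩, ⟨30, 66, 108, 97⟩, ⟨30, 68, 92, 58⟩, ⟨30, 68, 93, 62⟩,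
   ⟨30, 70, 90, 706⟩, ⟨30, 70, 94, 225⟩, ⟨30, 70, 96, 419⟩, ⟨30, 70, 100, 1059⟩, ⟨30, 70, 107, 206⟩,
   ⟨30, 70, 108, 206⟩, ⟨30, 75, 90, 10⟩, ⟨30, 75, 107, 95⟩, ⟨30, 75, 108, 95⟩, ⟨30, 75, 110, 99⟩,
   ⟨30, 75, 112, 25⟩, ⟨30, 76, 92, 63⟩, ⟨30, 76, 105, 51⟩, ⟨30, 76, 107, 16⟩, ⟨30, 76, 108, 17⟩,
   ⟨30, 76, 110, 19⟩, ⟨30, 76, 112, 12⟩, ⟨30, 78, 108, 15⟩, ⟨30, 78, 110, 18⟩, ⟨30, 80, 106, 18⟩,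
   ⟨30, 80, 107, 33⟩, ⟨30, 80, 108, 60⟩, ⟨30, 80, 110, 130⟩, ⟨30, 80, 112, 27⟩, ⟨30, 80, 114, 15⟩,
   ⟨30, 80, 116, 9⟩, ⟨30, 90, 90, 6347⟩, ⟨30, 90, 92, 8⟩, ⟨30, 90, 93, 8⟩, ⟨30, 90, 94, 9⟩,
   ⟨30, 90, 100, 656⟩, ⟨30, 90, 102, 191⟩, ⟨30, 90, 104, 48⟩, ⟨30, 90, 105, 410⟩, ⟨30, 90, 106, 81⟩,
   ⟨30, 90, 107, 669⟩, ⟨30, 90, 108, 184⟩, ⟨30, 90, 114, 5⟩, ⟨30, 90, 116, 2⟩, ⟨30, 92, 93, 4⟩,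
   ⟨30, 92, 94, 4⟩, ⟨30, 92, 104, 7⟩, ⟨30, 92, 105, 10⟩, ⟨30, 92, 110, 14⟩, ⟨30, 92, 114, 4⟩,
   ⟨30, 92, 116, 2⟩, ⟨30, 93, 93, 8⟩, ⟨30, 93, 94, 4⟩, ⟨30, 93, 105, 9⟩, ⟨30, 93, 107, 12⟩,
   ⟨30, 93, 114, 3⟩, ⟨30, 93, 116, 2⟩, ⟨30, 94, 94, 9⟩, ⟨30, 94, 105, 10⟩, ⟨30, 94, 110, 12⟩,
   ⟨30, 96, 96, 607⟩, ⟨30, 96, 100, 67⟩, ⟨30, 96, 102, 39⟩, ⟨30, 96, 105, 28⟩, ⟨30, 96, 107, 116⟩,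
   ⟨30, 96, 108, 184⟩, ⟨30, 96, 110, 200⟩, ⟨30, 96, 112, 7⟩, ⟨30, 96, 114, 5⟩, ⟨30, 96, 116, 3⟩,
   ⟨30, 98, 102, 44⟩, ⟨30, 100, 100, 1714⟩, ⟨30, 100, 102, 33⟩, ⟨30, 102, 102, 136⟩,
   ⟨30, 104, 104, 93⟩, ⟨30, 104, 108, 41⟩, ⟨30, 105, 108, 113⟩, ⟨30, 105, 110, 199⟩,
   ⟨30, 106, 107, 54⟩, ⟨30, 108, 108, 117⟩, ⟨30, 108, 110, 92⟩, ⟨30, 110, 110, 174⟩,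
   ⟨32, 34, 86, 5⟩, ⟨32, 34, 87, 5⟩, ⟨32, 34, 88, 6⟩, ⟨32, 34, 112, 14⟩, ⟨32, 36, 90, 13⟩,
   ⟨32, 36, 107, 9⟩, ⟨32, 38, 108, 12⟩, ⟨32, 38, 112, 10⟩, ⟨32, 40, 84, 392⟩, ⟨32, 40, 92, 220⟩,
   ⟨32, 40, 93, 234⟩, ⟨32, 40, 104, 47⟩, ⟨32, 40, 105, 216⟩, ⟨32, 40, 107, 236⟩, ⟨32, 40, 108, 236⟩,
   ⟨32, 40, 110, 236⟩, ⟨32, 40, 116, 24⟩, ⟨32, 80, 80, 1176⟩, ⟨34, 34, 84, 9⟩, ⟨34, 34, 87, 11⟩,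
   ⟨34, 34, 105, 11⟩, ⟨34, 34, 106, 11⟩, ⟨34, 36, 86, 8⟩, ⟨34, 36, 88, 11⟩, ⟨34, 36, 96, 14⟩,
   ⟨34, 36, 105, 9⟩, ⟨34, 38, 86, 8⟩, ⟨34, 38, 87, 10⟩, ⟨34, 38, 90, 17⟩, ⟨34, 38, 102, 8⟩,
   ⟨34, 40, 86, 26⟩, ⟨34, 40, 90, 173⟩, ⟨34, 40, 93, 19⟩, ⟨34, 40, 98, 13⟩, ⟨34, 40, 108, 20⟩,
   ⟨34, 50, 105, 10⟩, ⟨34, 50, 110, 1⟩, ⟨34, 50, 112, 1⟩, ⟨34, 50, 114, 1⟩, ⟨34, 50, 116, 1⟩,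
   ⟨34, 52, 110, 1⟩, ⟨34, 52, 112, 1⟩, ⟨34, 52, 114, 1⟩, ⟨34, 52, 116, 1⟩, ⟨34, 53, 105, 18⟩,
   ⟨34, 53, 107, 12⟩, ⟨34, 53, 108, 8⟩, ⟨34, 53, 110, 1⟩, ⟨34, 53, 112, 1⟩, ⟨34, 53, 114, 1⟩,
   ⟨34, 53, 116, 1⟩, ⟨34, 56, 107, 10⟩, ⟨34, 56, 108, 9⟩, ⟨34, 56, 112, 1⟩, ⟨34, 60, 107, 4⟩,
   ⟨34, 60, 108, 4⟩, ⟨34, 62, 110, 1⟩, ⟨34, 64, 107, 7⟩, ⟨34, 64, 108, 7⟩, ⟨34, 70, 110, 1⟩,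
   ⟨34, 72, 104, 16⟩, ⟨34, 72, 108, 12⟩, ⟨34, 75, 112, 7⟩, ⟨34, 78, 108, 9⟩, ⟨34, 80, 80, 5⟩,
   ⟨34, 80, 96, 25⟩, ⟨34, 80, 98, 11⟩, ⟨34, 80, 104, 17⟩, ⟨34, 80, 108, 218⟩, ⟨36, 36, 87, 54⟩,
   ⟨36, 36, 94, 45⟩, ⟨36, 36, 96, 85⟩, ⟨36, 36, 98, 54⟩, ⟨36, 38, 94, 11⟩, ⟨36, 38, 96, 15⟩,
   ⟨36, 38, 98, 13⟩, ⟨36, 38, 100, 11⟩, ⟨36, 38, 102, 14⟩, ⟨36, 38, 106, 21⟩, ⟨36, 38, 108, 33⟩,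
   ⟨36, 38, 114, 11⟩, ⟨36, 40, 94, 24⟩, ⟨36, 40, 96, 33⟩, ⟨36, 40, 98, 25⟩, ⟨36, 40, 100, 21⟩,
   ⟨36, 40, 105, 72⟩, ⟨36, 40, 107, 75⟩, ⟨36, 40, 112, 31⟩, ⟨36, 50, 81, 2⟩, ⟨36, 50, 84, 2⟩,
   ⟨36, 50, 86, 2⟩, ⟨36, 50, 88, 3⟩, ⟨36, 50, 90, 14⟩, ⟨36, 50, 96, 7⟩, ⟨36, 50, 102, 17⟩,
   ⟨36, 50, 110, 1⟩, ⟨36, 50, 112, 1⟩, ⟨36, 50, 114, 1⟩, ⟨36, 50, 116, 1⟩, ⟨36, 52, 84, 2⟩,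
   ⟨36, 52, 90, 15⟩, ⟨36, 52, 92, 24⟩, ⟨36, 52, 93, 80⟩, ⟨36, 52, 96, 8⟩, ⟨36, 52, 98, 7⟩,
   ⟨36, 52, 105, 42⟩, ⟨36, 52, 108, 13⟩, ⟨36, 53, 90, 35⟩, ⟨36, 53, 92, 102⟩, ⟨36, 53, 96, 7⟩,
   ⟨36, 53, 108, 20⟩, ⟨36, 53, 110, 1⟩, ⟨36, 54, 87, 2⟩, ⟨36, 56, 80, 1⟩, ⟨36, 56, 86, 2⟩,
   ⟨36, 56, 90, 59⟩, ⟨36, 56, 96, 10⟩, ⟨36, 56, 106, 26⟩, ⟨36, 56, 107, 24⟩, ⟨36, 56, 108, 21⟩,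
   ⟨36, 60, 92, 7⟩, ⟨36, 60, 98, 7⟩, ⟨36, 60, 102, 7⟩, ⟨36, 60, 104, 4⟩, ⟨36, 60, 107, 7⟩,
   ⟨36, 60, 108, 8⟩, ⟨36, 62, 93, 8⟩, ⟨36, 62, 108, 11⟩, ⟨36, 62, 114, 1⟩, ⟨36, 64, 90, 182⟩,
   ⟨36, 64, 98, 7⟩, ⟨36, 64, 106, 12⟩, ⟨36, 64, 107, 13⟩, ⟨36, 64, 108, 14⟩, ⟨36, 66, 110, 1⟩,
   ⟨36, 66, 112, 1⟩, ⟨36, 68, 93, 26⟩, ⟨36, 70, 92, 15⟩, ⟨36, 70, 106, 10⟩, ⟨36, 70, 108, 10⟩,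
   ⟨36, 72, 90, 28⟩, ⟨36, 72, 92, 18⟩, ⟨36, 72, 104, 316⟩, ⟨36, 72, 108, 18⟩, ⟨36, 74, 96, 17⟩,
   ⟨36, 74, 112, 6⟩, ⟨36, 74, 114, 5⟩, ⟨36, 78, 90, 10⟩, ⟨36, 78, 92, 18⟩, ⟨36, 78, 93, 21⟩,
   ⟨36, 80, 87, 341⟩, ⟨36, 80, 96, 783⟩, ⟨36, 80, 104, 63⟩, ⟨36, 80, 106, 37⟩, ⟨36, 80, 116, 35⟩,
   ⟨36, 84, 84, 64⟩, ⟨36, 87, 87, 55⟩, ⟨36, 96, 96, 23⟩, ⟨36, 96, 104, 335⟩, ⟨36, 96, 105, 1⟩,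
   ⟨36, 96, 106, 1⟩, ⟨36, 96, 112, 16⟩, ⟨36, 104, 112, 24⟩, ⟨36, 107, 107, 112⟩, ⟨36, 108, 108, 74⟩,
   ⟨36, 108, 110, 10⟩, ⟨36, 110, 110, 12⟩, ⟨38, 38, 93, 46⟩, ⟨38, 38, 94, 20⟩, ⟨38, 38, 96, 26⟩,
   ⟨38, 38, 98, 23⟩, ⟨38, 38, 100, 21⟩, ⟨38, 38, 108, 29⟩, ⟨38, 40, 92, 38⟩, ⟨38, 40, 93, 39⟩,
   ⟨38, 40, 94, 18⟩, ⟨38, 40, 96, 23⟩, ⟨38, 40, 98, 21⟩, ⟨38, 40, 100, 20⟩, ⟨38, 40, 102, 23⟩,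
   ⟨38, 40, 107, 24⟩, ⟨38, 40, 114, 14⟩, ⟨38, 50, 82, 1⟩, ⟨38, 50, 90, 9⟩, ⟨38, 50, 108, 9⟩,
   ⟨38, 50, 114, 1⟩, ⟨38, 52, 90, 11⟩, ⟨38, 52, 96, 10⟩, ⟨38, 52, 100, 9⟩, ⟨38, 52, 107, 20⟩,
   ⟨38, 53, 87, 2⟩, ⟨38, 53, 92, 23⟩, ⟨38, 53, 93, 115⟩, ⟨38, 53, 96, 6⟩, ⟨38, 53, 107, 67⟩,
   ⟨38, 54, 84, 2⟩, ⟨38, 54, 90, 11⟩, ⟨38, 54, 92, 17⟩, ⟨38, 56, 88, 2⟩, ⟨38, 56, 90, 28⟩,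
   ⟨38, 56, 94, 6⟩, ⟨38, 56, 107, 11⟩, ⟨38, 56, 108, 10⟩, ⟨38, 56, 110, 1⟩, ⟨38, 56, 114, 1⟩,
   ⟨38, 56, 116, 1⟩, ⟨38, 60, 102, 7⟩, ⟨38, 60, 107, 8⟩, ⟨38, 60, 108, 8⟩, ⟨38, 60, 110, 1⟩,
   ⟨38, 60, 112, 1⟩, ⟨38, 60, 114, 1⟩, ⟨38, 60, 116, 1⟩, ⟨38, 62, 90, 6⟩, ⟨38, 62, 102, 7⟩,
   ⟨38, 62, 107, 10⟩, ⟨38, 62, 110, 1⟩, ⟨38, 62, 112, 1⟩, ⟨38, 62, 114, 1⟩, ⟨38, 62, 116, 1⟩,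
   ⟨38, 64, 96, 7⟩, ⟨38, 64, 107, 11⟩, ⟨38, 64, 112, 1⟩, ⟨38, 64, 114, 1⟩, ⟨38, 64, 116, 1⟩,
   ⟨38, 66, 104, 7⟩, ⟨38, 66, 114, 1⟩, ⟨38, 68, 93, 8⟩, ⟨38, 68, 94, 6⟩, ⟨38, 68, 104, 8⟩,
   ⟨38, 68, 112, 1⟩, ⟨38, 70, 92, 6⟩, ⟨38, 70, 94, 5⟩, ⟨38, 70, 104, 7⟩, ⟨38, 70, 112, 1⟩,
   ⟨38, 72, 90, 49⟩, ⟨38, 72, 93, 27⟩, ⟨38, 72, 104, 175⟩, ⟨38, 72, 105, 16⟩, ⟨38, 74, 112, 4⟩,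
   ⟨38, 76, 90, 145⟩, ⟨38, 76, 96, 54⟩, ⟨38, 78, 96, 16⟩, ⟨38, 80, 87, 252⟩, ⟨38, 80, 96, 55⟩,
   ⟨38, 80, 100, 81⟩, ⟨38, 80, 104, 11⟩, ⟨38, 80, 105, 24⟩, ⟨38, 80, 108, 28⟩, ⟨38, 80, 116, 11⟩,
   ⟨38, 84, 84, 217⟩, ⟨38, 87, 87, 67⟩, ⟨38, 96, 96, 46⟩, ⟨38, 96, 104, 235⟩, ⟨38, 96, 107, 33⟩,
   ⟨38, 96, 108, 347⟩, ⟨38, 104, 112, 8⟩, ⟨38, 106, 108, 4⟩, ⟨38, 107, 108, 17⟩, ⟨38, 108, 108, 40⟩,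
   ⟨38, 108, 110, 8⟩, ⟨38, 110, 110, 10⟩, ⟨38, 110, 112, 3⟩, ⟨38, 112, 112, 5⟩,
   ⟨40, 40, 80, 130848⟩, ⟨40, 40, 90, 15110⟩, ⟨40, 40, 94, 15108⟩, ⟨40, 40, 96, 15108⟩,
   ⟨40, 40, 98, 15108⟩, ⟨40, 40, 100, 15108⟩, ⟨40, 40, 104, 15110⟩, ⟨40, 40, 106, 15110⟩,
   ⟨40, 40, 108, 15108⟩, ⟨40, 50, 90, 50⟩, ⟨40, 50, 96, 66⟩, ⟨40, 50, 105, 215⟩, ⟨40, 50, 110, 1⟩,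
   ⟨40, 52, 82, 2⟩, ⟨40, 52, 84, 2⟩, ⟨40, 52, 86, 2⟩, ⟨40, 52, 90, 380⟩, ⟨40, 52, 100, 39⟩,
   ⟨40, 52, 108, 340⟩, ⟨40, 52, 110, 1⟩, ⟨40, 53, 86, 2⟩, ⟨40, 53, 96, 14⟩, ⟨40, 53, 100, 11⟩,
   ⟨40, 53, 106, 24⟩, ⟨40, 53, 112, 1⟩, ⟨40, 54, 90, 160⟩, ⟨40, 56, 86, 2⟩, ⟨40, 56, 87, 2⟩,
   ⟨40, 56, 88, 3⟩, ⟨40, 56, 94, 17⟩, ⟨40, 56, 96, 248⟩, ⟨40, 56, 98, 33⟩, ⟨40, 56, 102, 90⟩,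
   ⟨40, 56, 108, 1072⟩, ⟨40, 60, 90, 42⟩, ⟨40, 60, 92, 15⟩, ⟨40, 60, 93, 16⟩, ⟨40, 60, 96, 850⟩,
   ⟨40, 60, 98, 850⟩, ⟨40, 60, 100, 659⟩, ⟨40, 60, 102, 317⟩, ⟨40, 60, 107, 214⟩, ⟨40, 60, 110, 1⟩,
   ⟨40, 62, 90, 13⟩, ⟨40, 62, 92, 11⟩, ⟨40, 62, 93, 11⟩, ⟨40, 62, 98, 523⟩, ⟨40, 62, 100, 354⟩,
   ⟨40, 62, 107, 158⟩, ⟨40, 62, 110, 1⟩, ⟨40, 64, 90, 361⟩, ⟨40, 64, 92, 361⟩, ⟨40, 64, 93, 642⟩,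
   ⟨40, 64, 98, 193⟩, ⟨40, 64, 100, 193⟩, ⟨40, 64, 108, 478⟩, ⟨40, 64, 110, 1⟩, ⟨40, 64, 116, 1⟩,
   ⟨40, 66, 90, 68⟩, ⟨40, 66, 92, 55⟩, ⟨40, 66, 93, 64⟩, ⟨40, 66, 104, 408⟩, ⟨40, 66, 112, 1⟩,
   ⟨40, 68, 93, 130⟩, ⟨40, 68, 108, 291⟩, ⟨40, 70, 90, 332⟩, ⟨40, 70, 94, 18⟩, ⟨40, 70, 104, 72⟩,
   ⟨40, 70, 110, 1⟩, ⟨40, 72, 112, 586⟩, ⟨40, 72, 116, 47⟩, ⟨40, 74, 104, 16⟩, ⟨40, 74, 112, 5⟩,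
   ⟨40, 74, 114, 4⟩, ⟨40, 75, 96, 93⟩, ⟨40, 75, 105, 8⟩, ⟨40, 75, 107, 7⟩, ⟨40, 76, 96, 141⟩,
   ⟨40, 76, 98, 15⟩, ⟨40, 76, 105, 11⟩, ⟨40, 78, 114, 9⟩, ⟨40, 80, 80, 247854⟩, ⟨40, 80, 96, 594⟩,
   ⟨40, 80, 100, 128⟩, ⟨40, 80, 104, 1340⟩, ⟨40, 80, 107, 323⟩, ⟨40, 96, 105, 1⟩, ⟨40, 96, 106, 1⟩,
   ⟨40, 104, 104, 872⟩, ⟨40, 104, 108, 67⟩, ⟨40, 105, 105, 1⟩, ⟨40, 105, 107, 2⟩, ⟨40, 105, 110, 2⟩,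
   ⟨40, 106, 107, 4⟩, ⟨40, 106, 108, 4⟩, ⟨40, 107, 107, 74⟩, ⟨40, 107, 108, 17⟩, ⟨40, 108, 108, 34⟩,
   ⟨40, 108, 110, 8⟩, ⟨40, 108, 112, 4⟩, ⟨40, 110, 110, 10⟩, ⟨40, 112, 112, 5⟩, ⟨42, 84, 107, 25⟩,
   ⟨42, 84, 108, 231⟩, ⟨42, 86, 107, 42⟩, ⟨42, 90, 90, 14⟩, ⟨42, 90, 92, 8⟩, ⟨42, 90, 93, 8⟩,
   ⟨42, 90, 96, 306⟩, ⟨42, 90, 107, 22⟩, ⟨42, 92, 107, 41⟩, ⟨42, 92, 108, 46⟩, ⟨42, 93, 93, 60⟩,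
   ⟨42, 93, 96, 203⟩, ⟨42, 93, 107, 101⟩, ⟨44, 44, 86, 1⟩, ⟨44, 44, 93, 60⟩, ⟨44, 44, 105, 64⟩,
   ⟨44, 44, 106, 11⟩, ⟨44, 44, 114, 1⟩, ⟨44, 45, 86, 1⟩, ⟨44, 45, 105, 35⟩, ⟨44, 45, 106, 5⟩,
   ⟨44, 60, 90, 4⟩, ⟨44, 60, 92, 3⟩, ⟨44, 60, 93, 3⟩, ⟨44, 62, 90, 4⟩, ⟨44, 62, 92, 3⟩,
   ⟨44, 62, 93, 3⟩, ⟨44, 64, 94, 12⟩, ⟨44, 68, 92, 36⟩, ⟨44, 70, 93, 22⟩, ⟨44, 74, 96, 22⟩,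
   ⟨44, 74, 100, 20⟩, ⟨44, 74, 102, 16⟩, ⟨44, 74, 104, 7⟩, ⟨44, 74, 105, 4⟩, ⟨44, 74, 106, 4⟩,
   ⟨44, 74, 107, 4⟩, ⟨44, 74, 110, 5⟩, ⟨44, 74, 112, 4⟩, ⟨44, 74, 114, 4⟩, ⟨44, 75, 96, 12⟩,
   ⟨44, 75, 98, 9⟩, ⟨44, 75, 100, 12⟩, ⟨44, 75, 102, 11⟩, ⟨44, 75, 104, 6⟩, ⟨44, 75, 105, 5⟩,
   ⟨44, 75, 106, 5⟩, ⟨44, 75, 107, 6⟩, ⟨44, 75, 108, 6⟩, ⟨44, 75, 110, 6⟩, ⟨44, 75, 112, 5⟩,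
   ⟨44, 75, 114, 4⟩, ⟨44, 75, 116, 4⟩, ⟨44, 76, 96, 13⟩, ⟨44, 76, 98, 9⟩, ⟨44, 76, 100, 16⟩,
   ⟨44, 76, 102, 13⟩, ⟨44, 76, 105, 6⟩, ⟨44, 76, 106, 6⟩, ⟨44, 76, 107, 6⟩, ⟨44, 76, 110, 7⟩,
   ⟨44, 76, 112, 6⟩, ⟨44, 76, 114, 5⟩, ⟨44, 76, 116, 5⟩, ⟨44, 78, 96, 10⟩, ⟨44, 78, 98, 8⟩,
   ⟨44, 78, 100, 11⟩, ⟨44, 78, 102, 10⟩, ⟨44, 80, 96, 11⟩, ⟨44, 80, 102, 9⟩, ⟨44, 80, 104, 1⟩,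
   ⟨44, 90, 96, 6⟩, ⟨44, 92, 92, 47⟩, ⟨44, 92, 96, 5⟩, ⟨44, 92, 108, 21⟩, ⟨44, 93, 93, 27⟩,
   ⟨44, 93, 107, 12⟩, ⟨44, 93, 110, 13⟩, ⟨44, 94, 104, 6⟩, ⟨44, 96, 96, 188⟩, ⟨44, 96, 104, 239⟩,
   ⟨44, 102, 104, 12⟩, ⟨44, 102, 107, 1⟩, ⟨44, 102, 112, 1⟩, ⟨44, 104, 104, 546⟩, ⟨44, 104, 107, 1⟩,
   ⟨44, 104, 110, 1⟩, ⟨44, 105, 112, 1⟩, ⟨44, 106, 108, 1⟩, ⟨44, 106, 110, 1⟩, ⟨44, 107, 107, 1⟩,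
   ⟨44, 108, 110, 1⟩, ⟨44, 108, 112, 1⟩, ⟨44, 110, 112, 1⟩, ⟨44, 112, 112, 1⟩, ⟨44, 116, 116, 1⟩,
   ⟨45, 45, 90, 13⟩, ⟨45, 45, 92, 69⟩, ⟨45, 45, 105, 83⟩, ⟨45, 45, 107, 121⟩, ⟨45, 47, 90, 49⟩,
   ⟨45, 47, 105, 84⟩, ⟨45, 60, 90, 4⟩, ⟨45, 60, 92, 4⟩, ⟨45, 60, 93, 4⟩, ⟨45, 62, 90, 4⟩,
   ⟨45, 62, 92, 3⟩, ⟨45, 62, 93, 4⟩, ⟨45, 68, 90, 206⟩, ⟨45, 74, 100, 23⟩, ⟨45, 75, 100, 13⟩,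
   ⟨45, 75, 102, 12⟩, ⟨45, 75, 110, 42⟩, ⟨45, 75, 112, 21⟩, ⟨45, 76, 96, 17⟩, ⟨45, 76, 100, 19⟩,
   ⟨45, 76, 107, 107⟩, ⟨45, 78, 98, 8⟩, ⟨45, 78, 105, 2⟩, ⟨45, 80, 96, 13⟩, ⟨45, 80, 100, 12⟩,
   ⟨45, 81, 84, 7⟩, ⟨45, 82, 84, 29⟩, ⟨45, 90, 90, 296⟩, ⟨45, 90, 93, 50⟩, ⟨45, 90, 94, 62⟩,
   ⟨45, 90, 96, 7⟩, ⟨45, 90, 107, 295⟩, ⟨45, 92, 93, 51⟩, ⟨45, 92, 96, 5⟩, ⟨45, 92, 105, 282⟩,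
   ⟨45, 93, 93, 54⟩, ⟨45, 93, 105, 19⟩, ⟨45, 94, 94, 55⟩, ⟨45, 94, 108, 189⟩, ⟨45, 96, 104, 23⟩,
   ⟨45, 98, 105, 1⟩, ⟨45, 98, 110, 1⟩, ⟨45, 100, 104, 26⟩, ⟨45, 102, 104, 7⟩, ⟨45, 102, 106, 1⟩,
   ⟨45, 102, 108, 1⟩, ⟨45, 102, 110, 1⟩, ⟨45, 104, 108, 1⟩, ⟨45, 105, 105, 127⟩, ⟨45, 105, 106, 24⟩,
   ⟨45, 105, 112, 17⟩, ⟨45, 105, 114, 7⟩, ⟨45, 106, 108, 68⟩, ⟨45, 106, 112, 9⟩, ⟨45, 106, 114, 5⟩,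
   ⟨45, 107, 114, 6⟩, ⟨45, 108, 108, 307⟩, ⟨46, 60, 90, 4⟩, ⟨46, 60, 92, 3⟩, ⟨46, 62, 92, 4⟩,
   ⟨46, 66, 92, 42⟩, ⟨46, 70, 90, 18⟩, ⟨46, 70, 92, 12⟩, ⟨46, 74, 96, 176⟩, ⟨46, 74, 98, 24⟩,
   ⟨46, 75, 102, 18⟩, ⟨46, 75, 104, 8⟩, ⟨46, 76, 96, 37⟩, ⟨46, 76, 105, 15⟩, ⟨46, 76, 112, 35⟩,
   ⟨46, 78, 98, 11⟩, ⟨46, 78, 102, 16⟩, ⟨46, 78, 108, 2⟩, ⟨46, 80, 96, 24⟩, ⟨46, 80, 100, 20⟩,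
   ⟨46, 80, 104, 1⟩, ⟨46, 90, 90, 261⟩, ⟨46, 90, 108, 67⟩, ⟨46, 90, 110, 55⟩, ⟨46, 92, 104, 29⟩,
   ⟨46, 93, 106, 26⟩, ⟨46, 94, 106, 16⟩, ⟨46, 94, 108, 105⟩, ⟨46, 96, 96, 381⟩, ⟨46, 96, 104, 140⟩,
   ⟨46, 96, 106, 1⟩, ⟨46, 98, 105, 1⟩, ⟨46, 98, 108, 1⟩, ⟨46, 100, 104, 172⟩, ⟨46, 102, 104, 10⟩,
   ⟨46, 104, 104, 101⟩, ⟨46, 106, 107, 1⟩, ⟨46, 106, 108, 1⟩, ⟨46, 107, 107, 3⟩, ⟨46, 107, 112, 1⟩,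
   ⟨47, 47, 87, 2⟩, ⟨47, 47, 88, 2⟩, ⟨47, 47, 90, 779⟩, ⟨47, 47, 92, 779⟩, ⟨47, 47, 105, 462⟩,
   ⟨47, 60, 92, 4⟩, ⟨47, 60, 93, 4⟩, ⟨47, 62, 90, 5⟩, ⟨47, 64, 92, 27⟩, ⟨47, 64, 93, 26⟩,
   ⟨47, 84, 107, 56⟩, ⟨47, 86, 107, 39⟩, ⟨47, 87, 107, 48⟩, ⟨48, 74, 96, 170⟩, ⟨48, 75, 96, 27⟩,
   ⟨48, 75, 102, 12⟩, ⟨48, 76, 96, 33⟩, ⟨48, 78, 96, 18⟩, ⟨48, 78, 98, 10⟩, ⟨48, 80, 96, 26⟩,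
   ⟨48, 80, 98, 12⟩, ⟨48, 80, 102, 12⟩, ⟨48, 84, 96, 62⟩, ⟨48, 84, 102, 83⟩, ⟨48, 84, 107, 194⟩,
   ⟨48, 84, 108, 128⟩, ⟨48, 84, 110, 21⟩, ⟨48, 86, 98, 5⟩, ⟨48, 86, 100, 8⟩, ⟨48, 86, 102, 5⟩,
   ⟨48, 86, 107, 9⟩, ⟨48, 86, 110, 6⟩, ⟨48, 86, 112, 4⟩, ⟨48, 86, 114, 3⟩, ⟨48, 96, 102, 7⟩,
   ⟨48, 96, 110, 56⟩, ⟨48, 96, 114, 12⟩, ⟨48, 98, 98, 25⟩, ⟨48, 98, 104, 9⟩, ⟨48, 98, 116, 50⟩,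
   ⟨48, 100, 100, 283⟩, ⟨48, 100, 102, 8⟩, ⟨48, 100, 104, 12⟩, ⟨48, 100, 108, 36⟩,
   ⟨48, 102, 104, 6⟩, ⟨48, 106, 110, 2⟩, ⟨48, 108, 108, 35⟩, ⟨48, 108, 110, 6⟩, ⟨48, 108, 112, 5⟩,
   ⟨48, 110, 110, 6⟩, ⟨48, 110, 112, 3⟩, ⟨48, 112, 112, 4⟩, ⟨50, 50, 87, 2⟩, ⟨50, 50, 88, 2⟩,
   ⟨50, 50, 90, 51⟩, ⟨50, 50, 92, 38⟩, ⟨50, 50, 104, 113⟩, ⟨50, 50, 106, 70⟩, ⟨50, 52, 82, 1⟩,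
   ⟨50, 52, 84, 1⟩, ⟨50, 52, 86, 1⟩, ⟨50, 52, 88, 1⟩, ⟨50, 52, 90, 54⟩, ⟨50, 52, 94, 7⟩,
   ⟨50, 52, 98, 28⟩, ⟨50, 52, 102, 11⟩, ⟨50, 52, 104, 59⟩, ⟨50, 52, 108, 266⟩, ⟨50, 53, 81, 1⟩,
   ⟨50, 53, 82, 1⟩, ⟨50, 53, 90, 37⟩, ⟨50, 53, 93, 18⟩, ⟨50, 54, 86, 1⟩, ⟨50, 54, 90, 62⟩,
   ⟨50, 54, 100, 14⟩, ⟨50, 54, 108, 88⟩, ⟨50, 54, 110, 1⟩, ⟨50, 60, 90, 77⟩, ⟨50, 60, 92, 26⟩,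
   ⟨50, 60, 102, 122⟩, ⟨50, 60, 106, 81⟩, ⟨50, 60, 108, 217⟩, ⟨50, 60, 110, 1⟩, ⟨50, 60, 112, 1⟩,
   ⟨50, 60, 114, 1⟩, ⟨50, 60, 116, 1⟩, ⟨50, 62, 92, 24⟩, ⟨50, 62, 110, 1⟩, ⟨50, 62, 114, 1⟩,
   ⟨50, 64, 90, 246⟩, ⟨50, 64, 94, 192⟩, ⟨50, 64, 104, 211⟩, ⟨50, 64, 105, 115⟩, ⟨50, 64, 106, 98⟩,
   ⟨50, 64, 116, 1⟩, ⟨50, 66, 90, 42⟩, ⟨50, 66, 92, 25⟩, ⟨50, 66, 93, 24⟩, ⟨50, 66, 104, 43⟩,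
   ⟨50, 66, 106, 16⟩, ⟨50, 66, 112, 1⟩, ⟨50, 68, 104, 47⟩, ⟨50, 68, 106, 21⟩, ⟨50, 68, 108, 68⟩,
   ⟨50, 70, 90, 246⟩, ⟨50, 70, 104, 65⟩, ⟨50, 70, 105, 29⟩, ⟨50, 70, 106, 29⟩, ⟨50, 70, 108, 265⟩,
   ⟨50, 75, 92, 7⟩, ⟨50, 75, 93, 7⟩, ⟨50, 75, 94, 3⟩, ⟨50, 75, 107, 14⟩, ⟨50, 75, 108, 14⟩,
   ⟨50, 76, 92, 14⟩, ⟨50, 76, 94, 3⟩, ⟨50, 76, 108, 24⟩, ⟨50, 76, 114, 14⟩, ⟨50, 78, 92, 43⟩,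
   ⟨50, 78, 93, 46⟩, ⟨50, 78, 94, 3⟩, ⟨50, 78, 100, 285⟩, ⟨50, 78, 110, 2⟩, ⟨50, 80, 92, 138⟩,
   ⟨50, 80, 93, 242⟩, ⟨50, 80, 96, 150⟩, ⟨50, 80, 98, 21⟩, ⟨50, 80, 100, 48⟩, ⟨50, 80, 105, 11⟩,
   ⟨50, 82, 84, 1⟩, ⟨50, 90, 90, 58⟩, ⟨50, 90, 92, 30⟩, ⟨50, 90, 93, 33⟩, ⟨50, 90, 94, 178⟩,
   ⟨50, 92, 94, 48⟩, ⟨50, 93, 93, 46⟩, ⟨50, 93, 94, 31⟩, ⟨50, 96, 98, 53⟩, ⟨50, 96, 102, 7⟩,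
   ⟨50, 96, 107, 30⟩, ⟨50, 100, 100, 1135⟩, ⟨50, 105, 108, 3⟩, ⟨50, 107, 107, 85⟩,
   ⟨50, 107, 108, 21⟩, ⟨50, 107, 110, 7⟩, ⟨50, 108, 108, 36⟩, ⟨50, 108, 110, 7⟩, ⟨50, 110, 110, 7⟩,
   ⟨52, 52, 81, 2⟩, ⟨52, 52, 82, 2⟩, ⟨52, 52, 86, 2⟩, ⟨52, 52, 87, 2⟩, ⟨52, 52, 96, 305⟩,
   ⟨52, 52, 110, 1⟩, ⟨52, 52, 112, 1⟩, ⟨52, 52, 114, 1⟩, ⟨52, 52, 116, 1⟩, ⟨52, 53, 87, 1⟩,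
   ⟨52, 53, 90, 66⟩, ⟨52, 53, 100, 11⟩, ⟨52, 54, 81, 1⟩, ⟨52, 54, 87, 1⟩, ⟨52, 54, 90, 113⟩,
   ⟨52, 54, 98, 25⟩, ⟨52, 60, 90, 30⟩, ⟨52, 60, 92, 18⟩, ⟨52, 60, 93, 18⟩, ⟨52, 60, 96, 44⟩,
   ⟨52, 62, 90, 28⟩, ⟨52, 62, 100, 1⟩, ⟨52, 62, 104, 4⟩, ⟨52, 62, 110, 1⟩, ⟨52, 62, 116, 1⟩,
   ⟨52, 64, 100, 1⟩, ⟨52, 64, 104, 108⟩, ⟨52, 64, 105, 75⟩, ⟨52, 64, 106, 67⟩, ⟨52, 64, 107, 249⟩,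
   ⟨52, 64, 110, 1⟩, ⟨52, 66, 93, 55⟩, ⟨52, 66, 104, 34⟩, ⟨52, 66, 105, 21⟩, ⟨52, 66, 106, 18⟩,
   ⟨52, 68, 106, 25⟩, ⟨52, 70, 105, 36⟩, ⟨52, 70, 106, 37⟩, ⟨52, 75, 92, 5⟩, ⟨52, 75, 106, 5⟩,
   ⟨52, 78, 106, 1⟩, ⟨52, 78, 107, 2⟩, ⟨52, 78, 108, 2⟩, ⟨52, 78, 110, 2⟩, ⟨52, 78, 112, 2⟩,
   ⟨52, 80, 90, 301⟩, ⟨52, 80, 92, 11⟩, ⟨52, 80, 96, 167⟩, ⟨52, 80, 108, 26⟩, ⟨52, 81, 84, 1⟩,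
   ⟨52, 82, 82, 1⟩, ⟨52, 82, 84, 1⟩, ⟨52, 90, 94, 33⟩, ⟨52, 93, 93, 33⟩, ⟨52, 96, 110, 189⟩,
   ⟨52, 100, 102, 6⟩, ⟨52, 104, 104, 41⟩, ⟨52, 104, 107, 1⟩, ⟨52, 104, 108, 1⟩, ⟨52, 104, 110, 1⟩,
   ⟨52, 105, 108, 2⟩, ⟨52, 107, 107, 15⟩, ⟨52, 107, 108, 7⟩, ⟨52, 107, 110, 4⟩, ⟨52, 108, 108, 15⟩,
   ⟨52, 108, 110, 4⟩, ⟨52, 110, 110, 5⟩, ⟨53, 53, 88, 2⟩, ⟨53, 53, 90, 76⟩, ⟨53, 54, 88, 2⟩,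
   ⟨53, 54, 105, 53⟩, ⟨53, 54, 107, 74⟩, ⟨53, 54, 108, 96⟩, ⟨53, 60, 92, 17⟩, ⟨53, 60, 108, 173⟩,
   ⟨53, 60, 110, 1⟩, ⟨53, 62, 98, 1⟩, ⟨53, 62, 106, 4⟩, ⟨53, 62, 114, 1⟩, ⟨53, 62, 116, 1⟩,
   ⟨53, 64, 90, 380⟩, ⟨53, 64, 94, 358⟩, ⟨53, 64, 110, 1⟩, ⟨53, 64, 116, 1⟩, ⟨53, 66, 93, 50⟩,
   ⟨53, 66, 107, 35⟩, ⟨53, 66, 114, 1⟩, ⟨53, 68, 93, 20⟩, ⟨53, 68, 94, 16⟩, ⟨53, 68, 110, 1⟩,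
   ⟨53, 70, 93, 36⟩, ⟨53, 70, 94, 25⟩, ⟨53, 70, 108, 112⟩, ⟨53, 75, 90, 215⟩, ⟨53, 76, 94, 12⟩,
   ⟨53, 78, 105, 1⟩, ⟨53, 78, 108, 2⟩, ⟨53, 78, 110, 2⟩, ⟨53, 78, 114, 2⟩, ⟨53, 78, 116, 2⟩,
   ⟨53, 80, 80, 30⟩, ⟨53, 80, 102, 9⟩, ⟨53, 80, 110, 272⟩, ⟨53, 81, 81, 1⟩, ⟨53, 81, 84, 1⟩,
   ⟨53, 82, 84, 1⟩, ⟨53, 84, 84, 125⟩, ⟨53, 90, 94, 33⟩, ⟨53, 92, 92, 35⟩, ⟨53, 92, 94, 24⟩,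
   ⟨53, 96, 98, 76⟩, ⟨53, 96, 100, 52⟩, ⟨53, 96, 102, 8⟩, ⟨53, 98, 98, 25⟩, ⟨53, 104, 104, 66⟩,
   ⟨53, 104, 110, 1⟩, ⟨53, 105, 110, 2⟩, ⟨53, 106, 108, 2⟩, ⟨53, 107, 107, 26⟩, ⟨53, 107, 108, 12⟩,
   ⟨53, 107, 110, 4⟩, ⟨53, 108, 108, 22⟩, ⟨53, 108, 110, 5⟩, ⟨53, 110, 110, 6⟩, ⟨54, 54, 90, 199⟩,
   ⟨54, 54, 93, 64⟩, ⟨54, 54, 94, 18⟩, ⟨54, 54, 100, 23⟩, ⟨54, 54, 104, 409⟩, ⟨54, 60, 90, 21⟩,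
   ⟨54, 60, 93, 16⟩, ⟨54, 60, 94, 8⟩, ⟨54, 60, 104, 53⟩, ⟨54, 60, 105, 43⟩, ⟨54, 60, 107, 84⟩,
   ⟨54, 62, 107, 4⟩, ⟨54, 62, 108, 4⟩, ⟨54, 62, 116, 1⟩, ⟨54, 64, 90, 215⟩, ⟨54, 64, 107, 88⟩,
   ⟨54, 64, 108, 111⟩, ⟨54, 64, 110, 1⟩, ⟨54, 64, 112, 1⟩, ⟨54, 64, 114, 1⟩, ⟨54, 64, 116, 1⟩,
   ⟨54, 66, 90, 55⟩, ⟨54, 66, 92, 44⟩, ⟨54, 66, 106, 16⟩, ⟨54, 66, 108, 23⟩, ⟨54, 66, 110, 1⟩,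
   ⟨54, 68, 90, 163⟩, ⟨54, 68, 92, 22⟩, ⟨54, 68, 112, 1⟩, ⟨54, 68, 114, 1⟩, ⟨54, 68, 116, 1⟩,
   ⟨54, 70, 93, 33⟩, ⟨54, 70, 104, 32⟩, ⟨54, 70, 105, 26⟩, ⟨54, 70, 107, 56⟩, ⟨54, 74, 102, 16⟩,
   ⟨54, 75, 98, 18⟩, ⟨54, 76, 96, 671⟩, ⟨54, 76, 102, 11⟩, ⟨54, 78, 107, 2⟩, ⟨54, 78, 108, 2⟩,
   ⟨54, 80, 96, 34⟩, ⟨54, 80, 104, 1425⟩, ⟨54, 80, 108, 69⟩, ⟨54, 96, 98, 50⟩, ⟨54, 96, 100, 39⟩,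
   ⟨54, 96, 104, 641⟩, ⟨54, 96, 108, 140⟩, ⟨54, 98, 102, 6⟩, ⟨54, 104, 104, 944⟩, ⟨54, 104, 106, 1⟩,
   ⟨54, 104, 108, 1⟩, ⟨54, 105, 105, 2⟩, ⟨54, 105, 110, 2⟩, ⟨54, 107, 107, 20⟩, ⟨54, 107, 108, 10⟩,
   ⟨54, 107, 110, 4⟩, ⟨54, 108, 108, 23⟩, ⟨54, 108, 110, 5⟩, ⟨54, 110, 110, 5⟩, ⟨56, 56, 105, 54⟩,
   ⟨56, 56, 108, 77⟩, ⟨56, 56, 114, 1⟩, ⟨56, 72, 104, 131⟩, ⟨56, 74, 104, 15⟩, ⟨56, 75, 104, 11⟩,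
   ⟨56, 75, 108, 102⟩, ⟨56, 76, 104, 29⟩, ⟨56, 76, 106, 79⟩, ⟨56, 80, 80, 1631⟩, ⟨56, 80, 112, 1⟩,
   ⟨56, 81, 82, 1⟩, ⟨56, 81, 84, 1⟩, ⟨56, 82, 84, 1⟩, ⟨56, 84, 84, 67⟩, ⟨60, 60, 98, 1684⟩,
   ⟨60, 60, 100, 1684⟩, ⟨60, 60, 102, 1684⟩, ⟨60, 62, 96, 41⟩, ⟨60, 66, 90, 203⟩, ⟨60, 66, 93, 71⟩,
   ⟨60, 66, 104, 587⟩, ⟨60, 66, 107, 42⟩, ⟨60, 66, 108, 232⟩, ⟨60, 66, 112, 2⟩, ⟨60, 68, 93, 44⟩,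
   ⟨60, 68, 94, 13⟩, ⟨60, 68, 104, 214⟩, ⟨60, 68, 106, 1⟩, ⟨60, 68, 110, 2⟩, ⟨60, 68, 114, 2⟩,
   ⟨60, 68, 116, 2⟩, ⟨60, 70, 90, 287⟩, ⟨60, 70, 94, 12⟩, ⟨60, 70, 96, 918⟩, ⟨60, 70, 102, 1991⟩,
   ⟨60, 75, 110, 263⟩, ⟨60, 76, 104, 110⟩, ⟨60, 76, 107, 147⟩, ⟨60, 76, 116, 24⟩, ⟨60, 80, 96, 622⟩,
   ⟨60, 80, 98, 26⟩, ⟨60, 80, 100, 106⟩, ⟨60, 80, 104, 1⟩, ⟨60, 80, 110, 178⟩, ⟨60, 90, 90, 5335⟩,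
   ⟨60, 90, 96, 1435⟩, ⟨60, 90, 102, 384⟩, ⟨60, 90, 106, 384⟩, ⟨60, 90, 108, 546⟩,
   ⟨60, 90, 110, 413⟩, ⟨60, 92, 92, 1⟩, ⟨60, 92, 102, 1⟩, ⟨60, 93, 100, 1⟩, ⟨60, 93, 102, 1⟩,
   ⟨60, 93, 108, 2⟩, ⟨60, 94, 106, 3⟩, ⟨60, 94, 108, 3⟩, ⟨60, 96, 98, 39⟩, ⟨60, 96, 102, 14⟩,
   ⟨60, 96, 105, 22⟩, ⟨60, 96, 106, 24⟩, ⟨60, 96, 107, 180⟩, ⟨60, 96, 108, 264⟩, ⟨60, 96, 110, 156⟩,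
   ⟨60, 98, 100, 28⟩, ⟨60, 100, 100, 1760⟩, ⟨60, 100, 102, 18⟩, ⟨60, 104, 105, 31⟩,
   ⟨60, 104, 106, 28⟩, ⟨60, 104, 108, 44⟩, ⟨60, 104, 110, 38⟩, ⟨60, 105, 105, 443⟩,
   ⟨60, 105, 106, 42⟩, ⟨60, 106, 108, 41⟩, ⟨60, 107, 110, 132⟩, ⟨60, 108, 108, 275⟩,
   ⟨60, 110, 110, 33⟩, ⟨62, 62, 96, 41⟩, ⟨62, 80, 80, 72⟩, ⟨64, 64, 96, 49⟩, ⟨64, 64, 98, 65⟩,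
   ⟨64, 64, 102, 165⟩, ⟨64, 80, 80, 525⟩, ⟨64, 80, 87, 509⟩, ⟨64, 80, 96, 216⟩, ⟨64, 80, 100, 20⟩,
   ⟨64, 80, 108, 143⟩, ⟨66, 66, 90, 718⟩, ⟨66, 66, 107, 35⟩, ⟨66, 66, 108, 75⟩, ⟨66, 66, 110, 46⟩,
   ⟨66, 68, 107, 17⟩, ⟨66, 68, 108, 43⟩, ⟨66, 68, 114, 12⟩, ⟨66, 70, 90, 122⟩, ⟨66, 75, 90, 174⟩,
   ⟨66, 75, 93, 78⟩, ⟨66, 75, 104, 264⟩, ⟨66, 75, 105, 1⟩, ⟨66, 75, 108, 7⟩, ⟨66, 75, 110, 6⟩,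
   ⟨66, 76, 92, 69⟩, ⟨66, 80, 87, 26⟩, ⟨66, 80, 93, 10⟩, ⟨66, 80, 96, 142⟩, ⟨66, 80, 98, 12⟩,
   ⟨66, 80, 100, 19⟩, ⟨66, 80, 104, 674⟩, ⟨66, 80, 107, 57⟩, ⟨66, 80, 110, 133⟩, ⟨66, 90, 96, 69⟩,
   ⟨66, 90, 106, 66⟩, ⟨66, 90, 108, 14⟩, ⟨66, 92, 96, 1⟩, ⟨66, 92, 106, 2⟩, ⟨66, 92, 107, 5⟩,
   ⟨66, 92, 108, 7⟩, ⟨66, 93, 93, 17⟩, ⟨66, 93, 106, 3⟩, ⟨66, 96, 107, 24⟩, ⟨66, 104, 104, 523⟩,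
   ⟨66, 104, 108, 14⟩, ⟨66, 104, 110, 13⟩, ⟨66, 107, 108, 13⟩, ⟨66, 107, 110, 8⟩,
   ⟨66, 108, 108, 21⟩, ⟨66, 110, 110, 10⟩, ⟨68, 68, 94, 91⟩, ⟨68, 68, 106, 2⟩, ⟨68, 68, 107, 45⟩,
   ⟨68, 68, 108, 286⟩, ⟨68, 68, 112, 63⟩, ⟨68, 70, 90, 64⟩, ⟨68, 70, 92, 38⟩, ⟨68, 75, 110, 8⟩,
   ⟨68, 76, 90, 111⟩, ⟨68, 76, 93, 15⟩, ⟨68, 76, 114, 7⟩, ⟨68, 80, 87, 77⟩, ⟨68, 80, 90, 14⟩,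
   ⟨68, 80, 92, 7⟩, ⟨68, 80, 96, 405⟩, ⟨68, 80, 100, 20⟩, ⟨68, 80, 104, 145⟩, ⟨68, 80, 107, 21⟩,
   ⟨68, 80, 108, 29⟩, ⟨68, 80, 110, 27⟩, ⟨68, 80, 112, 21⟩, ⟨68, 80, 114, 14⟩, ⟨68, 80, 116, 8⟩,
   ⟨68, 82, 84, 13⟩, ⟨68, 84, 84, 75⟩, ⟨68, 90, 94, 15⟩, ⟨68, 90, 96, 23⟩, ⟨68, 90, 105, 91⟩,
   ⟨68, 90, 106, 13⟩, ⟨68, 90, 107, 69⟩, ⟨68, 90, 110, 132⟩, ⟨68, 92, 92, 14⟩, ⟨68, 92, 96, 1⟩,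
   ⟨68, 92, 106, 2⟩, ⟨68, 93, 106, 2⟩, ⟨68, 93, 107, 33⟩, ⟨68, 96, 104, 2⟩, ⟨68, 96, 110, 105⟩,
   ⟨68, 104, 104, 66⟩, ⟨68, 104, 108, 29⟩, ⟨68, 104, 110, 27⟩, ⟨68, 105, 105, 1⟩,
   ⟨68, 105, 110, 12⟩, ⟨68, 107, 108, 86⟩, ⟨68, 108, 108, 67⟩, ⟨70, 70, 93, 476⟩, ⟨70, 75, 110, 10⟩,
   ⟨70, 76, 90, 185⟩, ⟨70, 80, 87, 88⟩, ⟨70, 80, 90, 15⟩, ⟨70, 80, 93, 7⟩, ⟨70, 80, 100, 24⟩,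
   ⟨70, 80, 104, 285⟩, ⟨70, 80, 108, 176⟩, ⟨70, 84, 84, 214⟩, ⟨70, 90, 94, 107⟩, ⟨70, 90, 96, 17⟩,
   ⟨70, 90, 106, 10⟩, ⟨70, 90, 107, 76⟩, ⟨70, 92, 92, 27⟩, ⟨70, 92, 93, 25⟩, ⟨70, 92, 106, 2⟩,
   ⟨70, 92, 107, 13⟩, ⟨70, 92, 108, 129⟩, ⟨70, 93, 93, 86⟩, ⟨70, 93, 96, 1⟩, ⟨70, 93, 105, 2⟩,
   ⟨70, 93, 106, 2⟩, ⟨70, 93, 110, 31⟩, ⟨70, 96, 108, 101⟩, ⟨70, 96, 110, 62⟩, ⟨70, 104, 106, 1⟩,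
   ⟨70, 104, 107, 25⟩, ⟨70, 104, 108, 23⟩, ⟨70, 104, 110, 21⟩, ⟨70, 105, 105, 1⟩,
   ⟨70, 105, 107, 14⟩, ⟨70, 106, 108, 40⟩, ⟨70, 107, 108, 44⟩, ⟨70, 108, 108, 111⟩,
   ⟨72, 72, 96, 43⟩, ⟨72, 72, 98, 30⟩, ⟨72, 72, 100, 31⟩, ⟨72, 72, 104, 522⟩, ⟨72, 74, 104, 224⟩,
   ⟨72, 75, 98, 14⟩, ⟨72, 78, 98, 23⟩, ⟨72, 78, 100, 109⟩, ⟨72, 78, 104, 41⟩, ⟨72, 78, 107, 2⟩,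
   ⟨72, 78, 108, 2⟩, ⟨72, 78, 116, 2⟩, ⟨72, 90, 96, 80⟩, ⟨72, 96, 96, 573⟩, ⟨72, 96, 98, 7⟩,
   ⟨72, 100, 100, 406⟩, ⟨72, 102, 102, 29⟩, ⟨74, 74, 96, 269⟩, ⟨74, 74, 104, 20⟩, ⟨74, 75, 98, 15⟩,
   ⟨74, 76, 104, 105⟩, ⟨74, 78, 96, 26⟩, ⟨74, 78, 98, 10⟩, ⟨74, 78, 100, 14⟩, ⟨74, 78, 108, 1⟩,
   ⟨74, 96, 98, 3⟩, ⟨74, 96, 100, 4⟩, ⟨74, 96, 102, 6⟩, ⟨74, 96, 104, 721⟩, ⟨74, 96, 107, 3⟩,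
   ⟨74, 96, 108, 4⟩, ⟨74, 100, 102, 3⟩, ⟨74, 104, 105, 1⟩, ⟨74, 104, 107, 1⟩, ⟨74, 104, 110, 1⟩,
   ⟨74, 105, 105, 1⟩, ⟨74, 105, 106, 1⟩, ⟨74, 105, 107, 1⟩, ⟨74, 105, 110, 1⟩, ⟨74, 106, 106, 1⟩,
   ⟨75, 75, 106, 259⟩, ⟨75, 75, 114, 266⟩, ⟨75, 78, 96, 20⟩, ⟨75, 78, 100, 7⟩, ⟨75, 78, 102, 6⟩,
   ⟨75, 78, 107, 18⟩, ⟨75, 78, 110, 39⟩, ⟨75, 78, 116, 5⟩, ⟨75, 90, 90, 509⟩, ⟨75, 90, 96, 176⟩,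
   ⟨75, 90, 105, 503⟩, ⟨75, 90, 106, 1⟩, ⟨75, 90, 108, 8⟩, ⟨75, 90, 110, 8⟩, ⟨75, 92, 96, 1⟩,
   ⟨75, 92, 98, 2⟩, ⟨75, 92, 105, 2⟩, ⟨75, 92, 108, 4⟩, ⟨75, 92, 110, 3⟩, ⟨75, 93, 96, 1⟩,
   ⟨75, 93, 105, 2⟩, ⟨75, 93, 108, 15⟩, ⟨75, 94, 105, 2⟩, ⟨75, 94, 107, 11⟩, ⟨75, 96, 96, 400⟩,
   ⟨75, 96, 104, 25⟩, ⟨75, 96, 107, 11⟩, ⟨75, 100, 100, 4⟩, ⟨75, 104, 104, 58⟩, ⟨75, 105, 105, 527⟩,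
   ⟨75, 106, 110, 6⟩, ⟨75, 110, 110, 76⟩, ⟨76, 76, 96, 251⟩, ⟨76, 78, 96, 23⟩, ⟨76, 78, 102, 6⟩,
   ⟨76, 90, 96, 53⟩, ⟨76, 90, 98, 7⟩, ⟨76, 92, 98, 1⟩, ⟨76, 93, 98, 1⟩, ⟨76, 94, 98, 1⟩,
   ⟨76, 96, 96, 219⟩, ⟨76, 96, 104, 644⟩, ⟨76, 96, 107, 30⟩, ⟨76, 104, 104, 717⟩, ⟨76, 104, 105, 1⟩,
   ⟨76, 104, 107, 1⟩, ⟨76, 104, 108, 1⟩, ⟨76, 105, 105, 3⟩, ⟨76, 105, 108, 4⟩, ⟨76, 106, 106, 2⟩,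
   ⟨76, 106, 110, 2⟩, ⟨76, 107, 107, 8⟩, ⟨76, 107, 108, 3⟩, ⟨76, 107, 110, 3⟩, ⟨76, 108, 108, 6⟩,
   ⟨76, 108, 110, 3⟩, ⟨76, 110, 110, 5⟩, ⟨78, 78, 90, 25⟩, ⟨78, 78, 92, 22⟩, ⟨78, 78, 93, 25⟩,
   ⟨78, 78, 96, 14⟩, ⟨78, 78, 98, 11⟩, ⟨78, 78, 108, 49⟩, ⟨78, 78, 110, 49⟩, ⟨78, 78, 112, 35⟩,
   ⟨78, 78, 116, 10⟩, ⟨78, 100, 100, 54⟩, ⟨80, 80, 80, 247135⟩, ⟨80, 80, 86, 182⟩,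
   ⟨80, 80, 88, 255⟩, ⟨80, 80, 96, 1371⟩, ⟨80, 80, 100, 758⟩, ⟨80, 80, 104, 1902⟩, ⟨80, 80, 112, 3⟩,
   ⟨80, 81, 107, 3⟩, ⟨80, 81, 110, 3⟩, ⟨80, 82, 112, 3⟩, ⟨80, 84, 96, 4⟩, ⟨80, 84, 107, 36⟩,
   ⟨80, 84, 108, 44⟩, ⟨80, 86, 96, 48⟩, ⟨80, 86, 107, 5⟩, ⟨80, 86, 108, 5⟩, ⟨80, 90, 96, 156⟩,
   ⟨80, 90, 107, 55⟩, ⟨80, 90, 108, 93⟩, ⟨80, 92, 96, 1⟩, ⟨80, 92, 107, 5⟩, ⟨80, 92, 108, 5⟩,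
   ⟨80, 93, 96, 1⟩, ⟨80, 96, 98, 4⟩, ⟨80, 96, 100, 9⟩, ⟨80, 96, 102, 5⟩, ⟨80, 96, 104, 69⟩,
   ⟨80, 96, 105, 1⟩, ⟨80, 96, 106, 1⟩, ⟨80, 96, 107, 23⟩, ⟨80, 96, 108, 161⟩, ⟨80, 98, 100, 4⟩,
   ⟨80, 98, 102, 4⟩, ⟨80, 98, 104, 24⟩, ⟨80, 98, 105, 1⟩, ⟨80, 98, 106, 1⟩, ⟨80, 98, 107, 13⟩,
   ⟨80, 98, 108, 37⟩, ⟨80, 100, 100, 1054⟩, ⟨80, 100, 102, 5⟩, ⟨80, 100, 104, 26⟩,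
   ⟨80, 100, 105, 1⟩, ⟨80, 100, 106, 1⟩, ⟨80, 100, 107, 13⟩, ⟨80, 100, 108, 36⟩, ⟨80, 102, 104, 1⟩,
   ⟨80, 102, 107, 1⟩, ⟨80, 102, 108, 1⟩, ⟨80, 104, 104, 292⟩, ⟨80, 104, 105, 1⟩, ⟨80, 104, 106, 1⟩,
   ⟨80, 104, 107, 1⟩, ⟨80, 104, 108, 1⟩, ⟨80, 105, 105, 3⟩, ⟨80, 105, 106, 1⟩, ⟨80, 105, 107, 5⟩,
   ⟨80, 105, 108, 5⟩, ⟨80, 106, 107, 3⟩, ⟨80, 106, 108, 2⟩, ⟨80, 107, 108, 79⟩, ⟨80, 108, 110, 12⟩,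
   ⟨81, 81, 82, 18⟩, ⟨81, 81, 107, 10⟩, ⟨81, 81, 108, 10⟩, ⟨81, 82, 82, 23⟩, ⟨81, 82, 108, 22⟩,
   ⟨81, 82, 112, 2⟩, ⟨81, 84, 108, 87⟩, ⟨81, 90, 107, 15⟩, ⟨81, 93, 96, 1⟩, ⟨81, 94, 107, 65⟩,
   ⟨81, 96, 98, 4⟩, ⟨81, 96, 100, 4⟩, ⟨81, 96, 102, 4⟩, ⟨81, 96, 104, 15⟩, ⟨81, 96, 105, 1⟩,
   ⟨81, 96, 106, 1⟩, ⟨81, 96, 107, 12⟩, ⟨81, 96, 108, 17⟩, ⟨81, 98, 100, 2⟩, ⟨81, 98, 102, 3⟩,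
   ⟨81, 98, 104, 9⟩, ⟨81, 98, 105, 1⟩, ⟨81, 98, 106, 1⟩, ⟨81, 102, 107, 1⟩, ⟨81, 104, 112, 1⟩,
   ⟨81, 105, 105, 3⟩, ⟨81, 105, 108, 6⟩, ⟨81, 108, 108, 157⟩, ⟨82, 82, 82, 121⟩, ⟨82, 82, 110, 30⟩,
   ⟨82, 90, 96, 17⟩, ⟨82, 90, 108, 38⟩, ⟨82, 92, 107, 5⟩, ⟨82, 92, 108, 5⟩, ⟨82, 96, 96, 165⟩,
   ⟨82, 96, 107, 13⟩, ⟨82, 98, 110, 18⟩, ⟨82, 102, 104, 1⟩, ⟨82, 104, 104, 209⟩, ⟨82, 104, 110, 1⟩,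
   ⟨82, 105, 108, 6⟩, ⟨82, 106, 108, 3⟩, ⟨82, 108, 110, 34⟩, ⟨84, 84, 84, 509⟩, ⟨84, 84, 108, 4⟩,
   ⟨84, 90, 96, 275⟩, ⟨84, 90, 108, 1⟩, ⟨84, 92, 96, 2⟩, ⟨84, 93, 96, 3⟩, ⟨84, 93, 107, 21⟩,
   ⟨84, 93, 108, 16⟩, ⟨84, 94, 107, 4⟩, ⟨84, 96, 98, 79⟩, ⟨84, 96, 100, 112⟩, ⟨84, 96, 102, 43⟩,
   ⟨84, 96, 104, 37⟩, ⟨84, 96, 110, 100⟩, ⟨84, 98, 102, 5⟩, ⟨84, 98, 107, 10⟩, ⟨84, 100, 100, 11⟩,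
   ⟨84, 100, 102, 6⟩, ⟨84, 100, 108, 13⟩, ⟨84, 100, 110, 11⟩, ⟨84, 100, 116, 3⟩, ⟨84, 102, 102, 12⟩,
   ⟨84, 102, 104, 1⟩, ⟨84, 104, 104, 427⟩, ⟨84, 107, 107, 8⟩, ⟨84, 107, 108, 4⟩, ⟨84, 107, 110, 3⟩,
   ⟨84, 107, 114, 2⟩, ⟨84, 107, 116, 1⟩, ⟨84, 108, 108, 36⟩, ⟨84, 108, 110, 9⟩, ⟨84, 108, 114, 3⟩,
   ⟨84, 110, 110, 12⟩, ⟨84, 110, 112, 4⟩, ⟨84, 110, 114, 2⟩, ⟨84, 110, 116, 1⟩, ⟨84, 112, 114, 2⟩,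
   ⟨84, 112, 116, 1⟩, ⟨84, 116, 116, 2⟩, ⟨90, 90, 90, 10941⟩, ⟨90, 90, 105, 972⟩,
   ⟨90, 90, 106, 198⟩, ⟨90, 90, 108, 492⟩, ⟨90, 96, 104, 1⟩, ⟨90, 96, 105, 1⟩, ⟨90, 96, 107, 213⟩,
   ⟨90, 96, 114, 29⟩, ⟨90, 98, 114, 27⟩, ⟨90, 100, 106, 1⟩, ⟨90, 100, 110, 60⟩, ⟨90, 102, 108, 1⟩,
   ⟨90, 102, 110, 1⟩, ⟨90, 102, 112, 1⟩, ⟨90, 104, 104, 244⟩, ⟨90, 104, 107, 25⟩,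
   ⟨90, 104, 114, 10⟩, ⟨90, 105, 105, 597⟩, ⟨90, 105, 107, 21⟩, ⟨90, 107, 108, 175⟩,
   ⟨90, 107, 112, 34⟩, ⟨90, 114, 114, 85⟩, ⟨96, 96, 96, 551⟩, ⟨96, 96, 98, 98⟩, ⟨96, 96, 100, 104⟩,
   ⟨96, 96, 104, 50⟩, ⟨96, 96, 107, 160⟩, ⟨96, 96, 112, 265⟩, ⟨96, 98, 98, 71⟩, ⟨96, 98, 100, 31⟩,
   ⟨96, 98, 104, 22⟩, ⟨96, 98, 107, 42⟩, ⟨96, 100, 106, 9⟩, ⟨96, 102, 102, 3⟩, ⟨96, 102, 104, 2⟩,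
   ⟨96, 105, 105, 230⟩, ⟨96, 106, 112, 35⟩, ⟨96, 108, 108, 431⟩, ⟨98, 98, 98, 174⟩,
   ⟨98, 100, 105, 6⟩, ⟨98, 100, 110, 14⟩, ⟨98, 102, 102, 3⟩, ⟨98, 102, 105, 2⟩, ⟨98, 102, 107, 2⟩,
   ⟨98, 102, 110, 2⟩, ⟨98, 104, 114, 36⟩, ⟨98, 105, 108, 32⟩, ⟨98, 106, 112, 24⟩,
   ⟨98, 108, 110, 30⟩, ⟨98, 110, 112, 19⟩, ⟨100, 100, 100, 1293⟩, ⟨100, 100, 102, 8⟩,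
   ⟨100, 100, 108, 21⟩, ⟨100, 100, 112, 18⟩, ⟨100, 102, 102, 3⟩, ⟨100, 102, 106, 2⟩,
   ⟨100, 102, 107, 2⟩, ⟨100, 102, 108, 2⟩, ⟨100, 102, 110, 2⟩, ⟨100, 104, 104, 439⟩,
   ⟨100, 105, 108, 8⟩, ⟨100, 106, 110, 8⟩, ⟨100, 108, 110, 8⟩, ⟨100, 108, 112, 8⟩,
   ⟨100, 108, 114, 6⟩, ⟨100, 112, 112, 13⟩, ⟨102, 102, 104, 2⟩, ⟨102, 102, 112, 2⟩,
   ⟨104, 104, 104, 1145⟩, ⟨104, 104, 106, 38⟩, ⟨104, 104, 110, 32⟩, ⟨104, 104, 112, 28⟩,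
   ⟨104, 105, 107, 12⟩, ⟨104, 106, 107, 12⟩, ⟨104, 108, 112, 15⟩, ⟨105, 105, 112, 118⟩,
   ⟨106, 108, 110, 24⟩, ⟨107, 108, 114, 38⟩, ⟨108, 108, 108, 602⟩]

/-- The certificate for bins with an item of type 2 and seven items of middle size. -/
def pointCertSeven : PointCert where
  t := 2
  -- The row length is 120 plus the largest box side 40, and 28 bits hold the sum of all masses
  -- including the core.
  fmt := ⟨120, 160, 29, 28⟩
  orbits := massesSeven
  -- In units of 1/120 the interval [2/3 - 0.65, 0.65] is [2, 78]. Its points are spaced by at most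
  -- 12, the smallest box side in use, and `heavy` exceeds all thresholds, so a box that hits the
  -- core passes at once.
  core := [2, 14, 26, 38, 50, 62, 74, 78]
  heavy := 320000
  -- The box sides are ⌊120 / n⌋ for n = 3, …, 10.
  th := [(40, 317057), (30, 35196), (24, 12889), (20, 5208), (17, 2992), (15, 1258), (13, 506),
    (12, 160)]
  D := 4000000
  cert := ⟨13317422 / 10000000, []⟩
  surplus := 6342704 / 10000000

set_option maxRecDepth 100000 in
lemma pointCertSeven_numerics : pointCertSeven.Numerics weightsSeven := by decide +kernel

set_option maxRecDepth 100000 in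
lemma pointCertSeven_valid : pointCertSeven.fmt.Valid
    (symmetrize pointCertSeven.orbits (cubeMasses pointCertSeven.core pointCertSeven.heavy))
    pointCertSeven.th := by decide +kernel

set_option maxRecDepth 100000 in
lemma pointCertSeven_check : pointCertSeven.fmt.check
    (symmetrize pointCertSeven.orbits (cubeMasses pointCertSeven.core pointCertSeven.heavy))
    pointCertSeven.th = true := by decide +kernel

/-! ### Data for a large item of type 3 -/

/-- Point masses for bins with an item of type 3, in units of `1 / 4000000`, on the grid of mesh
`1 / 60`. -/
def massesSix : List PointMass :=
  [⟨4, 4, 45, 14⟩, ⟨4, 4, 46, 16⟩, ⟨4, 4, 50, 41⟩, ⟨4, 4, 52, 23⟩, ⟨4, 4, 53, 4⟩, ⟨4, 4, 56, 27⟩,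
   ⟨4, 5, 45, 10⟩, ⟨4, 5, 46, 11⟩, ⟨4, 5, 50, 28⟩, ⟨4, 5, 55, 18⟩, ⟨4, 5, 56, 17⟩, ⟨4, 6, 40, 37⟩,
   ⟨4, 6, 41, 38⟩, ⟨4, 6, 45, 8⟩, ⟨4, 6, 46, 9⟩, ⟨4, 6, 50, 24⟩, ⟨4, 6, 52, 19⟩, ⟨4, 6, 53, 2⟩,
   ⟨4, 6, 55, 24⟩, ⟨4, 6, 56, 22⟩, ⟨4, 7, 45, 12⟩, ⟨4, 7, 46, 16⟩, ⟨4, 7, 50, 16⟩, ⟨4, 7, 52, 11⟩,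
   ⟨4, 7, 53, 4⟩, ⟨4, 8, 44, 44⟩, ⟨4, 8, 50, 37⟩, ⟨4, 8, 55, 7⟩, ⟨4, 8, 56, 4⟩, ⟨4, 12, 44, 69⟩,
   ⟨4, 12, 52, 101⟩, ⟨4, 16, 52, 203⟩, ⟨4, 18, 50, 101⟩, ⟨4, 20, 45, 14⟩, ⟨4, 20, 46, 111⟩,
   ⟨4, 20, 50, 5⟩, ⟨4, 20, 52, 24⟩, ⟨4, 20, 55, 14⟩, ⟨4, 21, 45, 18⟩, ⟨4, 21, 46, 32⟩,
   ⟨4, 21, 48, 56⟩, ⟨4, 21, 50, 5⟩, ⟨4, 24, 39, 11⟩, ⟨4, 24, 46, 17⟩, ⟨4, 24, 48, 31⟩,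
   ⟨4, 24, 49, 26⟩, ⟨4, 24, 52, 17⟩, ⟨4, 24, 55, 33⟩, ⟨4, 24, 56, 10⟩, ⟨4, 28, 39, 17⟩,
   ⟨4, 28, 40, 20⟩, ⟨4, 28, 44, 43⟩, ⟨4, 28, 50, 47⟩, ⟨4, 28, 52, 17⟩, ⟨4, 28, 54, 15⟩,
   ⟨4, 28, 55, 19⟩, ⟨4, 29, 44, 51⟩, ⟨4, 29, 45, 26⟩, ⟨4, 29, 46, 33⟩, ⟨4, 29, 50, 57⟩,
   ⟨4, 29, 52, 17⟩, ⟨4, 29, 55, 20⟩, ⟨4, 30, 45, 9⟩, ⟨4, 30, 46, 9⟩, ⟨4, 30, 48, 26⟩,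
   ⟨4, 31, 44, 11⟩, ⟨4, 31, 45, 12⟩, ⟨4, 31, 46, 12⟩, ⟨4, 32, 45, 14⟩, ⟨4, 32, 46, 13⟩,
   ⟨4, 32, 52, 36⟩, ⟨4, 32, 55, 56⟩, ⟨4, 33, 48, 35⟩, ⟨4, 33, 50, 11⟩, ⟨4, 36, 48, 28⟩,
   ⟨4, 37, 44, 22⟩, ⟨4, 37, 55, 14⟩, ⟨4, 37, 56, 12⟩, ⟨4, 39, 39, 20⟩, ⟨4, 39, 45, 23⟩,
   ⟨4, 39, 50, 120⟩, ⟨4, 39, 53, 8⟩, ⟨4, 39, 55, 22⟩, ⟨4, 40, 40, 39⟩, ⟨4, 40, 42, 47⟩,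
   ⟨4, 40, 44, 6⟩, ⟨4, 40, 45, 19⟩, ⟨4, 40, 46, 16⟩, ⟨4, 40, 52, 23⟩, ⟨4, 40, 53, 12⟩,
   ⟨4, 42, 42, 20⟩, ⟨4, 42, 44, 5⟩, ⟨4, 42, 45, 16⟩, ⟨4, 42, 46, 15⟩, ⟨4, 42, 48, 36⟩,
   ⟨4, 42, 50, 25⟩, ⟨4, 42, 53, 4⟩, ⟨4, 42, 55, 12⟩, ⟨4, 44, 44, 15⟩, ⟨4, 44, 48, 35⟩,
   ⟨4, 44, 52, 53⟩, ⟨4, 44, 54, 84⟩, ⟨4, 45, 45, 44⟩, ⟨4, 45, 46, 27⟩, ⟨4, 45, 48, 3⟩,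
   ⟨4, 45, 49, 3⟩, ⟨4, 45, 52, 40⟩, ⟨4, 45, 53, 17⟩, ⟨4, 46, 46, 46⟩, ⟨4, 46, 53, 5⟩,
   ⟨4, 46, 56, 6⟩, ⟨4, 48, 48, 25⟩, ⟨4, 48, 49, 4⟩, ⟨4, 48, 53, 29⟩, ⟨4, 48, 54, 21⟩,
   ⟨4, 48, 55, 17⟩, ⟨4, 48, 56, 16⟩, ⟨4, 49, 49, 5⟩, ⟨4, 49, 53, 12⟩, ⟨4, 49, 54, 16⟩,
   ⟨4, 50, 50, 67⟩, ⟨4, 50, 53, 8⟩, ⟨4, 50, 54, 13⟩, ⟨4, 50, 55, 20⟩, ⟨4, 50, 56, 18⟩,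
   ⟨4, 52, 56, 12⟩, ⟨4, 53, 53, 17⟩, ⟨4, 54, 55, 18⟩, ⟨4, 54, 56, 18⟩, ⟨5, 5, 40, 169⟩,
   ⟨5, 5, 42, 144⟩, ⟨5, 5, 45, 31⟩, ⟨5, 5, 46, 43⟩, ⟨5, 5, 50, 94⟩, ⟨5, 5, 53, 5⟩, ⟨5, 5, 54, 35⟩,
   ⟨5, 5, 55, 51⟩, ⟨5, 5, 56, 47⟩, ⟨5, 6, 44, 12⟩, ⟨5, 6, 45, 12⟩, ⟨5, 6, 46, 15⟩, ⟨5, 6, 50, 36⟩,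
   ⟨5, 6, 52, 27⟩, ⟨5, 6, 54, 27⟩, ⟨5, 6, 55, 29⟩, ⟨5, 6, 56, 26⟩, ⟨5, 7, 41, 95⟩, ⟨5, 7, 45, 23⟩,
   ⟨5, 7, 46, 45⟩, ⟨5, 7, 50, 19⟩, ⟨5, 7, 52, 13⟩, ⟨5, 7, 53, 5⟩, ⟨5, 7, 55, 55⟩, ⟨5, 7, 56, 10⟩,
   ⟨5, 8, 44, 45⟩, ⟨5, 8, 50, 39⟩, ⟨5, 8, 55, 13⟩, ⟨5, 8, 56, 6⟩, ⟨5, 12, 41, 95⟩, ⟨5, 12, 44, 82⟩,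
   ⟨5, 12, 46, 18⟩, ⟨5, 12, 48, 123⟩, ⟨5, 12, 50, 13⟩, ⟨5, 12, 52, 112⟩, ⟨5, 12, 55, 51⟩,
   ⟨5, 12, 56, 45⟩, ⟨5, 14, 39, 103⟩, ⟨5, 14, 42, 116⟩, ⟨5, 14, 45, 81⟩, ⟨5, 14, 46, 246⟩,
   ⟨5, 14, 50, 31⟩, ⟨5, 14, 55, 39⟩, ⟨5, 14, 56, 30⟩, ⟨5, 15, 39, 3⟩, ⟨5, 15, 40, 3⟩,
   ⟨5, 15, 46, 84⟩, ⟨5, 15, 50, 64⟩, ⟨5, 15, 56, 60⟩, ⟨5, 16, 44, 116⟩, ⟨5, 18, 39, 11⟩,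
   ⟨5, 18, 40, 79⟩, ⟨5, 18, 46, 31⟩, ⟨5, 18, 50, 113⟩, ⟨5, 18, 54, 17⟩, ⟨5, 18, 55, 36⟩,
   ⟨5, 18, 56, 28⟩, ⟨5, 20, 39, 3⟩, ⟨5, 20, 40, 3⟩, ⟨5, 20, 41, 3⟩, ⟨5, 20, 45, 14⟩, ⟨5, 20, 50, 5⟩,
   ⟨5, 20, 54, 21⟩, ⟨5, 20, 55, 23⟩, ⟨5, 20, 56, 19⟩, ⟨5, 21, 40, 40⟩, ⟨5, 21, 41, 47⟩,
   ⟨5, 21, 44, 16⟩, ⟨5, 21, 45, 22⟩, ⟨5, 21, 46, 42⟩, ⟨5, 21, 48, 106⟩, ⟨5, 21, 52, 67⟩,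
   ⟨5, 21, 56, 72⟩, ⟨5, 24, 39, 13⟩, ⟨5, 24, 40, 22⟩, ⟨5, 24, 41, 50⟩, ⟨5, 24, 42, 87⟩,
   ⟨5, 24, 44, 61⟩, ⟨5, 24, 46, 18⟩, ⟨5, 24, 48, 43⟩, ⟨5, 24, 49, 35⟩, ⟨5, 24, 52, 18⟩,
   ⟨5, 24, 54, 124⟩, ⟨5, 24, 55, 42⟩, ⟨5, 24, 56, 10⟩, ⟨5, 28, 39, 30⟩, ⟨5, 28, 40, 42⟩,
   ⟨5, 28, 41, 48⟩, ⟨5, 28, 44, 51⟩, ⟨5, 28, 45, 23⟩, ⟨5, 28, 46, 31⟩, ⟨5, 28, 50, 53⟩,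
   ⟨5, 28, 52, 18⟩, ⟨5, 28, 54, 25⟩, ⟨5, 28, 55, 37⟩, ⟨5, 29, 39, 23⟩, ⟨5, 29, 40, 32⟩,
   ⟨5, 29, 41, 33⟩, ⟨5, 29, 42, 142⟩, ⟨5, 29, 46, 36⟩, ⟨5, 29, 50, 66⟩, ⟨5, 29, 52, 17⟩,
   ⟨5, 29, 55, 35⟩, ⟨5, 29, 56, 26⟩, ⟨5, 30, 46, 9⟩, ⟨5, 30, 48, 29⟩, ⟨5, 30, 50, 46⟩,
   ⟨5, 31, 42, 61⟩, ⟨5, 31, 44, 12⟩, ⟨5, 31, 45, 13⟩, ⟨5, 31, 46, 13⟩, ⟨5, 31, 50, 62⟩,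
   ⟨5, 31, 55, 24⟩, ⟨5, 31, 56, 24⟩, ⟨5, 32, 41, 137⟩, ⟨5, 32, 42, 163⟩, ⟨5, 32, 45, 18⟩,
   ⟨5, 32, 46, 17⟩, ⟨5, 32, 54, 54⟩, ⟨5, 33, 48, 93⟩, ⟨5, 33, 50, 14⟩, ⟨5, 33, 56, 18⟩,
   ⟨5, 36, 40, 4⟩, ⟨5, 36, 41, 6⟩, ⟨5, 36, 44, 78⟩, ⟨5, 36, 48, 68⟩, ⟨5, 36, 50, 136⟩,
   ⟨5, 36, 52, 15⟩, ⟨5, 36, 54, 44⟩, ⟨5, 36, 55, 100⟩, ⟨5, 37, 39, 86⟩, ⟨5, 37, 44, 25⟩,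
   ⟨5, 37, 52, 51⟩, ⟨5, 37, 54, 22⟩, ⟨5, 37, 55, 19⟩, ⟨5, 37, 56, 15⟩, ⟨5, 39, 39, 77⟩,
   ⟨5, 39, 45, 31⟩, ⟨5, 39, 46, 47⟩, ⟨5, 39, 53, 9⟩, ⟨5, 39, 56, 26⟩, ⟨5, 40, 40, 49⟩,
   ⟨5, 40, 44, 6⟩, ⟨5, 40, 45, 23⟩, ⟨5, 40, 46, 20⟩, ⟨5, 40, 52, 27⟩, ⟨5, 40, 55, 37⟩,
   ⟨5, 41, 54, 62⟩, ⟨5, 41, 55, 30⟩, ⟨5, 42, 42, 22⟩, ⟨5, 42, 44, 5⟩, ⟨5, 42, 45, 18⟩,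
   ⟨5, 42, 46, 17⟩, ⟨5, 42, 48, 52⟩, ⟨5, 42, 50, 30⟩, ⟨5, 42, 52, 1⟩, ⟨5, 42, 54, 23⟩,
   ⟨5, 42, 55, 13⟩, ⟨5, 44, 44, 16⟩, ⟨5, 44, 48, 48⟩, ⟨5, 44, 52, 69⟩, ⟨5, 44, 56, 55⟩,
   ⟨5, 45, 45, 47⟩, ⟨5, 45, 46, 30⟩, ⟨5, 45, 48, 3⟩, ⟨5, 45, 49, 3⟩, ⟨5, 45, 53, 20⟩,
   ⟨5, 45, 56, 96⟩, ⟨5, 46, 46, 62⟩, ⟨5, 46, 55, 6⟩, ⟨5, 46, 56, 6⟩, ⟨5, 48, 48, 29⟩,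
   ⟨5, 48, 49, 5⟩, ⟨5, 48, 53, 36⟩, ⟨5, 48, 54, 24⟩, ⟨5, 48, 55, 19⟩, ⟨5, 48, 56, 17⟩,
   ⟨5, 49, 49, 6⟩, ⟨5, 49, 53, 14⟩, ⟨5, 49, 54, 18⟩, ⟨5, 49, 55, 22⟩, ⟨5, 49, 56, 20⟩,
   ⟨5, 50, 50, 107⟩, ⟨5, 50, 53, 9⟩, ⟨5, 50, 54, 14⟩, ⟨5, 50, 55, 24⟩, ⟨5, 50, 56, 21⟩,
   ⟨5, 53, 53, 20⟩, ⟨5, 53, 56, 8⟩, ⟨5, 54, 54, 58⟩, ⟨5, 54, 55, 26⟩, ⟨5, 55, 55, 121⟩,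
   ⟨5, 55, 56, 41⟩, ⟨6, 6, 40, 203⟩, ⟨6, 6, 44, 92⟩, ⟨6, 6, 45, 79⟩, ⟨6, 6, 46, 236⟩,
   ⟨6, 6, 50, 154⟩, ⟨6, 6, 52, 101⟩, ⟨6, 6, 54, 110⟩, ⟨6, 6, 55, 68⟩, ⟨6, 7, 50, 9⟩, ⟨6, 7, 52, 7⟩,
   ⟨6, 7, 53, 4⟩, ⟨6, 8, 41, 48⟩, ⟨6, 8, 42, 413⟩, ⟨6, 8, 44, 36⟩, ⟨6, 8, 50, 240⟩, ⟨6, 8, 54, 250⟩,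
   ⟨6, 8, 55, 56⟩, ⟨6, 8, 56, 42⟩, ⟨6, 12, 41, 41⟩, ⟨6, 12, 42, 68⟩, ⟨6, 12, 44, 84⟩,
   ⟨6, 12, 46, 30⟩, ⟨6, 12, 48, 135⟩, ⟨6, 12, 50, 31⟩, ⟨6, 12, 52, 154⟩, ⟨6, 12, 54, 140⟩,
   ⟨6, 12, 55, 27⟩, ⟨6, 12, 56, 25⟩, ⟨6, 14, 41, 74⟩, ⟨6, 14, 42, 169⟩, ⟨6, 14, 45, 84⟩,
   ⟨6, 14, 46, 163⟩, ⟨6, 14, 54, 280⟩, ⟨6, 14, 55, 29⟩, ⟨6, 15, 40, 27⟩, ⟨6, 15, 41, 27⟩,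
   ⟨6, 15, 46, 15⟩, ⟨6, 15, 55, 23⟩, ⟨6, 16, 44, 222⟩, ⟨6, 16, 52, 124⟩, ⟨6, 18, 39, 9⟩,
   ⟨6, 18, 41, 44⟩, ⟨6, 18, 42, 52⟩, ⟨6, 18, 45, 7⟩, ⟨6, 18, 46, 12⟩, ⟨6, 18, 50, 58⟩,
   ⟨6, 18, 56, 123⟩, ⟨6, 20, 41, 76⟩, ⟨6, 20, 42, 325⟩, ⟨6, 20, 44, 14⟩, ⟨6, 20, 48, 88⟩,
   ⟨6, 20, 54, 269⟩, ⟨6, 20, 55, 17⟩, ⟨6, 20, 56, 15⟩, ⟨6, 21, 45, 19⟩, ⟨6, 21, 46, 30⟩,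
   ⟨6, 21, 48, 35⟩, ⟨6, 21, 50, 3⟩, ⟨6, 21, 55, 11⟩, ⟨6, 24, 42, 482⟩, ⟨6, 24, 48, 496⟩,
   ⟨6, 24, 54, 445⟩, ⟨6, 28, 39, 50⟩, ⟨6, 28, 40, 98⟩, ⟨6, 28, 41, 131⟩, ⟨6, 28, 46, 109⟩,
   ⟨6, 28, 50, 96⟩, ⟨6, 28, 52, 21⟩, ⟨6, 28, 54, 214⟩, ⟨6, 28, 56, 62⟩, ⟨6, 29, 44, 131⟩,
   ⟨6, 29, 50, 102⟩, ⟨6, 29, 52, 20⟩, ⟨6, 29, 54, 137⟩, ⟨6, 29, 55, 76⟩, ⟨6, 30, 45, 8⟩,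
   ⟨6, 30, 46, 8⟩, ⟨6, 30, 48, 33⟩, ⟨6, 31, 39, 9⟩, ⟨6, 31, 42, 65⟩, ⟨6, 31, 45, 7⟩,
   ⟨6, 31, 54, 37⟩, ⟨6, 31, 55, 11⟩, ⟨6, 31, 56, 10⟩, ⟨6, 32, 39, 10⟩, ⟨6, 32, 40, 14⟩,
   ⟨6, 32, 41, 15⟩, ⟨6, 32, 42, 190⟩, ⟨6, 32, 44, 7⟩, ⟨6, 32, 45, 7⟩, ⟨6, 32, 46, 7⟩,
   ⟨6, 32, 52, 25⟩, ⟨6, 32, 54, 275⟩, ⟨6, 32, 55, 14⟩, ⟨6, 32, 56, 14⟩, ⟨6, 33, 48, 245⟩,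
   ⟨6, 33, 50, 12⟩, ⟨6, 33, 54, 107⟩, ⟨6, 33, 55, 10⟩, ⟨6, 33, 56, 10⟩, ⟨6, 36, 40, 4⟩,
   ⟨6, 36, 41, 5⟩, ⟨6, 36, 42, 476⟩, ⟨6, 36, 44, 40⟩, ⟨6, 36, 48, 1⟩, ⟨6, 36, 50, 63⟩,
   ⟨6, 36, 54, 216⟩, ⟨6, 36, 56, 52⟩, ⟨6, 37, 39, 85⟩, ⟨6, 37, 44, 31⟩, ⟨6, 37, 52, 24⟩,
   ⟨6, 37, 56, 24⟩, ⟨6, 39, 39, 115⟩, ⟨6, 39, 45, 75⟩, ⟨6, 39, 46, 121⟩, ⟨6, 39, 48, 128⟩,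
   ⟨6, 39, 50, 30⟩, ⟨6, 39, 54, 246⟩, ⟨6, 40, 40, 39⟩, ⟨6, 40, 42, 105⟩, ⟨6, 40, 44, 6⟩,
   ⟨6, 40, 45, 29⟩, ⟨6, 40, 46, 21⟩, ⟨6, 40, 52, 31⟩, ⟨6, 40, 53, 14⟩, ⟨6, 41, 55, 32⟩,
   ⟨6, 42, 42, 27⟩, ⟨6, 42, 44, 6⟩, ⟨6, 42, 45, 21⟩, ⟨6, 42, 46, 20⟩, ⟨6, 42, 48, 158⟩,
   ⟨6, 42, 50, 50⟩, ⟨6, 42, 54, 138⟩, ⟨6, 42, 55, 16⟩, ⟨6, 42, 56, 15⟩, ⟨6, 44, 44, 19⟩,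
   ⟨6, 44, 55, 32⟩, ⟨6, 45, 45, 78⟩, ⟨6, 45, 46, 81⟩, ⟨6, 45, 52, 352⟩, ⟨6, 45, 53, 22⟩,
   ⟨6, 45, 55, 129⟩, ⟨6, 46, 46, 323⟩, ⟨6, 46, 54, 22⟩, ⟨6, 46, 55, 10⟩, ⟨6, 46, 56, 10⟩,
   ⟨6, 48, 53, 29⟩, ⟨6, 48, 54, 204⟩, ⟨6, 49, 54, 47⟩, ⟨6, 49, 56, 22⟩, ⟨6, 50, 50, 488⟩,
   ⟨6, 50, 54, 29⟩, ⟨6, 50, 55, 25⟩, ⟨6, 50, 56, 24⟩, ⟨6, 52, 54, 13⟩, ⟨6, 52, 55, 12⟩,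
   ⟨6, 53, 54, 7⟩, ⟨6, 53, 55, 7⟩, ⟨6, 54, 54, 190⟩, ⟨6, 54, 55, 27⟩, ⟨6, 55, 55, 50⟩,
   ⟨7, 7, 41, 137⟩, ⟨7, 7, 42, 500⟩, ⟨7, 7, 44, 31⟩, ⟨7, 7, 45, 132⟩, ⟨7, 7, 46, 474⟩,
   ⟨7, 7, 50, 19⟩, ⟨7, 7, 52, 13⟩, ⟨7, 7, 53, 595⟩, ⟨7, 7, 55, 34⟩, ⟨7, 7, 56, 31⟩, ⟨7, 12, 41, 95⟩,
   ⟨7, 12, 48, 95⟩, ⟨7, 12, 52, 36⟩, ⟨7, 12, 56, 95⟩, ⟨7, 14, 39, 111⟩, ⟨7, 14, 42, 562⟩,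
   ⟨7, 14, 46, 167⟩, ⟨7, 14, 50, 53⟩, ⟨7, 14, 53, 473⟩, ⟨7, 14, 54, 15⟩, ⟨7, 14, 55, 33⟩,
   ⟨7, 14, 56, 32⟩, ⟨7, 15, 46, 17⟩, ⟨7, 15, 50, 43⟩, ⟨7, 15, 53, 36⟩, ⟨7, 15, 54, 13⟩,
   ⟨7, 15, 55, 24⟩, ⟨7, 15, 56, 23⟩, ⟨7, 16, 44, 156⟩, ⟨7, 18, 39, 101⟩, ⟨7, 18, 42, 3⟩,
   ⟨7, 18, 45, 43⟩, ⟨7, 18, 46, 49⟩, ⟨7, 18, 50, 244⟩, ⟨7, 18, 53, 11⟩, ⟨7, 18, 55, 167⟩,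
   ⟨7, 20, 44, 74⟩, ⟨7, 20, 45, 23⟩, ⟨7, 20, 46, 25⟩, ⟨7, 20, 52, 42⟩, ⟨7, 21, 39, 69⟩,
   ⟨7, 21, 40, 90⟩, ⟨7, 21, 41, 130⟩, ⟨7, 21, 42, 408⟩, ⟨7, 21, 44, 204⟩, ⟨7, 21, 45, 145⟩,
   ⟨7, 21, 46, 323⟩, ⟨7, 21, 50, 56⟩, ⟨7, 21, 52, 49⟩, ⟨7, 21, 53, 625⟩, ⟨7, 21, 55, 120⟩,
   ⟨7, 24, 40, 44⟩, ⟨7, 24, 44, 30⟩, ⟨7, 24, 52, 6⟩, ⟨7, 28, 42, 348⟩, ⟨7, 28, 44, 14⟩,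
   ⟨7, 28, 45, 104⟩, ⟨7, 28, 46, 362⟩, ⟨7, 28, 50, 188⟩, ⟨7, 28, 52, 7⟩, ⟨7, 28, 53, 409⟩,
   ⟨7, 28, 56, 48⟩, ⟨7, 29, 41, 113⟩, ⟨7, 29, 44, 12⟩, ⟨7, 29, 45, 8⟩, ⟨7, 29, 46, 8⟩,
   ⟨7, 29, 50, 9⟩, ⟨7, 29, 53, 71⟩, ⟨7, 29, 54, 47⟩, ⟨7, 29, 55, 49⟩, ⟨7, 29, 56, 48⟩,
   ⟨7, 31, 39, 29⟩, ⟨7, 31, 40, 47⟩, ⟨7, 31, 41, 56⟩, ⟨7, 31, 42, 101⟩, ⟨7, 31, 44, 42⟩,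
   ⟨7, 31, 45, 50⟩, ⟨7, 31, 46, 148⟩, ⟨7, 31, 50, 66⟩, ⟨7, 31, 53, 41⟩, ⟨7, 31, 54, 9⟩,
   ⟨7, 32, 39, 28⟩, ⟨7, 32, 40, 50⟩, ⟨7, 32, 41, 64⟩, ⟨7, 32, 42, 110⟩, ⟨7, 32, 44, 49⟩,
   ⟨7, 32, 45, 55⟩, ⟨7, 32, 46, 179⟩, ⟨7, 32, 50, 155⟩, ⟨7, 32, 52, 57⟩, ⟨7, 32, 53, 179⟩,
   ⟨7, 32, 54, 19⟩, ⟨7, 32, 55, 37⟩, ⟨7, 32, 56, 34⟩, ⟨7, 33, 50, 9⟩, ⟨7, 36, 40, 3⟩,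
   ⟨7, 36, 41, 3⟩, ⟨7, 36, 44, 244⟩, ⟨7, 36, 48, 95⟩, ⟨7, 36, 50, 244⟩, ⟨7, 36, 52, 21⟩,
   ⟨7, 36, 53, 9⟩, ⟨7, 36, 55, 48⟩, ⟨7, 36, 56, 41⟩, ⟨7, 37, 39, 39⟩, ⟨7, 37, 44, 124⟩,
   ⟨7, 37, 52, 70⟩, ⟨7, 37, 53, 9⟩, ⟨7, 37, 54, 9⟩, ⟨7, 37, 56, 29⟩, ⟨7, 39, 39, 362⟩,
   ⟨7, 39, 45, 110⟩, ⟨7, 39, 46, 307⟩, ⟨7, 39, 53, 304⟩, ⟨7, 39, 54, 31⟩, ⟨7, 39, 56, 36⟩,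
   ⟨7, 40, 40, 29⟩, ⟨7, 40, 42, 46⟩, ⟨7, 40, 46, 23⟩, ⟨7, 40, 48, 5⟩, ⟨7, 40, 50, 16⟩,
   ⟨7, 40, 52, 51⟩, ⟨7, 40, 53, 111⟩, ⟨7, 41, 48, 8⟩, ⟨7, 41, 53, 85⟩, ⟨7, 41, 55, 17⟩,
   ⟨7, 41, 56, 16⟩, ⟨7, 42, 44, 9⟩, ⟨7, 42, 46, 20⟩, ⟨7, 42, 48, 25⟩, ⟨7, 42, 52, 1⟩,
   ⟨7, 42, 53, 6⟩, ⟨7, 42, 54, 6⟩, ⟨7, 42, 55, 5⟩, ⟨7, 42, 56, 5⟩, ⟨7, 44, 44, 179⟩,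
   ⟨7, 44, 48, 21⟩, ⟨7, 44, 53, 60⟩, ⟨7, 45, 45, 379⟩, ⟨7, 45, 48, 5⟩, ⟨7, 45, 49, 7⟩,
   ⟨7, 45, 53, 342⟩, ⟨7, 45, 54, 44⟩, ⟨7, 45, 55, 17⟩, ⟨7, 45, 56, 17⟩, ⟨7, 46, 46, 243⟩,
   ⟨7, 46, 53, 8⟩, ⟨7, 46, 56, 5⟩, ⟨7, 48, 48, 37⟩, ⟨7, 48, 53, 171⟩, ⟨7, 48, 55, 15⟩,
   ⟨7, 49, 53, 20⟩, ⟨7, 49, 54, 15⟩, ⟨7, 50, 50, 72⟩, ⟨7, 50, 53, 11⟩, ⟨7, 50, 55, 25⟩,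
   ⟨7, 52, 53, 308⟩, ⟨7, 52, 55, 11⟩, ⟨7, 52, 56, 11⟩, ⟨7, 53, 53, 674⟩, ⟨7, 53, 54, 13⟩,
   ⟨7, 55, 56, 16⟩, ⟨8, 8, 44, 537⟩, ⟨8, 8, 50, 146⟩, ⟨8, 8, 52, 778⟩, ⟨8, 8, 55, 15⟩,
   ⟨8, 8, 56, 15⟩, ⟨8, 12, 44, 498⟩, ⟨8, 12, 52, 265⟩, ⟨8, 16, 44, 629⟩, ⟨8, 16, 52, 860⟩,
   ⟨8, 18, 50, 213⟩, ⟨8, 20, 44, 285⟩, ⟨8, 20, 46, 22⟩, ⟨8, 20, 50, 15⟩, ⟨8, 20, 52, 301⟩,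
   ⟨8, 21, 44, 139⟩, ⟨8, 21, 45, 32⟩, ⟨8, 21, 50, 30⟩, ⟨8, 21, 52, 90⟩, ⟨8, 24, 41, 247⟩,
   ⟨8, 24, 44, 375⟩, ⟨8, 24, 48, 95⟩, ⟨8, 24, 50, 117⟩, ⟨8, 24, 52, 585⟩, ⟨8, 24, 54, 76⟩,
   ⟨8, 24, 55, 129⟩, ⟨8, 24, 56, 73⟩, ⟨8, 28, 39, 4⟩, ⟨8, 28, 42, 4⟩, ⟨8, 28, 44, 110⟩,
   ⟨8, 28, 50, 36⟩, ⟨8, 28, 52, 145⟩, ⟨8, 29, 39, 5⟩, ⟨8, 29, 40, 5⟩, ⟨8, 29, 41, 5⟩,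
   ⟨8, 29, 42, 4⟩, ⟨8, 29, 44, 362⟩, ⟨8, 29, 50, 8⟩, ⟨8, 29, 52, 180⟩, ⟨8, 31, 39, 3⟩,
   ⟨8, 31, 40, 3⟩, ⟨8, 31, 41, 3⟩, ⟨8, 31, 42, 53⟩, ⟨8, 31, 44, 11⟩, ⟨8, 31, 52, 135⟩,
   ⟨8, 31, 54, 28⟩, ⟨8, 31, 55, 42⟩, ⟨8, 31, 56, 35⟩, ⟨8, 32, 39, 2⟩, ⟨8, 32, 40, 3⟩,
   ⟨8, 32, 41, 3⟩, ⟨8, 32, 42, 54⟩, ⟨8, 32, 44, 16⟩, ⟨8, 32, 52, 228⟩, ⟨8, 32, 54, 146⟩,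
   ⟨8, 33, 50, 6⟩, ⟨8, 33, 54, 26⟩, ⟨8, 33, 55, 77⟩, ⟨8, 33, 56, 56⟩, ⟨8, 36, 40, 19⟩,
   ⟨8, 36, 41, 32⟩, ⟨8, 36, 44, 150⟩, ⟨8, 36, 50, 151⟩, ⟨8, 36, 52, 329⟩, ⟨8, 37, 44, 452⟩,
   ⟨8, 37, 52, 301⟩, ⟨8, 39, 45, 36⟩, ⟨8, 39, 46, 24⟩, ⟨8, 39, 54, 49⟩, ⟨8, 39, 55, 68⟩,
   ⟨8, 39, 56, 59⟩, ⟨8, 40, 40, 83⟩, ⟨8, 40, 42, 173⟩, ⟨8, 40, 44, 11⟩, ⟨8, 40, 45, 51⟩,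
   ⟨8, 40, 46, 15⟩, ⟨8, 40, 52, 245⟩, ⟨8, 40, 54, 118⟩, ⟨8, 40, 55, 48⟩, ⟨8, 41, 48, 8⟩,
   ⟨8, 41, 50, 59⟩, ⟨8, 41, 52, 9⟩, ⟨8, 41, 54, 17⟩, ⟨8, 41, 55, 15⟩, ⟨8, 41, 56, 15⟩,
   ⟨8, 42, 42, 23⟩, ⟨8, 42, 45, 31⟩, ⟨8, 42, 46, 21⟩, ⟨8, 42, 48, 70⟩, ⟨8, 42, 50, 159⟩,
   ⟨8, 42, 54, 7⟩, ⟨8, 42, 55, 6⟩, ⟨8, 42, 56, 6⟩, ⟨8, 44, 44, 114⟩, ⟨8, 44, 48, 47⟩,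
   ⟨8, 44, 52, 132⟩, ⟨8, 44, 53, 20⟩, ⟨8, 44, 54, 56⟩, ⟨8, 44, 55, 26⟩, ⟨8, 44, 56, 25⟩,
   ⟨8, 45, 45, 108⟩, ⟨8, 45, 46, 31⟩, ⟨8, 45, 48, 6⟩, ⟨8, 45, 49, 10⟩, ⟨8, 45, 52, 88⟩,
   ⟨8, 45, 53, 64⟩, ⟨8, 45, 56, 130⟩, ⟨8, 48, 48, 15⟩, ⟨8, 48, 49, 8⟩, ⟨8, 48, 54, 90⟩,
   ⟨8, 48, 55, 27⟩, ⟨8, 48, 56, 26⟩, ⟨8, 49, 54, 22⟩, ⟨8, 49, 55, 23⟩, ⟨8, 49, 56, 22⟩,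
   ⟨8, 50, 50, 86⟩, ⟨8, 50, 54, 23⟩, ⟨8, 52, 52, 279⟩, ⟨8, 52, 53, 88⟩, ⟨8, 52, 54, 15⟩,
   ⟨8, 52, 55, 35⟩, ⟨8, 53, 53, 60⟩, ⟨8, 53, 55, 18⟩, ⟨8, 54, 54, 261⟩, ⟨8, 54, 56, 36⟩,
   ⟨8, 55, 55, 46⟩, ⟨8, 55, 56, 23⟩, ⟨8, 56, 56, 45⟩, ⟨12, 12, 40, 174⟩, ⟨12, 12, 41, 309⟩,
   ⟨12, 12, 42, 182⟩, ⟨12, 12, 44, 95⟩, ⟨12, 12, 48, 3109⟩, ⟨12, 12, 52, 13⟩, ⟨12, 12, 53, 83⟩,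
   ⟨12, 12, 54, 214⟩, ⟨12, 12, 55, 214⟩, ⟨12, 12, 56, 207⟩, ⟨12, 14, 42, 60⟩, ⟨12, 14, 54, 136⟩,
   ⟨12, 15, 49, 95⟩, ⟨12, 15, 54, 25⟩, ⟨12, 15, 56, 24⟩, ⟨12, 16, 39, 15⟩, ⟨12, 16, 40, 166⟩,
   ⟨12, 16, 42, 48⟩, ⟨12, 16, 44, 95⟩, ⟨12, 16, 56, 229⟩, ⟨12, 18, 42, 397⟩, ⟨12, 18, 46, 11⟩,
   ⟨12, 18, 48, 579⟩, ⟨12, 18, 49, 5⟩, ⟨12, 18, 50, 5⟩, ⟨12, 18, 54, 78⟩, ⟨12, 18, 55, 87⟩,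
   ⟨12, 18, 56, 85⟩, ⟨12, 19, 41, 17⟩, ⟨12, 19, 42, 14⟩, ⟨12, 19, 45, 12⟩, ⟨12, 19, 48, 55⟩,
   ⟨12, 19, 49, 5⟩, ⟨12, 19, 50, 4⟩, ⟨12, 20, 39, 14⟩, ⟨12, 20, 41, 121⟩, ⟨12, 20, 42, 199⟩,
   ⟨12, 20, 44, 284⟩, ⟨12, 20, 45, 7⟩, ⟨12, 20, 49, 4⟩, ⟨12, 20, 50, 3⟩, ⟨12, 20, 52, 335⟩,
   ⟨12, 20, 53, 65⟩, ⟨12, 20, 54, 97⟩, ⟨12, 20, 55, 179⟩, ⟨12, 20, 56, 171⟩, ⟨12, 21, 39, 16⟩,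
   ⟨12, 21, 41, 586⟩, ⟨12, 21, 44, 382⟩, ⟨12, 21, 46, 7⟩, ⟨12, 21, 48, 868⟩, ⟨12, 21, 49, 4⟩,
   ⟨12, 21, 50, 4⟩, ⟨12, 21, 52, 398⟩, ⟨12, 21, 53, 120⟩, ⟨12, 21, 54, 93⟩, ⟨12, 21, 55, 167⟩,
   ⟨12, 21, 56, 160⟩, ⟨12, 24, 41, 147⟩, ⟨12, 24, 42, 272⟩, ⟨12, 24, 46, 95⟩, ⟨12, 24, 48, 262⟩,
   ⟨12, 24, 50, 95⟩, ⟨12, 24, 54, 252⟩, ⟨12, 24, 55, 78⟩, ⟨12, 24, 56, 57⟩, ⟨12, 28, 39, 37⟩,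
   ⟨12, 28, 40, 47⟩, ⟨12, 28, 41, 48⟩, ⟨12, 28, 42, 296⟩, ⟨12, 28, 45, 61⟩, ⟨12, 28, 48, 88⟩,
   ⟨12, 28, 56, 371⟩, ⟨12, 29, 39, 30⟩, ⟨12, 29, 40, 36⟩, ⟨12, 29, 41, 37⟩, ⟨12, 29, 42, 108⟩,
   ⟨12, 29, 46, 35⟩, ⟨12, 29, 48, 7⟩, ⟨12, 29, 52, 95⟩, ⟨12, 29, 54, 294⟩, ⟨12, 30, 48, 902⟩,
   ⟨12, 31, 39, 10⟩, ⟨12, 31, 40, 13⟩, ⟨12, 31, 41, 17⟩, ⟨12, 31, 42, 34⟩, ⟨12, 31, 56, 2⟩,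
   ⟨12, 32, 39, 13⟩, ⟨12, 32, 40, 18⟩, ⟨12, 32, 41, 33⟩, ⟨12, 32, 42, 404⟩, ⟨12, 32, 54, 45⟩,
   ⟨12, 32, 55, 85⟩, ⟨12, 32, 56, 42⟩, ⟨12, 33, 45, 95⟩, ⟨12, 33, 48, 1009⟩, ⟨12, 33, 49, 95⟩,
   ⟨12, 33, 54, 83⟩, ⟨12, 36, 40, 38⟩, ⟨12, 36, 41, 137⟩, ⟨12, 36, 42, 439⟩, ⟨12, 36, 48, 1027⟩,
   ⟨12, 36, 53, 94⟩, ⟨12, 36, 54, 202⟩, ⟨12, 36, 55, 221⟩, ⟨12, 37, 44, 95⟩, ⟨12, 37, 53, 1⟩,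
   ⟨12, 37, 56, 1⟩, ⟨12, 39, 39, 473⟩, ⟨12, 39, 45, 196⟩, ⟨12, 39, 46, 39⟩, ⟨12, 39, 48, 471⟩,
   ⟨12, 39, 54, 13⟩, ⟨12, 39, 55, 37⟩, ⟨12, 39, 56, 16⟩, ⟨12, 40, 40, 789⟩, ⟨12, 40, 44, 56⟩,
   ⟨12, 40, 52, 43⟩, ⟨12, 40, 53, 151⟩, ⟨12, 40, 54, 125⟩, ⟨12, 40, 55, 72⟩, ⟨12, 41, 52, 12⟩,
   ⟨12, 41, 53, 59⟩, ⟨12, 42, 48, 95⟩, ⟨12, 44, 44, 39⟩, ⟨12, 44, 52, 613⟩, ⟨12, 44, 53, 58⟩,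
   ⟨12, 44, 54, 19⟩, ⟨12, 44, 55, 23⟩, ⟨12, 44, 56, 22⟩, ⟨12, 45, 45, 347⟩, ⟨12, 45, 46, 130⟩,
   ⟨12, 45, 50, 95⟩, ⟨12, 45, 54, 341⟩, ⟨12, 45, 55, 31⟩, ⟨12, 45, 56, 29⟩, ⟨12, 46, 46, 49⟩,
   ⟨12, 46, 55, 2⟩, ⟨12, 46, 56, 2⟩, ⟨12, 48, 48, 2003⟩, ⟨12, 48, 49, 134⟩, ⟨12, 48, 54, 267⟩,
   ⟨12, 48, 55, 87⟩, ⟨12, 48, 56, 74⟩, ⟨12, 49, 50, 37⟩, ⟨12, 50, 50, 378⟩, ⟨12, 52, 52, 453⟩,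
   ⟨12, 52, 54, 21⟩, ⟨12, 52, 55, 63⟩, ⟨12, 52, 56, 58⟩, ⟨12, 53, 53, 18⟩, ⟨12, 54, 54, 101⟩,
   ⟨12, 54, 56, 8⟩, ⟨12, 55, 56, 52⟩, ⟨14, 14, 39, 169⟩, ⟨14, 14, 40, 169⟩, ⟨14, 14, 41, 211⟩,
   ⟨14, 14, 42, 211⟩, ⟨14, 14, 45, 297⟩, ⟨14, 14, 46, 240⟩, ⟨14, 14, 53, 100⟩, ⟨14, 14, 54, 186⟩,
   ⟨14, 14, 55, 282⟩, ⟨14, 14, 56, 261⟩, ⟨14, 15, 39, 27⟩, ⟨14, 15, 40, 27⟩, ⟨14, 15, 41, 29⟩,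
   ⟨14, 15, 44, 9⟩, ⟨14, 15, 45, 272⟩, ⟨14, 15, 50, 357⟩, ⟨14, 19, 49, 20⟩, ⟨14, 20, 39, 10⟩,
   ⟨14, 20, 40, 51⟩, ⟨14, 20, 41, 54⟩, ⟨14, 20, 49, 20⟩, ⟨14, 20, 54, 41⟩, ⟨14, 20, 55, 90⟩,
   ⟨14, 20, 56, 28⟩, ⟨14, 21, 41, 9⟩, ⟨14, 21, 42, 6⟩, ⟨14, 21, 44, 32⟩, ⟨14, 21, 45, 8⟩,
   ⟨14, 21, 50, 7⟩, ⟨14, 21, 52, 27⟩, ⟨14, 21, 54, 20⟩, ⟨14, 21, 56, 9⟩, ⟨14, 24, 41, 300⟩,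
   ⟨14, 24, 46, 467⟩, ⟨14, 24, 50, 461⟩, ⟨14, 24, 54, 208⟩, ⟨14, 24, 55, 88⟩, ⟨14, 24, 56, 77⟩,
   ⟨14, 28, 39, 28⟩, ⟨14, 28, 40, 33⟩, ⟨14, 28, 41, 36⟩, ⟨14, 28, 42, 214⟩, ⟨14, 28, 48, 26⟩,
   ⟨14, 28, 53, 46⟩, ⟨14, 28, 55, 128⟩, ⟨14, 29, 39, 14⟩, ⟨14, 29, 40, 15⟩, ⟨14, 29, 41, 16⟩,
   ⟨14, 29, 42, 24⟩, ⟨14, 29, 54, 2⟩, ⟨14, 30, 49, 406⟩, ⟨14, 30, 50, 627⟩, ⟨14, 31, 39, 24⟩,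
   ⟨14, 31, 40, 81⟩, ⟨14, 31, 41, 88⟩, ⟨14, 31, 42, 151⟩, ⟨14, 31, 54, 517⟩, ⟨14, 31, 55, 140⟩,
   ⟨14, 32, 39, 21⟩, ⟨14, 32, 40, 57⟩, ⟨14, 32, 41, 82⟩, ⟨14, 32, 42, 137⟩, ⟨14, 32, 53, 98⟩,
   ⟨14, 32, 54, 43⟩, ⟨14, 32, 55, 29⟩, ⟨14, 32, 56, 23⟩, ⟨14, 33, 45, 45⟩, ⟨14, 33, 48, 12⟩,
   ⟨14, 33, 49, 16⟩, ⟨14, 33, 50, 14⟩, ⟨14, 36, 39, 27⟩, ⟨14, 36, 40, 220⟩, ⟨14, 36, 45, 11⟩,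
   ⟨14, 36, 46, 11⟩, ⟨14, 36, 48, 81⟩, ⟨14, 36, 50, 65⟩, ⟨14, 36, 54, 114⟩, ⟨14, 36, 55, 32⟩,
   ⟨14, 36, 56, 24⟩, ⟨14, 37, 39, 3⟩, ⟨14, 37, 44, 9⟩, ⟨14, 37, 53, 103⟩, ⟨14, 37, 54, 1⟩,
   ⟨14, 39, 39, 94⟩, ⟨14, 39, 40, 23⟩, ⟨14, 39, 45, 244⟩, ⟨14, 39, 46, 602⟩, ⟨14, 39, 52, 2⟩,
   ⟨14, 39, 53, 213⟩, ⟨14, 39, 54, 240⟩, ⟨14, 39, 55, 130⟩, ⟨14, 40, 40, 31⟩, ⟨14, 40, 52, 1⟩,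
   ⟨14, 40, 54, 29⟩, ⟨14, 40, 55, 10⟩, ⟨14, 41, 48, 56⟩, ⟨14, 41, 53, 5⟩, ⟨14, 45, 45, 176⟩,
   ⟨14, 45, 46, 683⟩, ⟨14, 45, 48, 10⟩, ⟨14, 45, 49, 10⟩, ⟨14, 45, 50, 12⟩, ⟨14, 45, 52, 6⟩,
   ⟨14, 45, 53, 9⟩, ⟨14, 45, 54, 71⟩, ⟨14, 46, 49, 6⟩, ⟨14, 46, 52, 3⟩, ⟨14, 46, 54, 434⟩,
   ⟨14, 46, 55, 22⟩, ⟨14, 46, 56, 21⟩, ⟨14, 48, 55, 12⟩, ⟨14, 49, 55, 83⟩, ⟨14, 50, 50, 38⟩,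
   ⟨14, 53, 53, 549⟩, ⟨14, 54, 54, 295⟩, ⟨14, 54, 55, 32⟩, ⟨14, 54, 56, 26⟩, ⟨14, 55, 55, 12⟩,
   ⟨14, 55, 56, 6⟩, ⟨14, 56, 56, 11⟩, ⟨15, 15, 41, 72⟩, ⟨15, 15, 45, 4545⟩, ⟨15, 15, 49, 4545⟩,
   ⟨15, 15, 55, 95⟩, ⟨15, 19, 46, 20⟩, ⟨15, 19, 49, 21⟩, ⟨15, 19, 50, 22⟩, ⟨15, 20, 44, 30⟩,
   ⟨15, 20, 45, 10⟩, ⟨15, 20, 49, 22⟩, ⟨15, 24, 41, 366⟩, ⟨15, 24, 45, 54⟩, ⟨15, 24, 46, 127⟩,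
   ⟨15, 24, 48, 283⟩, ⟨15, 24, 49, 190⟩, ⟨15, 24, 50, 84⟩, ⟨15, 24, 55, 292⟩, ⟨15, 28, 39, 17⟩,
   ⟨15, 28, 40, 19⟩, ⟨15, 28, 41, 20⟩, ⟨15, 28, 42, 25⟩, ⟨15, 28, 48, 23⟩, ⟨15, 28, 49, 21⟩,
   ⟨15, 28, 53, 26⟩, ⟨15, 28, 54, 88⟩, ⟨15, 28, 56, 63⟩, ⟨15, 29, 39, 10⟩, ⟨15, 29, 40, 11⟩,
   ⟨15, 29, 41, 11⟩, ⟨15, 29, 42, 12⟩, ⟨15, 29, 48, 25⟩, ⟨15, 30, 45, 3776⟩, ⟨15, 30, 50, 3776⟩,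
   ⟨15, 31, 39, 14⟩, ⟨15, 31, 40, 27⟩, ⟨15, 31, 41, 27⟩, ⟨15, 31, 42, 32⟩, ⟨15, 32, 39, 21⟩,
   ⟨15, 32, 40, 54⟩, ⟨15, 32, 41, 76⟩, ⟨15, 32, 42, 121⟩, ⟨15, 32, 54, 322⟩, ⟨15, 33, 46, 57⟩,
   ⟨15, 33, 48, 17⟩, ⟨15, 33, 49, 26⟩, ⟨15, 33, 50, 18⟩, ⟨15, 36, 39, 13⟩, ⟨15, 36, 50, 61⟩,
   ⟨15, 36, 55, 111⟩, ⟨15, 37, 39, 2⟩, ⟨15, 37, 44, 7⟩, ⟨15, 37, 53, 20⟩, ⟨15, 37, 56, 1⟩,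
   ⟨15, 39, 39, 12⟩, ⟨15, 39, 40, 8⟩, ⟨15, 39, 45, 303⟩, ⟨15, 39, 46, 214⟩, ⟨15, 39, 53, 218⟩,
   ⟨15, 39, 54, 14⟩, ⟨15, 39, 55, 14⟩, ⟨15, 39, 56, 9⟩, ⟨15, 40, 40, 33⟩, ⟨15, 40, 54, 6⟩,
   ⟨15, 40, 56, 4⟩, ⟨15, 41, 48, 39⟩, ⟨15, 41, 53, 4⟩, ⟨15, 41, 55, 4⟩, ⟨15, 45, 45, 6168⟩,
   ⟨15, 45, 48, 14⟩, ⟨15, 45, 49, 15⟩, ⟨15, 45, 50, 19⟩, ⟨15, 45, 52, 6⟩, ⟨15, 45, 53, 8⟩,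
   ⟨15, 45, 56, 17⟩, ⟨15, 46, 46, 454⟩, ⟨15, 46, 50, 8⟩, ⟨15, 46, 52, 3⟩, ⟨15, 46, 53, 348⟩,
   ⟨15, 46, 55, 10⟩, ⟨15, 50, 50, 57⟩, ⟨15, 53, 53, 261⟩, ⟨16, 16, 44, 803⟩, ⟨16, 16, 52, 867⟩,
   ⟨16, 24, 44, 471⟩, ⟨16, 24, 52, 295⟩, ⟨16, 28, 39, 23⟩, ⟨16, 28, 40, 30⟩, ⟨16, 28, 41, 33⟩,
   ⟨16, 28, 42, 49⟩, ⟨16, 28, 44, 69⟩, ⟨16, 28, 52, 195⟩, ⟨16, 28, 53, 65⟩, ⟨16, 28, 54, 123⟩,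
   ⟨16, 28, 55, 71⟩, ⟨16, 28, 56, 70⟩, ⟨16, 29, 40, 13⟩, ⟨16, 29, 41, 14⟩, ⟨16, 29, 42, 15⟩,
   ⟨16, 29, 44, 404⟩, ⟨16, 29, 52, 359⟩, ⟨16, 29, 54, 3⟩, ⟨16, 29, 56, 3⟩, ⟨16, 36, 40, 134⟩,
   ⟨16, 36, 42, 78⟩, ⟨16, 36, 52, 663⟩, ⟨16, 37, 37, 16⟩, ⟨16, 37, 44, 576⟩, ⟨16, 37, 52, 71⟩,
   ⟨16, 37, 53, 189⟩, ⟨16, 37, 54, 26⟩, ⟨16, 37, 55, 21⟩, ⟨16, 37, 56, 21⟩, ⟨16, 44, 44, 304⟩,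
   ⟨16, 44, 52, 344⟩, ⟨16, 44, 53, 48⟩, ⟨16, 44, 54, 232⟩, ⟨16, 44, 55, 103⟩, ⟨16, 52, 52, 856⟩,
   ⟨16, 52, 55, 6⟩, ⟨16, 52, 56, 6⟩, ⟨16, 53, 53, 18⟩, ⟨16, 54, 54, 27⟩, ⟨16, 54, 55, 21⟩,
   ⟨16, 54, 56, 19⟩, ⟨16, 55, 55, 114⟩, ⟨18, 18, 41, 1715⟩, ⟨18, 18, 45, 343⟩, ⟨18, 18, 46, 343⟩,
   ⟨18, 18, 49, 684⟩, ⟨18, 18, 54, 979⟩, ⟨18, 19, 45, 275⟩, ⟨18, 19, 56, 626⟩, ⟨18, 21, 42, 300⟩,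
   ⟨18, 21, 45, 300⟩, ⟨18, 21, 46, 300⟩, ⟨18, 21, 48, 532⟩, ⟨18, 21, 55, 1925⟩, ⟨18, 28, 39, 30⟩,
   ⟨18, 28, 42, 110⟩, ⟨18, 28, 45, 8⟩, ⟨18, 28, 46, 12⟩, ⟨18, 28, 48, 21⟩, ⟨18, 28, 49, 13⟩,
   ⟨18, 28, 54, 53⟩, ⟨18, 28, 55, 39⟩, ⟨18, 28, 56, 34⟩, ⟨18, 29, 42, 11⟩, ⟨18, 29, 45, 7⟩,
   ⟨18, 29, 46, 10⟩, ⟨18, 29, 48, 15⟩, ⟨18, 29, 49, 11⟩, ⟨18, 29, 50, 10⟩, ⟨18, 31, 48, 27⟩,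
   ⟨18, 31, 50, 17⟩, ⟨18, 32, 46, 32⟩, ⟨18, 32, 48, 123⟩, ⟨18, 32, 49, 33⟩, ⟨18, 33, 39, 27⟩,
   ⟨18, 33, 40, 50⟩, ⟨18, 33, 41, 51⟩, ⟨18, 33, 42, 126⟩, ⟨18, 33, 54, 88⟩, ⟨18, 33, 56, 224⟩,
   ⟨18, 36, 45, 8⟩, ⟨18, 36, 48, 331⟩, ⟨18, 36, 50, 537⟩, ⟨18, 39, 39, 1574⟩, ⟨18, 39, 40, 531⟩,
   ⟨18, 39, 48, 7⟩, ⟨18, 39, 49, 7⟩, ⟨18, 39, 50, 11⟩, ⟨18, 39, 55, 10⟩, ⟨18, 40, 41, 444⟩,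
   ⟨18, 40, 50, 34⟩, ⟨18, 40, 53, 2⟩, ⟨18, 41, 50, 89⟩, ⟨18, 41, 54, 105⟩, ⟨18, 41, 55, 91⟩,
   ⟨18, 42, 48, 67⟩, ⟨18, 42, 50, 352⟩, ⟨18, 42, 53, 2⟩, ⟨18, 45, 45, 71⟩, ⟨18, 45, 46, 33⟩,
   ⟨18, 46, 46, 55⟩, ⟨18, 48, 48, 642⟩, ⟨18, 48, 49, 51⟩, ⟨18, 48, 50, 22⟩, ⟨18, 48, 55, 118⟩,
   ⟨18, 48, 56, 102⟩, ⟨18, 49, 50, 19⟩, ⟨18, 49, 54, 46⟩, ⟨18, 49, 56, 69⟩, ⟨18, 50, 50, 479⟩,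
   ⟨18, 50, 54, 72⟩, ⟨18, 50, 56, 150⟩, ⟨19, 20, 44, 1700⟩, ⟨19, 20, 45, 1700⟩, ⟨19, 21, 39, 536⟩,
   ⟨19, 21, 41, 936⟩, ⟨19, 21, 42, 936⟩, ⟨19, 21, 50, 936⟩, ⟨19, 21, 54, 936⟩, ⟨19, 24, 49, 35⟩,
   ⟨19, 24, 50, 17⟩, ⟨19, 28, 40, 179⟩, ⟨19, 28, 45, 8⟩, ⟨19, 28, 46, 13⟩, ⟨19, 28, 48, 23⟩,
   ⟨19, 28, 49, 14⟩, ⟨19, 28, 56, 21⟩, ⟨19, 29, 39, 10⟩, ⟨19, 29, 41, 12⟩, ⟨19, 29, 42, 13⟩,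
   ⟨19, 29, 45, 8⟩, ⟨19, 29, 46, 11⟩, ⟨19, 29, 48, 16⟩, ⟨19, 29, 49, 11⟩, ⟨19, 31, 45, 16⟩,
   ⟨19, 31, 48, 21⟩, ⟨19, 31, 49, 17⟩, ⟨19, 32, 39, 28⟩, ⟨19, 32, 46, 24⟩, ⟨19, 32, 48, 50⟩,
   ⟨19, 32, 49, 32⟩, ⟨19, 33, 42, 150⟩, ⟨19, 33, 49, 27⟩, ⟨19, 36, 45, 10⟩, ⟨19, 39, 42, 4211⟩,
   ⟨19, 40, 53, 1⟩, ⟨19, 41, 42, 1057⟩, ⟨19, 45, 48, 69⟩, ⟨19, 46, 46, 58⟩, ⟨19, 46, 49, 8⟩,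
   ⟨19, 48, 49, 37⟩, ⟨19, 48, 50, 19⟩, ⟨20, 20, 40, 52117⟩, ⟨20, 20, 41, 52118⟩,
   ⟨20, 20, 50, 52118⟩, ⟨20, 21, 42, 1497⟩, ⟨20, 21, 48, 1497⟩, ⟨20, 24, 40, 134⟩,
   ⟨20, 24, 42, 263⟩, ⟨20, 24, 44, 152⟩, ⟨20, 24, 48, 86⟩, ⟨20, 24, 54, 262⟩, ⟨20, 24, 55, 105⟩,
   ⟨20, 24, 56, 41⟩, ⟨20, 28, 39, 27⟩, ⟨20, 28, 44, 84⟩, ⟨20, 28, 50, 10⟩, ⟨20, 28, 53, 37⟩,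
   ⟨20, 28, 54, 72⟩, ⟨20, 28, 55, 49⟩, ⟨20, 28, 56, 41⟩, ⟨20, 29, 40, 22⟩, ⟨20, 29, 41, 23⟩,
   ⟨20, 29, 42, 27⟩, ⟨20, 29, 44, 110⟩, ⟨20, 29, 48, 12⟩, ⟨20, 29, 50, 9⟩, ⟨20, 29, 52, 400⟩,
   ⟨20, 31, 40, 62⟩, ⟨20, 31, 42, 90⟩, ⟨20, 31, 44, 99⟩, ⟨20, 31, 45, 50⟩, ⟨20, 31, 46, 74⟩,
   ⟨20, 31, 48, 69⟩, ⟨20, 31, 49, 26⟩, ⟨20, 31, 50, 35⟩, ⟨20, 31, 53, 11⟩, ⟨20, 31, 54, 10⟩,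
   ⟨20, 31, 55, 19⟩, ⟨20, 31, 56, 17⟩, ⟨20, 32, 40, 41⟩, ⟨20, 32, 42, 52⟩, ⟨20, 32, 44, 242⟩,
   ⟨20, 32, 48, 49⟩, ⟨20, 32, 49, 23⟩, ⟨20, 32, 50, 28⟩, ⟨20, 32, 52, 139⟩, ⟨20, 32, 53, 7⟩,
   ⟨20, 32, 56, 9⟩, ⟨20, 33, 39, 21⟩, ⟨20, 33, 41, 36⟩, ⟨20, 33, 42, 64⟩, ⟨20, 33, 48, 164⟩,
   ⟨20, 33, 50, 13⟩, ⟨20, 33, 52, 9⟩, ⟨20, 33, 56, 19⟩, ⟨20, 36, 39, 18⟩, ⟨20, 36, 40, 25⟩,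
   ⟨20, 36, 41, 28⟩, ⟨20, 36, 42, 44⟩, ⟨20, 36, 48, 96⟩, ⟨20, 36, 49, 38⟩, ⟨20, 36, 50, 13⟩,
   ⟨20, 36, 52, 50⟩, ⟨20, 36, 56, 174⟩, ⟨20, 39, 45, 37⟩, ⟨20, 39, 46, 76⟩, ⟨20, 39, 52, 29⟩,
   ⟨20, 39, 56, 278⟩, ⟨20, 40, 40, 171868⟩, ⟨20, 40, 52, 555⟩, ⟨20, 40, 55, 33⟩, ⟨20, 41, 48, 129⟩,
   ⟨20, 41, 53, 10⟩, ⟨20, 41, 54, 13⟩, ⟨20, 41, 55, 10⟩, ⟨20, 42, 42, 1136⟩, ⟨20, 42, 50, 90⟩,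
   ⟨20, 42, 53, 19⟩, ⟨20, 42, 54, 53⟩, ⟨20, 42, 55, 26⟩, ⟨20, 42, 56, 26⟩, ⟨20, 44, 44, 95⟩,
   ⟨20, 45, 49, 18⟩, ⟨20, 45, 52, 110⟩, ⟨20, 45, 54, 435⟩, ⟨20, 45, 56, 130⟩, ⟨20, 48, 49, 6⟩,
   ⟨20, 48, 50, 6⟩, ⟨20, 48, 52, 267⟩, ⟨20, 48, 54, 180⟩, ⟨20, 50, 56, 58⟩, ⟨20, 52, 52, 249⟩,
   ⟨20, 52, 54, 28⟩, ⟨20, 52, 55, 22⟩, ⟨20, 53, 56, 27⟩, ⟨20, 54, 54, 144⟩, ⟨20, 54, 56, 51⟩,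
   ⟨20, 55, 56, 163⟩, ⟨21, 21, 39, 1240⟩, ⟨21, 21, 45, 2399⟩, ⟨21, 21, 46, 2399⟩,
   ⟨21, 21, 48, 2399⟩, ⟨21, 21, 49, 2399⟩, ⟨21, 21, 50, 2399⟩, ⟨21, 21, 52, 2399⟩,
   ⟨21, 21, 53, 2399⟩, ⟨21, 21, 54, 2399⟩, ⟨21, 21, 55, 2399⟩, ⟨21, 24, 39, 25⟩, ⟨21, 24, 41, 48⟩,
   ⟨21, 24, 42, 196⟩, ⟨21, 24, 44, 89⟩, ⟨21, 24, 48, 352⟩, ⟨21, 24, 49, 46⟩, ⟨21, 24, 50, 128⟩,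
   ⟨21, 24, 54, 209⟩, ⟨21, 24, 55, 48⟩, ⟨21, 28, 40, 166⟩, ⟨21, 28, 42, 355⟩, ⟨21, 28, 44, 72⟩,
   ⟨21, 28, 45, 95⟩, ⟨21, 28, 46, 207⟩, ⟨21, 28, 48, 382⟩, ⟨21, 28, 50, 46⟩, ⟨21, 28, 52, 273⟩,
   ⟨21, 28, 53, 104⟩, ⟨21, 28, 54, 244⟩, ⟨21, 28, 55, 134⟩, ⟨21, 29, 44, 71⟩, ⟨21, 29, 46, 71⟩,
   ⟨21, 29, 48, 65⟩, ⟨21, 29, 49, 24⟩, ⟨21, 29, 50, 30⟩, ⟨21, 31, 42, 355⟩, ⟨21, 31, 44, 74⟩,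
   ⟨21, 31, 45, 17⟩, ⟨21, 31, 48, 26⟩, ⟨21, 31, 54, 608⟩, ⟨21, 32, 40, 112⟩, ⟨21, 32, 41, 117⟩,
   ⟨21, 32, 42, 127⟩, ⟨21, 32, 44, 130⟩, ⟨21, 32, 48, 26⟩, ⟨21, 32, 50, 20⟩, ⟨21, 32, 53, 29⟩,
   ⟨21, 32, 54, 16⟩, ⟨21, 32, 55, 54⟩, ⟨21, 32, 56, 41⟩, ⟨21, 33, 40, 66⟩, ⟨21, 33, 42, 216⟩,
   ⟨21, 33, 45, 33⟩, ⟨21, 33, 46, 134⟩, ⟨21, 33, 53, 263⟩, ⟨21, 33, 54, 95⟩, ⟨21, 36, 41, 93⟩,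
   ⟨21, 36, 45, 30⟩, ⟨21, 36, 46, 100⟩, ⟨21, 36, 48, 48⟩, ⟨21, 36, 53, 270⟩, ⟨21, 36, 54, 57⟩,
   ⟨21, 36, 55, 92⟩, ⟨21, 36, 56, 54⟩, ⟨21, 39, 40, 8722⟩, ⟨21, 39, 45, 367⟩, ⟨21, 39, 50, 185⟩,
   ⟨21, 39, 52, 52⟩, ⟨21, 39, 55, 303⟩, ⟨21, 40, 40, 1647⟩, ⟨21, 40, 49, 588⟩, ⟨21, 40, 53, 142⟩,
   ⟨21, 40, 54, 52⟩, ⟨21, 40, 55, 38⟩, ⟨21, 41, 41, 1647⟩, ⟨21, 41, 42, 531⟩, ⟨21, 41, 48, 172⟩,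
   ⟨21, 41, 49, 64⟩, ⟨21, 41, 52, 27⟩, ⟨21, 41, 53, 128⟩, ⟨21, 41, 54, 30⟩, ⟨21, 41, 56, 25⟩,
   ⟨21, 42, 42, 784⟩, ⟨21, 42, 48, 100⟩, ⟨21, 42, 52, 27⟩, ⟨21, 42, 53, 349⟩, ⟨21, 42, 54, 66⟩,
   ⟨21, 42, 55, 42⟩, ⟨21, 42, 56, 42⟩, ⟨21, 45, 45, 466⟩, ⟨21, 45, 46, 126⟩, ⟨21, 45, 52, 16⟩,
   ⟨21, 46, 46, 200⟩, ⟨21, 46, 55, 12⟩, ⟨21, 48, 48, 57⟩, ⟨21, 48, 49, 21⟩, ⟨21, 48, 53, 652⟩,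
   ⟨21, 48, 55, 21⟩, ⟨21, 49, 49, 34⟩, ⟨21, 49, 55, 18⟩, ⟨21, 50, 50, 14⟩, ⟨21, 50, 52, 51⟩,
   ⟨21, 50, 53, 38⟩, ⟨21, 50, 54, 29⟩, ⟨21, 50, 55, 44⟩, ⟨21, 52, 52, 151⟩, ⟨21, 52, 53, 40⟩,
   ⟨21, 52, 54, 24⟩, ⟨21, 52, 56, 19⟩, ⟨21, 53, 53, 613⟩, ⟨21, 53, 56, 34⟩, ⟨21, 54, 54, 81⟩,
   ⟨21, 54, 56, 36⟩, ⟨21, 56, 56, 102⟩, ⟨24, 24, 39, 20⟩, ⟨24, 24, 40, 33⟩, ⟨24, 24, 41, 61⟩,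
   ⟨24, 24, 42, 551⟩, ⟨24, 24, 44, 130⟩, ⟨24, 24, 48, 543⟩, ⟨24, 24, 50, 122⟩, ⟨24, 24, 54, 555⟩,
   ⟨24, 24, 55, 73⟩, ⟨24, 24, 56, 36⟩, ⟨24, 28, 39, 9⟩, ⟨24, 28, 41, 39⟩, ⟨24, 28, 42, 105⟩,
   ⟨24, 28, 44, 25⟩, ⟨24, 28, 48, 350⟩, ⟨24, 28, 49, 66⟩, ⟨24, 28, 50, 80⟩, ⟨24, 28, 54, 196⟩,
   ⟨24, 28, 55, 91⟩, ⟨24, 28, 56, 31⟩, ⟨24, 29, 40, 30⟩, ⟨24, 29, 41, 54⟩, ⟨24, 29, 42, 429⟩,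
   ⟨24, 29, 46, 129⟩, ⟨24, 29, 48, 186⟩, ⟨24, 29, 54, 347⟩, ⟨24, 31, 41, 61⟩, ⟨24, 31, 42, 102⟩,
   ⟨24, 31, 44, 80⟩, ⟨24, 31, 45, 13⟩, ⟨24, 31, 48, 537⟩, ⟨24, 31, 49, 38⟩, ⟨24, 31, 54, 53⟩,
   ⟨24, 31, 55, 48⟩, ⟨24, 32, 39, 26⟩, ⟨24, 32, 41, 94⟩, ⟨24, 32, 42, 81⟩, ⟨24, 32, 44, 127⟩,
   ⟨24, 32, 45, 12⟩, ⟨24, 32, 46, 210⟩, ⟨24, 32, 48, 171⟩, ⟨24, 32, 49, 35⟩, ⟨24, 32, 50, 64⟩,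
   ⟨24, 32, 52, 223⟩, ⟨24, 32, 54, 76⟩, ⟨24, 32, 55, 120⟩, ⟨24, 32, 56, 67⟩, ⟨24, 33, 42, 301⟩,
   ⟨24, 33, 54, 301⟩, ⟨24, 36, 39, 13⟩, ⟨24, 36, 40, 23⟩, ⟨24, 36, 41, 60⟩, ⟨24, 36, 42, 269⟩,
   ⟨24, 36, 45, 43⟩, ⟨24, 36, 46, 52⟩, ⟨24, 36, 48, 570⟩, ⟨24, 36, 49, 15⟩, ⟨24, 36, 50, 28⟩,
   ⟨24, 36, 54, 156⟩, ⟨24, 36, 55, 36⟩, ⟨24, 36, 56, 19⟩, ⟨24, 37, 52, 52⟩, ⟨24, 37, 54, 112⟩,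
   ⟨24, 37, 55, 25⟩, ⟨24, 37, 56, 15⟩, ⟨24, 39, 39, 269⟩, ⟨24, 39, 40, 32⟩, ⟨24, 39, 45, 429⟩,
   ⟨24, 39, 46, 236⟩, ⟨24, 39, 49, 95⟩, ⟨24, 39, 54, 262⟩, ⟨24, 39, 55, 24⟩, ⟨24, 39, 56, 15⟩,
   ⟨24, 40, 41, 166⟩, ⟨24, 40, 52, 80⟩, ⟨24, 40, 54, 81⟩, ⟨24, 40, 55, 95⟩, ⟨24, 40, 56, 30⟩,
   ⟨24, 41, 52, 11⟩, ⟨24, 41, 54, 158⟩, ⟨24, 42, 48, 290⟩, ⟨24, 42, 49, 189⟩, ⟨24, 44, 44, 161⟩,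
   ⟨24, 44, 48, 25⟩, ⟨24, 44, 49, 22⟩, ⟨24, 44, 54, 5⟩, ⟨24, 44, 55, 6⟩, ⟨24, 45, 45, 394⟩,
   ⟨24, 45, 46, 252⟩, ⟨24, 45, 49, 6⟩, ⟨24, 45, 52, 43⟩, ⟨24, 45, 54, 279⟩, ⟨24, 45, 55, 101⟩,
   ⟨24, 45, 56, 24⟩, ⟨24, 46, 46, 1064⟩, ⟨24, 46, 49, 43⟩, ⟨24, 46, 52, 48⟩, ⟨24, 46, 54, 216⟩,
   ⟨24, 46, 55, 22⟩, ⟨24, 46, 56, 12⟩, ⟨24, 48, 48, 417⟩, ⟨24, 48, 49, 8⟩, ⟨24, 48, 52, 60⟩,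
   ⟨24, 48, 54, 238⟩, ⟨24, 48, 56, 20⟩, ⟨24, 49, 52, 31⟩, ⟨24, 49, 54, 58⟩, ⟨24, 49, 55, 79⟩,
   ⟨24, 49, 56, 43⟩, ⟨24, 50, 50, 50⟩, ⟨24, 52, 54, 227⟩, ⟨24, 54, 54, 200⟩, ⟨24, 54, 55, 99⟩,
   ⟨24, 54, 56, 46⟩, ⟨24, 55, 55, 79⟩, ⟨24, 55, 56, 27⟩, ⟨24, 56, 56, 42⟩, ⟨28, 28, 39, 83⟩,
   ⟨28, 28, 40, 110⟩, ⟨28, 28, 41, 271⟩, ⟨28, 28, 42, 201⟩, ⟨28, 28, 44, 178⟩, ⟨28, 28, 52, 63⟩,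
   ⟨28, 28, 54, 157⟩, ⟨28, 28, 55, 141⟩, ⟨28, 28, 56, 133⟩, ⟨28, 29, 46, 30⟩, ⟨28, 29, 48, 139⟩,
   ⟨28, 29, 52, 108⟩, ⟨28, 29, 54, 36⟩, ⟨28, 29, 55, 34⟩, ⟨28, 29, 56, 29⟩, ⟨28, 31, 53, 15⟩,
   ⟨28, 31, 54, 75⟩, ⟨28, 31, 55, 60⟩, ⟨28, 31, 56, 45⟩, ⟨28, 32, 40, 52⟩, ⟨28, 32, 42, 54⟩,
   ⟨28, 32, 44, 28⟩, ⟨28, 32, 52, 13⟩, ⟨28, 32, 53, 10⟩, ⟨28, 32, 54, 30⟩, ⟨28, 32, 55, 28⟩,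
   ⟨28, 32, 56, 23⟩, ⟨28, 33, 41, 53⟩, ⟨28, 33, 42, 184⟩, ⟨28, 33, 48, 54⟩, ⟨28, 33, 49, 41⟩,
   ⟨28, 33, 56, 110⟩, ⟨28, 36, 41, 20⟩, ⟨28, 36, 42, 225⟩, ⟨28, 36, 48, 249⟩, ⟨28, 36, 50, 175⟩,
   ⟨28, 36, 52, 86⟩, ⟨28, 36, 53, 5⟩, ⟨28, 36, 54, 112⟩, ⟨28, 36, 55, 83⟩, ⟨28, 36, 56, 63⟩,
   ⟨28, 37, 37, 38⟩, ⟨28, 37, 44, 168⟩, ⟨28, 37, 52, 250⟩, ⟨28, 37, 53, 19⟩, ⟨28, 37, 54, 32⟩,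
   ⟨28, 37, 55, 26⟩, ⟨28, 37, 56, 23⟩, ⟨28, 39, 39, 178⟩, ⟨28, 39, 40, 32⟩, ⟨28, 39, 41, 23⟩,
   ⟨28, 39, 45, 84⟩, ⟨28, 39, 46, 212⟩, ⟨28, 39, 48, 53⟩, ⟨28, 39, 53, 31⟩, ⟨28, 39, 56, 85⟩,
   ⟨28, 40, 40, 245⟩, ⟨28, 40, 41, 116⟩, ⟨28, 40, 48, 39⟩, ⟨28, 40, 49, 20⟩, ⟨28, 40, 52, 14⟩,
   ⟨28, 40, 53, 116⟩, ⟨28, 40, 54, 136⟩, ⟨28, 40, 55, 29⟩, ⟨28, 41, 41, 120⟩, ⟨28, 41, 48, 32⟩,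
   ⟨28, 41, 49, 20⟩, ⟨28, 41, 52, 6⟩, ⟨28, 41, 53, 29⟩, ⟨28, 41, 56, 148⟩, ⟨28, 42, 48, 136⟩,
   ⟨28, 42, 49, 56⟩, ⟨28, 44, 44, 36⟩, ⟨28, 44, 48, 29⟩, ⟨28, 44, 49, 19⟩, ⟨28, 44, 52, 7⟩,
   ⟨28, 44, 53, 175⟩, ⟨28, 44, 54, 33⟩, ⟨28, 44, 55, 18⟩, ⟨28, 44, 56, 17⟩, ⟨28, 45, 52, 314⟩,
   ⟨28, 45, 54, 31⟩, ⟨28, 45, 55, 19⟩, ⟨28, 45, 56, 18⟩, ⟨28, 46, 52, 9⟩, ⟨28, 46, 54, 110⟩,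
   ⟨28, 46, 55, 46⟩, ⟨28, 46, 56, 38⟩, ⟨28, 48, 52, 118⟩, ⟨28, 48, 53, 68⟩, ⟨28, 48, 54, 141⟩,
   ⟨28, 48, 55, 96⟩, ⟨28, 48, 56, 60⟩, ⟨28, 49, 49, 152⟩, ⟨28, 49, 52, 31⟩, ⟨28, 49, 53, 22⟩,
   ⟨28, 50, 50, 65⟩, ⟨28, 52, 52, 122⟩, ⟨28, 52, 53, 8⟩, ⟨28, 52, 54, 3⟩, ⟨28, 53, 53, 506⟩,
   ⟨28, 54, 54, 140⟩, ⟨28, 54, 55, 26⟩, ⟨28, 55, 55, 70⟩, ⟨28, 55, 56, 32⟩, ⟨29, 29, 44, 330⟩,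
   ⟨29, 29, 46, 35⟩, ⟨29, 29, 52, 409⟩, ⟨29, 29, 54, 12⟩, ⟨29, 29, 55, 12⟩, ⟨29, 29, 56, 12⟩,
   ⟨29, 31, 39, 29⟩, ⟨29, 31, 40, 62⟩, ⟨29, 31, 41, 71⟩, ⟨29, 31, 42, 252⟩, ⟨29, 31, 54, 89⟩,
   ⟨29, 31, 55, 69⟩, ⟨29, 31, 56, 60⟩, ⟨29, 32, 42, 24⟩, ⟨29, 32, 44, 342⟩, ⟨29, 32, 52, 161⟩,
   ⟨29, 32, 54, 65⟩, ⟨29, 33, 41, 13⟩, ⟨29, 33, 55, 12⟩, ⟨29, 36, 41, 17⟩, ⟨29, 36, 42, 56⟩,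
   ⟨29, 36, 52, 53⟩, ⟨29, 36, 53, 4⟩, ⟨29, 36, 54, 30⟩, ⟨29, 36, 55, 28⟩, ⟨29, 36, 56, 26⟩,
   ⟨29, 37, 37, 30⟩, ⟨29, 37, 39, 55⟩, ⟨29, 37, 40, 28⟩, ⟨29, 37, 41, 14⟩, ⟨29, 37, 44, 296⟩,
   ⟨29, 37, 52, 204⟩, ⟨29, 37, 53, 14⟩, ⟨29, 37, 54, 120⟩, ⟨29, 39, 39, 192⟩, ⟨29, 39, 45, 51⟩,
   ⟨29, 39, 46, 318⟩, ⟨29, 39, 48, 76⟩, ⟨29, 39, 53, 31⟩, ⟨29, 39, 56, 67⟩, ⟨29, 40, 40, 62⟩,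
   ⟨29, 40, 41, 39⟩, ⟨29, 40, 48, 61⟩, ⟨29, 40, 52, 104⟩, ⟨29, 40, 54, 136⟩, ⟨29, 41, 41, 58⟩,
   ⟨29, 41, 48, 14⟩, ⟨29, 41, 49, 12⟩, ⟨29, 41, 54, 39⟩, ⟨29, 41, 55, 24⟩, ⟨29, 42, 49, 21⟩,
   ⟨29, 44, 44, 93⟩, ⟨29, 44, 46, 8⟩, ⟨29, 44, 48, 27⟩, ⟨29, 44, 49, 20⟩, ⟨29, 44, 52, 26⟩,
   ⟨29, 44, 53, 158⟩, ⟨29, 44, 54, 203⟩, ⟨29, 44, 55, 57⟩, ⟨29, 45, 54, 63⟩, ⟨29, 46, 55, 13⟩,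
   ⟨29, 48, 54, 99⟩, ⟨29, 49, 54, 26⟩, ⟨29, 49, 55, 48⟩, ⟨29, 52, 52, 149⟩, ⟨29, 52, 53, 136⟩,
   ⟨29, 52, 54, 68⟩, ⟨29, 52, 56, 124⟩, ⟨29, 53, 53, 109⟩, ⟨29, 54, 54, 224⟩, ⟨29, 54, 55, 31⟩,
   ⟨29, 54, 56, 27⟩, ⟨30, 30, 45, 2831⟩, ⟨30, 30, 46, 983⟩, ⟨30, 30, 49, 1204⟩, ⟨30, 30, 50, 2097⟩,
   ⟨30, 33, 48, 15⟩, ⟨30, 33, 49, 14⟩, ⟨30, 33, 50, 2⟩, ⟨30, 36, 48, 74⟩, ⟨30, 36, 49, 48⟩,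
   ⟨30, 36, 50, 908⟩, ⟨30, 45, 45, 4045⟩, ⟨30, 45, 46, 472⟩, ⟨30, 46, 46, 165⟩, ⟨30, 48, 48, 434⟩,
   ⟨30, 50, 50, 1034⟩, ⟨31, 31, 45, 136⟩, ⟨31, 32, 40, 68⟩, ⟨31, 32, 41, 116⟩, ⟨31, 32, 42, 101⟩,
   ⟨31, 32, 45, 244⟩, ⟨31, 32, 53, 244⟩, ⟨31, 32, 56, 7⟩, ⟨31, 33, 45, 22⟩, ⟨31, 33, 53, 1⟩,
   ⟨31, 33, 54, 104⟩, ⟨31, 33, 55, 50⟩, ⟨31, 33, 56, 43⟩, ⟨31, 36, 42, 96⟩, ⟨31, 37, 37, 161⟩,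
   ⟨31, 37, 40, 54⟩, ⟨31, 37, 41, 33⟩, ⟨31, 37, 53, 180⟩, ⟨31, 39, 39, 100⟩, ⟨31, 39, 41, 3⟩,
   ⟨31, 39, 45, 402⟩, ⟨31, 39, 46, 37⟩, ⟨31, 39, 48, 199⟩, ⟨31, 39, 49, 32⟩, ⟨31, 39, 54, 149⟩,
   ⟨31, 39, 55, 29⟩, ⟨31, 39, 56, 16⟩, ⟨31, 40, 41, 41⟩, ⟨31, 40, 55, 3⟩, ⟨31, 41, 41, 53⟩,
   ⟨31, 41, 48, 28⟩, ⟨31, 41, 53, 4⟩, ⟨31, 41, 55, 3⟩, ⟨31, 41, 56, 3⟩, ⟨31, 42, 48, 28⟩,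
   ⟨31, 42, 49, 26⟩, ⟨31, 45, 45, 16⟩, ⟨31, 45, 46, 11⟩, ⟨31, 45, 52, 71⟩, ⟨31, 45, 53, 180⟩,
   ⟨31, 45, 55, 24⟩, ⟨31, 45, 56, 21⟩, ⟨31, 46, 46, 32⟩, ⟨31, 46, 52, 6⟩, ⟨31, 46, 53, 242⟩,
   ⟨31, 46, 54, 108⟩, ⟨31, 46, 55, 30⟩, ⟨31, 48, 52, 1⟩, ⟨31, 48, 53, 1⟩, ⟨31, 48, 54, 2⟩,
   ⟨31, 48, 55, 2⟩, ⟨31, 48, 56, 2⟩, ⟨31, 49, 54, 2⟩, ⟨31, 52, 53, 7⟩, ⟨31, 53, 53, 62⟩,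
   ⟨31, 54, 55, 70⟩, ⟨31, 55, 55, 29⟩, ⟨32, 32, 42, 120⟩, ⟨32, 32, 45, 166⟩, ⟨32, 32, 52, 6⟩,
   ⟨32, 33, 45, 17⟩, ⟨32, 36, 52, 55⟩, ⟨32, 36, 53, 10⟩, ⟨32, 36, 54, 78⟩, ⟨32, 36, 55, 31⟩,
   ⟨32, 36, 56, 27⟩, ⟨32, 37, 37, 24⟩, ⟨32, 37, 40, 73⟩, ⟨32, 37, 44, 105⟩, ⟨32, 37, 52, 113⟩,
   ⟨32, 37, 53, 83⟩, ⟨32, 37, 54, 8⟩, ⟨32, 37, 55, 7⟩, ⟨32, 37, 56, 6⟩, ⟨32, 39, 39, 114⟩,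
   ⟨32, 39, 40, 3⟩, ⟨32, 39, 45, 103⟩, ⟨32, 39, 46, 28⟩, ⟨32, 39, 49, 67⟩, ⟨32, 39, 53, 18⟩,
   ⟨32, 39, 54, 186⟩, ⟨32, 39, 55, 38⟩, ⟨32, 39, 56, 19⟩, ⟨32, 40, 40, 238⟩, ⟨32, 40, 44, 16⟩,
   ⟨32, 40, 48, 8⟩, ⟨32, 40, 49, 6⟩, ⟨32, 40, 53, 75⟩, ⟨32, 40, 54, 19⟩, ⟨32, 41, 41, 72⟩,
   ⟨32, 41, 44, 9⟩, ⟨32, 41, 48, 94⟩, ⟨32, 41, 49, 45⟩, ⟨32, 41, 53, 14⟩, ⟨32, 42, 45, 13⟩,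
   ⟨32, 42, 46, 57⟩, ⟨32, 42, 48, 81⟩, ⟨32, 42, 49, 61⟩, ⟨32, 45, 45, 16⟩, ⟨32, 45, 46, 9⟩,
   ⟨32, 45, 52, 191⟩, ⟨32, 45, 54, 196⟩, ⟨32, 45, 55, 55⟩, ⟨32, 45, 56, 41⟩, ⟨32, 46, 46, 19⟩,
   ⟨32, 46, 52, 6⟩, ⟨32, 46, 53, 74⟩, ⟨32, 46, 56, 21⟩, ⟨32, 48, 52, 1⟩, ⟨32, 48, 55, 2⟩,
   ⟨32, 49, 54, 2⟩, ⟨32, 49, 55, 2⟩, ⟨32, 49, 56, 2⟩, ⟨32, 52, 52, 81⟩, ⟨32, 52, 53, 31⟩,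
   ⟨32, 53, 53, 331⟩, ⟨32, 54, 54, 277⟩, ⟨32, 55, 55, 124⟩, ⟨33, 33, 42, 365⟩, ⟨33, 33, 45, 15⟩,
   ⟨33, 33, 48, 253⟩, ⟨33, 33, 49, 130⟩, ⟨33, 33, 50, 3⟩, ⟨33, 33, 53, 1⟩, ⟨33, 33, 56, 260⟩,
   ⟨33, 36, 42, 44⟩, ⟨33, 36, 48, 490⟩, ⟨33, 36, 50, 9⟩, ⟨33, 36, 53, 1⟩, ⟨33, 36, 55, 53⟩,
   ⟨33, 39, 39, 280⟩, ⟨33, 39, 40, 3⟩, ⟨33, 39, 41, 3⟩, ⟨33, 39, 53, 1⟩, ⟨33, 39, 54, 18⟩,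
   ⟨33, 39, 55, 14⟩, ⟨33, 39, 56, 10⟩, ⟨33, 40, 40, 44⟩, ⟨33, 40, 41, 33⟩, ⟨33, 40, 54, 19⟩,
   ⟨33, 40, 55, 84⟩, ⟨33, 40, 56, 26⟩, ⟨33, 41, 41, 89⟩, ⟨33, 41, 54, 31⟩, ⟨33, 42, 48, 99⟩,
   ⟨33, 42, 49, 54⟩, ⟨33, 45, 45, 416⟩, ⟨33, 45, 46, 393⟩, ⟨33, 45, 48, 12⟩, ⟨33, 45, 49, 13⟩,
   ⟨33, 45, 50, 70⟩, ⟨33, 45, 54, 133⟩, ⟨33, 45, 55, 55⟩, ⟨33, 45, 56, 41⟩, ⟨33, 48, 48, 375⟩,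
   ⟨33, 48, 49, 123⟩, ⟨33, 48, 53, 7⟩, ⟨33, 48, 56, 376⟩, ⟨33, 49, 49, 89⟩, ⟨33, 49, 52, 6⟩,
   ⟨33, 49, 55, 181⟩, ⟨33, 49, 56, 99⟩, ⟨33, 50, 50, 153⟩, ⟨33, 54, 55, 47⟩, ⟨36, 36, 40, 33⟩,
   ⟨36, 36, 41, 100⟩, ⟨36, 36, 42, 42⟩, ⟨36, 36, 48, 275⟩, ⟨36, 36, 49, 209⟩, ⟨36, 36, 53, 4⟩,
   ⟨36, 36, 54, 177⟩, ⟨36, 36, 55, 96⟩, ⟨36, 36, 56, 82⟩, ⟨36, 37, 40, 12⟩, ⟨36, 37, 41, 6⟩,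
   ⟨36, 37, 44, 80⟩, ⟨36, 39, 39, 121⟩, ⟨36, 39, 41, 2⟩, ⟨36, 39, 45, 459⟩, ⟨36, 39, 46, 499⟩,
   ⟨36, 39, 48, 9⟩, ⟨36, 39, 49, 8⟩, ⟨36, 39, 52, 3⟩, ⟨36, 39, 54, 42⟩, ⟨36, 39, 55, 46⟩,
   ⟨36, 39, 56, 41⟩, ⟨36, 40, 40, 92⟩, ⟨36, 40, 41, 20⟩, ⟨36, 40, 48, 4⟩, ⟨36, 40, 49, 4⟩,
   ⟨36, 40, 52, 293⟩, ⟨36, 40, 54, 85⟩, ⟨36, 40, 55, 47⟩, ⟨36, 40, 56, 42⟩, ⟨36, 41, 41, 26⟩,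
   ⟨36, 41, 48, 47⟩, ⟨36, 41, 49, 24⟩, ⟨36, 41, 52, 28⟩, ⟨36, 41, 53, 249⟩, ⟨36, 41, 54, 80⟩,
   ⟨36, 41, 55, 45⟩, ⟨36, 41, 56, 40⟩, ⟨36, 42, 48, 61⟩, ⟨36, 42, 49, 32⟩, ⟨36, 45, 45, 256⟩,
   ⟨36, 45, 46, 185⟩, ⟨36, 45, 48, 95⟩, ⟨36, 46, 46, 113⟩, ⟨36, 48, 48, 730⟩, ⟨36, 48, 52, 185⟩,
   ⟨36, 48, 53, 23⟩, ⟨36, 48, 54, 154⟩, ⟨36, 49, 52, 11⟩, ⟨36, 49, 55, 127⟩, ⟨36, 50, 50, 36⟩,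
   ⟨36, 52, 52, 170⟩, ⟨36, 52, 53, 20⟩, ⟨36, 52, 54, 29⟩, ⟨36, 52, 55, 79⟩, ⟨36, 53, 53, 49⟩,
   ⟨36, 53, 54, 18⟩, ⟨36, 54, 55, 103⟩, ⟨36, 55, 55, 77⟩, ⟨36, 55, 56, 25⟩, ⟨36, 56, 56, 38⟩,
   ⟨37, 37, 37, 514⟩, ⟨37, 37, 44, 227⟩, ⟨37, 37, 52, 256⟩, ⟨37, 37, 53, 173⟩, ⟨37, 37, 55, 45⟩,
   ⟨37, 37, 56, 45⟩, ⟨37, 44, 44, 296⟩, ⟨37, 44, 52, 229⟩, ⟨37, 44, 54, 265⟩, ⟨37, 44, 55, 62⟩,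
   ⟨37, 44, 56, 60⟩, ⟨37, 45, 54, 16⟩, ⟨37, 45, 55, 20⟩, ⟨37, 46, 54, 13⟩, ⟨37, 52, 52, 226⟩,
   ⟨37, 52, 53, 144⟩, ⟨37, 52, 54, 117⟩, ⟨37, 53, 53, 259⟩, ⟨37, 54, 54, 128⟩, ⟨37, 55, 55, 48⟩,
   ⟨37, 55, 56, 19⟩, ⟨37, 56, 56, 32⟩, ⟨39, 39, 40, 1309⟩, ⟨39, 39, 41, 1309⟩, ⟨39, 39, 42, 757⟩,
   ⟨39, 39, 45, 18⟩, ⟨39, 39, 46, 19⟩, ⟨39, 39, 48, 363⟩, ⟨39, 39, 49, 204⟩, ⟨39, 39, 50, 188⟩,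
   ⟨39, 39, 52, 21⟩, ⟨39, 39, 56, 365⟩, ⟨39, 40, 42, 318⟩, ⟨39, 40, 45, 6⟩, ⟨39, 40, 46, 6⟩,
   ⟨39, 40, 48, 25⟩, ⟨39, 40, 49, 23⟩, ⟨39, 40, 50, 22⟩, ⟨39, 41, 45, 4⟩, ⟨39, 41, 46, 4⟩,
   ⟨39, 41, 50, 13⟩, ⟨39, 42, 42, 486⟩, ⟨39, 42, 49, 99⟩, ⟨39, 42, 50, 135⟩, ⟨39, 45, 45, 360⟩,
   ⟨39, 45, 46, 228⟩, ⟨39, 45, 52, 370⟩, ⟨39, 45, 53, 177⟩, ⟨39, 45, 55, 26⟩, ⟨39, 46, 46, 704⟩,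
   ⟨39, 46, 53, 79⟩, ⟨39, 46, 54, 127⟩, ⟨39, 46, 55, 55⟩, ⟨39, 46, 56, 49⟩, ⟨39, 48, 49, 19⟩,
   ⟨39, 48, 52, 9⟩, ⟨39, 48, 53, 27⟩, ⟨39, 48, 55, 157⟩, ⟨39, 50, 50, 773⟩, ⟨39, 50, 54, 28⟩,
   ⟨39, 52, 56, 4⟩, ⟨39, 53, 53, 56⟩, ⟨39, 54, 54, 214⟩, ⟨39, 54, 55, 27⟩, ⟨39, 54, 56, 21⟩,
   ⟨39, 55, 55, 32⟩, ⟨39, 55, 56, 13⟩, ⟨39, 56, 56, 23⟩, ⟨40, 40, 40, 191512⟩, ⟨40, 40, 45, 17⟩,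
   ⟨40, 40, 46, 19⟩, ⟨40, 40, 48, 30⟩, ⟨40, 40, 49, 29⟩, ⟨40, 40, 50, 29⟩, ⟨40, 40, 53, 145⟩,
   ⟨40, 40, 54, 127⟩, ⟨40, 40, 55, 85⟩, ⟨40, 40, 56, 85⟩, ⟨40, 41, 45, 4⟩, ⟨40, 41, 46, 5⟩,
   ⟨40, 41, 48, 9⟩, ⟨40, 41, 49, 9⟩, ⟨40, 41, 52, 6⟩, ⟨40, 41, 53, 15⟩, ⟨40, 41, 54, 16⟩,
   ⟨40, 41, 55, 14⟩, ⟨40, 41, 56, 14⟩, ⟨40, 42, 45, 5⟩, ⟨40, 42, 46, 6⟩, ⟨40, 42, 48, 26⟩,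
   ⟨40, 42, 49, 28⟩, ⟨40, 42, 50, 29⟩, ⟨40, 42, 52, 6⟩, ⟨40, 42, 53, 21⟩, ⟨40, 42, 55, 29⟩,
   ⟨40, 42, 56, 29⟩, ⟨40, 45, 45, 15⟩, ⟨40, 45, 46, 9⟩, ⟨40, 45, 48, 18⟩, ⟨40, 45, 53, 196⟩,
   ⟨40, 45, 54, 52⟩, ⟨40, 45, 55, 27⟩, ⟨40, 45, 56, 25⟩, ⟨40, 46, 46, 21⟩, ⟨40, 46, 48, 13⟩,
   ⟨40, 48, 52, 15⟩, ⟨40, 48, 54, 208⟩, ⟨40, 49, 49, 18⟩, ⟨40, 50, 50, 80⟩, ⟨40, 50, 53, 11⟩,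
   ⟨40, 50, 54, 17⟩, ⟨40, 50, 56, 21⟩, ⟨40, 52, 52, 44⟩, ⟨40, 52, 53, 53⟩, ⟨40, 53, 53, 221⟩,
   ⟨40, 53, 56, 19⟩, ⟨40, 54, 54, 229⟩, ⟨40, 55, 56, 15⟩, ⟨41, 41, 41, 4594⟩, ⟨41, 41, 42, 561⟩,
   ⟨41, 41, 45, 6⟩, ⟨41, 41, 46, 6⟩, ⟨41, 41, 48, 13⟩, ⟨41, 41, 49, 13⟩, ⟨41, 41, 50, 13⟩,
   ⟨41, 41, 52, 8⟩, ⟨41, 41, 53, 17⟩, ⟨41, 41, 54, 19⟩, ⟨41, 41, 55, 18⟩, ⟨41, 41, 56, 17⟩,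
   ⟨41, 42, 42, 353⟩, ⟨41, 42, 45, 3⟩, ⟨41, 42, 46, 3⟩, ⟨41, 42, 48, 12⟩, ⟨41, 42, 49, 13⟩,
   ⟨41, 42, 50, 12⟩, ⟨41, 42, 53, 10⟩, ⟨41, 42, 54, 15⟩, ⟨41, 42, 55, 13⟩, ⟨41, 42, 56, 13⟩,
   ⟨41, 45, 45, 15⟩, ⟨41, 45, 46, 9⟩, ⟨41, 45, 48, 22⟩, ⟨41, 45, 49, 16⟩, ⟨41, 45, 52, 57⟩,
   ⟨41, 45, 54, 68⟩, ⟨41, 45, 55, 30⟩, ⟨41, 46, 46, 21⟩, ⟨41, 46, 48, 15⟩, ⟨41, 46, 49, 12⟩,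
   ⟨41, 46, 52, 5⟩, ⟨41, 46, 54, 20⟩, ⟨41, 48, 48, 81⟩, ⟨41, 48, 49, 16⟩, ⟨41, 48, 52, 15⟩,
   ⟨41, 48, 53, 143⟩, ⟨41, 48, 55, 28⟩, ⟨41, 49, 54, 43⟩, ⟨41, 49, 55, 80⟩, ⟨41, 50, 52, 5⟩,
   ⟨41, 50, 53, 8⟩, ⟨41, 50, 55, 14⟩, ⟨41, 50, 56, 13⟩, ⟨41, 52, 52, 6⟩, ⟨41, 52, 53, 3⟩,
   ⟨41, 52, 54, 3⟩, ⟨41, 52, 55, 3⟩, ⟨41, 52, 56, 3⟩, ⟨41, 53, 53, 7⟩, ⟨41, 53, 54, 3⟩,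
   ⟨41, 53, 55, 3⟩, ⟨41, 53, 56, 3⟩, ⟨41, 54, 54, 7⟩, ⟨41, 54, 55, 3⟩, ⟨41, 54, 56, 3⟩,
   ⟨41, 55, 55, 6⟩, ⟨41, 55, 56, 3⟩, ⟨41, 56, 56, 6⟩, ⟨42, 42, 42, 789⟩, ⟨42, 42, 45, 8⟩,
   ⟨42, 42, 46, 8⟩, ⟨42, 42, 48, 152⟩, ⟨42, 42, 49, 218⟩, ⟨42, 42, 50, 175⟩, ⟨42, 42, 54, 29⟩,
   ⟨42, 42, 55, 24⟩, ⟨42, 45, 45, 14⟩, ⟨42, 45, 46, 8⟩, ⟨42, 45, 55, 42⟩, ⟨42, 45, 56, 34⟩,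
   ⟨42, 46, 46, 20⟩, ⟨42, 46, 53, 18⟩, ⟨42, 46, 55, 15⟩, ⟨42, 48, 48, 56⟩, ⟨42, 48, 49, 13⟩,
   ⟨42, 48, 54, 43⟩, ⟨42, 49, 53, 21⟩, ⟨42, 50, 50, 78⟩, ⟨42, 50, 52, 5⟩, ⟨42, 50, 53, 8⟩,
   ⟨42, 50, 54, 18⟩, ⟨42, 50, 55, 21⟩, ⟨42, 50, 56, 20⟩, ⟨44, 44, 52, 52⟩, ⟨44, 44, 54, 103⟩,
   ⟨44, 44, 55, 42⟩, ⟨44, 44, 56, 38⟩, ⟨44, 52, 52, 124⟩, ⟨44, 52, 53, 103⟩, ⟨44, 52, 56, 38⟩,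
   ⟨44, 53, 53, 226⟩, ⟨44, 53, 54, 18⟩, ⟨44, 53, 55, 17⟩, ⟨44, 53, 56, 16⟩, ⟨44, 54, 54, 32⟩,
   ⟨44, 54, 55, 14⟩, ⟨44, 54, 56, 13⟩, ⟨44, 55, 55, 22⟩, ⟨44, 55, 56, 10⟩, ⟨44, 56, 56, 20⟩,
   ⟨45, 45, 45, 2164⟩, ⟨45, 45, 46, 317⟩, ⟨45, 45, 48, 103⟩, ⟨45, 45, 49, 59⟩, ⟨45, 45, 50, 62⟩,
   ⟨45, 45, 52, 160⟩, ⟨45, 45, 56, 113⟩, ⟨45, 46, 46, 160⟩, ⟨45, 46, 48, 22⟩, ⟨45, 46, 49, 17⟩,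
   ⟨45, 46, 50, 17⟩, ⟨45, 46, 52, 40⟩, ⟨45, 46, 53, 302⟩, ⟨45, 48, 48, 157⟩, ⟨45, 48, 49, 31⟩,
   ⟨45, 48, 50, 27⟩, ⟨45, 48, 52, 17⟩, ⟨45, 48, 55, 148⟩, ⟨45, 49, 49, 38⟩, ⟨45, 49, 50, 18⟩,
   ⟨45, 49, 55, 90⟩, ⟨45, 50, 50, 53⟩, ⟨45, 50, 54, 17⟩, ⟨45, 50, 55, 22⟩, ⟨45, 50, 56, 21⟩,
   ⟨45, 52, 52, 77⟩, ⟨45, 52, 53, 35⟩, ⟨45, 52, 54, 215⟩, ⟨45, 53, 53, 97⟩, ⟨45, 53, 54, 33⟩,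
   ⟨45, 53, 55, 42⟩, ⟨45, 53, 56, 37⟩, ⟨45, 55, 55, 195⟩, ⟨45, 55, 56, 55⟩, ⟨45, 56, 56, 78⟩,
   ⟨46, 46, 46, 308⟩, ⟨46, 46, 48, 30⟩, ⟨46, 46, 49, 25⟩, ⟨46, 46, 50, 26⟩, ⟨46, 46, 52, 76⟩,
   ⟨46, 46, 55, 394⟩, ⟨46, 48, 48, 11⟩, ⟨46, 48, 49, 5⟩, ⟨46, 48, 50, 5⟩, ⟨46, 48, 52, 5⟩,
   ⟨46, 48, 53, 7⟩, ⟨46, 48, 55, 9⟩, ⟨46, 48, 56, 9⟩, ⟨46, 49, 49, 9⟩, ⟨46, 49, 50, 5⟩,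
   ⟨46, 49, 54, 9⟩, ⟨46, 50, 55, 7⟩, ⟨46, 52, 55, 12⟩, ⟨46, 53, 55, 50⟩, ⟨46, 54, 54, 190⟩,
   ⟨46, 55, 55, 70⟩, ⟨46, 55, 56, 25⟩, ⟨48, 48, 48, 1050⟩, ⟨48, 48, 49, 75⟩, ⟨48, 48, 50, 61⟩,
   ⟨48, 48, 53, 246⟩, ⟨48, 48, 54, 269⟩, ⟨48, 49, 49, 42⟩, ⟨48, 49, 55, 103⟩, ⟨48, 50, 55, 27⟩,
   ⟨48, 52, 54, 9⟩, ⟨48, 53, 53, 38⟩, ⟨48, 53, 54, 19⟩, ⟨48, 53, 55, 30⟩, ⟨48, 54, 54, 321⟩,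
   ⟨48, 55, 56, 96⟩, ⟨49, 50, 50, 36⟩, ⟨49, 50, 55, 56⟩, ⟨49, 52, 52, 5⟩, ⟨49, 52, 53, 3⟩,
   ⟨49, 52, 55, 3⟩, ⟨49, 54, 54, 9⟩, ⟨49, 54, 55, 5⟩, ⟨49, 54, 56, 5⟩, ⟨49, 55, 55, 17⟩,
   ⟨49, 55, 56, 6⟩, ⟨49, 56, 56, 9⟩, ⟨50, 50, 50, 1266⟩, ⟨50, 50, 53, 24⟩, ⟨50, 50, 56, 54⟩,
   ⟨52, 52, 52, 290⟩, ⟨52, 52, 53, 89⟩, ⟨52, 52, 54, 36⟩, ⟨52, 53, 53, 240⟩, ⟨52, 54, 55, 11⟩,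
   ⟨52, 55, 55, 86⟩, ⟨52, 55, 56, 20⟩, ⟨53, 53, 53, 632⟩, ⟨53, 53, 54, 26⟩, ⟨53, 54, 54, 20⟩,
   ⟨54, 54, 54, 406⟩, ⟨54, 54, 55, 24⟩, ⟨54, 54, 56, 24⟩, ⟨54, 55, 55, 21⟩, ⟨55, 56, 56, 47⟩]

/-- The certificate for bins with an item of type 3 and seven items of middle size. -/
def pointCertSix : PointCert where
  t := 3
  fmt := ⟨60, 81, 29, 28⟩
  orbits := massesSix
  -- In units of 1/60 the interval [2/3 - 0.6, 0.6] is [4, 36]; the spacing is at most the smallest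
  -- box side 5.
  core := [4, 9, 14, 19, 24, 29, 34, 36]
  heavy := 290000
  th := [(21, 285194), (20, 228041), (15, 29547), (12, 11425), (10, 4694), (8, 3344), (7, 1490),
    (6, 663), (5, 94)]
  D := 4000000
  cert := ⟨12997216 / 10000000, [(4, 9368739 / 1000000000000), (9, 4598674 / 1000000000000)]⟩
  surplus := 7186105 / 10000000

set_option maxRecDepth 100000 in
lemma pointCertSix_numerics : pointCertSix.Numerics weightsSix := by decide +kernel

set_option maxRecDepth 100000 in
lemma pointCertSix_valid : pointCertSix.fmt.Valid
    (symmetrize pointCertSix.orbits (cubeMasses pointCertSix.core pointCertSix.heavy))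
    pointCertSix.th := by decide +kernel

set_option maxRecDepth 100000 in
lemma pointCertSix_check : pointCertSix.fmt.check
    (symmetrize pointCertSix.orbits (cubeMasses pointCertSix.core pointCertSix.heavy))
    pointCertSix.th = true := by decide +kernel

end CubePacking

end

/-! ### The theorem -/

theorem theorem2 :
    -- The algorithm always produces a correct packing and can always pack one more item.
    (∀ (L : List ℝ) (S : CubePacking.State 3), CubePacking.Run CubePacking.cubeParams L S →
      CubePacking.IsPacking L S.packing ∧
      ∀ x : ℝ, 0 < x → x ≤ 1 →
        ∃ S' : CubePacking.State 3, CubePacking.Step CubePacking.cubeParams S x S') ∧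
    -- Its asymptotic competitive ratio, over all ways to break ties, is at most 2.6852.
    CubePacking.asymptoticRatio 3 (CubePacking.Cost 3 CubePacking.cubeParams) ≤
      ENNReal.ofReal 2.6852 := by
  refine ⟨fun L S h => ⟨CubePacking.Run.isPacking h, fun x h0 h1 =>
    CubePacking.exists_step (CubePacking.Run.largeOK h) h0 h1⟩, ?_⟩
  refine CubePacking.ratio_le (a := ((269 / 1000 : ℚ) : ℝ)) (a' := ((16 / 100 : ℚ) : ℝ))
    (by norm_num) (by norm_num) CubePacking.binBound_blue CubePacking.binBound_lonely_eleven
    CubePacking.binBound_lonely_ten CubePacking.binBound_lonely_nine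
    (CubePacking.binBound_seven fun b hb hs h2 h7 => ?_)
    (CubePacking.binBound_six fun b hb hs h3 h7 => ?_)
  · exact CubePacking.PointCert.binWeight_le CubePacking.pointCertSeven_numerics
      CubePacking.pointCertSeven_valid CubePacking.pointCertSeven_check hb hs h2 h7
  · exact CubePacking.PointCert.binWeight_le CubePacking.pointCertSix_numerics
      CubePacking.pointCertSix_valid CubePacking.pointCertSix_check hb hs h3 h7
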